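/- **Setting.** Let $E$ be a complete separable metric space, $\overline C(E)$ the bounded continuous real functions on $E$, and $A\subset\overline C(E)\times\overline C(E)$ a (possibly multivalued) operator with domain $\mathcal D(A)=\{f:(f,g)\in A\}$. Let $m\in\mathbb N_0$, $E_0=\{0,\dots,m\}$, $S=E\times E_0$. Let $\varpi$ be a Borel probability measure on $E$ with $\int g\,d\varpi=0$ for all $(f,g)\in A$ (as holds if $\varpi$ is a stationary distribution for $A$), and let $\lambda_1,\dots,\lambda_m>0$ and $\eta_1,\dots,\eta_m\in\overline C(E)$ satisfy $\int\eta_k\,d\varpi=0$ and $\int g\,\eta_k\,d\varpi=-\lambda_k\int f\,\eta_k\,d\varpi$ for all $(f,g)\in A$. Let $Q\in\mathbb R^{(m+1)\times(m+1)}$ be the generator of a continuous-time Markov chain on $E_0$ with eigenvalues $\{0,-\lambda_1,\dots,-\lambda_m\}$, let $\xi^{(k)}$ be a right eigenvector of $Q$ for $-\lambda_k$, and assume $\alpha_i(x)=1+\sum_{k=1}^m\xi^{(k)}_i\eta_k(x)>0$ for all $i\in E_0$, $x\in E$. For $i\ne j$ put $q_{ij}(x)=Q_{ij}\,\alpha_j(x)/\alpha_i(x)$.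 Let $B$ be the operator consisting of the pairs $(f,Bf)$ with $f(x,i)=f_1(x)f_2(i)$, $(f_1,g_1)\in A$, $f_2:E_0\to\mathbb R$, and $$Bf(x,i)=f_2(i)g_1(x)+\sum_{j\ne i}q_{ij}(x)\bigl(f(x,j)-f(x,i)\bigr).$$ A cadlag process $Z$ solves the martingale problem (respectively, the local martingale problem) for an operator $G$ if for every $(f,g)\in G$ the process $f(Z(t))-f(Z(0))-\int_0^t g(Z(s))\,ds$ is a martingale (respectively, a local martingale) with respect to the natural filtration of $Z$. The (local) martingale problem for $G$ is well-posed if for every initial distribution there is exactly one law on the space of cadlag paths under which the coordinate process is a solution with that initial distribution. A process is Markov if it has the Markov property with respect to its natural filtration. **Lemma.** (a) Let $X$ be a cadlag solution of the martingale problem for $A$ on some probability space, and let $k\in E_0$. Then on some extension of this probability space there are independent unit rate Poisson processes $N_{ij}$ ($i,j\in E_0$, $i\ne j$), independent of $X$, and a cadlag $E_0$-valued process $Y$ such that almost surely, for all $t\ge0$, $$Y(t)=k+\sum_{i\ne j}(j-i)\,N_{ij}\!\left(\int_0^t 1_{\{Y(s)=i\}}\,q_{ij}(X(s))\,ds\right),$$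 such that $(X,Y)$ solves the local martingale problem for $B$, and such that, if $X$ is Markov, then $(X,Y)$ is Markov. (b) Assume that $\mathcal D(A)$ determines total mass: whenever $\mu,\nu$ are finite Borel measures on $E$ with $\int f\,d\mu=\int f\,d\nu$ for all $f\in\mathcal D(A)$, then $\mu(E)=\nu(E)$ (for example $1\in\mathcal D(A)$, or $E=\mathbb R^d$ and $\mathcal D(A)\supset C_c^\infty(\mathbb R^d)$). If the martingale problem for $A$ is well-posed, then the local martingale problem for $B$ is well-posed. -/

import Mathlib

open MeasureTheory ProbabilityTheory Filter Topology
open scoped NNReal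

universe u v

namespace MarkovCoupling

noncomputable section

/-! ### Cadlag paths, martingale problems, Markov processes -/

/-- A path is cadlag: right continuous with left limits. (At time `0` the second requirement is
empty, because `𝓝[<] 0 = ⊥` in `ℝ≥0`.) -/
def IsCadlag {S : Type*} [TopologicalSpace S] (x : ℝ≥0 → S) : Prop :=
  ∀ t, ContinuousWithinAt x (Set.Ici t) t ∧ ∃ l, Tendsto x (𝓝[<] t) (𝓝 l)

/-- The path space `D_S[0,∞)` of all cadlag paths. It carries the `σ`-algebra generated by the
coordinate maps, which for separable metric `S` is the Borel `σ`-algebra of the Skorokhod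
topology. -/
abbrev PathSpace (S : Type*) [TopologicalSpace S] : Type _ := {x : ℝ≥0 → S // IsCadlag x}

/-- The coordinate process on the path space. -/
def coord {S : Type*} [TopologicalSpace S] (t : ℝ≥0) (x : PathSpace S) : S := x.1 t

/-- The natural filtration `𝓕_t = σ(Z(s) : s ≤ t)` of a process with values in a separable
metrizable space. -/
abbrev naturalFiltration {S Ω : Type*} [TopologicalSpace S] [TopologicalSpace.MetrizableSpace S]
    [SecondCountableTopology S] [MeasurableSpace S] [BorelSpace S] [MeasurableSpace Ω]
    (Z : ℝ≥0 → Ω → S) (hZ : ∀ t, Measurable (Z t)) : Filtration ℝ≥0 ‹MeasurableSpace Ω› :=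
  Filtration.natural Z fun t => (hZ t).stronglyMeasurable

/-- The process `f(Z(t)) - f(Z(0)) - ∫₀ᵗ g(Z(s)) ds`. -/
def testProcess {S Ω : Type*} (f g : S → ℝ) (Z : ℝ≥0 → Ω → S) : ℝ≥0 → Ω → ℝ :=
  fun t ω => f (Z t ω) - f (Z 0 ω) - ∫ s in (0 : ℝ)..t, g (Z s.toNNReal ω)

section MartingaleProblem

variable {S Ω : Type*} [TopologicalSpace S] [TopologicalSpace.MetrizableSpace S]
  [SecondCountableTopology S] [MeasurableSpace S] [BorelSpace S] [MeasurableSpace Ω]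

/-- `Z` is a cadlag solution of the martingale problem for the (possibly multivalued) operator
`G`, a set of pairs of functions: for every `(f, g) ∈ G`, the test process is a martingale with
respect to the natural filtration of `Z`. -/
structure SolvesMP (G : Set ((S → ℝ) × (S → ℝ))) (Z : ℝ≥0 → Ω → S) (P : Measure Ω) : Prop where
  measurable : ∀ t, Measurable (Z t)
  cadlag : ∀ ω, IsCadlag fun t => Z t ω
  martingale : ∀ p ∈ G,
    Martingale (testProcess p.1 p.2 Z) (naturalFiltration Z measurable) P

/-- `Z` is a cadlag solution of the local martingale problem for `G`: for every `(f, g) ∈ G`, the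
test process is a local martingale with respect to the natural filtration of `Z`. -/
structure SolvesLocalMP (G : Set ((S → ℝ) × (S → ℝ))) (Z : ℝ≥0 → Ω → S) (P : Measure Ω) :
    Prop where
  measurable : ∀ t, Measurable (Z t)
  cadlag : ∀ ω, IsCadlag fun t => Z t ω
  localMartingale : ∀ p ∈ G,
    Locally (fun M => Martingale M (naturalFiltration Z measurable) P)
      (naturalFiltration Z measurable) (testProcess p.1 p.2 Z) P

/-- The Markov property of `Z` with respect to its natural filtration:
`P(Z(t) ∈ Γ | 𝓕_s) = P(Z(t) ∈ Γ | Z(s))` a.s. for all `s ≤ t` and all Borel sets `Γ`. -/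
structure IsMarkov (Z : ℝ≥0 → Ω → S) (P : Measure Ω) : Prop where
  measurable : ∀ t, Measurable (Z t)
  markov : ∀ s t : ℝ≥0, s ≤ t → ∀ Γ : Set S, MeasurableSet Γ →
    P[(Z t ⁻¹' Γ).indicator (fun _ => (1 : ℝ)) | naturalFiltration Z measurable s] =ᵐ[P]
      P[(Z t ⁻¹' Γ).indicator (fun _ => (1 : ℝ)) | MeasurableSpace.comap (Z s) inferInstance]

/-- The martingale problem for `G` is well-posed: for each initial distribution `μ` there is
exactly one law on the path space that solves it. -/
def WellPosedMP (G : Set ((S → ℝ) × (S → ℝ))) : Prop :=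
  ∀ μ : Measure S, IsProbabilityMeasure μ →
    ∃! P : Measure (PathSpace S),
      IsProbabilityMeasure P ∧ P.map (coord 0) = μ ∧ SolvesMP G coord P

/-- The local martingale problem for `G` is well-posed. -/
def WellPosedLocalMP (G : Set ((S → ℝ) × (S → ℝ))) : Prop :=
  ∀ μ : Measure S, IsProbabilityMeasure μ →
    ∃! P : Measure (PathSpace S),
      IsProbabilityMeasure P ∧ P.map (coord 0) = μ ∧ SolvesLocalMP G coord P

end MartingaleProblem

/-- A family `D` of functions determines the total mass of finite measures: two finite measures
with the same integrals of all `f ∈ D` have the same total mass. -/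
def DeterminesMass {E : Type*} [MeasurableSpace E] (D : Set (E → ℝ)) : Prop :=
  ∀ μ ν : Measure E, IsFiniteMeasure μ → IsFiniteMeasure ν →
    (∀ f ∈ D, ∫ x, f x ∂μ = ∫ x, f x ∂ν) → μ Set.univ = ν Set.univ

/-- A unit rate Poisson process (with nondecreasing right continuous paths). -/
structure IsUnitPoisson {Ω : Type*} [MeasurableSpace Ω] (N : ℝ≥0 → Ω → ℕ) (P : Measure Ω) :
    Prop where
  measurable : ∀ t, Measurable (N t)
  zero : ∀ ω, N 0 ω = 0
  mono : ∀ ω, Monotone fun t => N t ω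
  rightCont : ∀ ω t, ContinuousWithinAt (fun s => N s ω) (Set.Ici t) t
  indep : HasIndepIncrements N P
  law : ∀ s t : ℝ≥0, s ≤ t → P.map (fun ω => N t ω - N s ω) = poissonMeasure (t - s)

/-! ### The setting of the coupling -/

/-- The bounded continuous functions, as a set of plain functions. -/
def boundedContinuous (E : Type*) [TopologicalSpace E] : Set (E → ℝ) :=
  {f | Continuous f ∧ ∃ C, ∀ x, |f x| ≤ C}

/-- The assumption on an operator `A` of bounded continuous functions: `ϖ` is a stationary
distribution, which enters only through `∫ Af dϖ = 0`, and `ϖ_k(dx) = η_k(x) ϖ(dx)` are signed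
measures of total mass zero which are left eigenmeasures of `A` for the eigenvalues `-lam k`. -/
structure EigenmeasureAssumption {E : Type*} [TopologicalSpace E] [MeasurableSpace E]
    (A : Set ((E → ℝ) × (E → ℝ))) (m : ℕ) (ϖ : Measure E) (η : Fin m → E → ℝ)
    (lam : Fin m → ℝ) : Prop where
  subset : A ⊆ boundedContinuous E ×ˢ boundedContinuous E
  isProbabilityMeasure : IsProbabilityMeasure ϖ
  stationary : ∀ p ∈ A, ∫ x, p.2 x ∂ϖ = 0
  lam_pos : ∀ k, 0 < lam k
  eta_mem : ∀ k, η k ∈ boundedContinuous E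
  eigen : ∀ k, ∀ p ∈ A, ∫ x, p.2 x * η k x ∂ϖ = -lam k * ∫ x, p.1 x * η k x ∂ϖ
  mass_zero : ∀ k, ∫ x, η k x ∂ϖ = 0

/-- `α_i(x) = 1 + ∑_k ξ^{(k)}_i η_k(x)`. -/
def alpha {E : Type*} {m : ℕ} (η : Fin m → E → ℝ) (ξ : Fin m → Fin (m + 1) → ℝ)
    (i : Fin (m + 1)) (x : E) : ℝ :=
  1 + ∑ k, ξ k i * η k x

/-- `Q` is the generator of a Markov chain on `{0, …, m}` with eigenvalues
`0, -lam 1, …, -lam m`, the vector `ξ k` is a right eigenvector for `-lam k`, and all the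
functions `α_i` are strictly positive. -/
structure ChainAssumption {E : Type*} [TopologicalSpace E] [MeasurableSpace E]
    (A : Set ((E → ℝ) × (E → ℝ))) (m : ℕ) (ϖ : Measure E) (η : Fin m → E → ℝ)
    (lam : Fin m → ℝ) (Q : Matrix (Fin (m + 1)) (Fin (m + 1)) ℝ)
    (ξ : Fin m → Fin (m + 1) → ℝ) : Prop where
  eigenmeasure : EigenmeasureAssumption A m ϖ η lam
  offDiag_nonneg : ∀ i j, i ≠ j → 0 ≤ Q i j
  rowSum_zero : ∀ i, ∑ j, Q i j = 0
  eigenvalues : spectrum ℂ (Q.map (fun a : ℝ => (a : ℂ))) =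
    insert 0 (Set.range fun k => ((-lam k : ℝ) : ℂ))
  eigenvector : ∀ k, Module.End.HasEigenvector (Matrix.toLin' Q) (-lam k) (ξ k)
  alpha_pos : ∀ i x, 0 < alpha η ξ i x

/-- The state-dependent rates `q_{ij}(x) = Q_{ij} α_j(x) / α_i(x)`, used for `i ≠ j`. -/
def rate {E : Type*} {m : ℕ} (Q : Matrix (Fin (m + 1)) (Fin (m + 1)) ℝ) (η : Fin m → E → ℝ)
    (ξ : Fin m → Fin (m + 1) → ℝ) (i j : Fin (m + 1)) (x : E) : ℝ :=
  Q i j * alpha η ξ j x / alpha η ξ i x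

/-- The operator `B` on functions on `E × {0, …, m}`. Its domain consists of the products
`f(x,i) = f₁(x) f₂(i)` with `f₁` in the domain of `A` and `f₂` arbitrary, and
`Bf(x,i) = f₂(i) Af₁(x) + ∑_{j ≠ i} q_{ij}(x) (f(x,j) - f(x,i))`. -/
def coupledGenerator {E : Type*} {m : ℕ} (A : Set ((E → ℝ) × (E → ℝ)))
    (Q : Matrix (Fin (m + 1)) (Fin (m + 1)) ℝ) (η : Fin m → E → ℝ)
    (ξ : Fin m → Fin (m + 1) → ℝ) :
    Set ((E × Fin (m + 1) → ℝ) × (E × Fin (m + 1) → ℝ)) :=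
  {p | ∃ a ∈ A, ∃ f₂ : Fin (m + 1) → ℝ,
    p = (fun z => a.1 z.1 * f₂ z.2,
      fun z => f₂ z.2 * a.2 z.1 + ∑ j ∈ Finset.univ.erase z.2,
        rate Q η ξ z.2 j z.1 * (a.1 z.1 * f₂ j - a.1 z.1 * f₂ z.2))}

/-- The ordered pairs of distinct states of the chain. -/
abbrev OffDiag (m : ℕ) : Type := {p : Fin (m + 1) × Fin (m + 1) // p.1 ≠ p.2}

/-- The internal clock `∫₀ᵗ 1_{Y(s) = i} q_{ij}(X(s)) ds` of the transition `(i, j)`; it is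
nonnegative, hence `Real.toNNReal` only changes its type. -/
def clock {E Ω : Type*} {m : ℕ} (q : Fin (m + 1) → Fin (m + 1) → E → ℝ) (X : ℝ≥0 → Ω → E)
    (Y : ℝ≥0 → Ω → Fin (m + 1)) (p : OffDiag m) (t : ℝ≥0) (ω : Ω) : ℝ≥0 :=
  (∫ s in (0 : ℝ)..t,
    if Y s.toNNReal ω = p.1.1 then q p.1.1 p.1.2 (X s.toNNReal ω) else 0).toNNReal

/-- The independent unit rate Poisson processes `N_{ij}`, `i ≠ j`, are independent of `X`, and
almost surely, for all `t ≥ 0`,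
`Y(t) = k + ∑_{i ≠ j} (j - i) N_{ij}(∫₀ᵗ 1_{Y(s) = i} q_{ij}(X(s)) ds)`. -/
structure IsPoissonDriven {E Ω : Type*} [MeasurableSpace E] [MeasurableSpace Ω] {m : ℕ}
    (q : Fin (m + 1) → Fin (m + 1) → E → ℝ) (k : Fin (m + 1)) (X : ℝ≥0 → Ω → E)
    (Y : ℝ≥0 → Ω → Fin (m + 1)) (N : OffDiag m → ℝ≥0 → Ω → ℕ) (P : Measure Ω) : Prop where
  poisson : ∀ p, IsUnitPoisson (N p) P
  indep : iIndepFun (fun p ω (t : ℝ≥0) => N p t ω) P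
  indep_X : IndepFun (fun ω (t : ℝ≥0) => X t ω) (fun ω (p : OffDiag m) (t : ℝ≥0) => N p t ω) P
  equation : ∀ᵐ ω ∂P, ∀ t, ((Y t ω : ℕ) : ℤ) =
    ((k : ℕ) : ℤ) + ∑ p : OffDiag m,
      (((p.1.2 : ℕ) : ℤ) - ((p.1.1 : ℕ) : ℤ)) * (N p (clock q X Y p t ω) ω : ℤ)

end

end MarkovCoupling

namespace MarkovCoupling

set_option linter.unusedSectionVars false

/-! ### Right continuous paths and processes -/

/-! Existence of the coupling. For a fixed path of `X` and fixed counting paths the equation for `Y`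
is a time change equation. Its clocks at time `t` depend only on `Y` before `t`, so Picard iteration
stabilises after finitely many steps on every bounded interval (`picard_stabilizes`). The clocks are
read from explicitly constructed Poisson processes independent of `X`. These processes start afresh
at the random clock values (`map_shift_solClk`), and over a short step at most one potential jump
occurs up to an error of second order. Two consequences follow: `Y` almost surely never has to be
forced back into `{0, …, m}` (`ae_solZ_mem`), and, given `X`, the process `f₂(Y)` minus its
compensator is a martingale (`setIntegral_compens_eq`).

Conversely, for fixed counting paths `Y` is an adapted functional of `X`, so the martingales of `X`
may be tested against it. The product `f₁(X) f₂(Y)` is then treated by integration by parts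
(`product_increment_eq`, `setIntegral_couplOp_eq`), each factor being averaged with the randomness
of the other one frozen. The rates need not be bounded, hence everything is stopped when the
integrated total rate reaches a level `n`, and the result is a local martingale. The Markov property
combines the fresh start of the Poisson processes with the Markov property of `X`.

Well-posedness. Existence comes from the coupling by mixing over the initial state of the chain. For
uniqueness let `(X, Y)` be any solution. The choice `f₂ = 1` shows that `X` solves the martingale
problem for `A` in the joint filtration. The central claim is that the compensated increments of `Y`
are orthogonal to the whole path of `X`. It is proved first while `Y` stays in one state `i`
(`Sojourn`). If `f₂(i) = 0` and `f₂ ≥ 0`, the product identity says that the exit distribution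
weighted by `f₂` and the measure of the expected exit rates agree on `𝒟(A)`; since `𝒟(A)` determines
total mass they agree on the constant `1`, so the compensated increment `D` has mean zero. A second
use of the product identity makes `D` orthogonal to the martingales of `X`. Hence, for a constant
`C` that bounds `D`, the densities `C + D` and `C`, once normalised, both turn the law of `X` into a
solution for `A` with one and the same initial distribution; well-posedness for `A` makes these laws
equal, so `D` is orthogonal to the path of `X`. Successive exit times extend this to arbitrary time
intervals (`setIntegral_compIncr_path`).

As a result, on events where the rates are bounded, the integrals of path functionals of `X` over
`{Y(r) = k}` satisfy a closed linear evolution equation. A factorial bound shows that two solutions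
with the same data at time `s` agree at later times (`abs_occ_sub_le`, `Agree.mono`). Induction on
the number of observation times gives the joint law of `X` and the finite dimensional distributions
of `Y`. -/

def RightCont {S : Type*} [TopologicalSpace S] (x : ℝ≥0 → S) : Prop :=
  ∀ t, ContinuousWithinAt x (Set.Ici t) t

lemma IsCadlag.rightCont {S : Type*} [TopologicalSpace S] {x : ℝ≥0 → S} (h : IsCadlag x) :
    RightCont x := fun t => (h t).1

lemma IsCadlag.comp {S T : Type*} [TopologicalSpace S] [TopologicalSpace T] {x : ℝ≥0 → S}
    (h : IsCadlag x) {f : S → T} (hf : Continuous f) : IsCadlag fun t => f (x t) := by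
  intro t
  obtain ⟨l, hl⟩ := (h t).2
  exact ⟨hf.continuousAt.comp_continuousWithinAt (h t).1, f l, (hf.tendsto l).comp hl⟩

lemma RightCont.comp {S T : Type*} [TopologicalSpace S] [TopologicalSpace T] {x : ℝ≥0 → S}
    (h : RightCont x) {f : S → T} (hf : Continuous f) : RightCont fun t => f (x t) :=
  fun t => hf.continuousAt.comp_continuousWithinAt (h t)

/-- Right continuity is preserved by nondecreasing continuous time changes. -/
lemma RightCont.comp_monotone {S : Type*} [TopologicalSpace S] {x : ℝ≥0 → S}
    (h : RightCont x) {a : ℝ≥0 → ℝ≥0} (ha : Continuous a) (hm : Monotone a) :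
    RightCont fun t => x (a t) := fun t =>
  (h (a t)).comp ha.continuousWithinAt fun _ hs => hm hs

/-- The smallest dyadic point of level `n` strictly to the right of `r`. -/
noncomputable def gridUp (n : ℕ) (r : ℝ≥0) : ℝ≥0 := (⌊r * 2 ^ n⌋₊ + 1) / 2 ^ n

lemma lt_gridUp (n : ℕ) (r : ℝ≥0) : r < gridUp n r := by
  rw [gridUp, lt_div_iff₀ (by positivity)]
  exact Nat.lt_floor_add_one _

lemma gridUp_le (n : ℕ) (r : ℝ≥0) : gridUp n r ≤ r + (1 / 2) ^ n := by
  rw [gridUp, add_div, one_div_pow]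
  gcongr
  rw [div_le_iff₀ (by positivity)]
  exact Nat.floor_le (by positivity)

lemma tendsto_gridUp (r : ℝ≥0) : Tendsto (fun n => gridUp n r) atTop (𝓝[≥] r) := by
  refine tendsto_nhdsWithin_iff.2 ⟨?_, .of_forall fun n => (lt_gridUp n r).le⟩
  refine tendsto_of_tendsto_of_tendsto_of_le_of_le tendsto_const_nhds ?_
    (fun n => (lt_gridUp n r).le) (fun n => gridUp_le n r)
  have : Tendsto (fun n : ℕ => r + (1 / 2 : ℝ≥0) ^ n) atTop (𝓝 (r + 0)) :=
    tendsto_const_nhds.add (NNReal.tendsto_pow_atTop_nhds_zero_of_lt_one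
      (by rw [one_div]; exact inv_lt_one_of_one_lt₀ one_lt_two))
  simpa using this

lemma RightCont.tendsto_gridUp {S : Type*} [TopologicalSpace S] {x : ℝ≥0 → S}
    (h : RightCont x) (r : ℝ≥0) : Tendsto (fun n => x (gridUp n r)) atTop (𝓝 (x r)) :=
  (h r).tendsto.comp (MarkovCoupling.tendsto_gridUp r)

lemma tendsto_min_gridUp {r t : ℝ≥0} (h : r ≤ t) :
    Tendsto (fun n => min (gridUp n r) t) atTop (𝓝[≥] r) := by
  have h1 := tendsto_nhdsWithin_iff.1 (tendsto_gridUp r)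
  refine tendsto_nhdsWithin_iff.2 ⟨?_, .of_forall fun n => le_min (lt_gridUp n r).le h⟩
  simpa [min_eq_left h] using h1.1.min (tendsto_const_nhds (x := t))

section Joint

variable {Θ : Type*} [MeasurableSpace Θ] {S : Type*} [TopologicalSpace S]
  [TopologicalSpace.PseudoMetrizableSpace S] [MeasurableSpace S] [BorelSpace S]

/-- By right continuity the process is the pointwise limit of its values at `gridUp n r`, and these
depend on time only through the natural number `⌊r * 2 ^ n⌋₊`. -/
lemma measurable_uncurry_of_rightCont {x : ℝ≥0 → Θ → S} (hm : ∀ r, Measurable (x r))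
    (hc : ∀ θ, RightCont fun r => x r θ) : Measurable fun p : ℝ≥0 × Θ => x p.1 p.2 := by
  have hlim : Tendsto (fun (n : ℕ) (p : ℝ≥0 × Θ) => x (gridUp n p.1) p.2) atTop
      (𝓝 fun p => x p.1 p.2) := by
    rw [tendsto_pi_nhds]
    intro p
    exact (hc p.2).tendsto_gridUp p.1
  refine measurable_of_tendsto_metrizable (fun n => ?_) hlim
  have h1 : Measurable fun q : ℕ × Θ => x (((q.1 : ℝ≥0) + 1) / 2 ^ n) q.2 :=
    measurable_from_prod_countable_right fun k => hm (((k : ℝ≥0) + 1) / 2 ^ n)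
  have h2 : Measurable fun p : ℝ≥0 × Θ => (⌊p.1 * 2 ^ n⌋₊, p.2) :=
    (Nat.measurable_floor.comp (measurable_fst.mul_const _)).prodMk measurable_snd
  have h3 : (fun p : ℝ≥0 × Θ => x (gridUp n p.1) p.2) =
      (fun q : ℕ × Θ => x ((q.1 + 1) / 2 ^ n) q.2) ∘ fun p => (⌊p.1 * 2 ^ n⌋₊, p.2) := rfl
  rw [h3]
  exact h1.comp h2

lemma measurable_eval_of_rightCont {x : ℝ≥0 → Θ → S} (hm : ∀ r, Measurable (x r))
    (hc : ∀ θ, RightCont fun r => x r θ) {σ : Θ → ℝ≥0} (hσ : Measurable σ) :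
    Measurable fun θ => x (σ θ) θ :=
  (measurable_uncurry_of_rightCont hm hc).comp (hσ.prodMk measurable_id)

lemma RightCont.measurable {x : ℝ≥0 → S} (h : RightCont x) : Measurable x := by
  have := measurable_uncurry_of_rightCont (Θ := Unit) (x := fun r _ => x r)
    (fun r => measurable_const) (fun _ => h)
  exact this.comp (g := fun p : ℝ≥0 × Unit => x p.1)
    (measurable_id.prodMk (measurable_const (a := ())))

end Joint

/-! ### Path integrals -/

section Integrals

/-- A measurable path which is bounded on bounded time intervals. -/
structure LocBdd (x : ℝ≥0 → ℝ) : Prop where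
  measurable : Measurable x
  bdd : ∀ T, ∃ C, ∀ s ≤ T, |x s| ≤ C

/-- One-sided limits bound the path near every point, and compactness of `[0, T]` reduces this to
finitely many neighbourhoods. -/
lemma IsCadlag.locBdd {x : ℝ≥0 → ℝ} (h : IsCadlag x) : LocBdd x := by
  refine ⟨h.rightCont.measurable, fun T => ?_⟩
  have key : ∀ t : ℝ≥0, ∃ C, ∀ᶠ s in 𝓝 t, |x s| ≤ C := by
    intro t
    obtain ⟨l, hl⟩ := (h t).2
    have h1 : ∀ᶠ s in 𝓝[≥] t, |x s| ≤ |x t| + 1 :=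
      ((continuous_abs.tendsto _).comp (h t).1.tendsto).eventually_le_const (by simp)
    have h2 : ∀ᶠ s in 𝓝[<] t, |x s| ≤ |l| + 1 :=
      ((continuous_abs.tendsto _).comp hl).eventually_le_const (by simp)
    refine ⟨max (|x t| + 1) (|l| + 1), ?_⟩
    rw [← nhdsLT_sup_nhdsGE t, eventually_sup]
    exact ⟨h2.mono fun s hs => hs.trans (le_max_right _ _),
      h1.mono fun s hs => hs.trans (le_max_left _ _)⟩
  choose C hC using key
  obtain ⟨F, hF, hF'⟩ := (isCompact_Icc (a := (0 : ℝ≥0)) (b := T)).elim_nhds_subcover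
    (fun t => {s | |x s| ≤ C t}) fun t _ => hC t
  refine ⟨∑ t ∈ F, |C t|, fun s hs => ?_⟩
  obtain ⟨t, ht, hst⟩ := Set.mem_iUnion₂.1 (hF' ⟨zero_le, hs⟩)
  exact (show |x s| ≤ C t from hst).trans <| (le_abs_self _).trans <|
    Finset.single_le_sum (f := fun t => |C t|) (fun i _ => abs_nonneg _) ht

lemma LocBdd.intervalIntegrable {x : ℝ≥0 → ℝ} (h : LocBdd x) (a b : ℝ) :
    IntervalIntegrable (fun s : ℝ => x s.toNNReal) volume a b := by
  obtain ⟨C, hC⟩ := h.bdd (max a b).toNNReal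
  refine IntervalIntegrable.mono_fun' (g := fun _ => C) intervalIntegrable_const
    (h.measurable.comp measurable_real_toNNReal).aestronglyMeasurable ?_
  refine (ae_restrict_iff' measurableSet_uIoc).2 (.of_forall fun s hs => ?_)
  exact hC _ (Real.toNNReal_le_toNNReal hs.2)

lemma LocBdd.mul {x y : ℝ≥0 → ℝ} (hx : LocBdd x) (hy : LocBdd y) : LocBdd fun s => x s * y s := by
  refine ⟨hx.measurable.mul hy.measurable, fun T => ?_⟩
  obtain ⟨C, hC⟩ := hx.bdd T
  obtain ⟨D, hD⟩ := hy.bdd T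
  refine ⟨C * D, fun s hs => ?_⟩
  rw [abs_mul]
  exact mul_le_mul (hC s hs) (hD s hs) (abs_nonneg _) ((abs_nonneg _).trans (hC s hs))

lemma LocBdd.add {x y : ℝ≥0 → ℝ} (hx : LocBdd x) (hy : LocBdd y) : LocBdd fun s => x s + y s := by
  refine ⟨hx.measurable.add hy.measurable, fun T => ?_⟩
  obtain ⟨C, hC⟩ := hx.bdd T
  obtain ⟨D, hD⟩ := hy.bdd T
  exact ⟨C + D, fun s hs => (abs_add_le _ _).trans (add_le_add (hC s hs) (hD s hs))⟩

lemma LocBdd.of_bound {x : ℝ≥0 → ℝ} (hx : Measurable x) {C : ℝ} (h : ∀ s, |x s| ≤ C) : LocBdd x :=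
  ⟨hx, fun _ => ⟨C, fun s _ => h s⟩⟩

lemma LocBdd.sum {ι : Type*} {s : Finset ι} {x : ι → ℝ≥0 → ℝ} (h : ∀ i ∈ s, LocBdd (x i)) :
    LocBdd fun r => ∑ i ∈ s, x i r := by
  classical
  induction s using Finset.induction_on with
  | empty => simpa using LocBdd.of_bound (x := fun _ => 0) measurable_const (C := 0) (by simp)
  | insert a s ha ih =>
    simp only [Finset.sum_insert ha]
    exact (h a (by simp)).add (ih fun i hi => h i (by simp [hi]))

lemma LocBdd.shift {x : ℝ≥0 → ℝ} (h : LocBdd x) (t : ℝ≥0) : LocBdd fun s => x (t + s) := by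
  refine ⟨h.measurable.comp (measurable_const_add t), fun T => ?_⟩
  obtain ⟨C, hC⟩ := h.bdd (t + T)
  exact ⟨C, fun s hs => hC _ (by gcongr)⟩

lemma LocBdd.indicator {x : ℝ≥0 → ℝ} (h : LocBdd x) {A : Set ℝ≥0} (hA : MeasurableSet A) :
    LocBdd (A.indicator x) := by
  refine ⟨h.measurable.indicator hA, fun T => ?_⟩
  obtain ⟨C, hC⟩ := h.bdd T
  refine ⟨C, fun s hs => ?_⟩
  by_cases hsA : s ∈ A
  · simpa [hsA] using hC s hs
  · simpa [hsA] using (abs_nonneg _).trans (hC s hs)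

lemma LocBdd.continuous_integral {x : ℝ≥0 → ℝ} (h : LocBdd x) :
    Continuous fun t : ℝ≥0 => ∫ s in (0 : ℝ)..t, x s.toNNReal :=
  (intervalIntegral.continuous_primitive (fun a b => h.intervalIntegrable a b) 0).comp
    NNReal.continuous_coe

variable {Θ : Type*} [MeasurableSpace Θ]

lemma measurable_integral_path {x : ℝ≥0 → Θ → ℝ}
    (hx : Measurable fun p : ℝ≥0 × Θ => x p.1 p.2) (a b : ℝ) :
    Measurable fun θ => ∫ s in a..b, x s.toNNReal θ := by
  have h1 : StronglyMeasurable fun p : Θ × ℝ => x p.2.toNNReal p.1 := by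
    refine (hx.comp (?_ : Measurable fun p : Θ × ℝ => (p.2.toNNReal, p.1))).stronglyMeasurable
    fun_prop
  simp only [intervalIntegral]
  exact (h1.integral_prod_right (ν := volume.restrict (Set.Ioc a b))).measurable.sub
    (h1.integral_prod_right (ν := volume.restrict (Set.Ioc b a))).measurable

end Integrals

/-! ### Optional stopping -/

section OptionalStopping

variable {Ω : Type*} {mΩ : MeasurableSpace Ω} {P : Measure Ω} {ℱ : Filtration ℝ≥0 mΩ}

/-- A finite stopping time. -/
abbrev IsStop (ℱ : Filtration ℝ≥0 mΩ) (σ : Ω → ℝ≥0) : Prop :=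
  IsStoppingTime ℱ fun ω => (σ ω : WithTop ℝ≥0)

lemma measurable_of_isStoppingTime {σ : Ω → ℝ≥0} (hσ : IsStop ℱ σ) : Measurable σ := by
  refine measurable_of_Iic fun a => ?_
  have := ℱ.le a _ (hσ a)
  simp only [WithTop.coe_le_coe] at this
  exact this

lemma isStoppingTime_min_gridUp {σ : Ω → ℝ≥0} (hσ : IsStop ℱ σ) (t : ℝ≥0) (n : ℕ) :
    IsStop ℱ fun ω => min (gridUp n (σ ω)) t := by
  intro r
  simp only [WithTop.coe_le_coe, min_le_iff]
  by_cases htr : t ≤ r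
  · simp [htr]
  · simp only [htr, or_false]
    -- Rounding strictly upwards to the grid turns the event into a strict inequality at the largest
    -- grid point not exceeding `r`.
    have : {ω | gridUp n (σ ω) ≤ r} =
        {ω | (σ ω : WithTop ℝ≥0) < ((⌊r * 2 ^ n⌋₊ / 2 ^ n : ℝ≥0) : WithTop ℝ≥0)} := by
      ext ω
      simp only [Set.mem_ofPred_eq, WithTop.coe_lt_coe, gridUp]
      rw [div_le_iff₀ (by positivity), lt_div_iff₀ (by positivity), ← Nat.floor_lt (by positivity),
        ← Nat.cast_one, ← Nat.cast_add, ← Nat.le_floor_iff (by positivity), Nat.succ_le_iff]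
    rw [this]
    refine ℱ.mono ?_ _ (hσ.measurableSet_lt _)
    rw [div_le_iff₀ (by positivity)]
    exact Nat.floor_le (by positivity)

variable [IsProbabilityMeasure P]

/-- Optional stopping for right continuous martingales at a bounded stopping time, tested with a
bounded right continuous adapted process. -/
lemma integral_mul_sub_stopped_eq_zero {M : ℝ≥0 → Ω → ℝ} (hM : Martingale M ℱ P)
    (hMc : ∀ ω, RightCont fun t => M t ω) {σ : Ω → ℝ≥0} {s t : ℝ≥0}
    (hσ : IsStop ℱ σ) (hs : ∀ ω, s ≤ σ ω) (ht : ∀ ω, σ ω ≤ t)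
    {G : ℝ≥0 → Ω → ℝ} (hG : ∀ r, s ≤ r → Measurable[ℱ r] (G r))
    (hGc : ∀ ω r, s ≤ r → ContinuousWithinAt (fun q => G q ω) (Set.Ici r) r) {C : ℝ}
    (hGb : ∀ r ω, |G r ω| ≤ C) :
    Integrable (fun ω => M (σ ω) ω) P ∧ ∫ ω, G (σ ω) ω * (M t ω - M (σ ω) ω) ∂P = 0 := by
  set τ : ℕ → Ω → ℝ≥0 := fun n ω => min (gridUp n (σ ω)) t with hτ
  have hτst : ∀ n, IsStop ℱ (τ n) := fun n =>
    isStoppingTime_min_gridUp hσ t n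
  have hτt : ∀ n ω, τ n ω ≤ t := fun n ω => min_le_right _ _
  have hsτ : ∀ n ω, s ≤ τ n ω := fun n ω => (hs ω).trans (le_min (lt_gridUp n _).le (ht ω))
  have hσm := measurable_of_isStoppingTime hσ
  have hτm : ∀ n, Measurable (τ n) := fun n => measurable_of_isStoppingTime (hτst n)
  have hlim : ∀ ω, Tendsto (fun n => τ n ω) atTop (𝓝[≥] (σ ω)) := fun ω =>
    tendsto_min_gridUp (ht ω)
  have hcount : ∀ n, (Set.range (τ n)).Countable := fun n => by
    refine (Set.countable_range fun k : ℕ => min (((k : ℝ≥0) + 1) / 2 ^ n) t).mono ?_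
    rintro _ ⟨ω, rfl⟩
    exact ⟨⌊σ ω * 2 ^ n⌋₊, rfl⟩
  have hcount' : ∀ n, (Set.range fun ω => (τ n ω : WithTop ℝ≥0)).Countable := fun n => by
    rw [show (fun ω => (τ n ω : WithTop ℝ≥0)) = (fun x : ℝ≥0 => (x : WithTop ℝ≥0)) ∘ τ n from rfl,
      Set.range_comp]
    exact (hcount n).image _
  have hMm : ∀ r, Measurable (M r) := fun r => ((hM.1 r).mono (ℱ.le r)).measurable
  have hMτm : ∀ n, Measurable fun ω => M (τ n ω) ω := fun n =>
    measurable_eval_of_rightCont hMm hMc (hτm n)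
  have hMσm : Measurable fun ω => M (σ ω) ω := measurable_eval_of_rightCont hMm hMc hσm
  have hcond : ∀ n, (fun ω => M (τ n ω) ω) =ᵐ[P] P[M t | (hτst n).measurableSpace] := fun n => by
    have := hM.stoppedValue_ae_eq_condExp_of_le_const_of_countable_range (hτst n) (n := t)
      (fun ω => WithTop.coe_le_coe.2 (hτt n ω)) (hcount' n)
    exact this
  -- The stopped values are conditional expectations of the single integrable variable `M t`, hence
  -- uniformly integrable. Vitali's theorem then upgrades the pointwise convergence to convergence
  -- in `L¹`.
  have hui : UniformIntegrable (fun n ω => M (τ n ω) ω) 1 P :=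
    ((hM.integrable t).uniformIntegrable_condExp
      (fun n => (hτst n).measurableSpace_le)).ae_eq fun n => (hcond n).symm
  have hMlim : ∀ ω, Tendsto (fun n => M (τ n ω) ω) atTop (𝓝 (M (σ ω) ω)) := fun ω =>
    (hMc ω (σ ω)).tendsto.comp (hlim ω)
  have hMσ1 : MemLp (fun ω => M (σ ω) ω) 1 P := by
    refine hui.memLp_of_ae_tendsto (.of_forall hMlim)
  have hL1 := tendsto_Lp_finite_of_tendsto_ae le_rfl ENNReal.one_ne_top
    (fun n => (hMτm n).aestronglyMeasurable) hMσ1 hui.2.1 (.of_forall hMlim)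
  have hMσi : Integrable (fun ω => M (σ ω) ω) P := memLp_one_iff_integrable.1 hMσ1
  have hMτi : ∀ n, Integrable (fun ω => M (τ n ω) ω) P := fun n =>
    integrable_condExp.congr (hcond n).symm
  refine ⟨hMσi, ?_⟩
  -- the discretised identity
  have hGτm : ∀ n, Measurable[(hτst n).measurableSpace] fun ω => G (τ n ω) ω := by
    intro n A hA
    have : (fun ω => G (τ n ω) ω) ⁻¹' A =
        ⋃ x ∈ Set.range (τ n), {ω | τ n ω = x} ∩ (G x) ⁻¹' A := by
      ext ω
      simp only [Set.mem_preimage, Set.mem_iUnion, Set.mem_inter_iff, Set.mem_ofPred_eq]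
      exact ⟨fun h => ⟨τ n ω, ⟨ω, rfl⟩, rfl, h⟩, fun ⟨x, _, h1, h2⟩ => by rw [h1]; exact h2⟩
    rw [this]
    refine MeasurableSet.biUnion (hcount n) fun x hx => ?_
    obtain ⟨ω0, rfl⟩ := hx
    have h1 := (hτst n).measurableSet_inter_eq_iff ((G (τ n ω0)) ⁻¹' A) (τ n ω0)
    simp only [WithTop.coe_inj] at h1
    rw [Set.inter_comm]
    refine h1.2 ?_
    refine MeasurableSet.inter (hG _ (hsτ n ω0) hA) ?_
    have := (hτst n).measurableSet_eq (τ n ω0)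
    simpa only [WithTop.coe_inj] using this
  have hdisc : ∀ n, ∫ ω, G (τ n ω) ω * (M t ω - M (τ n ω) ω) ∂P = 0 := by
    intro n
    have h0 : P[fun ω => G (τ n ω) ω * (M t ω - M (τ n ω) ω) | (hτst n).measurableSpace]
        =ᵐ[P] 0 := by
      have hi : Integrable (fun ω => M t ω - M (τ n ω) ω) P := (hM.integrable t).sub (hMτi n)
      have hbd : Integrable (fun ω => G (τ n ω) ω * (M t ω - M (τ n ω) ω)) P :=
        hi.bdd_mul (c := C) ((hGτm n).mono (hτst n).measurableSpace_le le_rfl).aestronglyMeasurable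
          (.of_forall fun ω => hGb _ _)
      have h1 := condExp_mul_of_stronglyMeasurable_left (hGτm n).stronglyMeasurable hbd hi
      have h2 := condExp_sub (hM.integrable t) (hMτi n) (hτst n).measurableSpace
      have h3 : P[fun ω => M (τ n ω) ω | (hτst n).measurableSpace]
          =ᵐ[P] P[M t | (hτst n).measurableSpace] :=
        (condExp_congr_ae (hcond n)).trans
          (condExp_condExp_of_le le_rfl (hτst n).measurableSpace_le)
      refine h1.trans ?_
      filter_upwards [h2, h3] with ω h2 h3
      have h2' : (P[fun ω => M t ω - M (τ n ω) ω | (hτst n).measurableSpace]) ω = 0 := by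
        refine Eq.trans h2 ?_
        rw [Pi.sub_apply]
        linarith
      rw [Pi.mul_apply, h2', mul_zero, Pi.zero_apply]
    rw [← integral_condExp (hτst n).measurableSpace_le, integral_congr_ae h0]
    simp
  -- passage to the limit
  have hGlim : ∀ ω, Tendsto (fun n => G (τ n ω) ω) atTop (𝓝 (G (σ ω) ω)) := fun ω =>
    (hGc ω (σ ω) (hs ω)).tendsto.comp (hlim ω)
  have hGτm' : ∀ n, Measurable fun ω => G (τ n ω) ω := fun n =>
    (hGτm n).mono (hτst n).measurableSpace_le le_rfl
  have hA : Tendsto (fun n => ∫ ω, G (τ n ω) ω * (M t ω - M (σ ω) ω) ∂P) atTop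
      (𝓝 (∫ ω, G (σ ω) ω * (M t ω - M (σ ω) ω) ∂P)) := by
    refine tendsto_integral_of_dominated_convergence (fun ω => C * |M t ω - M (σ ω) ω|)
      (fun n => ((hGτm' n).mul ((hMm t).sub hMσm)).aestronglyMeasurable)
      (((hM.integrable t).sub hMσi).abs.const_mul C) (fun n => .of_forall fun ω => ?_)
      (.of_forall fun ω => (hGlim ω).mul tendsto_const_nhds)
    rw [Real.norm_eq_abs, abs_mul]
    exact mul_le_mul_of_nonneg_right (hGb _ _) (abs_nonneg _)
  have hB : Tendsto (fun n => ∫ ω, G (τ n ω) ω * (M (τ n ω) ω - M (σ ω) ω) ∂P) atTop (𝓝 0) := by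
    have hC : Tendsto (fun n => C * (eLpNorm ((fun ω => M (τ n ω) ω) - fun ω => M (σ ω) ω) 1
        P).toReal) atTop (𝓝 0) := by
      have := (ENNReal.tendsto_toReal ENNReal.zero_ne_top).comp hL1
      simpa using this.const_mul C
    refine squeeze_zero_norm (fun n => ?_) hC
    rw [eLpNorm_one_eq_lintegral_enorm, ← integral_norm_eq_lintegral_enorm
      ((hMτm n).sub hMσm).aestronglyMeasurable, ← integral_const_mul]
    refine (norm_integral_le_integral_norm _).trans ?_
    refine integral_mono_of_nonneg (.of_forall fun _ => norm_nonneg _)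
      (((hMτi n).sub hMσi).norm.const_mul C) (.of_forall fun ω => ?_)
    simp only [norm_mul, Pi.sub_apply]
    exact mul_le_mul_of_nonneg_right (hGb _ _) (norm_nonneg _)
  have hsum : ∀ n, ∫ ω, G (τ n ω) ω * (M t ω - M (σ ω) ω) ∂P =
      ∫ ω, G (τ n ω) ω * (M (τ n ω) ω - M (σ ω) ω) ∂P := by
    intro n
    rw [← sub_eq_zero, ← integral_sub, ← hdisc n]
    · congr 1 with ω
      ring
    · exact ((hM.integrable t).sub hMσi).bdd_mul (c := C) (hGτm' n).aestronglyMeasurable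
        (.of_forall fun ω => hGb _ _)
    · exact ((hMτi n).sub hMσi).bdd_mul (c := C) (hGτm' n).aestronglyMeasurable
        (.of_forall fun ω => hGb _ _)
  simp only [hsum] at hA
  exact tendsto_nhds_unique hA hB

end OptionalStopping

/-! ### Construction of Poisson processes -/

section Poisson

open Complex

lemma integral_infinitePi_prod {X : Type*} [MeasurableSpace X] (μ : Measure X)
    [IsProbabilityMeasure μ] (s : Finset ℕ) {f : ℕ → X → ℂ} (hf : ∀ i, Measurable (f i)) :
    ∫ y, ∏ i ∈ s, f i (y i) ∂(Measure.infinitePi fun _ : ℕ => μ) = ∏ i ∈ s, ∫ x, f i x ∂μ := by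
  have h1 := integral_restrict_infinitePi (μ := fun _ : ℕ => μ) (s := s)
    (f := fun y : (Π _ : s, X) => ∏ i : s, f i (y i)) (by
      refine Measurable.aestronglyMeasurable ?_
      exact Finset.measurable_prod _ fun i _ => (hf i).comp (measurable_pi_apply i))
  rw [integral_fintype_prod_eq_prod (f := fun (i : s) x => f i x),
    Finset.prod_coe_sort s (fun i => ∫ x, f i x ∂μ)] at h1
  rw [← h1]
  congr 1 with y
  exact (Finset.prod_coe_sort s (fun i => f i (y i))).symm

noncomputable def unifMeasure : Measure ℝ := volume.restrict (Set.Ioc 0 1)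

instance : IsProbabilityMeasure unifMeasure := ⟨by simp [unifMeasure]⟩

/-- A Poisson number of independent uniform points. -/
noncomputable def cellMeasure : Measure (ℕ × (ℕ → ℝ)) :=
  (poissonMeasure 1).prod (Measure.infinitePi fun _ : ℕ => unifMeasure)

instance : IsProbabilityMeasure cellMeasure := by unfold cellMeasure; infer_instance

/-- A sequence of point configurations, one for each of the cells `(n, n + 1]`. -/
abbrev PoiSpace : Type := ℕ → ℕ × (ℕ → ℝ)

/-- The law of independent Poisson point configurations. -/
noncomputable def poiMeasure : Measure PoiSpace := Measure.infinitePi fun _ => cellMeasure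

instance : IsProbabilityMeasure poiMeasure := by unfold poiMeasure; infer_instance

/-- The sum of `g` over the points of the first `M` cells. -/
noncomputable def pts (g : ℝ → ℝ) (M : ℕ) (w : PoiSpace) : ℝ :=
  ∑ n ∈ Finset.range M, ∑ l ∈ Finset.range (w n).1,
    if 0 < (w n).2 l then g (n + (w n).2 l) else 0

lemma measurable_sum_range {f : ℕ → ℝ → ℝ} (hf : ∀ l, Measurable (f l)) :
    Measurable fun c : ℕ × (ℕ → ℝ) => ∑ l ∈ Finset.range c.1, f l (c.2 l) :=
  measurable_from_prod_countable_right fun k =>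
    Finset.measurable_sum (Finset.range k) fun l _ =>
      (hf l).comp (measurable_pi_apply (X := fun _ : ℕ => ℝ) l)

lemma measurable_pts {g : ℝ → ℝ} (hg : Measurable g) (M : ℕ) : Measurable (pts g M) := by
  refine Finset.measurable_sum _ fun n _ => ?_
  refine (measurable_sum_range (f := fun _ x => if 0 < x then g (n + x) else 0)
    fun _ => ?_).comp (measurable_pi_apply n)
  exact Measurable.ite measurableSet_Ioi (hg.comp (measurable_const_add _)) measurable_const

/-- Given `k` points, independence yields the power `z ^ k` of the one point integral `z`; summation
against the Poisson weights with mean one gives `exp (z - 1)`. -/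
lemma integral_cell {h : ℝ → ℝ} (hh : Measurable h) :
    ∫ c, cexp ((∑ l ∈ Finset.range c.1, h (c.2 l) : ℝ) * I) ∂cellMeasure =
      cexp (∫ x, cexp (h x * I) ∂unifMeasure - 1) := by
  have hm : Measurable fun c : ℕ × (ℕ → ℝ) =>
      cexp ((∑ l ∈ Finset.range c.1, h (c.2 l) : ℝ) * I) :=
    Complex.measurable_exp.comp ((measurable_ofReal.comp
      (measurable_sum_range fun _ => hh)).mul_const I)
  have hi : Integrable (fun c : ℕ × (ℕ → ℝ) =>
      cexp ((∑ l ∈ Finset.range c.1, h (c.2 l) : ℝ) * I)) cellMeasure :=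
    Integrable.of_bound hm.aestronglyMeasurable 1 (.of_forall fun c => by
      rw [Complex.norm_exp_ofReal_mul_I])
  set z := ∫ x, cexp (h x * I) ∂unifMeasure
  have hz : ‖z‖ ≤ 1 := by
    refine (norm_integral_le_of_norm_le_const (C := 1) (.of_forall fun x => ?_)).trans ?_
    · rw [Complex.norm_exp_ofReal_mul_I]
    · simp
  unfold cellMeasure at hi ⊢
  rw [integral_prod _ hi]
  have h1 : ∀ k : ℕ, ∫ y : ℕ → ℝ, cexp ((∑ l ∈ Finset.range k, h (y l) : ℝ) * I)
      ∂(Measure.infinitePi fun _ : ℕ => unifMeasure) = z ^ k := by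
    intro k
    have := integral_infinitePi_prod unifMeasure (Finset.range k)
      (f := fun _ x => cexp (h x * I)) (fun _ => by fun_prop)
    rw [Finset.prod_const, Finset.card_range] at this
    rw [← this]
    congr 1 with y
    rw [← Complex.exp_sum]
    push_cast
    rw [Finset.sum_mul]
  simp only [h1]
  rw [integral_poissonMeasure, Complex.exp_sub]
  simp only [NNReal.coe_one, one_pow, mul_one]
  have h2 : ∀ k : ℕ, (Real.exp (-1) / (k.factorial : ℝ)) • z ^ k =
      cexp (-1) * (z ^ k / k.factorial) := by
    intro k
    rw [Complex.real_smul]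
    push_cast
    ring
  simp only [h2]
  rw [tsum_mul_left, Complex.exp_neg, div_eq_inv_mul]
  congr 1
  rw [Complex.exp_eq_exp_ℂ, NormedSpace.exp_eq_tsum_div]

/-- Campbell's formula for the characteristic functional. -/
lemma integral_pts {g : ℝ → ℝ} (hg : Measurable g) (M : ℕ) : ∫ w, cexp (pts g M w * I) ∂poiMeasure =
      cexp (∫ y in (0 : ℝ)..M, (cexp (g y * I) - 1)) := by
  have hh : ∀ n : ℕ, Measurable fun x : ℝ => if 0 < x then g (n + x) else 0 := fun n =>
    Measurable.ite measurableSet_Ioi (hg.comp (measurable_const_add _)) measurable_const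
  have h1 := integral_infinitePi_prod cellMeasure (Finset.range M)
    (f := fun n c => cexp ((∑ l ∈ Finset.range c.1,
      (fun x : ℝ => if 0 < x then g (n + x) else 0) (c.2 l) : ℝ) * I)) (fun n =>
      Complex.measurable_exp.comp ((measurable_ofReal.comp
      (measurable_sum_range fun _ => hh n)).mul_const I))
  -- A cell has length one, so the constant `-1` can be moved under the integral over `(n, n + 1]`;
  -- the cells then join to one integral over `[0, M]`.
  have h2 : ∀ n : ℕ, ∫ x, cexp (((fun x : ℝ => if 0 < x then g (n + x) else 0) x : ℝ) * I)
      ∂unifMeasure - 1 = ∫ y in ((n : ℕ) : ℝ)..(n + 1 : ℕ), (cexp (g y * I) - 1) := by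
    intro n
    have e1 : ∫ x, cexp (((fun x : ℝ => if 0 < x then g (n + x) else 0) x : ℝ) * I)
        ∂unifMeasure = ∫ x in (0 : ℝ)..1, cexp (g (n + x) * I) := by
      rw [intervalIntegral.integral_of_le zero_le_one]
      refine setIntegral_congr_fun measurableSet_Ioc fun x hx => ?_
      simp [hx.1]
    have e2 : ∫ x in (0 : ℝ)..1, (cexp (g (n + x) * I) - 1) =
        (∫ x in (0 : ℝ)..1, cexp (g (n + x) * I)) - 1 := by
      rw [intervalIntegral.integral_sub]
      · simp
      · refine IntervalIntegrable.mono_fun' (g := fun _ => 1) intervalIntegrable_const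
          (Measurable.aestronglyMeasurable (by fun_prop)) (.of_forall fun x => ?_)
        exact (Complex.norm_exp_ofReal_mul_I _).le
      · exact intervalIntegrable_const
    rw [e1, ← e2, intervalIntegral.integral_comp_add_left (fun y => cexp (g y * I) - 1)]
    simp
  simp only [integral_cell (hh _)] at h1
  simp only [h2] at h1
  rw [← Complex.exp_sum, intervalIntegral.sum_integral_adjacent_intervals] at h1
  · rw [Nat.cast_zero] at h1
    rw [← h1]
    unfold poiMeasure
    congr 1 with w
    rw [← Complex.exp_sum]
    congr 1
    simp only [pts]
    push_cast
    rw [Finset.sum_mul]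
  · intro k _
    refine IntervalIntegrable.mono_fun' (g := fun _ => 2) intervalIntegrable_const
      (by fun_prop) (.of_forall fun x => ?_)
    refine (norm_sub_le _ _).trans ?_
    rw [Complex.norm_exp_ofReal_mul_I, norm_one]
    norm_num

lemma intervalIntegrable_cexp_sub_one {g : ℝ → ℝ} (hg : Measurable g) (a b : ℝ) :
    IntervalIntegrable (fun y => cexp (g y * I) - 1) volume a b := by
  refine IntervalIntegrable.mono_fun' (g := fun _ => 2) intervalIntegrable_const
    (by fun_prop) (.of_forall fun x => ?_)
  refine (norm_sub_le _ _).trans ?_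
  rw [Complex.norm_exp_ofReal_mul_I, norm_one]
  norm_num

/-- Sums over disjointly supported functions are uncorrelated exponentially. -/
lemma integral_pts_sum {ι : Type*} [Fintype ι] {g : ι → ℝ → ℝ} (hg : ∀ i, Measurable (g i))
    (hd : ∀ y i j, i ≠ j → g i y = 0 ∨ g j y = 0) (M : ℕ) :
    ∫ w, cexp (pts (fun y => ∑ i, g i y) M w * I) ∂poiMeasure =
      ∏ i, ∫ w, cexp (pts (g i) M w * I) ∂poiMeasure := by
  simp only [integral_pts (hg _)]
  rw [integral_pts (Finset.measurable_sum _ fun i _ => hg i), ← Complex.exp_sum,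
    ← intervalIntegral.integral_finsetSum fun i _ => intervalIntegrable_cexp_sub_one (hg i) _ _]
  congr 2 with y
  -- At each `y` at most one `g i y` is nonzero, so `exp (i ∑ g) - 1` equals the sum of the terms
  -- `exp (i g) - 1`.
  by_cases h : ∃ i, g i y ≠ 0
  · obtain ⟨i, hi⟩ := h
    have h0 : ∀ j, j ≠ i → g j y = 0 := fun j hj => (hd y j i hj).resolve_right hi
    rw [Finset.sum_eq_single i (fun j _ hj => h0 j hj) (by simp),
      Finset.sum_eq_single i (fun j _ hj => by simp [h0 j hj]) (by simp)]
  · push Not at h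
    simp [h]

/-- The counting process of the points. -/
noncomputable def poi (t : ℝ≥0) (w : PoiSpace) : ℕ :=
  ∑ n ∈ Finset.range ⌈t⌉₊, ∑ l ∈ Finset.range (w n).1,
    if 0 < (w n).2 l ∧ (n : ℝ) + (w n).2 l ≤ t then 1 else 0

/-- The guard `0 < (w n).2 l` puts the counted points of cell `n` strictly to the right of `n`, for
every `w` and not just almost surely. Cells that begin at or after time `t` therefore contribute
nothing. -/
lemma poi_eq {t : ℝ≥0} {M : ℕ} (h : t ≤ M) (w : PoiSpace) :
    poi t w = ∑ n ∈ Finset.range M, ∑ l ∈ Finset.range (w n).1,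
      if 0 < (w n).2 l ∧ (n : ℝ) + (w n).2 l ≤ t then 1 else 0 := by
  refine Finset.sum_subset (Finset.range_mono (Nat.ceil_le.2 h)) fun n _ hn => ?_
  refine Finset.sum_eq_zero fun l _ => if_neg fun hl => ?_
  have h1 : t ≤ n := Nat.ceil_le.1 (not_lt.1 (by simpa using hn))
  have h2 : (t : ℝ) ≤ n := by exact_mod_cast h1
  linarith [hl.1, hl.2]

noncomputable def ind (a b : ℝ) (y : ℝ) : ℝ := if a < y ∧ y ≤ b then 1 else 0

lemma measurable_ind (a b : ℝ) : Measurable (ind a b) :=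
  Measurable.ite measurableSet_Ioc measurable_const measurable_const

lemma poi_sub_eq_pts {s t : ℝ≥0} (hst : s ≤ t) {M : ℕ} (h : t ≤ M) (w : PoiSpace) :
    (poi t w : ℝ) - poi s w = pts (ind s t) M w := by
  rw [poi_eq h, poi_eq (hst.trans h), pts]
  push_cast
  rw [← Finset.sum_sub_distrib]
  refine Finset.sum_congr rfl fun n _ => ?_
  rw [← Finset.sum_sub_distrib]
  refine Finset.sum_congr rfl fun l _ => ?_
  have : (s : ℝ) ≤ t := by exact_mod_cast hst
  simp only [ind]
  split_ifs <;> first | (norm_num; done) | (exfalso; grind)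

lemma poi_mono (w : PoiSpace) : Monotone fun t => poi t w := by
  intro s t hst
  have := poi_sub_eq_pts hst (Nat.le_ceil t) w
  have h2 : 0 ≤ pts (ind s t) ⌈t⌉₊ w := by
    refine Finset.sum_nonneg fun n _ => Finset.sum_nonneg fun l _ => ?_
    unfold ind
    split_ifs <;> norm_num
  have h3 : (poi s w : ℝ) ≤ poi t w := by linarith
  exact_mod_cast h3

@[simp] lemma poi_zero (w : PoiSpace) : poi 0 w = 0 := by simp [poi]

lemma poi_eq_pts {t : ℝ≥0} {M : ℕ} (h : t ≤ M) (w : PoiSpace) :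
    (poi t w : ℝ) = pts (ind 0 t) M w := by
  have := poi_sub_eq_pts (zero_le : 0 ≤ t) h w
  simpa using this

lemma measurable_poi (t : ℝ≥0) : Measurable (poi t) := by
  have h1 : Measurable fun w => (poi t w : ℝ) := by
    simp only [poi_eq_pts (Nat.le_ceil t)]
    exact measurable_pts (measurable_ind _ _) _
  have h2 : poi t = fun w => ⌊(poi t w : ℝ)⌋₊ := by ext w; simp
  rw [h2]
  exact Nat.measurable_floor.comp h1

lemma rightCont_poi (w : PoiSpace) : RightCont fun t => poi t w := by
  intro t
  obtain ⟨M, hM⟩ := exists_nat_gt t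
  have h1 : ∀ᶠ s : ℝ≥0 in 𝓝[≥] t, s ≤ (M : ℝ≥0) :=
    mem_nhdsWithin_of_mem_nhds (Iic_mem_nhds hM)
  refine ContinuousWithinAt.congr_of_eventuallyEq (f := fun s : ℝ≥0 => ∑ n ∈ Finset.range M,
    ∑ l ∈ Finset.range (w n).1, if 0 < (w n).2 l ∧ (n : ℝ) + (w n).2 l ≤ s then 1 else 0) ?_
    (h1.mono fun s hs => poi_eq hs w) (poi_eq hM.le w)
  refine tendsto_finsetSum _ fun n _ => tendsto_finsetSum _ fun l _ => ?_
  refine tendsto_const_nhds.congr' ?_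
  by_cases hl : (n : ℝ) + (w n).2 l ≤ t
  · filter_upwards [self_mem_nhdsWithin] with s hs
    have : (t : ℝ) ≤ s := by exact_mod_cast hs
    simp [hl, hl.trans this]
  · have h2 : ∀ᶠ s : ℝ≥0 in 𝓝[≥] t, (s : ℝ) < n + (w n).2 l :=
      mem_nhdsWithin_of_mem_nhds
        ((NNReal.continuous_coe.tendsto t).eventually_lt_const (not_le.1 hl))
    filter_upwards [h2] with s hs
    simp [hl, not_le.2 hs]

lemma pts_finset_sum {ι : Type*} (s : Finset ι) (c : ι → ℝ) (g : ι → ℝ → ℝ) (M : ℕ) (w : PoiSpace) :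
    pts (fun y => ∑ i ∈ s, c i * g i y) M w = ∑ i ∈ s, c i * pts (g i) M w := by
  simp only [pts, Finset.mul_sum]
  rw [Finset.sum_comm]
  refine Finset.sum_congr rfl fun n _ => ?_
  rw [Finset.sum_comm]
  refine Finset.sum_congr rfl fun l _ => ?_
  split_ifs <;> simp

lemma isProbabilityMeasure_map_poi {T : Type*} [MeasurableSpace T] {X : PoiSpace → T}
    (hX : Measurable X) : IsProbabilityMeasure (poiMeasure.map X) :=
  Measure.isProbabilityMeasure_map hX.aemeasurable

lemma dual_apply_eq_sum {J : Type*} [Fintype J] [DecidableEq J] (L : (J → ℝ) →L[ℝ] ℝ)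
    (x : J → ℝ) : L x = ∑ j, L (Pi.single j 1) * x j := by
  have := LinearMap.pi_apply_eq_sum_univ L.toLinearMap x
  simp only [ContinuousLinearMap.coe_coe, smul_eq_mul] at this
  rw [this]
  refine Finset.sum_congr rfl fun j _ => ?_
  rw [mul_comm]
  congr 2
  ext k
  simp [Pi.single_apply, eq_comm]

/-- The increment is a sum of the indicator of `(s, t]` over the points, so Campbell's formula
yields the characteristic function of the Poisson law. The comparison takes place on `ℝ` after a
cast, which the floor function undoes. -/
lemma map_poi_sub {s t : ℝ≥0} (hst : s ≤ t) :
    poiMeasure.map (fun w => poi t w - poi s w) = poissonMeasure (t - s) := by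
  have hm : Measurable fun w => poi t w - poi s w := by
    have : (fun w => poi t w - poi s w) = (fun q : ℕ × ℕ => q.1 - q.2) ∘
      fun w => (poi t w, poi s w) := rfl
    rw [this]
    exact (measurable_of_countable _).comp ((measurable_poi t).prodMk (measurable_poi s))
  have hc : Measurable (Nat.cast : ℕ → ℝ) := measurable_of_countable _
  have := isProbabilityMeasure_map_poi hm
  have key : (poiMeasure.map (fun w => poi t w - poi s w)).map (Nat.cast : ℕ → ℝ) =
      (poissonMeasure (t - s)).map (Nat.cast : ℕ → ℝ) := by
    have := Measure.isProbabilityMeasure_map (μ := poiMeasure.map fun w => poi t w - poi s w)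
      hc.aemeasurable
    have := Measure.isProbabilityMeasure_map (μ := poissonMeasure (t - s)) hc.aemeasurable
    refine Measure.ext_of_charFun ?_
    ext θ
    rw [charFun_map_cast_poissonMeasure, Measure.map_map hc hm, charFun_apply_real,
      integral_map (hc.comp hm).aemeasurable (by fun_prop)]
    have h1 : ∀ w, (θ : ℂ) * (((Nat.cast : ℕ → ℝ) ∘ fun w => poi t w - poi s w) w : ℝ) * I =
        (pts (fun y => θ * ind s t y) ⌈t⌉₊ w : ℝ) * I := by
      intro w
      have h2 := pts_finset_sum (Finset.univ : Finset Unit) (fun _ => θ)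
        (fun _ => ind s t) ⌈t⌉₊ w
      simp only [Finset.univ_unique, Finset.sum_singleton] at h2
      rw [h2, ← poi_sub_eq_pts hst (Nat.le_ceil t)]
      simp only [Function.comp_apply, Nat.cast_sub (poi_mono w hst)]
      push_cast
      ring
    simp only [h1]
    rw [integral_pts ((measurable_ind _ _).const_mul θ)]
    congr 1
    have h3 : ∀ y : ℝ, cexp ((θ * ind s t y : ℝ) * I) - 1 =
        (Set.Ioc (s : ℝ) t).indicator (fun _ => cexp (θ * I) - 1) y := by
      intro y
      unfold ind
      by_cases hy : y ∈ Set.Ioc (s : ℝ) t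
      · rw [Set.indicator_of_mem hy, if_pos (show (s : ℝ) < y ∧ y ≤ t from hy)]; simp
      · rw [Set.indicator_of_notMem hy, if_neg (show ¬((s : ℝ) < y ∧ y ≤ t) from hy)]; simp
    simp only [h3]
    have hsub : Set.Ioc (s : ℝ) t ⊆ Set.Ioc (0 : ℝ) (⌈t⌉₊ : ℝ) :=
      Set.Ioc_subset_Ioc s.2 (by exact_mod_cast Nat.le_ceil t)
    rw [intervalIntegral.integral_of_le (by positivity), integral_indicator measurableSet_Ioc,
      Measure.restrict_restrict measurableSet_Ioc, Set.inter_eq_self_of_subset_left hsub,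
      setIntegral_const]
    simp [Measure.real, NNReal.coe_sub hst, hst]
  have hf : Measurable (fun x : ℝ => ⌊x⌋₊) := Nat.measurable_floor
  have h4 : ((fun x : ℝ => ⌊x⌋₊) ∘ (Nat.cast : ℕ → ℝ)) = id := by ext n; simp
  have := congrArg (Measure.map fun x : ℝ => ⌊x⌋₊) key
  rwa [Measure.map_map hf hc, Measure.map_map hf hc, h4, Measure.map_id, Measure.map_id] at this

lemma measurable_cast_nat : Measurable (Nat.cast : ℕ → ℝ) := measurable_of_countable _

lemma measurable_poi_sub (t s : ℝ≥0) : Measurable fun w => poi t w - poi s w := by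
  have : (fun w => poi t w - poi s w) = (fun q : ℕ × ℕ => q.1 - q.2) ∘
    fun w => (poi t w, poi s w) := rfl
  rw [this]
  exact (measurable_of_countable _).comp ((measurable_poi t).prodMk (measurable_poi s))

/-- Increments are sums over points of indicators of disjoint intervals; `integral_pts_sum` factors
their joint characteristic functional. -/
lemma hasIndepIncrements_poi : HasIndepIncrements poi poiMeasure := by
  intro n t ht
  have hle : ∀ i : Fin n, t i.castSucc ≤ t i.succ := fun i => ht (Fin.castSucc_le_succ _)
  obtain ⟨M, hM⟩ := exists_nat_ge (t (Fin.last n))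
  have hMt : ∀ i, t i ≤ M := fun i => (ht (Fin.le_last i)).trans hM
  suffices h : iIndepFun (fun (i : Fin n) w => ((poi (t i.succ) w - poi (t i.castSucc) w : ℕ) : ℝ))
      poiMeasure by
    have h2 := h.comp (fun _ x => ⌊x⌋₊) fun _ => Nat.measurable_floor
    convert h2 using 2 with i
    ext w
    simp only [Function.comp_apply, Nat.floor_natCast]
  have hm : ∀ i : Fin n, Measurable fun w =>
      ((poi (t i.succ) w - poi (t i.castSucc) w : ℕ) : ℝ) := fun i =>
    measurable_cast_nat.comp (measurable_poi_sub _ _)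
  have heq : ∀ (i : Fin n) w, ((poi (t i.succ) w - poi (t i.castSucc) w : ℕ) : ℝ) =
      pts (ind (t i.castSucc) (t i.succ)) M w := fun i w => by
    rw [Nat.cast_sub (poi_mono w (hle i)), poi_sub_eq_pts (hle i) (hMt _)]
  rw [iIndepFun_iff_charFunDual_pi fun i => (hm i).aemeasurable]
  intro L
  simp only [charFunDual_apply]
  rw [integral_map (measurable_pi_lambda _ hm).aemeasurable (by fun_prop)]
  have e1 : ∀ i : Fin n, ∫ v, cexp ((L.comp (.single ℝ (fun _ : Fin n => ℝ) i)) v * I)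
      ∂(poiMeasure.map fun w => ((poi (t i.succ) w - poi (t i.castSucc) w : ℕ) : ℝ)) =
      ∫ w, cexp (pts (fun y => L (Pi.single i 1) * ind (t i.castSucc) (t i.succ) y) M w * I)
        ∂poiMeasure := by
    intro i
    rw [integral_map (hm i).aemeasurable (by fun_prop)]
    congr 1 with w
    have h2 := pts_finset_sum (Finset.univ : Finset Unit) (fun _ => L (Pi.single i 1))
      (fun _ => ind (t i.castSucc) (t i.succ)) M w
    simp only [Finset.univ_unique, Finset.sum_singleton] at h2
    rw [h2, heq]
    congr 3
    have : (Pi.single i (pts (ind (t i.castSucc) (t i.succ)) M w) : Fin n → ℝ) =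
        pts (ind (t i.castSucc) (t i.succ)) M w • Pi.single i (1 : ℝ) := by
      ext j; simp [Pi.single_apply]
    simp [this, mul_comm]
  simp only [e1]
  rw [← integral_pts_sum fun i => (measurable_ind _ _).const_mul _]
  · congr 1 with w
    rw [pts_finset_sum, dual_apply_eq_sum]
    simp only [heq]
  · intro y i j hij
    have hd : ∀ i j : Fin n, i < j → ¬ ((t i.castSucc < y ∧ y ≤ t i.succ) ∧
        (t j.castSucc < y ∧ y ≤ t j.succ)) := by
      rintro i j hij ⟨⟨_, h1⟩, ⟨h2, _⟩⟩
      have h3 : t i.succ ≤ t j.castSucc := ht (by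
        rw [Fin.le_def]; simp; exact hij)
      have : (t i.succ : ℝ) ≤ t j.castSucc := by exact_mod_cast h3
      linarith
    unfold ind
    rcases lt_or_gt_of_ne hij with h | h
    · have := hd i j h
      split_ifs <;> simp_all
    · have := hd j i h
      split_ifs <;> simp_all

lemma isUnitPoisson_poi : IsUnitPoisson poi poiMeasure where
  measurable := measurable_poi
  zero := poi_zero
  mono := poi_mono
  rightCont := rightCont_poi
  indep := hasIndepIncrements_poi
  law _ _ h := map_poi_sub h

/-- The past up to time `u` is independent of the increments after time `u`. -/
lemma indepFun_poi_past_future (u : ℝ≥0) : IndepFun (fun w (r : ℝ≥0) => poi (min r u) w)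
      (fun w (a : ℝ≥0) => poi (u + a) w - poi u w) poiMeasure := by
  refine IndepFun.process_indepFun_process (fun r => measurable_poi _)
    (fun a => measurable_poi_sub _ _) fun I J => ?_
  classical
  obtain ⟨M, hM⟩ := exists_nat_ge (u + ∑ a ∈ J, a)
  have hMu : u ≤ M := le_self_add.trans hM
  have hMJ : ∀ a : J, u + a ≤ M := fun a => le_trans (by
    gcongr; exact Finset.single_le_sum (f := fun a : ℝ≥0 => a) (fun _ _ => zero_le) a.2) hM
  suffices h : IndepFun (fun w (r : I) => (poi (min r u) w : ℝ))
      (fun w (a : J) => ((poi (u + a) w - poi u w : ℕ) : ℝ)) poiMeasure by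
    have hf : ∀ K : Finset ℝ≥0, Measurable fun (x : K → ℝ) (r : K) => ⌊x r⌋₊ := fun K =>
      measurable_pi_lambda _ fun r => Nat.measurable_floor.comp (measurable_pi_apply r)
    have h2 := h.comp (hf I) (hf J)
    convert h2 using 1
    · ext w r; simp
    · ext w r; simp only [Function.comp_apply, Nat.floor_natCast]
  have hX : Measurable fun w (r : I) => (poi (min r u) w : ℝ) :=
    measurable_pi_lambda _ fun r => measurable_cast_nat.comp (measurable_poi _)
  have hY : Measurable fun w (a : J) => ((poi (u + a) w - poi u w : ℕ) : ℝ) :=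
    measurable_pi_lambda _ fun r => measurable_cast_nat.comp (measurable_poi_sub _ _)
  have heX : ∀ (r : I) w, (poi (min r u) w : ℝ) = pts (ind 0 (min r u : ℝ≥0)) M w := fun r w =>
    poi_eq_pts ((min_le_right _ _).trans hMu) w
  have heY : ∀ (a : J) w, ((poi (u + a) w - poi u w : ℕ) : ℝ) =
      pts (ind u (u + a : ℝ≥0)) M w := fun a w => by
    rw [Nat.cast_sub (poi_mono w le_self_add), poi_sub_eq_pts le_self_add (hMJ a)]
  rw [indepFun_iff_charFunDual_prod hX.aemeasurable hY.aemeasurable]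
  intro L
  simp only [charFunDual_apply]
  rw [integral_map (hX.prodMk hY).aemeasurable (by fun_prop),
    integral_map hX.aemeasurable (by fun_prop), integral_map hY.aemeasurable (by fun_prop)]
  set L1 := L.comp (.inl ℝ (I → ℝ) (J → ℝ))
  set L2 := L.comp (.inr ℝ (I → ℝ) (J → ℝ))
  have hL : ∀ x y, L (x, y) = L1 x + L2 y := fun x y => by
    have : (x, y) = (x, (0 : J → ℝ)) + ((0 : I → ℝ), y) := by simp
    rw [this, map_add]; rfl
  -- A linear functional of past and future is a sum over points of two functions, one supported in
  -- `(0, u]` and the other in `(u, ∞)`, so that `integral_pts_sum` applies with two summands.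
  set g : Bool → ℝ → ℝ := fun b y => bif b
    then ∑ r : I, L1 (Pi.single r 1) * ind 0 (min r u : ℝ≥0) y
    else ∑ a : J, L2 (Pi.single a 1) * ind u (u + a : ℝ≥0) y with hg
  have e1 : ∀ w, L1 (fun r : I => (poi (min r u) w : ℝ)) = pts (g true) M w := fun w => by
    simp only [hg, cond_true, pts_finset_sum]
    rw [dual_apply_eq_sum]
    simp only [heX]
  have e2 : ∀ w, L2 (fun a : J => ((poi (u + a) w - poi u w : ℕ) : ℝ)) = pts (g false) M w :=
    fun w => by
    simp only [hg, cond_false, pts_finset_sum]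
    rw [dual_apply_eq_sum]
    simp only [heY]
  have hgm : ∀ b, Measurable (g b) := by
    rintro (_ | _)
    · exact Finset.measurable_sum _ fun i _ => (measurable_ind _ _).const_mul _
    · exact Finset.measurable_sum _ fun i _ => (measurable_ind _ _).const_mul _
  have hd : ∀ y, g true y = 0 ∨ g false y = 0 := by
    intro y
    by_cases hy : y ≤ u
    · right
      simp only [hg, cond_false]
      refine Finset.sum_eq_zero fun a _ => ?_
      simp [ind, not_lt.2 hy]
    · left
      simp only [hg, cond_true]
      refine Finset.sum_eq_zero fun a _ => ?_
      have : ¬ y ≤ (min (a : ℝ≥0) u : ℝ≥0) := fun h =>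
        hy (h.trans (by exact_mod_cast min_le_right _ _))
      simp only [ind, this, and_false, if_false, mul_zero]
  have h1 := integral_pts_sum hgm (fun y i j hij => by
    rcases i with _ | _ <;> rcases j with _ | _ <;> simp at hij
    · exact (hd y).symm
    · exact hd y) M
  rw [Fintype.prod_bool] at h1
  simp only [e1, e2, hL]
  rw [← h1]
  congr 1 with w
  have h3 := pts_finset_sum (Finset.univ : Finset Bool) (fun _ => 1) g M w
  simp only [one_mul, Fintype.sum_bool] at h3
  simp only [Fintype.sum_bool]
  rw [h3]

/-- The increments after time `u` form again a Poisson process. -/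
lemma map_poi_shift (u : ℝ≥0) : poiMeasure.map (fun w (a : ℝ≥0) => poi (u + a) w - poi u w) =
      poiMeasure.map (fun w (a : ℝ≥0) => poi a w) := by
  classical
  refine (map_eq_iff_forall_finset_map_restrict_eq
    (measurable_pi_lambda _ fun a => measurable_poi_sub _ _).aemeasurable
    (measurable_pi_lambda _ fun a => measurable_poi _).aemeasurable).2 fun J => ?_
  obtain ⟨K, hK⟩ := exists_nat_ge (∑ a ∈ J, a)
  have hKJ : ∀ a : J, (a : ℝ≥0) ≤ K := fun a =>
    (Finset.single_le_sum (f := fun a : ℝ≥0 => a) (fun _ _ => zero_le) a.2).trans hK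
  obtain ⟨M, hM⟩ := exists_nat_ge (u + K)
  have hMJ : ∀ a : J, u + a ≤ M := fun a => le_trans (by gcongr; exact hKJ a) hM
  have hX : Measurable fun w (a : J) => ((poi (u + a) w - poi u w : ℕ) : ℝ) :=
    measurable_pi_lambda _ fun r => measurable_cast_nat.comp (measurable_poi_sub _ _)
  have hY : Measurable fun w (a : J) => (poi a w : ℝ) :=
    measurable_pi_lambda _ fun r => measurable_cast_nat.comp (measurable_poi _)
  have hf : Measurable fun (x : J → ℝ) (r : J) => ⌊x r⌋₊ :=
    measurable_pi_lambda _ fun r => Nat.measurable_floor.comp (measurable_pi_apply r)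
  have heX : ∀ (a : J) w, ((poi (u + a) w - poi u w : ℕ) : ℝ) =
      pts (ind u (u + a : ℝ≥0)) M w := fun a w => by
    rw [Nat.cast_sub (poi_mono w le_self_add), poi_sub_eq_pts le_self_add (hMJ a)]
  have heY : ∀ (a : J) w, (poi a w : ℝ) = pts (ind 0 (a : ℝ≥0)) K w := fun a w =>
    poi_eq_pts (hKJ a) w
  suffices h : poiMeasure.map (fun w (a : J) => ((poi (u + a) w - poi u w : ℕ) : ℝ)) =
      poiMeasure.map (fun w (a : J) => (poi a w : ℝ)) by
    have := congrArg (Measure.map fun (x : J → ℝ) (r : J) => ⌊x r⌋₊) h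
    rw [Measure.map_map hf hX, Measure.map_map hf hY] at this
    convert this using 2
    · ext w r; simp only [Function.comp_apply, Nat.floor_natCast, Finset.restrict]
    · ext w r; simp
  have := isProbabilityMeasure_map_poi hX
  have := isProbabilityMeasure_map_poi hY
  refine Measure.ext_of_charFunDual ?_
  ext L
  simp only [charFunDual_apply]
  rw [integral_map hX.aemeasurable (by fun_prop), integral_map hY.aemeasurable (by fun_prop)]
  have e1 : ∀ w, L (fun a : J => ((poi (u + a) w - poi u w : ℕ) : ℝ)) =
      pts (fun y => ∑ a : J, L (Pi.single a 1) * ind u (u + a : ℝ≥0) y) M w := fun w => by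
    rw [pts_finset_sum, dual_apply_eq_sum]
    simp only [heX]
  have e2 : ∀ w, L (fun a : J => (poi a w : ℝ)) =
      pts (fun y => ∑ a : J, L (Pi.single a 1) * ind 0 (a : ℝ≥0) y) K w := fun w => by
    rw [pts_finset_sum, dual_apply_eq_sum]
    simp only [heY]
  simp only [e1, e2]
  rw [integral_pts (Finset.measurable_sum _ fun i _ => (measurable_ind _ _).const_mul _),
    integral_pts (Finset.measurable_sum _ fun i _ => (measurable_ind _ _).const_mul _)]
  congr 1
  set g : ℝ → ℂ := fun y =>
    cexp ((∑ a : J, L (Pi.single a 1) * ind u (u + a : ℝ≥0) y : ℝ) * I) - 1 with hg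
  have hgi : ∀ a b, IntervalIntegrable g volume a b := fun a b =>
    intervalIntegrable_cexp_sub_one
      (Finset.measurable_sum _ fun i _ => (measurable_ind _ _).const_mul _) a b
  have hg1 : ∀ y : ℝ, y ≤ u → g y = 0 := fun y hy => by
    have : ∑ a : J, L (Pi.single a 1) * ind u (u + a : ℝ≥0) y = 0 :=
      Finset.sum_eq_zero fun a _ => by simp [ind, not_lt.2 hy]
    simp only [hg, this]
    simp
  have hg2 : ∀ y, (u + K : ℝ) < y → g y = 0 := fun y hy => by
    have : ∑ a : J, L (Pi.single a 1) * ind u (u + a : ℝ≥0) y = 0 :=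
      Finset.sum_eq_zero fun a _ => by
        have h1 : ((a : ℝ≥0) : ℝ) ≤ K := by exact_mod_cast hKJ a
        have : ¬ y ≤ ((u + a : ℝ≥0) : ℝ) := by push_cast; linarith
        simp only [ind, this, and_false, if_false, mul_zero]
    simp only [hg, this]
    simp
  have hM' : (u + K : ℝ) ≤ M := by exact_mod_cast hM
  have h0u : ∫ y in (0 : ℝ)..u, g y = 0 := by
    rw [intervalIntegral.integral_of_le u.coe_nonneg]
    exact setIntegral_eq_zero_of_forall_eq_zero fun y hy => hg1 y hy.2
  have huM : ∫ y in (u + K : ℝ)..M, g y = 0 := by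
    rw [intervalIntegral.integral_of_le hM']
    exact setIntegral_eq_zero_of_forall_eq_zero fun y hy => hg2 y hy.1
  -- The integrand lives on `(u, u + K]`; after the empty pieces are dropped, translation by `u`
  -- identifies the two exponents.
  rw [← intervalIntegral.integral_add_adjacent_intervals (hgi 0 u) (hgi u M),
    ← intervalIntegral.integral_add_adjacent_intervals (hgi u (u + K)) (hgi (u + K) M),
    h0u, huM, zero_add, add_zero]
  have h5 := intervalIntegral.integral_comp_add_left (a := 0) (b := K) g (u : ℝ)
  rw [add_zero] at h5
  rw [← h5]
  refine intervalIntegral.integral_congr fun y _ => ?_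
  have h6 : ∀ a : J, ind u (u + a : ℝ≥0) (u + y) = ind 0 (a : ℝ≥0) y := fun a => by simp [ind]
  simp only [hg, h6]

end Poisson

/-! ### The time change equation, pathwise -/

section PathSolution

variable {m : ℕ}

/-- Families of real functions of time. -/
abbrev Rates (m : ℕ) : Type := OffDiag m → ℝ≥0 → ℝ

/-- Families of paths of natural numbers. -/
abbrev Counts (m : ℕ) : Type := OffDiag m → ℝ≥0 → ℕ

/-- A family of nonnegative, locally bounded rates. -/
structure RatePath (lam : Rates m) : Prop where
  nonneg : ∀ p s, 0 ≤ lam p s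
  locBdd : ∀ p, LocBdd (lam p)

/-- A family of paths of counting processes. -/
structure CountPath (N : Counts m) : Prop where
  zero : ∀ p, N p 0 = 0
  mono : ∀ p, Monotone (N p)
  rightCont : ∀ p, RightCont (N p)

/-- The internal clock of the transition `p`. -/
noncomputable def clk (lam : Rates m) (y : ℝ≥0 → Fin (m + 1)) (p : OffDiag m)
    (t : ℝ≥0) : ℝ≥0 :=
  (∫ s in (0 : ℝ)..t, if y s.toNNReal = p.1.1 then lam p s.toNNReal else 0).toNNReal

/-- The projection of an integer to `{0, …, m}`. -/
def clampFin (m : ℕ) (z : ℤ) : Fin (m + 1) := ⟨min z.toNat m, by omega⟩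

/-- The position after the transitions counted by `c`. -/
def shiftZ (z : ℤ) (c : OffDiag m → ℕ) : ℤ :=
  z + ∑ p : OffDiag m, (((p.1.2 : ℕ) : ℤ) - ((p.1.1 : ℕ) : ℤ)) * (c p : ℤ)

/-- The integer valued position at time `t` if the clocks are run by the path `y`. -/
noncomputable def posZ (lam : Rates m) (N : Counts m) (z : ℤ)
    (y : ℝ≥0 → Fin (m + 1)) (t : ℝ≥0) : ℤ :=
  shiftZ z fun p => N p (clk lam y p t)

/-- The map whose fixed point is the solution of the time change equation. -/
noncomputable def stepY (lam : Rates m) (N : Counts m) (z : ℤ)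
    (y : ℝ≥0 → Fin (m + 1)) (t : ℝ≥0) : Fin (m + 1) :=
  clampFin m (posZ lam N z y t)

noncomputable def picard (lam : Rates m) (N : Counts m) (z : ℤ) :
    ℕ → ℝ≥0 → Fin (m + 1)
  | 0 => fun _ => clampFin m z
  | n + 1 => stepY lam N z (picard lam N z n)

open Classical in
/-- The solution of the time change equation, as the eventual value of the Picard iterates. -/
noncomputable def sol (lam : Rates m) (N : Counts m) (z : ℤ)
    (t : ℝ≥0) : Fin (m + 1) :=
  if h : ∃ i, ∀ᶠ n in atTop, picard lam N z n t = i then h.choose else 0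

/-- Induction along the half line. If the property failed somewhere, the infimum of the failure set
would satisfy it, by `h0` or `hl`, and `hr` would push the infimum further to the right. -/
lemma real_induction {Q : ℝ≥0 → Prop} (hd : ∀ s t, s ≤ t → Q t → Q s) (h0 : Q 0)
    (hr : ∀ t, Q t → ∃ t' > t, Q t') (hl : ∀ t, 0 < t → (∀ s < t, Q s) → Q t) (t : ℝ≥0) : Q t := by
  by_contra hn
  set B : Set ℝ≥0 := {t | ¬ Q t} with hB
  have hlt : ∀ s < sInf B, Q s := fun s hs => by
    by_contra h
    exact absurd (csInf_le (OrderBot.bddBelow B) h) (not_le.2 hs)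
  have hQ : Q (sInf B) := by
    rcases eq_or_lt_of_le (zero_le : 0 ≤ sInf B) with h | h
    · rw [← h]; exact h0
    · exact hl _ h hlt
  obtain ⟨t', ht', hQ'⟩ := hr _ hQ
  have : t' ≤ sInf B := le_csInf ⟨t, hn⟩ fun b hb => by
    by_contra h
    exact hb (hd _ _ (not_le.1 h).le hQ')
  exact absurd this (not_le.2 ht')

section Clock

variable {lam : Rates m} {y y' : ℝ≥0 → Fin (m + 1)}

@[simp] lemma clk_zero (p : OffDiag m) : clk lam y p 0 = 0 := by simp [clk]

/-- Agreement strictly before `t` suffices because one point has no length. This makes the time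
change equation causal, and both the Picard iteration and uniqueness rest on it. -/
lemma clk_congr (p : OffDiag m) {t : ℝ≥0} (h : ∀ s < t, y s = y' s) :
    clk lam y p t = clk lam y' p t := by
  unfold clk
  congr 1
  refine intervalIntegral.integral_congr_Ioo_of_le t.coe_nonneg fun s hs => ?_
  simp only [h _ ((Real.toNNReal_lt_iff_lt_coe hs.1.le).2 hs.2)]

variable (hl : RatePath lam) (hy : Measurable y) (p : OffDiag m)

include hl

lemma RatePath.ite_nonneg (s : ℝ≥0) : 0 ≤ if y s = p.1.1 then lam p s else 0 := by
  split_ifs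
  · exact hl.nonneg p s
  · exact le_rfl

lemma coe_clk (t : ℝ≥0) : (clk lam y p t : ℝ) =
    ∫ s in (0 : ℝ)..t, if y s.toNNReal = p.1.1 then lam p s.toNNReal else 0 :=
  Real.coe_toNNReal _ (intervalIntegral.integral_nonneg t.coe_nonneg fun _ _ => hl.ite_nonneg p _)

include hy

lemma RatePath.locBdd_ite : LocBdd fun s => if y s = p.1.1 then lam p s else 0 := by
  have : (fun s => if y s = p.1.1 then lam p s else 0) = {s | y s = p.1.1}.indicator (lam p) := by
    ext s; simp [Set.indicator]
  rw [this]
  exact (hl.locBdd p).indicator (hy (measurableSet_singleton _))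

lemma coe_clk_add (s t : ℝ≥0) : (clk lam y p t : ℝ) = clk lam y p s +
      ∫ r in (s : ℝ)..t, if y r.toNNReal = p.1.1 then lam p r.toNNReal else 0 := by
  rw [coe_clk hl, coe_clk hl, intervalIntegral.integral_add_adjacent_intervals]
  · exact (hl.locBdd_ite hy p).intervalIntegrable _ _
  · exact (hl.locBdd_ite hy p).intervalIntegrable _ _

lemma clk_mono : Monotone (clk lam y p) := by
  intro s t hst
  rw [← NNReal.coe_le_coe, coe_clk_add hl hy p s t]
  have := intervalIntegral.integral_nonneg (μ := volume) (a := (s : ℝ)) (b := t)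
    (by exact_mod_cast hst) fun r _ => hl.ite_nonneg (y := y) p r.toNNReal
  linarith

lemma continuous_clk : Continuous (clk lam y p) :=
  continuous_real_toNNReal.comp (hl.locBdd_ite hy p).continuous_integral

/-- A clock runs at most at the full speed of its rate. -/
lemma clk_le_full {s t : ℝ≥0}
    (hst : s ≤ t) : (clk lam y p t : ℝ) ≤ clk lam y p s + ∫ r in (s : ℝ)..t, lam p r.toNNReal := by
  rw [coe_clk_add hl hy p s t]
  gcongr
  refine intervalIntegral.integral_mono_on (by exact_mod_cast hst)
    ((hl.locBdd_ite hy p).intervalIntegrable _ _) ((hl.locBdd p).intervalIntegrable _ _)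
    fun r _ => ?_
  split_ifs
  · exact le_rfl
  · exact hl.nonneg _ _

lemma clk_full {s t : ℝ≥0} (hst : s ≤ t) (h : ∀ r, s ≤ r → r < t → y r = p.1.1) :
    (clk lam y p t : ℝ) = clk lam y p s + ∫ r in (s : ℝ)..t, lam p r.toNNReal := by
  rw [coe_clk_add hl hy p s t]
  congr 1
  refine intervalIntegral.integral_congr_Ioo_of_le (by exact_mod_cast hst) fun r hr => ?_
  exact if_pos (h _ (NNReal.le_toNNReal_of_coe_le hr.1.le)
    ((Real.toNNReal_lt_iff_lt_coe (s.coe_nonneg.trans hr.1.le)).2 hr.2))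

lemma clk_stop {s t : ℝ≥0} (hst : s ≤ t) (h : ∀ r, s ≤ r → r < t → y r ≠ p.1.1) :
    clk lam y p t = clk lam y p s := by
  rw [← NNReal.coe_inj, coe_clk_add hl hy p s t]
  have : ∫ r in (s : ℝ)..t, (if y r.toNNReal = p.1.1 then lam p r.toNNReal else 0) =
      ∫ r in (s : ℝ)..t, 0 := by
    refine intervalIntegral.integral_congr_Ioo_of_le (by exact_mod_cast hst) fun r hr => ?_
    exact if_neg (h _ (NNReal.le_toNNReal_of_coe_le hr.1.le)
      ((Real.toNNReal_lt_iff_lt_coe (s.coe_nonneg.trans hr.1.le)).2 hr.2))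
  rw [this]
  simp

omit hy in
/-- Clocks advance little on short time intervals, uniformly in the driving path. -/
lemma exists_clk_le (T : ℝ≥0) {ε : ℝ≥0} (hε : 0 < ε) :
    ∃ δ > 0, ∀ y : ℝ≥0 → Fin (m + 1), Measurable y → ∀ p s t, s ≤ t → t ≤ T → t ≤ s + δ →
      clk lam y p t ≤ clk lam y p s + ε := by
  choose C hC using fun p => (hl.locBdd p).bdd T
  set D : ℝ := 1 + ∑ p, |C p| with hD
  have hD0 : 0 < D := by positivity
  refine ⟨⟨ε / D, by positivity⟩, ?_, fun y hy p s t hst htT hts => ?_⟩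
  · exact div_pos (by exact_mod_cast hε) hD0
  rw [← NNReal.coe_le_coe, NNReal.coe_add]
  refine (clk_le_full hl hy p hst).trans ?_
  gcongr
  have hst' : (s : ℝ) ≤ t := by exact_mod_cast hst
  have h1 : ∫ r in (s : ℝ)..t, lam p r.toNNReal ≤ ∫ r in (s : ℝ)..t, D := by
    refine intervalIntegral.integral_mono_on hst' ((hl.locBdd p).intervalIntegrable _ _)
      intervalIntegrable_const fun r hr => ?_
    have h2 := hC p r.toNNReal ((Real.toNNReal_le_iff_le_coe.2 hr.2).trans htT)
    have h3 := Finset.single_le_sum (f := fun p => |C p|) (fun i _ => abs_nonneg _)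
      (Finset.mem_univ p)
    have h4 := le_abs_self (lam p r.toNNReal)
    have h5 := le_abs_self (C p)
    linarith
  refine h1.trans ?_
  rw [intervalIntegral.integral_const, smul_eq_mul]
  have h6 : (t : ℝ) ≤ s + ε / D := by exact_mod_cast hts
  calc ((t : ℝ) - s) * D ≤ ε / D * D := by gcongr; linarith
    _ = ε := by field_simp

end Clock

section Solve

variable {lam : Rates m} {N : Counts m} {z : ℤ} (hl : RatePath lam)
  (hN : CountPath N)

include hN

/-- Integer valued right continuous paths are locally constant to the right, and there are finitely
many of them, so one `ε` serves all. If there are no transitions at all, any `ε` does. -/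
lemma CountPath.right (v : OffDiag m → ℝ≥0) :
    ∃ ε > 0, ∀ p v', v p ≤ v' → v' ≤ v p + ε → N p v' = N p (v p) := by
  have h1 : ∀ p, ∃ ε > 0, ∀ v', v p ≤ v' → v' ≤ v p + ε → N p v' = N p (v p) := by
    intro p
    have h2 : ∀ᶠ v' in 𝓝[≥] (v p), N p v' = N p (v p) :=
      (hN.rightCont p (v p)).tendsto.eventually_mem
        ((isOpen_discrete {N p (v p)}).mem_nhds rfl)
    obtain ⟨b, hb, hb'⟩ := mem_nhdsGE_iff_exists_Icc_subset.1 h2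
    exact ⟨b - v p, tsub_pos_of_lt hb, fun v' h3 h4 => hb' ⟨h3, by
      rwa [add_tsub_cancel_of_le hb.le] at h4⟩⟩
  choose ε hε h using h1
  by_cases hne : Nonempty (OffDiag m)
  · refine ⟨Finset.univ.inf' Finset.univ_nonempty ε, ?_, fun p v' h3 h4 => h p v' h3 ?_⟩
    · simpa using hε
    · refine h4.trans ?_
      gcongr
      exact Finset.inf'_le _ (Finset.mem_univ p)
  · exact ⟨1, one_pos, fun p => (hne ⟨p⟩).elim⟩

/-- A bounded nonempty set of natural numbers contains its supremum, so a monotone count is constant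
just before `v`. -/
lemma CountPath.left (p : OffDiag m) {v : ℝ≥0} (hv : 0 < v) :
    ∃ v0 < v, ∀ v', v0 ≤ v' → v' < v → N p v' = N p v0 := by
  have hbdd : BddAbove (N p '' Set.Iio v) :=
    ⟨N p v, by rintro _ ⟨x, hx, rfl⟩; exact hN.mono p (le_of_lt hx)⟩
  have hne : (N p '' Set.Iio v).Nonempty := ⟨_, 0, hv, rfl⟩
  obtain ⟨v0, hv0, hmax⟩ := Nat.sSup_mem hne hbdd
  refine ⟨v0, hv0, fun v' h1 h2 => le_antisymm ?_ (hN.mono p h1)⟩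
  rw [hmax]
  exact le_csSup hbdd ⟨v', h2, rfl⟩

omit hN in
lemma stepY_congr {y y' : ℝ≥0 → Fin (m + 1)} {t : ℝ≥0} (h : ∀ s < t, y s = y' s) :
    stepY lam N z y t = stepY lam N z y' t := by
  unfold stepY posZ
  simp only [clk_congr _ h]

lemma picard_at_zero (n : ℕ) : picard lam N z n 0 = clampFin m z := by
  cases n with
  | zero => rfl
  | succ n => simp [picard, stepY, posZ, shiftZ, hN.zero]

include hl

lemma rightCont_posZ {y : ℝ≥0 → Fin (m + 1)} (hy : Measurable y) : RightCont (posZ lam N z y) := by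
  have h1 : RightCont fun t (p : OffDiag m) => N p (clk lam y p t) := fun t =>
    continuousWithinAt_pi.2 fun p =>
      (hN.rightCont p).comp_monotone (continuous_clk hl hy p) (clk_mono hl hy p) t
  exact h1.comp (continuous_of_discreteTopology (f := shiftZ z))

lemma rightCont_stepY {y : ℝ≥0 → Fin (m + 1)} (hy : Measurable y) : RightCont (stepY lam N z y) :=
  (rightCont_posZ hl hN hy).comp (continuous_of_discreteTopology (f := clampFin m))

lemma rightCont_picard (n : ℕ) : RightCont (picard lam N z n) := by
  induction n with
  | zero => exact fun _ => continuousWithinAt_const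
  | succ n ih => exact rightCont_stepY hl hN ih.measurable

/-- By induction along the half line. To the right of a good time the clocks advance too little for
any count to change, so one more iterate is settled a little further. At a limit time `t` the counts
driven by the common value are constant just before `t`, and the iterates cannot produce a jump
there either, so finitely many further iterates settle the values up to and including `t`. -/
lemma picard_stabilizes (T : ℝ≥0) :
    ∃ n₀, ∀ n ≥ n₀, ∀ s ≤ T, picard lam N z n s = picard lam N z n₀ s := by
  have hpm : ∀ n, Measurable (picard lam N z n) := fun n => (rightCont_picard hl hN n).measurable
  refine real_induction (Q := fun T => ∃ n₀, ∀ n ≥ n₀, ∀ s ≤ T, picard lam N z n s =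
    picard lam N z n₀ s) ?_ ?_ ?_ ?_ T
  · rintro s t hst ⟨n₀, h⟩
    exact ⟨n₀, fun n hn r hr => h n hn r (hr.trans hst)⟩
  · refine ⟨0, fun n _ s hs => ?_⟩
    rw [nonpos_iff_eq_zero.1 hs, picard_at_zero hN, picard_at_zero hN]
  · rintro t ⟨n₀, h⟩
    obtain ⟨ε, hε, hNε⟩ := hN.right fun p => clk lam (picard lam N z n₀) p t
    obtain ⟨δ, hδ, hclk⟩ := exists_clk_le hl (t + 1) hε
    refine ⟨t + min δ 1, lt_add_of_pos_right t (lt_min hδ one_pos), n₀ + 1, ?_⟩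
    -- Up to time `t` the iterates coincide, hence so do their clocks at `t`; afterwards no clock
    -- advances by more than `ε`, whichever path drives it.
    have key : ∀ n ≥ n₀, ∀ s, t ≤ s → s ≤ t + min δ 1 → picard lam N z (n + 1) s =
        clampFin m (shiftZ z fun p => N p (clk lam (picard lam N z n₀) p t)) := by
      intro n hn s hts hs
      change stepY lam N z (picard lam N z n) s = _
      unfold stepY posZ
      congr 2
      ext p
      have h1 : clk lam (picard lam N z n) p t = clk lam (picard lam N z n₀) p t :=
        clk_congr p fun r hr => h n hn r hr.le
      refine hNε p _ ?_ ?_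
      · rw [← h1]; exact clk_mono hl (hpm n) p hts
      · rw [← h1]
        exact hclk _ (hpm n) p t s hts (hs.trans (by gcongr; exact min_le_right _ _))
          (hs.trans (by gcongr; exact min_le_left _ _))
    intro n hn s hs
    obtain ⟨k, rfl⟩ : ∃ k, n = k + 1 := ⟨n - 1, by omega⟩
    rcases le_total s t with hst | hts
    · rw [h _ (by omega) s hst, h (n₀ + 1) (by omega) s hst]
    · rw [key k (by omega) s hts hs, key n₀ le_rfl s hts hs]
  · intro t ht h
    choose! n₀ hn₀ using h
    -- the common value before time `t`
    set y : ℝ≥0 → Fin (m + 1) := fun s => if s < t then picard lam N z (n₀ s) s else 0 with hy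
    have hyn : ∀ s < t, ∀ n ≥ n₀ s, ∀ r ≤ s, picard lam N z n r = y r := by
      intro s hs n hn r hr
      have hrt := hr.trans_lt hs
      simp only [hy, if_pos hrt]
      rw [hn₀ s hs n hn r hr, ← hn₀ s hs (max (n₀ s) (n₀ r)) (le_max_left _ _) r hr,
        hn₀ r hrt (max (n₀ s) (n₀ r)) (le_max_right _ _) r le_rfl]
    have hym : Measurable y := by
      refine measurable_of_tendsto_metrizable
        (f := fun n s => if s < t then picard lam N z n s else 0)
        (fun n => Measurable.ite measurableSet_Iio (hpm n) measurable_const) ?_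
      rw [tendsto_pi_nhds]
      intro s
      by_cases hs : s < t
      · refine tendsto_const_nhds.congr' ?_
        filter_upwards [eventually_ge_atTop (n₀ s)] with n hn
        rw [if_pos hs, hyn s hs n hn s le_rfl]
      · simp only [hy, if_neg hs]; exact tendsto_const_nhds
    have hystep : ∀ s < t, y s = stepY lam N z y s := by
      intro s hs
      rw [← hyn s hs (n₀ s + 1) (by omega) s le_rfl]
      change stepY lam N z (picard lam N z (n₀ s)) s = _
      exact stepY_congr fun r hr => hyn s hs _ le_rfl r hr.le
    -- the counts are constant immediately before time `t`
    have hconst : ∀ p, ∃ s < t, ∀ r, s ≤ r → r < t →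
        N p (clk lam y p r) = N p (clk lam y p s) := by
      intro p
      -- Either the clock has already stopped before `t`, or it approaches its value at `t` strictly
      -- from below, where `CountPath.left` gives constancy.
      by_cases hA : ∃ s < t, clk lam y p s = clk lam y p t
      · obtain ⟨s, hs, hst⟩ := hA
        refine ⟨s, hs, fun r hsr hrt => ?_⟩
        rw [le_antisymm ((clk_mono hl hym p hrt.le).trans hst.ge) (clk_mono hl hym p hsr)]
      · push Not at hA
        have hlt : ∀ s < t, clk lam y p s < clk lam y p t := fun s hs =>
          lt_of_le_of_ne (clk_mono hl hym p hs.le) (hA s hs)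
        obtain ⟨v0, hv0, hNv⟩ := hN.left p (zero_le.trans_lt (hlt 0 ht))
        have h2 : ∀ᶠ s in 𝓝[<] t, v0 < clk lam y p s :=
          mem_nhdsWithin_of_mem_nhds
            (((continuous_clk hl hym p).tendsto t).eventually_const_lt hv0)
        have hne : (𝓝[<] t).NeBot := nhdsLT_neBot_of_exists_lt ⟨0, ht⟩
        obtain ⟨s, hs1, hs2⟩ := (h2.and self_mem_nhdsWithin).exists
        refine ⟨s, hs2, fun r hsr hrt => ?_⟩
        rw [hNv _ (hs1.le.trans (clk_mono hl hym p hsr)) (hlt r hrt), hNv _ hs1.le (hlt s hs2)]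
    choose s0 hs0 hs0c using hconst
    obtain ⟨s1, hs1t, hs01⟩ : ∃ s1 < t, ∀ p, s0 p ≤ s1 := by
      refine ⟨Finset.univ.sup s0, ?_, fun p => Finset.le_sup (Finset.mem_univ p)⟩
      rw [Finset.sup_lt_iff (by simpa using ht)]
      exact fun p _ => hs0 p
    have hcc : ∀ p r, s1 ≤ r → r < t → N p (clk lam y p r) = N p (clk lam y p s1) :=
      fun p r h1 h2 => by
        rw [hs0c p r ((hs01 p).trans h1) h2, hs0c p s1 (hs01 p) hs1t]
    have hyc : ∀ r, s1 ≤ r → r < t → y r = y s1 := fun r h1 h2 => by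
      rw [hystep r h2, hystep s1 hs1t]
      unfold stepY posZ
      simp only [hcc _ r h1 h2]
    obtain ⟨ε, hε, hNε⟩ := hN.right fun p => clk lam y p s1
    obtain ⟨δ, hδ, hclk⟩ := exists_clk_le hl t hε
    obtain ⟨s2, hs12, hs2t, hs2δ⟩ : ∃ s2, s1 ≤ s2 ∧ s2 < t ∧ t ≤ s2 + δ := by
      refine ⟨max s1 (t - δ), le_max_left _ _, max_lt hs1t (tsub_lt_self ht hδ), ?_⟩
      exact tsub_le_iff_right.1 (le_max_right _ _)
    have key : ∀ n ≥ n₀ s2, ∀ r < t, picard lam N z (n + 1) r = y r := by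
      intro n hn r hr
      rcases le_total r s2 with hrs | hrs
      · exact hyn s2 hs2t (n + 1) (by omega) r hrs
      rw [hystep r hr]
      change stepY lam N z (picard lam N z n) r = _
      unfold stepY posZ
      congr 2
      ext p
      have e1 : clk lam (picard lam N z n) p s2 = clk lam y p s2 :=
        clk_congr p fun q hq => hyn s2 hs2t n hn q hq.le
      -- For transitions out of the current state, `y` runs the clock at full speed, so the
      -- iterate's clock cannot overtake it and its count is squeezed between equal values. For all
      -- other transitions the clock of `y` stands still and the iterate's clock moves by at most
      -- `ε`.
      by_cases hp : y s1 = p.1.1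
      · have h1 : clk lam (picard lam N z n) p r ≤ clk lam y p r := by
          rw [← NNReal.coe_le_coe]
          refine (clk_le_full hl (hpm n) p hrs).trans ?_
          rw [e1, ← clk_full hl hym p hrs fun q h2 h3 => ?_]
          rw [hyc q (hs12.trans h2) (h3.trans hr), hp]
        refine le_antisymm (hN.mono p h1) ?_
        rw [hcc p r (hs12.trans hrs) hr, ← hcc p s2 hs12 hs2t, ← e1]
        exact hN.mono p (clk_mono hl (hpm n) p hrs)
      · have e2 : ∀ q, s1 ≤ q → q < t → clk lam y p q = clk lam y p s1 := fun q h1 h2 =>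
          clk_stop hl hym p h1 fun x h3 h4 => by rwa [hyc x h3 (h4.trans h2)]
        rw [e2 r (hs12.trans hrs) hr]
        refine hNε p _ ?_ ?_
        · rw [← e2 s2 hs12 hs2t, ← e1]
          exact clk_mono hl (hpm n) p hrs
        · rw [← e2 s2 hs12 hs2t, ← e1]
          exact hclk _ (hpm n) p s2 r hrs hr.le (hr.le.trans hs2δ)
    have key2 : ∀ n ≥ n₀ s2 + 2, ∀ r ≤ t, picard lam N z n r = stepY lam N z y r := by
      intro n hn r hr
      obtain ⟨k, rfl⟩ : ∃ k, n = k + 1 + 1 := ⟨n - 2, by omega⟩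
      change stepY lam N z (picard lam N z (k + 1)) r = _
      exact stepY_congr fun q hq => key k (by omega) q (hq.trans_le hr)
    exact ⟨n₀ s2 + 2, fun n hn r hr => by rw [key2 n hn r hr, key2 _ le_rfl r hr]⟩

lemma eventually_picard_eq_sol (T : ℝ≥0) :
    ∀ᶠ n in atTop, ∀ s ≤ T, picard lam N z n s = sol lam N z s := by
  obtain ⟨n₀, h⟩ := picard_stabilizes (z := z) hl hN T
  filter_upwards [eventually_ge_atTop n₀] with n hn s hs
  have hex : ∃ i, ∀ᶠ n in atTop, picard lam N z n s = i :=
    ⟨_, (eventually_ge_atTop n₀).mono fun k hk => h k hk s hs⟩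
  rw [sol, dif_pos hex]
  obtain ⟨k, h1, h2⟩ := (hex.choose_spec.and (eventually_ge_atTop n₀)).exists
  rw [h n hn s hs, ← h k h2 s hs, h1]

lemma tendsto_picard (t : ℝ≥0) : Tendsto (fun n => picard lam N z n t) atTop (𝓝 (sol lam N z t)) :=
  tendsto_const_nhds.congr' <|
    (eventually_picard_eq_sol hl hN t).mono fun _ hn => (hn t le_rfl).symm

lemma measurable_sol_path : Measurable (sol lam N z) :=
  measurable_of_tendsto_metrizable (fun n => (rightCont_picard (z := z) hl hN n).measurable)
    (tendsto_pi_nhds.2 fun t => tendsto_picard hl hN t)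

lemma sol_eq_stepY (t : ℝ≥0) : sol lam N z t = stepY lam N z (sol lam N z) t := by
  obtain ⟨n, h1⟩ := eventually_atTop.1 (eventually_picard_eq_sol (z := z) hl hN t)
  rw [← h1 (n + 1) (by omega) t le_rfl]
  exact stepY_congr fun s hs => h1 n le_rfl s hs.le

lemma rightCont_sol : RightCont (sol lam N z) := by
  have : sol lam N z = stepY lam N z (sol lam N z) := funext (sol_eq_stepY hl hN)
  rw [this]
  exact rightCont_stepY hl hN (measurable_sol_path hl hN)

omit hl hN in
-- Monotone integer counts are eventually constant on the left of every positive time, so any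
-- function of finitely many of them has left limits.
lemma isCadlag_of_count {c : Counts m} (hm : ∀ p, Monotone (c p))
    (hr : ∀ p, RightCont (c p)) (f : (OffDiag m → ℕ) → Fin (m + 1)) :
    IsCadlag fun t => f fun p => c p t := by
  intro t
  refine ⟨(RightCont.comp (x := fun t p => c p t) (fun t => continuousWithinAt_pi.2 fun p =>
    hr p t) (continuous_of_discreteTopology (f := f))) t, ?_⟩
  have h1 : ∀ p, ∃ l, Tendsto (c p) (𝓝[<] t) (𝓝 l) := by
    intro p
    rcases eq_or_lt_of_le (zero_le : 0 ≤ t) with h | h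
    · subst h
      refine ⟨0, ?_⟩
      have : 𝓝[<] (0 : ℝ≥0) = ⊥ := by simp
      rw [this]; exact tendsto_bot
    · have hb : BddAbove (c p '' Set.Iio t) :=
        ⟨c p t, by rintro _ ⟨x, hx, rfl⟩; exact hm p (le_of_lt hx)⟩
      obtain ⟨s0, hs0, hmax⟩ := Nat.sSup_mem (s := c p '' Set.Iio t) ⟨_, 0, h, rfl⟩ hb
      refine ⟨c p s0, tendsto_const_nhds.congr' ?_⟩
      filter_upwards [Ioo_mem_nhdsLT hs0] with s hs
      refine le_antisymm (hm p hs.1.le) ?_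
      rw [hmax]
      exact le_csSup hb ⟨s, hs.2, rfl⟩
  choose l hl using h1
  exact ⟨f l, ((continuous_of_discreteTopology (f := f)).tendsto l).comp (tendsto_pi_nhds.2 hl)⟩

lemma isCadlag_sol : IsCadlag (sol lam N z) := by
  have h : sol lam N z = stepY lam N z (sol lam N z) := funext (sol_eq_stepY hl hN)
  have hy := measurable_sol_path (z := z) hl hN
  rw [h]
  exact isCadlag_of_count (c := fun p t => N p (clk lam (sol lam N z) p t))
    (fun p => (hN.mono p).comp (clk_mono hl hy p))
    (fun p => (hN.rightCont p).comp_monotone (continuous_clk hl hy p) (clk_mono hl hy p))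
    (fun c => clampFin m (shiftZ z c))

/-- Uniqueness for the time change equation on `[0, T]`. -/
lemma eq_of_stepY {y y' : ℝ≥0 → Fin (m + 1)} (hy : Measurable y) (hy' : Measurable y') {T : ℝ≥0}
    (h : ∀ t ≤ T, y t = stepY lam N z y t) (h' : ∀ t ≤ T, y' t = stepY lam N z y' t) :
    ∀ t ≤ T, y t = y' t := by
  have key := real_induction (Q := fun t => ∀ s ≤ t, s ≤ T → y s = y' s)
    (fun s t hst hQ r hr => hQ r (hr.trans hst)) ?_ ?_ ?_
  · exact fun t ht => key t t le_rfl ht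
  · intro s hs hsT
    rw [h s hsT, h' s hsT]
    exact stepY_congr fun r hr => absurd (hr.trans_le hs) not_lt_zero
  · intro t hQ
    by_cases htT : t < T
    · have hclkt : ∀ p, clk lam y p t = clk lam y' p t := fun p =>
        clk_congr p fun s hs => hQ s hs.le (hs.le.trans htT.le)
      obtain ⟨ε, hε, hNε⟩ := hN.right fun p => clk lam y p t
      obtain ⟨δ, hδ, hclk⟩ := exists_clk_le hl T hε
      refine ⟨t + δ, lt_add_of_pos_right t hδ, fun s hs hsT => ?_⟩
      rcases le_total s t with hst | hts
      · exact hQ s hst hsT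
      rw [h s hsT, h' s hsT]
      unfold stepY posZ
      congr 2
      ext p
      rw [hNε p _ (clk_mono hl hy p hts) (hclk y hy p t s hts hsT hs),
        hNε p _ ((hclkt p).le.trans (clk_mono hl hy' p hts))
          ((hclk y' hy' p t s hts hsT hs).trans_eq (by rw [hclkt p]))]
    · exact ⟨t + 1, lt_add_of_pos_right t one_pos, fun s _ hsT =>
        hQ s (hsT.trans (not_lt.1 htT)) hsT⟩
  · intro t _ hQ s hs hsT
    rcases eq_or_lt_of_le hs with rfl | hs
    · rw [h s hsT, h' s hsT]
      exact stepY_congr fun r hr => hQ r hr r le_rfl (hr.le.trans hsT)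
    · exact hQ s hs s le_rfl hsT

lemma sol_unique {y : ℝ≥0 → Fin (m + 1)}
    (hy : Measurable y) {T : ℝ≥0} (h : ∀ t ≤ T, y t = stepY lam N z y t) :
    ∀ t ≤ T, y t = sol lam N z t :=
  eq_of_stepY hl hN hy (measurable_sol_path hl hN) h fun t _ => sol_eq_stepY hl hN t

/-- The solution up to time `T` uses the counting paths only up to the values of the clocks. -/
lemma sol_congr_count {N' : Counts m} (hN' : CountPath N') {T : ℝ≥0}
    (h : ∀ p, ∀ v ≤ clk lam (sol lam N z) p T, N p v = N' p v) :
    ∀ t ≤ T, sol lam N z t = sol lam N' z t := by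
  have hy := measurable_sol_path (z := z) hl hN
  refine sol_unique hl hN' hy fun t ht => ?_
  conv_lhs => rw [sol_eq_stepY hl hN]
  unfold stepY posZ
  congr 2
  ext p
  exact h p _ (clk_mono hl hy p ht)

omit hl hN in
lemma clk_congr_rate {lam' : Rates m} {y : ℝ≥0 → Fin (m + 1)} {p : OffDiag m}
    {t : ℝ≥0} (h : ∀ s ≤ t, lam p s = lam' p s) : clk lam y p t = clk lam' y p t := by
  unfold clk
  congr 1
  refine intervalIntegral.integral_congr fun s hs => ?_
  rw [Set.uIcc_of_le t.coe_nonneg] at hs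
  simp only [h _ (Real.toNNReal_le_iff_le_coe.2 hs.2)]

/-- The solution up to time `T` uses the rates only up to time `T`. -/
lemma sol_congr_rate {lam' : Rates m} (hl' : RatePath lam')
    {T : ℝ≥0} (h : ∀ p, ∀ s ≤ T, lam p s = lam' p s) : ∀ t ≤ T, sol lam N z t = sol lam' N z t := by
  refine sol_unique hl' hN (measurable_sol_path hl hN) fun t ht => ?_
  conv_lhs => rw [sol_eq_stepY hl hN]
  unfold stepY posZ
  simp only [clk_congr_rate fun s hs => h _ s (hs.trans ht)]

/-- The integer valued position of the solution. -/
noncomputable def solZ (lam : Rates m) (N : Counts m) (z : ℤ)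
    (t : ℝ≥0) : ℤ := posZ lam N z (sol lam N z) t

/-- The counting paths after the values `v` of the clocks. -/
def shiftN (N : Counts m) (v : OffDiag m → ℝ≥0) (p : OffDiag m) (a : ℝ≥0) : ℕ :=
  N p (v p + a) - N p (v p)

omit hl in
lemma CountPath.shiftN (v : OffDiag m → ℝ≥0) : CountPath (MarkovCoupling.shiftN N v) where
  zero p := by simp [MarkovCoupling.shiftN]
  mono p a b hab := by
    unfold MarkovCoupling.shiftN
    exact Nat.sub_le_sub_right (hN.mono p (by gcongr)) _
  rightCont p := by
    have h1 := (hN.rightCont p).comp_monotone (a := fun a => v p + a)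
      (continuous_const.add continuous_id) (fun a b hab => by simpa using hab)
    exact h1.comp (continuous_of_discreteTopology (f := fun k : ℕ => k - N p (v p)))

omit hN in
lemma RatePath.shift (t : ℝ≥0) : RatePath fun p s => lam p (t + s) :=
  ⟨fun p _ => hl.nonneg p _, fun p => (hl.locBdd p).shift t⟩

omit hN in
lemma clk_shift {y : ℝ≥0 → Fin (m + 1)} (hy : Measurable y) (p : OffDiag m)
    (t r : ℝ≥0) : clk lam y p (t + r) =
      clk lam y p t + clk (fun p s => lam p (t + s)) (fun s => y (t + s)) p r := by
  rw [← NNReal.coe_inj, NNReal.coe_add, coe_clk_add hl hy p t (t + r), coe_clk (hl.shift t)]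
  congr 1
  have := intervalIntegral.integral_comp_add_left (a := 0) (b := r)
    (fun s : ℝ => if y s.toNNReal = p.1.1 then lam p s.toNNReal else 0) (t : ℝ)
  rw [add_zero] at this
  rw [NNReal.coe_add, ← this]
  refine intervalIntegral.integral_congr fun s hs => ?_
  rw [Set.uIcc_of_le r.coe_nonneg] at hs
  simp only [Real.toNNReal_add t.coe_nonneg hs.1, Real.toNNReal_coe]

/-- The solution restarts at time `t`. -/
lemma sol_restart (t r : ℝ≥0) : sol lam N z (t + r) = sol (fun p s => lam p (t + s))
      (shiftN N fun p => clk lam (sol lam N z) p t) (solZ lam N z t) r := by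
  have hy := measurable_sol_path (z := z) hl hN
  refine sol_unique (hl.shift t) (hN.shiftN _) (y := fun r => sol lam N z (t + r))
    (hy.comp (measurable_const_add t)) (T := r) (fun s _ => ?_) r le_rfl
  rw [sol_eq_stepY hl hN]
  unfold stepY
  congr 1
  simp only [solZ, posZ, shiftZ, shiftN, clk_shift hl hy]
  rw [add_assoc, ← Finset.sum_add_distrib]
  congr 1
  refine Finset.sum_congr rfl fun p _ => ?_
  rw [← mul_add, Nat.cast_sub (hN.mono p le_self_add)]
  ring

end Solve

section Measurability

variable {Θ : Type*} [MeasurableSpace Θ]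

lemma measurable_clk {lam : Θ → Rates m} {y : Θ → ℝ≥0 → Fin (m + 1)}
    (hlm : ∀ p, Measurable fun q : ℝ≥0 × Θ => lam q.2 p q.1)
    (hym : Measurable fun q : ℝ≥0 × Θ => y q.2 q.1) (p : OffDiag m) (t : ℝ≥0) :
    Measurable fun θ => clk (lam θ) (y θ) p t := by
  refine measurable_real_toNNReal.comp ?_
  refine measurable_integral_path (x := fun s θ => if y θ s = p.1.1 then lam θ p s else 0) ?_ 0 t
  exact Measurable.ite (hym (measurableSet_singleton _)) (hlm p) measurable_const

variable {lam : Θ → Rates m} {N : Θ → Counts m} {z : Θ → ℤ}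

lemma measurable_posZ (hN : ∀ θ, CountPath (N θ))
    (hlm : ∀ p, Measurable fun q : ℝ≥0 × Θ => lam q.2 p q.1)
    (hNm : ∀ p v, Measurable fun θ => N θ p v) (hz : Measurable z)
    {y : Θ → ℝ≥0 → Fin (m + 1)} (hym : Measurable fun q : ℝ≥0 × Θ => y q.2 q.1) (t : ℝ≥0) :
    Measurable fun θ => posZ (lam θ) (N θ) (z θ) (y θ) t := by
  have h1 : ∀ p, Measurable fun θ => N θ p (clk (lam θ) (y θ) p t) := fun p =>
    measurable_eval_of_rightCont (x := fun v θ => N θ p v) (fun v => hNm p v)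
      (fun θ => (hN θ).rightCont p) (measurable_clk hlm hym p t)
  unfold posZ shiftZ
  refine hz.add (Finset.measurable_sum _ fun p _ => Measurable.const_mul ?_ _)
  exact (measurable_of_countable (Nat.cast : ℕ → ℤ)).comp (h1 p)

lemma measurable_sol (hl : ∀ θ, RatePath (lam θ)) (hN : ∀ θ, CountPath (N θ))
    (hlm : ∀ p, Measurable fun q : ℝ≥0 × Θ => lam q.2 p q.1)
    (hNm : ∀ p v, Measurable fun θ => N θ p v) (hz : Measurable z) (t : ℝ≥0) :
    Measurable fun θ => sol (lam θ) (N θ) (z θ) t := by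
  have h1 : ∀ n t, Measurable fun θ => picard (lam θ) (N θ) (z θ) n t := by
    intro n
    induction n with
    | zero => exact fun t => (measurable_of_countable (clampFin m)).comp hz
    | succ n ih =>
      intro t
      refine (measurable_of_countable (clampFin m)).comp ?_
      refine measurable_posZ hN hlm hNm hz ?_ t
      exact measurable_uncurry_of_rightCont (x := fun t θ => picard (lam θ) (N θ) (z θ) n t) ih
        fun θ => rightCont_picard (hl θ) (hN θ) n
  refine measurable_of_tendsto_metrizable (fun n => h1 n t) ?_
  rw [tendsto_pi_nhds]
  exact fun θ => tendsto_picard (hl θ) (hN θ) t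

lemma measurable_solZ (hl : ∀ θ, RatePath (lam θ)) (hN : ∀ θ, CountPath (N θ))
    (hlm : ∀ p, Measurable fun q : ℝ≥0 × Θ => lam q.2 p q.1)
    (hNm : ∀ p v, Measurable fun θ => N θ p v) (hz : Measurable z) (t : ℝ≥0) :
    Measurable fun θ => solZ (lam θ) (N θ) (z θ) t := by
  refine measurable_posZ hN hlm hNm hz ?_ t
  exact measurable_uncurry_of_rightCont (x := fun t θ => sol (lam θ) (N θ) (z θ) t)
    (fun t => measurable_sol hl hN hlm hNm hz t) fun θ => rightCont_sol (hl θ) (hN θ)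

end Measurability

end PathSolution

/-! ### The space of families of counting paths -/

section Transfer

variable {Ω₁ Ω₂ : Type*} [MeasurableSpace Ω₁] [MeasurableSpace Ω₂] {P₁ : Measure Ω₁}
  {P₂ : Measure Ω₂} {f : Ω₁ → Ω₂}

lemma iIndepFun_comp_iff (hf : MeasurePreserving f P₁ P₂) {ι : Type*} {β : ι → Type*}
    {mβ : ∀ i, MeasurableSpace (β i)} {X : ∀ i, Ω₂ → β i} (hX : ∀ i, Measurable (X i)) :
    iIndepFun (fun i ω => X i (f ω)) P₁ ↔ iIndepFun X P₂ := by
  rw [iIndepFun_iff_measure_inter_preimage_eq_mul, iIndepFun_iff_measure_inter_preimage_eq_mul]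
  refine forall_congr' fun S => forall_congr' fun sets => forall_congr' fun hs => ?_
  rw [← hf.measure_preimage (Finset.measurableSet_biInter S fun i hi =>
    hX i (hs i hi)).nullMeasurableSet, Finset.prod_congr rfl fun i hi =>
    (hf.measure_preimage (hX i (hs i hi)).nullMeasurableSet).symm]
  simp only [Set.preimage_iInter]
  rfl

lemma measurable_nat_sub {Ω : Type*} [MeasurableSpace Ω] {f g : Ω → ℕ} (hf : Measurable f)
    (hg : Measurable g) : Measurable fun ω => f ω - g ω :=
  (measurable_of_countable fun q : ℕ × ℕ => q.1 - q.2).comp (hf.prodMk hg)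

lemma hasIndepIncrements_comp_iff (hf : MeasurePreserving f P₁ P₂) {N : ℝ≥0 → Ω₂ → ℕ}
    (hN : ∀ t, Measurable (N t)) :
    HasIndepIncrements (fun t ω => N t (f ω)) P₁ ↔ HasIndepIncrements N P₂ := by
  unfold HasIndepIncrements
  refine forall_congr' fun n => forall_congr' fun t => forall_congr' fun _ => ?_
  exact iIndepFun_comp_iff (X := fun i : Fin n => N (t i.succ) - N (t i.castSucc)) hf
    fun i => measurable_nat_sub (hN _) (hN _)

lemma IsUnitPoisson.comp (hf : MeasurePreserving f P₁ P₂) {N : ℝ≥0 → Ω₂ → ℕ}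
    (hN : IsUnitPoisson N P₂) : IsUnitPoisson (fun t ω => N t (f ω)) P₁ where
  measurable t := (hN.measurable t).comp hf.measurable
  zero ω := hN.zero _
  mono ω := hN.mono _
  rightCont ω := hN.rightCont _
  indep := (hasIndepIncrements_comp_iff hf hN.measurable).2 hN.indep
  law s t hst := by
    rw [← hN.law s t hst, ← hf.map_eq,
      Measure.map_map (measurable_nat_sub (hN.measurable _) (hN.measurable _)) hf.measurable]
    rfl

end Transfer

/-- The space of families of paths of counting processes, with the `σ`-algebra generated by the
evaluations. -/
structure CountSpace (m : ℕ) : Type where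
  val : Counts m
  property : CountPath val

section CountSpace

variable {m : ℕ}

/-- The family of paths as a function of the pairs of indices and times. -/
def CountSpace.eval (N : CountSpace m) (a : OffDiag m × ℝ≥0) : ℕ := N.1 a.1 a.2

instance : MeasurableSpace (CountSpace m) :=
  MeasurableSpace.comap CountSpace.eval inferInstance

lemma measurable_countSpace_eval : Measurable (CountSpace.eval (m := m)) :=
  comap_measurable _

lemma measurable_count (p : OffDiag m) (t : ℝ≥0) : Measurable fun N : CountSpace m => N.1 p t :=
  (measurable_pi_apply (p, t)).comp measurable_countSpace_eval

lemma measurable_toCountSpace {Θ : Type*} [MeasurableSpace Θ] {f : Θ → CountSpace m}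
    (h : ∀ p t, Measurable fun θ => (f θ).1 p t) : Measurable f :=
  measurable_comap_iff.2 (measurable_pi_iff.2 fun a => h a.1 a.2)

/-- Finite measures on the space of counting paths are determined by their finite dimensional
marginals. -/
lemma ext_countSpace {ρ₁ ρ₂ : Measure (CountSpace m)} [IsFiniteMeasure ρ₁] [IsFiniteMeasure ρ₂]
    (h : ∀ (I : Finset (OffDiag m × ℝ≥0)) (c : I → ℕ),
      ρ₁ {N | ∀ a : I, N.1 a.1.1 a.1.2 = c a} = ρ₂ {N | ∀ a : I, N.1 a.1.1 a.1.2 = c a}) :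
    ρ₁ = ρ₂ := by
  have h1 : ρ₁.map CountSpace.eval = ρ₂.map CountSpace.eval := by
    refine IsProjectiveLimit.unique (P := fun I => (ρ₂.map CountSpace.eval).map I.restrict)
      (fun I => ?_) fun I => rfl
    beta_reduce
    rw [Measure.map_map (Finset.measurable_restrict I) measurable_countSpace_eval,
      Measure.map_map (Finset.measurable_restrict I) measurable_countSpace_eval]
    have hm : Measurable (I.restrict ∘ CountSpace.eval (m := m)) :=
      (Finset.measurable_restrict I).comp measurable_countSpace_eval
    refine Measure.ext_of_singleton fun c => ?_
    rw [Measure.map_apply hm (measurableSet_singleton c),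
      Measure.map_apply hm (measurableSet_singleton c)]
    convert h I c using 2 <;>
    · ext N
      simp only [Set.mem_preimage, Function.comp_apply, Set.mem_singleton_iff, funext_iff]
      rfl
  refine Measure.ext fun S hS => ?_
  obtain ⟨B, hB, rfl⟩ := hS
  rw [← Measure.map_apply measurable_countSpace_eval hB, h1,
    Measure.map_apply measurable_countSpace_eval hB]

/-- The paths stopped at the times `u`. -/
def stopCount (u : OffDiag m → ℝ≥0) (N : CountSpace m) : CountSpace m :=
  ⟨fun p r => N.1 p (min r (u p)), fun p => by simp [N.2.zero],
    fun p a b hab => N.2.mono p (min_le_min_right _ hab), fun p =>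
      (N.2.rightCont p).comp_monotone (a := fun r => min r (u p)) (by fun_prop)
        fun a b hab => min_le_min_right _ hab⟩

/-- The paths restarted at the times `u`. -/
def shiftCount (u : OffDiag m → ℝ≥0) (N : CountSpace m) : CountSpace m :=
  ⟨shiftN N.1 u, N.2.shiftN u⟩

lemma measurable_stopCount (u : OffDiag m → ℝ≥0) : Measurable (stopCount u) :=
  measurable_toCountSpace fun p _ => measurable_count p _

lemma measurable_shiftCount (u : OffDiag m → ℝ≥0) : Measurable (shiftCount u) :=
  measurable_toCountSpace fun p _ => measurable_nat_sub (measurable_count p _) (measurable_count p _)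

/-- The law of the pair of families is the product of the laws of the coordinate pairs, each of
which is a product; regrouping the factors gives a product of two product measures. -/
lemma indepFun_pi_components {ι A B C : Type*} [Fintype ι] [MeasurableSpace A] [MeasurableSpace B]
    [MeasurableSpace C] {μ : Measure A} [IsProbabilityMeasure μ] {f : ι → A → B} {g : ι → A → C}
    (hf : ∀ i, Measurable (f i)) (hg : ∀ i, Measurable (g i)) (h : ∀ i, IndepFun (f i) (g i) μ) :
    IndepFun (fun w i => f i (w i)) (fun w i => g i (w i)) (Measure.pi fun _ : ι => μ) := by
  have hfm : Measurable fun (w : ι → A) i => f i (w i) :=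
    measurable_pi_iff.2 fun i => (hf i).comp (measurable_pi_apply i)
  have hgm : Measurable fun (w : ι → A) i => g i (w i) :=
    measurable_pi_iff.2 fun i => (hg i).comp (measurable_pi_apply i)
  have hpf : ∀ i, IsProbabilityMeasure (μ.map (f i)) := fun i =>
    Measure.isProbabilityMeasure_map (hf i).aemeasurable
  have hpg : ∀ i, IsProbabilityMeasure (μ.map (g i)) := fun i =>
    Measure.isProbabilityMeasure_map (hg i).aemeasurable
  have hpfg : ∀ i, IsProbabilityMeasure (μ.map fun w => (f i w, g i w)) := fun i =>
    Measure.isProbabilityMeasure_map ((hf i).prodMk (hg i)).aemeasurable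
  rw [indepFun_iff_map_prod_eq_prod_map_map hfm.aemeasurable hgm.aemeasurable,
    Measure.pi_map_pi fun i => (hf i).aemeasurable, Measure.pi_map_pi fun i => (hg i).aemeasurable,
    ← (measurePreserving_arrowProdEquivProdArrow B C ι (fun i => μ.map (f i))
      (fun i => μ.map (g i))).map_eq]
  have h1 : (Measure.pi fun i => (μ.map (f i)).prod (μ.map (g i))) =
      (Measure.pi fun _ : ι => μ).map fun w i => (f i (w i), g i (w i)) := by
    rw [Measure.pi_map_pi (f := fun i w => (f i w, g i w)) fun i => ((hf i).prodMk (hg i)).aemeasurable]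
    congr 1
    ext1 i
    rw [(indepFun_iff_map_prod_eq_prod_map_map (hf i).aemeasurable (hg i).aemeasurable).1 (h i)]
  have hfgm : Measurable fun (w : ι → A) i => (f i (w i), g i (w i)) :=
    measurable_pi_iff.2 fun i => ((hf i).prodMk (hg i)).comp (measurable_pi_apply i)
  rw [h1, Measure.map_map (MeasurableEquiv.measurable _) hfgm]
  rfl

/-- The counting paths of a family of Poisson point configurations. -/
noncomputable def toCount (w : OffDiag m → PoiSpace) : CountSpace m :=
  ⟨fun p t => poi t (w p), fun _ => poi_zero _, fun _ => poi_mono _, fun _ => rightCont_poi _⟩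

lemma measurable_toCount : Measurable (toCount (m := m)) :=
  measurable_toCountSpace fun p t => (measurable_poi t).comp (measurable_pi_apply p)

/-- The law of a family of independent unit rate Poisson processes. -/
noncomputable def countMeasure (m : ℕ) : Measure (CountSpace m) :=
  (Measure.pi fun _ : OffDiag m => poiMeasure).map toCount

instance : IsProbabilityMeasure (countMeasure m) :=
  Measure.isProbabilityMeasure_map measurable_toCount.aemeasurable

lemma measurePreserving_toCount :
    MeasurePreserving toCount (Measure.pi fun _ : OffDiag m => poiMeasure) (countMeasure m) :=
  ⟨measurable_toCount, rfl⟩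

lemma isUnitPoisson_count (p : OffDiag m) :
    IsUnitPoisson (fun t (N : CountSpace m) => N.1 p t) (countMeasure m) := by
  have h1 : IsUnitPoisson (fun t (w : OffDiag m → PoiSpace) => poi t (w p))
      (Measure.pi fun _ : OffDiag m => poiMeasure) :=
    isUnitPoisson_poi.comp (measurePreserving_eval (fun _ : OffDiag m => poiMeasure) p)
  refine ⟨measurable_count p, fun N => N.2.zero p, fun N => N.2.mono p, fun N => N.2.rightCont p,
    ?_, fun s t hst => ?_⟩
  · exact (hasIndepIncrements_comp_iff measurePreserving_toCount (measurable_count p)).1 h1.indep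
  · rw [← h1.law s t hst, countMeasure,
      Measure.map_map (measurable_nat_sub (measurable_count p _) (measurable_count p _))
        measurable_toCount]
    rfl

lemma iIndepFun_count :
    iIndepFun (fun (p : OffDiag m) (N : CountSpace m) (t : ℝ≥0) => N.1 p t) (countMeasure m) := by
  refine (iIndepFun_comp_iff measurePreserving_toCount
    fun p => measurable_pi_iff.2 fun t => measurable_count p t).1 ?_
  exact iIndepFun_pi (μ := fun _ : OffDiag m => poiMeasure) (X := fun _ w (t : ℝ≥0) => poi t w)
    fun _ => (measurable_pi_iff.2 fun t => measurable_poi t).aemeasurable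

/-- The paths up to the times `u` are independent of the paths restarted at the times `u`. -/
lemma indepFun_stopCount_shiftCount (u : OffDiag m → ℝ≥0) :
    IndepFun (stopCount u) (shiftCount u) (countMeasure m) := by
  set φ : Counts m → (OffDiag m × ℝ≥0 → ℕ) := fun N a => N a.1 a.2 with hφ
  have hφm : Measurable φ := measurable_pi_iff.2 fun a =>
    (measurable_pi_apply a.2).comp (measurable_pi_apply a.1)
  have h1 := (indepFun_pi_components (ι := OffDiag m) (μ := poiMeasure)
    (f := fun p w (r : ℝ≥0) => poi (min r (u p)) w)
    (g := fun p w (a : ℝ≥0) => poi (u p + a) w - poi (u p) w)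
    (fun p => measurable_pi_iff.2 fun r => measurable_poi _)
    (fun p => measurable_pi_iff.2 fun r => measurable_poi_sub _ _)
    fun p => indepFun_poi_past_future (u p)).comp hφm hφm
  have h2 : IndepFun (CountSpace.eval ∘ stopCount u) (CountSpace.eval ∘ shiftCount u)
      (countMeasure m) := by
    rw [indepFun_iff_measure_inter_preimage_eq_mul] at h1 ⊢
    intro s t hs ht
    have hs' := (measurable_countSpace_eval.comp (measurable_stopCount u)) hs
    have ht' := (measurable_countSpace_eval.comp (measurable_shiftCount u)) ht
    have := h1 s t hs ht
    rw [countMeasure, Measure.map_apply measurable_toCount (hs'.inter ht'),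
      Measure.map_apply measurable_toCount hs', Measure.map_apply measurable_toCount ht']
    exact this
  rw [IndepFun_iff_Indep] at h2 ⊢
  simp only [← MeasurableSpace.comap_comp] at h2
  exact h2

/-- The paths restarted at the times `u` have the original law. -/
lemma map_shiftCount (u : OffDiag m → ℝ≥0) :
    (countMeasure m).map (shiftCount u) = countMeasure m := by
  have h1 : (Measure.pi fun _ : OffDiag m => poiMeasure).map
        (fun w p (a : ℝ≥0) => poi (u p + a) (w p) - poi (u p) (w p)) =
      (Measure.pi fun _ : OffDiag m => poiMeasure).map (fun w p (a : ℝ≥0) => poi a (w p)) := by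
    have hm1 : ∀ p, Measurable fun w (a : ℝ≥0) => poi (u p + a) w - poi (u p) w := fun p =>
      measurable_pi_iff.2 fun r => measurable_poi_sub _ _
    have hm2 : Measurable fun w (a : ℝ≥0) => poi a w := measurable_pi_iff.2 fun r => measurable_poi r
    have i1 : ∀ p, IsProbabilityMeasure
        (poiMeasure.map fun w (a : ℝ≥0) => poi (u p + a) w - poi (u p) w) := fun p =>
      Measure.isProbabilityMeasure_map (hm1 p).aemeasurable
    have i2 : IsProbabilityMeasure (poiMeasure.map fun w (a : ℝ≥0) => poi a w) :=
      Measure.isProbabilityMeasure_map hm2.aemeasurable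
    rw [Measure.pi_map_pi (f := fun p w (a : ℝ≥0) => poi (u p + a) w - poi (u p) w)
        fun p => (hm1 p).aemeasurable,
      Measure.pi_map_pi (f := fun p w (a : ℝ≥0) => poi a w) fun p => hm2.aemeasurable]
    simp only [map_poi_shift]
  have hp := Measure.isProbabilityMeasure_map (μ := countMeasure m)
    (measurable_shiftCount u).aemeasurable
  refine ext_countSpace fun I c => ?_
  have hS : MeasurableSet {N : Counts m | ∀ a : I, N a.1.1 a.1.2 = c a} := by
    simp only [Set.ofPred_forall]
    refine MeasurableSet.iInter fun a => ?_
    have hm : Measurable fun N : Counts m => N a.1.1 a.1.2 :=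
      (measurable_pi_apply a.1.2).comp (measurable_pi_apply a.1.1)
    exact hm (measurableSet_singleton (c a))
  have hS' : MeasurableSet {N : CountSpace m | ∀ a : I, N.1 a.1.1 a.1.2 = c a} := by
    simp only [Set.ofPred_forall]
    exact MeasurableSet.iInter fun a => (measurable_count _ _) (measurableSet_singleton (c a))
  have h2 := congrArg (fun μ => μ {N : Counts m | ∀ a : I, N a.1.1 a.1.2 = c a}) h1
  simp only at h2
  have hm1 : Measurable fun (w : OffDiag m → PoiSpace) p (a : ℝ≥0) =>
      poi (u p + a) (w p) - poi (u p) (w p) := measurable_pi_iff.2 fun p =>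
    measurable_pi_iff.2 fun a => (measurable_poi_sub _ _).comp (measurable_pi_apply p)
  have hm2 : Measurable fun (w : OffDiag m → PoiSpace) p (a : ℝ≥0) => poi a (w p) :=
    measurable_pi_iff.2 fun p => measurable_pi_iff.2 fun a =>
      (measurable_poi _).comp (measurable_pi_apply p)
  rw [Measure.map_apply hm1 hS, Measure.map_apply hm2 hS] at h2
  rw [Measure.map_apply (measurable_shiftCount u) hS', countMeasure,
    Measure.map_apply measurable_toCount ((measurable_shiftCount u) hS'),
    Measure.map_apply measurable_toCount hS']
  exact h2

end CountSpace

/-! ### The strong Markov property of the driven chain -/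

section StrongMarkov

variable {m : ℕ} {lam : Rates m} {z : ℤ} (hl : RatePath lam)

/-- The vector of clock values is treated as a multiparameter stopping time of the counting paths,
with the `Determined` events as its past. -/
noncomputable def solClk (lam : Rates m) (z : ℤ) (t : ℝ≥0) (N : CountSpace m)
    (p : OffDiag m) : ℝ≥0 := clk lam (sol lam N.1 z) p t

include hl

lemma measurable_sol_count (t : ℝ≥0) : Measurable fun N : CountSpace m => sol lam N.1 z t :=
  measurable_sol (lam := fun _ => lam) (N := fun N : CountSpace m => N.1) (z := fun _ => z)
    (fun _ => hl) (fun N => N.2) (fun p => (hl.locBdd p).measurable.comp measurable_fst)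
    (fun p v => measurable_count p v) measurable_const t

lemma measurable_sol_count_uncurry : Measurable fun q : ℝ≥0 × CountSpace m => sol lam q.2.1 z q.1 :=
  measurable_uncurry_of_rightCont (x := fun t (N : CountSpace m) => sol lam N.1 z t)
    (fun t => measurable_sol_count hl t) fun N => rightCont_sol hl N.2

lemma measurable_solClk (t : ℝ≥0) (p : OffDiag m) :
    Measurable fun N : CountSpace m => solClk lam z t N p :=
  measurable_clk (lam := fun _ => lam) (y := fun (N : CountSpace m) t => sol lam N.1 z t)
    (fun p => (hl.locBdd p).measurable.comp measurable_fst) (measurable_sol_count_uncurry hl) p t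

/-- Events that depend on the counting paths only up to the values of the clocks at time `t`. -/
structure Determined (lam : Rates m) (z : ℤ) (t : ℝ≥0) (A : Set (CountSpace m)) :
    Prop where
  measurableSet : MeasurableSet A
  congr : ∀ N N' : CountSpace m, (∀ p, ∀ v ≤ solClk lam z t N p, N.1 p v = N'.1 p v) →
    N ∈ A → N' ∈ A

omit hl in
lemma Determined.univ (t : ℝ≥0) : Determined lam z t Set.univ := ⟨.univ, fun _ _ _ _ => trivial⟩

omit hl in
lemma Determined.inter {t : ℝ≥0} {A B : Set (CountSpace m)} (hA : Determined lam z t A)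
    (hB : Determined lam z t B) : Determined lam z t (A ∩ B) :=
  ⟨hA.1.inter hB.1, fun N N' h hN => ⟨hA.2 N N' h hN.1, hB.2 N N' h hN.2⟩⟩

lemma Determined.mono {s t : ℝ≥0} (hst : s ≤ t) {A : Set (CountSpace m)}
    (hA : Determined lam z s A) : Determined lam z t A :=
  ⟨hA.1, fun N N' h => hA.2 N N' fun p v hv =>
    h p v (hv.trans (clk_mono hl (measurable_sol_path hl N.2) p hst))⟩

lemma sol_eq_of_agree {t : ℝ≥0} {N N' : CountSpace m}
    (h : ∀ p, ∀ v ≤ solClk lam z t N p, N.1 p v = N'.1 p v) :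
    ∀ s ≤ t, sol lam N.1 z s = sol lam N'.1 z s := sol_congr_count hl N.2 N'.2 h

lemma solClk_eq_of_agree {t : ℝ≥0} {N N' : CountSpace m}
    (h : ∀ p, ∀ v ≤ solClk lam z t N p, N.1 p v = N'.1 p v) :
    solClk lam z t N = solClk lam z t N' :=
  funext fun p => clk_congr p fun s hs => sol_eq_of_agree hl h s hs.le

lemma determined_sol (t : ℝ≥0) {B : Set (Set.Iic t → Fin (m + 1))} (hB : MeasurableSet B) :
    Determined lam z t {N | (fun r : Set.Iic t => sol lam N.1 z r) ∈ B} := by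
  have hm : Measurable fun (N : CountSpace m) (r : Set.Iic t) => sol lam N.1 z r :=
    measurable_pi_iff.2 fun r => measurable_sol_count hl r
  refine ⟨hm hB, fun N N' h hN => ?_⟩
  have : (fun r : Set.Iic t => sol lam N.1 z r) = fun r : Set.Iic t => sol lam N'.1 z r :=
    funext fun r => sol_eq_of_agree hl h r r.2
  rwa [Set.mem_ofPred_eq, this] at hN

lemma determined_sol_eq (t : ℝ≥0) (i : Fin (m + 1)) :
    Determined lam z t {N | sol lam N.1 z t = i} :=
  ⟨measurable_sol_count hl t (measurableSet_singleton i), fun N N' h hN => by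
    rw [Set.mem_ofPred_eq] at hN ⊢
    rw [← hN, sol_eq_of_agree hl h t le_rfl]⟩

omit hl in
lemma measurableSet_cylinder (I : Finset (OffDiag m × ℝ≥0)) (c : I → ℕ) :
    MeasurableSet {N : CountSpace m | ∀ a : I, N.1 a.1.1 a.1.2 = c a} := by
  simp only [Set.ofPred_forall]
  exact MeasurableSet.iInter fun a => (measurable_count _ _) (measurableSet_singleton (c a))

omit hl in
lemma measurable_shiftCount_random {Θ : Type*} [MeasurableSpace Θ] {f : Θ → CountSpace m}
    (hf : Measurable f) {u : Θ → OffDiag m → ℝ≥0} (hu : ∀ p, Measurable fun θ => u θ p) :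
    Measurable fun θ => shiftCount (u θ) (f θ) := by
  have h1 : ∀ (p : OffDiag m) {v : Θ → ℝ≥0}, Measurable v → Measurable fun θ => (f θ).1 p (v θ) :=
    fun p v hv => measurable_eval_of_rightCont (x := fun r θ => (f θ).1 p r)
      (fun r => (measurable_count p r).comp hf) (fun θ => (f θ).2.rightCont p) hv
  exact measurable_toCountSpace fun p a =>
    measurable_nat_sub (h1 p ((hu p).add_const a)) (h1 p (hu p))

/-- Strong Markov property for clock values rounded up to the dyadic points of level `n`. -/
lemma measure_shift_gridUp {t : ℝ≥0} {A : Set (CountSpace m)}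
    (hA : Determined lam z t A) {S : Set (CountSpace m)} (hS : MeasurableSet S) (n : ℕ) :
    countMeasure m {N | N ∈ A ∧ shiftCount (fun p => gridUp n (solClk lam z t N p)) N ∈ S} =
      countMeasure m A * countMeasure m S := by
  set G : (OffDiag m → ℕ) → Set (CountSpace m) := fun v =>
    {N | ∀ p, ⌊solClk lam z t N p * 2 ^ n⌋₊ = v p} with hG
  set u : (OffDiag m → ℕ) → OffDiag m → ℝ≥0 := fun v p => ((v p : ℝ≥0) + 1) / 2 ^ n with hu
  have hGm : ∀ v, MeasurableSet (G v) := fun v => by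
    simp only [hG, Set.ofPred_forall]
    exact MeasurableSet.iInter fun p =>
      (((measurable_solClk hl t p).mul_const _).nat_floor) (measurableSet_singleton (v p))
  have hGu : ∀ v, ∀ N ∈ G v, (fun p => gridUp n (solClk lam z t N p)) = u v := by
    intro v N hN
    ext1 p
    simp only [gridUp, hu, hN p]
  -- On `A ∩ G v` all clocks are strictly below `u v`, by `lt_gridUp`. Stopping the counting paths
  -- at `u v` therefore does not affect membership, and the event belongs to the past of the
  -- deterministic times `u v`.
  have hcnt : ∀ v, stopCount (u v) ⁻¹' (A ∩ G v) = A ∩ G v := by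
    intro v
    ext N
    constructor
    · rintro ⟨h1, h2⟩
      have hag : ∀ p, ∀ w ≤ solClk lam z t (stopCount (u v) N) p,
          (stopCount (u v) N).1 p w = N.1 p w := fun p w hw => by
        have h3 := congrFun (hGu v _ h2) p
        have h4 := lt_gridUp n (solClk lam z t (stopCount (u v) N) p)
        simp only [h3] at h4
        simp only [stopCount, min_eq_left (hw.trans h4.le)]
      refine ⟨hA.2 _ _ hag h1, fun p => ?_⟩
      rw [← solClk_eq_of_agree hl hag]
      exact h2 p
    · rintro ⟨h1, h2⟩
      have hag : ∀ p, ∀ w ≤ solClk lam z t N p, N.1 p w = (stopCount (u v) N).1 p w :=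
        fun p w hw => by
          have h3 := congrFun (hGu v _ h2) p
          have h4 := lt_gridUp n (solClk lam z t N p)
          simp only [h3] at h4
          simp only [stopCount, min_eq_left (hw.trans h4.le)]
      refine ⟨hA.2 _ _ hag h1, fun p => ?_⟩
      rw [← solClk_eq_of_agree hl hag]
      exact h2 p
  have hprod : ∀ v, countMeasure m (A ∩ G v ∩ shiftCount (u v) ⁻¹' S) =
      countMeasure m (A ∩ G v) * countMeasure m S := by
    intro v
    have h1 := (indepFun_iff_measure_inter_preimage_eq_mul.1
      (indepFun_stopCount_shiftCount (u v))) (A ∩ G v) S (hA.1.inter (hGm v)) hS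
    rw [hcnt, ← Measure.map_apply (measurable_shiftCount (u v)) hS, map_shiftCount] at h1
    exact h1
  have hdisj : Pairwise (Function.onFun Disjoint G) := by
    intro v v' hvv
    refine Set.disjoint_left.2 fun N h1 h2 => hvv (funext fun p => ?_)
    rw [← h1 p, h2 p]
  have hcover : ∀ N, N ∈ G fun p => ⌊solClk lam z t N p * 2 ^ n⌋₊ := fun N p => rfl
  have e1 : {N | N ∈ A ∧ shiftCount (fun p => gridUp n (solClk lam z t N p)) N ∈ S} =
      ⋃ v, A ∩ G v ∩ shiftCount (u v) ⁻¹' S := by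
    ext N
    simp only [Set.mem_ofPred_eq, Set.mem_iUnion, Set.mem_inter_iff, Set.mem_preimage]
    constructor
    · rintro ⟨h1, h2⟩
      rw [hGu _ N (hcover N)] at h2
      exact ⟨_, ⟨h1, hcover N⟩, h2⟩
    · rintro ⟨v, ⟨h1, h2⟩, h3⟩
      refine ⟨h1, ?_⟩
      rwa [hGu v N h2]
  have e2 : A = ⋃ v, A ∩ G v := by
    rw [← Set.inter_iUnion, Set.inter_eq_left.2]
    exact fun N _ => Set.mem_iUnion.2 ⟨_, hcover N⟩
  rw [e1, measure_iUnion]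
  · simp only [hprod]
    rw [ENNReal.tsum_mul_right, ← measure_iUnion, ← e2]
    · exact fun v v' h => (hdisj h).mono Set.inter_subset_right Set.inter_subset_right
    · exact fun v => hA.1.inter (hGm v)
  · exact fun v v' h => (hdisj h).mono (Set.inter_subset_left.trans Set.inter_subset_right)
      (Set.inter_subset_left.trans Set.inter_subset_right)
  · exact fun v => (hA.1.inter (hGm v)).inter (measurable_shiftCount _ hS)

lemma measurable_shift_solClk (t : ℝ≥0) :
    Measurable fun N : CountSpace m => shiftCount (solClk lam z t N) N :=
  measurable_shiftCount_random measurable_id fun p => measurable_solClk hl t p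

/-- Strong Markov property: after the values of the clocks at time `t` the counting paths start
afresh. -/
theorem map_shift_solClk {t : ℝ≥0} {A : Set (CountSpace m)} (hA : Determined lam z t A) :
    ((countMeasure m).restrict A).map (fun N => shiftCount (solClk lam z t N) N) =
      countMeasure m A • countMeasure m := by
  have hfin : IsFiniteMeasure (countMeasure m A • countMeasure m) :=
    ⟨by simp⟩
  refine ext_countSpace fun I c => ?_
  set S := {N : CountSpace m | ∀ a : I, N.1 a.1.1 a.1.2 = c a} with hSdef
  have hS : MeasurableSet S := measurableSet_cylinder I c
  have hgr : ∀ n, Measurable fun N : CountSpace m =>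
      shiftCount (fun p => gridUp n (solClk lam z t N p)) N := fun n =>
    measurable_shiftCount_random measurable_id fun p => by
      have := measurable_solClk (z := z) hl t p
      unfold gridUp
      fun_prop
  rw [Measure.map_apply (measurable_shift_solClk hl t) hS,
    Measure.restrict_apply (measurable_shift_solClk hl t hS), Measure.smul_apply, smul_eq_mul]
  have hlim := tendsto_measure_of_tendsto_indicator_of_isFiniteMeasure (L := atTop)
    (countMeasure m)
    (As := fun n => {N | N ∈ A ∧ shiftCount (fun p => gridUp n (solClk lam z t N p)) N ∈ S})
    (A := (fun N => shiftCount (solClk lam z t N) N) ⁻¹' S ∩ A)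
    (fun n => hA.1.inter (hgr n hS)) fun N => by
      -- Right continuous integer paths are eventually constant along the grid points that decrease
      -- to the clock values, so the cylinder indicators converge pointwise.
      have h1 : ∀ a : OffDiag m × ℝ≥0, ∀ᶠ n in atTop,
          (shiftCount (fun p => gridUp n (solClk lam z t N p)) N).1 a.1 a.2 =
            (shiftCount (solClk lam z t N) N).1 a.1 a.2 := by
        intro a
        have h2 : RightCont fun v => N.1 a.1 (v + a.2) :=
          (N.2.rightCont a.1).comp_monotone (a := fun v => v + a.2) (by fun_prop)
            fun x y hxy => by simpa using hxy
        have h3 := h2.tendsto_gridUp (solClk lam z t N a.1)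
        have h4 := (N.2.rightCont a.1).tendsto_gridUp (solClk lam z t N a.1)
        rw [nhds_discrete, tendsto_pure] at h3 h4
        filter_upwards [h3, h4] with n h5 h6
        simp only [shiftCount, shiftN, h5, h6]
      have h2 : ∀ᶠ n in atTop, ∀ a : I,
          (shiftCount (fun p => gridUp n (solClk lam z t N p)) N).1 a.1.1 a.1.2 =
            (shiftCount (solClk lam z t N) N).1 a.1.1 a.1.2 :=
        eventually_all.2 fun a => h1 a.1
      filter_upwards [h2] with n hn
      simp only [Set.mem_ofPred_eq, Set.mem_inter_iff, Set.mem_preimage, hSdef, hn]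
      exact and_comm
  simp only [measure_shift_gridUp hl hA hS] at hlim
  exact tendsto_nhds_unique hlim tendsto_const_nhds

lemma setIntegral_shift_solClk {t : ℝ≥0} {A : Set (CountSpace m)}
    (hA : Determined lam z t A) {h : CountSpace m → ℝ} (hh : Measurable h) :
    ∫ N in A, h (shiftCount (solClk lam z t N) N) ∂(countMeasure m) =
      (countMeasure m).real A * ∫ N, h N ∂(countMeasure m) := by
  have := integral_map (μ := (countMeasure m).restrict A)
    (measurable_shift_solClk (z := z) hl t).aemeasurable hh.aestronglyMeasurable
  rw [← this, map_shift_solClk hl hA, integral_smul_measure, smul_eq_mul]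
  rfl

end StrongMarkov

/-! ### Probabilities of one and of two Poisson jumps in a short time -/

section Tail

variable {m : ℕ}

lemma countMeasure_one_le (p : OffDiag m) (a : ℝ≥0) :
    (countMeasure m).real {N | 1 ≤ N.1 p a} = 1 - Real.exp (-a) := by
  have h1 : (countMeasure m).map (fun N => N.1 p a) = poissonMeasure a := by
    have := (isUnitPoisson_count p).law 0 a zero_le
    simpa [(isUnitPoisson_count p).zero] using this
  have h2 : {N : CountSpace m | 1 ≤ N.1 p a} = ((fun N : CountSpace m => N.1 p a) ⁻¹' {0})ᶜ := by
    ext N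
    simp [Nat.one_le_iff_ne_zero]
  rw [h2, probReal_compl_eq_one_sub (measurable_count p a (measurableSet_singleton 0)),
    ← map_measureReal_apply (measurable_count p a) (measurableSet_singleton 0), h1,
    poissonMeasure_real_singleton]
  simp

lemma countMeasure_one_le_le (p : OffDiag m) (a : ℝ≥0) :
    (countMeasure m).real {N | 1 ≤ N.1 p a} ≤ a := by
  rw [countMeasure_one_le]
  have := Real.add_one_le_exp (-(a : ℝ))
  linarith

lemma abs_countMeasure_one_le_sub (p : OffDiag m) (a : ℝ≥0) :
    |(countMeasure m).real {N | 1 ≤ N.1 p a} - a| ≤ (a : ℝ) ^ 2 := by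
  rw [countMeasure_one_le, abs_le]
  have h1 := Real.add_one_le_exp (-(a : ℝ))
  have h2 := Real.add_one_le_exp (a : ℝ)
  have h3 : Real.exp (-a) * Real.exp a = 1 := by rw [← Real.exp_add]; simp
  have h4 := Real.exp_pos (-(a : ℝ))
  have ha := a.coe_nonneg
  have h5 : Real.exp (-a) ≤ 1 := Real.exp_le_one_iff.2 (by linarith)
  constructor
  · nlinarith
  · nlinarith

lemma countMeasure_two_le (p : OffDiag m) (a : ℝ≥0) :
    (countMeasure m).real {N | 2 ≤ N.1 p a} ≤ (a : ℝ) ^ 2 := by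
  have h1 : (countMeasure m).map (fun N => N.1 p a) = poissonMeasure a := by
    have := (isUnitPoisson_count p).law 0 a zero_le
    simpa [(isUnitPoisson_count p).zero] using this
  have h2 : {N : CountSpace m | 2 ≤ N.1 p a} = ((fun N : CountSpace m => N.1 p a) ⁻¹' {0, 1})ᶜ := by
    ext N
    simp only [Set.mem_ofPred_eq, Set.mem_compl_iff, Set.mem_preimage, Set.mem_insert_iff,
      Set.mem_singleton_iff]
    omega
  have hm : MeasurableSet ({0, 1} : Set ℕ) := .of_discrete
  rw [h2, probReal_compl_eq_one_sub (measurable_count p a hm),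
    ← map_measureReal_apply (measurable_count p a) hm, h1,
    show ({0, 1} : Set ℕ) = {0} ∪ {1} from rfl,
    measureReal_union (by simp) (measurableSet_singleton 1), poissonMeasure_real_singleton,
    poissonMeasure_real_singleton]
  have h3 := Real.add_one_le_exp (-(a : ℝ))
  have ha := a.coe_nonneg
  simp only [pow_zero, Nat.factorial_zero, Nat.cast_one, div_one, mul_one, pow_one,
    Nat.factorial_one]
  nlinarith

lemma countMeasure_both_le {p q : OffDiag m} (hpq : p ≠ q) (a : ℝ≥0) :
    (countMeasure m).real {N | 1 ≤ N.1 p a ∧ 1 ≤ N.1 q a} ≤ (a : ℝ) ^ 2 := by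
  have h1 := (iIndepFun_count (m := m)).indepFun hpq
  have hS : MeasurableSet {x : ℝ≥0 → ℕ | 1 ≤ x a} :=
    (measurable_pi_apply a) (MeasurableSet.of_discrete (s := Set.Ici 1))
  have h2 := indepFun_iff_measure_inter_preimage_eq_mul.1 h1 _ _ hS hS
  have h3 : (countMeasure m).real {N | 1 ≤ N.1 p a ∧ 1 ≤ N.1 q a} =
      (countMeasure m).real {N | 1 ≤ N.1 p a} * (countMeasure m).real {N | 1 ≤ N.1 q a} := by
    simp only [measureReal_def]
    rw [← ENNReal.toReal_mul]
    exact congrArg ENNReal.toReal h2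
  rw [h3, pow_two]
  exact mul_le_mul (countMeasure_one_le_le p a) (countMeasure_one_le_le q a) measureReal_nonneg
    a.coe_nonneg

/-- The event of at least one potential jump before all clocks reach `a`. -/
def activeSet (m : ℕ) (a : ℝ≥0) : Set (CountSpace m) := {N | 1 ≤ ∑ p, N.1 p a}

/-- The event of at least two potential jumps before all clocks reach `a`. -/
def busySet (m : ℕ) (a : ℝ≥0) : Set (CountSpace m) := {N | 2 ≤ ∑ p, N.1 p a}

lemma measurableSet_activeSet (a : ℝ≥0) : MeasurableSet (activeSet m a) :=
  (Finset.measurable_sum Finset.univ fun p _ => measurable_count p a)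
    (MeasurableSet.of_discrete (s := Set.Ici 1))

lemma measurableSet_busySet (a : ℝ≥0) : MeasurableSet (busySet m a) :=
  (Finset.measurable_sum Finset.univ fun p _ => measurable_count p a)
    (MeasurableSet.of_discrete (s := Set.Ici 2))

lemma countMeasure_activeSet_le (a : ℝ≥0) :
    (countMeasure m).real (activeSet m a) ≤ Fintype.card (OffDiag m) * a := by
  have h1 : activeSet m a ⊆ ⋃ p ∈ Finset.univ, {N : CountSpace m | 1 ≤ N.1 p a} := by
    intro N hN
    by_contra h
    simp only [Finset.mem_univ, Set.iUnion_true, Set.mem_iUnion, not_exists,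
      Set.mem_ofPred_eq, not_le, Nat.lt_one_iff] at h
    simp [activeSet, h] at hN
  refine (measureReal_mono h1 (measure_ne_top _ _)).trans ((measureReal_biUnion_finset_le _ _).trans ?_)
  refine (Finset.sum_le_sum fun p _ => countMeasure_one_le_le p a).trans ?_
  simp

/-- Two jumps in total are either two jumps of one process or one jump each of two independent
processes. Each case has probability at most `a ^ 2`, and there are `card ^ 2` ordered pairs. -/
lemma countMeasure_busySet_le (a : ℝ≥0) :
    (countMeasure m).real (busySet m a) ≤ (Fintype.card (OffDiag m) : ℝ) ^ 2 * (a : ℝ) ^ 2 := by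
  classical
  set T : OffDiag m × OffDiag m → Set (CountSpace m) := fun r =>
    if r.1 = r.2 then {N | 2 ≤ N.1 r.1 a} else {N | 1 ≤ N.1 r.1 a ∧ 1 ≤ N.1 r.2 a} with hT
  have hTle : ∀ r, (countMeasure m).real (T r) ≤ (a : ℝ) ^ 2 := by
    intro r
    simp only [hT]
    split_ifs with h
    · exact countMeasure_two_le _ _
    · exact countMeasure_both_le h a
  have h1 : busySet m a ⊆ ⋃ r ∈ Finset.univ, T r := by
    intro N hN
    by_contra h
    simp only [Finset.mem_univ, Set.iUnion_true, Set.mem_iUnion, not_exists] at h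
    have h2 : ∀ p, N.1 p a ≤ 1 := fun p => by
      have := h (p, p)
      simp only [hT, if_true, Set.mem_ofPred_eq] at this
      omega
    have h3 : ∀ p q, p ≠ q → N.1 p a = 0 ∨ N.1 q a = 0 := fun p q hpq => by
      have := h (p, q)
      simp only [hT, if_neg hpq, Set.mem_ofPred_eq] at this
      omega
    have h4 : ∑ p, N.1 p a ≤ 1 := by
      by_cases hex : ∃ p, N.1 p a ≠ 0
      · obtain ⟨p, hp⟩ := hex
        rw [Finset.sum_eq_single p (fun q _ hq => (h3 p q hq.symm).resolve_left hp) (by simp)]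
        exact h2 p
      · push Not at hex
        simp [hex]
    have h5 : 2 ≤ ∑ p, N.1 p a := hN
    omega
  refine (measureReal_mono h1 (measure_ne_top _ _)).trans ((measureReal_biUnion_finset_le _ _).trans ?_)
  refine (Finset.sum_le_sum fun r _ => hTle r).trans (le_of_eq ?_)
  simp [pow_two]

end Tail

/-! ### Short time behaviour and the generator of the driven chain -/

section Window

variable {m : ℕ} {lam : Rates m} {N : Counts m} {z : ℤ}
  {h a : ℝ≥0} {i : Fin (m + 1)} (hl : RatePath lam) (hN : CountPath N)

lemma clampFin_coe (i : Fin (m + 1)) : clampFin m ((i : ℕ) : ℤ) = i := by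
  ext
  simp only [clampFin, Int.toNat_natCast]
  omega

/-- All clocks stay below `a` up to time `h`. -/
def ClkBound (lam : Rates m) (h a : ℝ≥0) : Prop :=
  ∀ p, ∫ r in (0 : ℝ)..h, lam p r.toNNReal ≤ a

lemma sum_count_cases (hs : ∑ p, N p a ≤ 1) :
    (∀ p, N p a = 0) ∨ ∃ p₀, N p₀ a = 1 ∧ ∀ p, p ≠ p₀ → N p a = 0 := by
  classical
  by_cases hex : ∃ p, N p a ≠ 0
  · obtain ⟨p₀, hp₀⟩ := hex
    refine .inr ⟨p₀, ?_, fun p hp => ?_⟩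
    · have := Finset.single_le_sum (f := fun p => N p a) (fun _ _ => Nat.zero_le _)
        (Finset.mem_univ p₀)
      have h1 : N p₀ a ≤ 1 := this.trans hs
      omega
    · have h1 : ∑ q ∈ {p, p₀}, N q a ≤ ∑ q, N q a :=
        Finset.sum_le_sum_of_subset (Finset.subset_univ _)
      rw [Finset.sum_pair hp] at h1
      omega
  · push Not at hex
    exact .inl hex

variable (hb : ClkBound lam h a)

include hl

include hb

lemma ClkBound.clk_le
    {y : ℝ≥0 → Fin (m + 1)} (hy : Measurable y) (p : OffDiag m) {r : ℝ≥0} (hr : r ≤ h) :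
    clk lam y p r ≤ a := by
  refine (clk_mono hl hy p hr).trans ?_
  rw [← NNReal.coe_le_coe]
  have := clk_le_full hl hy p (zero_le : 0 ≤ h)
  rw [clk_zero, NNReal.coe_zero, zero_add] at this
  exact this.trans (hb p)

/-- The value of the rate integral of the transition `p` up to time `h`. -/
noncomputable def fullClk (lam : Rates m) (h : ℝ≥0) (p : OffDiag m) : ℝ≥0 :=
  (∫ r in (0 : ℝ)..h, lam p r.toNNReal).toNNReal

omit hb in
lemma coe_fullClk (p : OffDiag m) : (fullClk lam h p : ℝ) = ∫ r in (0 : ℝ)..h, lam p r.toNNReal :=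
  Real.coe_toNNReal _ (intervalIntegral.integral_nonneg h.coe_nonneg fun _ _ => hl.nonneg _ _)

lemma ClkBound.fullClk_le (p : OffDiag m) : fullClk lam h p ≤ a := by
  rw [← NNReal.coe_le_coe, coe_fullClk hl]
  exact hb p

omit hb

include hN

lemma solZ_restart (t r : ℝ≥0) : solZ lam N z (t + r) = solZ (fun p s => lam p (t + s))
      (shiftN N fun p => clk lam (sol lam N z) p t) (solZ lam N z t) r := by
  have hy := measurable_sol_path (z := z) hl hN
  have h1 : sol (fun p s => lam p (t + s)) (shiftN N fun p => clk lam (sol lam N z) p t)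
      (solZ lam N z t) = fun r => sol lam N z (t + r) := by
    ext1 r
    rw [sol_restart hl hN]
  conv_rhs => rw [solZ, h1]
  conv_lhs => rw [solZ]
  simp only [solZ, posZ, shiftZ, shiftN, clk_shift hl hy]
  rw [add_assoc, ← Finset.sum_add_distrib]
  congr 1
  refine Finset.sum_congr rfl fun p _ => ?_
  rw [← mul_add, Nat.cast_sub (hN.mono p le_self_add)]
  ring

lemma sol_eq_clampFin_solZ (t : ℝ≥0) :
    sol lam N z t = clampFin m (solZ lam N z t) := sol_eq_stepY hl hN t

/-- If no clock driven by the constant path `i` rings, this constant path itself solves the time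
change equation, and uniqueness identifies it with the solution. -/
lemma eq_of_const_solution (hc : ∀ p, p.1.1 = i → N p (clk lam (fun _ => i) p h) = 0) :
    ∀ r ≤ h, sol lam N i r = i := by
  intro r hr
  refine (sol_unique hl hN (y := fun _ => i) measurable_const (T := h) (fun t ht => ?_) r hr).symm
  unfold stepY posZ shiftZ
  rw [Finset.sum_eq_zero, add_zero, clampFin_coe]
  intro p _
  by_cases hp : p.1.1 = i
  · have h1 : N p (clk lam (fun _ => i) p t) = 0 :=
      Nat.le_zero.1 ((hN.mono p (clk_mono hl measurable_const p ht)).trans (hc p hp).le)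
    simp [h1]
  · have h1 : clk lam (fun _ => i) p t = 0 := by
      rw [clk_stop hl measurable_const p (zero_le : 0 ≤ t) fun _ _ _ => Ne.symm hp, clk_zero]
    simp [h1, hN.zero]

include hb

lemma solZ_eq_of_inactive
    (hs : ∀ p, N p a = 0) {r : ℝ≥0} (hr : r ≤ h) : solZ lam N i r = (i : ℕ) := by
  have hy := measurable_sol_path (z := i) hl hN
  unfold solZ posZ shiftZ
  rw [Finset.sum_eq_zero, add_zero]
  intro p _
  have h1 : N p (clk lam (sol lam N i) p r) = 0 :=
    Nat.le_zero.1 ((hN.mono p (hb.clk_le hl hy p hr)).trans (hs p).le)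
  simp [h1]

lemma sol_eq_of_inactive (hs : ∀ p, N p a = 0) {r : ℝ≥0} (hr : r ≤ h) : sol lam N i r = i := by
  rw [sol_eq_clampFin_solZ hl hN, solZ_eq_of_inactive hl hN hb hs hr, clampFin_coe]

/-- With a single potential jump, of type `p₀`, the position only moves along `p₀`. -/
lemma solZ_eq_of_single {p₀ : OffDiag m} (hs : ∀ p, p ≠ p₀ → N p a = 0) {r : ℝ≥0} (hr : r ≤ h) :
    solZ lam N i r = (i : ℕ) + (((p₀.1.2 : ℕ) : ℤ) - ((p₀.1.1 : ℕ) : ℤ)) *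
      (N p₀ (clk lam (sol lam N i) p₀ r) : ℤ) := by
  have hy := measurable_sol_path (z := i) hl hN
  unfold solZ posZ shiftZ
  rw [Finset.sum_eq_single p₀ _ (by simp)]
  intro p _ hp
  have h1 : N p (clk lam (sol lam N i) p r) = 0 :=
    Nat.le_zero.1 ((hN.mono p (hb.clk_le hl hy p hr)).trans (hs p hp).le)
  simp [h1]

lemma sol_eq_of_single_ne {p₀ : OffDiag m} (hs : ∀ p, p ≠ p₀ → N p a = 0) (hp₀ : p₀.1.1 ≠ i) :
    ∀ r ≤ h, sol lam N i r = i :=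
  eq_of_const_solution hl hN fun p hp => Nat.le_zero.1 ((hN.mono p
    (hb.clk_le hl measurable_const p le_rfl)).trans (hs p (by rintro rfl; exact hp₀ hp)).le)

/-- Only one transition `p₀` can ring, and only once. If it starts at `i` it can only lead to its
target; if not, the chain stays at `i` and the clock of `p₀` never runs. Either way the position
remains in `{0, …, m}`. -/
lemma exists_solZ_eq (hs : ∑ p, N p a ≤ 1) {r : ℝ≥0} (hr : r ≤ h) :
    ∃ j : Fin (m + 1), solZ lam N i r = (j : ℕ) := by
  have hy := measurable_sol_path (z := i) hl hN
  rcases sum_count_cases hs with h0 | ⟨p₀, h1, h0⟩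
  · exact ⟨i, solZ_eq_of_inactive hl hN hb h0 hr⟩
  · have hle : N p₀ (clk lam (sol lam N i) p₀ r) ≤ 1 :=
      (hN.mono p₀ (hb.clk_le hl hy p₀ hr)).trans h1.le
    rw [solZ_eq_of_single hl hN hb h0 hr]
    by_cases hp₀ : p₀.1.1 = i
    · rcases Nat.le_one_iff_eq_zero_or_eq_one.1 hle with h2 | h2
      · exact ⟨i, by rw [h2]; simp⟩
      · exact ⟨p₀.1.2, by rw [h2, hp₀]; simp⟩
    · have h2 := sol_eq_of_single_ne hl hN hb h0 hp₀
      refine ⟨i, ?_⟩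
      rw [clk_stop hl hy p₀ (zero_le : 0 ≤ r) fun s _ hs => ?_, clk_zero, hN.zero]
      · simp
      · rw [h2 s (hs.le.trans hr)]
        exact Ne.symm hp₀

/-- With at most one potential jump, the change of a function of the chain is read off from the
counts at the values of the full clocks. -/
lemma sol_sub_eq (hs : ∑ p, N p a ≤ 1) (f : Fin (m + 1) → ℝ) :
    f (sol lam N i h) - f i = ∑ p : OffDiag m, if p.1.1 = i then
      (f p.1.2 - f i) * (if 1 ≤ N p (fullClk lam h p) then 1 else 0) else 0 := by
  have hy := measurable_sol_path (z := i) hl hN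
  have hzero : ∀ p, N p a = 0 → N p (fullClk lam h p) = 0 := fun p hp =>
    Nat.le_zero.1 ((hN.mono p (hb.fullClk_le hl p)).trans hp.le)
  rcases sum_count_cases hs with h0 | ⟨p₀, h1, h0⟩
  · rw [sol_eq_of_inactive hl hN hb h0 le_rfl, sub_self]
    refine (Finset.sum_eq_zero fun p _ => ?_).symm
    simp [hzero p (h0 p)]
  rw [Finset.sum_eq_single p₀ (fun p _ hp => by simp [hzero p (h0 p hp)]) (by simp)]
  by_cases hp₀ : p₀.1.1 = i
  · rw [if_pos hp₀]
    have hZ := fun r (hr : r ≤ h) => solZ_eq_of_single (i := i) hl hN hb h0 hr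
    -- As long as the clock of `p₀` has not rung the chain has stayed in `i`, so the clock has run
    -- at full speed. Hence it rings exactly if the count at the full clock value is positive.
    have hconst : N p₀ (clk lam (sol lam N i) p₀ h) = 0 → (∀ r ≤ h, sol lam N i r = i) ∧
        clk lam (sol lam N i) p₀ h = fullClk lam h p₀ := by
      intro hz
      have hr0 : ∀ r ≤ h, sol lam N i r = i := fun r hr => by
        have h2 : N p₀ (clk lam (sol lam N i) p₀ r) = 0 :=
          Nat.le_zero.1 ((hN.mono p₀ (clk_mono hl hy p₀ hr)).trans hz.le)
        rw [sol_eq_clampFin_solZ hl hN, hZ r hr, h2]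
        simpa using clampFin_coe i
      refine ⟨hr0, ?_⟩
      rw [← NNReal.coe_inj, coe_fullClk hl,
        clk_full hl hy p₀ (zero_le : 0 ≤ h) fun r _ hr => by rw [hr0 r hr.le, hp₀]]
      simp
    by_cases hfull : 1 ≤ N p₀ (fullClk lam h p₀)
    · rw [if_pos hfull, mul_one]
      have h2 : N p₀ (clk lam (sol lam N i) p₀ h) ≠ 0 := fun hz => by
        have := (hconst hz).2
        rw [this] at hz
        omega
      have h3 : N p₀ (clk lam (sol lam N i) p₀ h) ≤ 1 :=
        (hN.mono p₀ (hb.clk_le hl hy p₀ le_rfl)).trans h1.le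
      have h4 : N p₀ (clk lam (sol lam N i) p₀ h) = 1 := by omega
      have h5 : sol lam N i h = p₀.1.2 := by
        rw [sol_eq_clampFin_solZ hl hN, hZ h le_rfl, h4, hp₀]
        simpa using clampFin_coe p₀.1.2
      rw [h5]
    · rw [if_neg hfull, mul_zero]
      have h2 : N p₀ (clk lam (sol lam N i) p₀ h) ≤ N p₀ (fullClk lam h p₀) := by
        refine hN.mono p₀ ?_
        rw [← NNReal.coe_le_coe, coe_fullClk hl]
        have := clk_le_full hl hy p₀ (zero_le : 0 ≤ h)
        simpa using this
      rw [(hconst (by omega)).1 h le_rfl, sub_self]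
  · rw [if_neg hp₀, sol_eq_of_single_ne hl hN hb h0 hp₀ h le_rfl, sub_self]

end Window

/-! ### Almost surely the integer valued position never leaves the state space -/

section NoTies

variable {m : ℕ} {lam : Rates m} (hl : RatePath lam)

include hl

lemma clkBound_shift {T : ℝ≥0} {L : ℝ≥0}
    (hL : ∀ p, ∀ s ≤ T, lam p s ≤ L) {t h : ℝ≥0} (hth : t + h ≤ T) :
    ClkBound (fun p s => lam p (t + s)) h (L * h) := by
  intro p
  have h1 : ∫ r in (0 : ℝ)..h, lam p (t + r.toNNReal) ≤ ∫ r in (0 : ℝ)..h, (L : ℝ) := by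
    refine intervalIntegral.integral_mono_on h.coe_nonneg
      (((hl.shift t).locBdd p).intervalIntegrable _ _) intervalIntegrable_const fun r hr => ?_
    exact hL p _ (le_trans (by gcongr; exact Real.toNNReal_le_iff_le_coe.2 hr.2) hth)
  refine h1.trans (le_of_eq ?_)
  simp [mul_comm]

lemma RatePath.exists_bound (T : ℝ≥0) : ∃ L : ℝ≥0, ∀ p, ∀ s ≤ T, lam p s ≤ L := by
  choose C hC using fun p => (hl.locBdd p).bdd T
  refine ⟨∑ p, (C p).toNNReal, fun p s hs => ?_⟩
  refine (le_abs_self _).trans ((hC p s hs).trans ((Real.le_coe_toNNReal _).trans ?_))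
  exact_mod_cast Finset.single_le_sum (f := fun p => (C p).toNNReal) (fun _ _ => zero_le)
    (Finset.mem_univ p)

/-- Cut `[0, T]` into `n + 1` windows. By the strong Markov property each is busy with probability
`O(n⁻²)`, so some window is busy with probability `O(n⁻¹)`. Otherwise `exists_solZ_eq` carries the
position from one grid point to the next. Consequently the truncation `clampFin` in the construction
is almost surely inactive. -/
lemma ae_solZ_mem (k : Fin (m + 1)) :
    ∀ᵐ N ∂(countMeasure m), ∀ t, ∃ j : Fin (m + 1), solZ lam N.1 k t = (j : ℕ) := by
  suffices H : ∀ T : ℕ, ∀ᵐ N ∂(countMeasure m), ∀ t ≤ (T : ℝ≥0), ∃ j : Fin (m + 1),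
      solZ lam N.1 k t = (j : ℕ) by
    filter_upwards [ae_all_iff.2 H] with N hN t
    obtain ⟨T, hT⟩ := exists_nat_ge t
    exact hN T t hT
  intro T
  obtain ⟨L, hL⟩ := hl.exists_bound T
  set B := {N : CountSpace m | ¬ ∀ t ≤ (T : ℝ≥0), ∃ j : Fin (m + 1),
    solZ lam N.1 k t = (j : ℕ)} with hB
  set d : ℝ := (Fintype.card (OffDiag m) : ℝ) with hd
  have key : ∀ n : ℕ, (countMeasure m).real B ≤ d ^ 2 * (L * T) ^ 2 / (n + 1) := by
    intro n
    set h : ℝ≥0 := (T : ℝ≥0) / (n + 1) with hh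
    have hnh : ((n + 1 : ℕ) : ℝ≥0) * h = T := by
      rw [hh]; push_cast; field_simp
    set bad : ℕ → Set (CountSpace m) := fun l =>
      (fun N => shiftCount (solClk lam k (l * h) N) N) ⁻¹' busySet m (L * h) with hbad
    have hsub : B ⊆ ⋃ l ∈ Finset.range (n + 1), bad l := by
      intro N hN
      by_contra hgood
      simp only [Finset.mem_range, Set.mem_iUnion, not_exists] at hgood
      refine hN ?_
      have hwin : ∀ l < n + 1, (∃ i : Fin (m + 1), solZ lam N.1 k (l * h) = (i : ℕ)) →
          ∀ r ≤ h, ∃ j : Fin (m + 1), solZ lam N.1 k (l * h + r) = (j : ℕ) := by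
        rintro l hln ⟨i, hi⟩ r hr
        rw [solZ_restart hl N.2, hi]
        refine exists_solZ_eq (hl.shift _) (N.2.shiftN _) (clkBound_shift hl hL ?_) ?_ hr
        · rw [← hnh, ← add_one_mul]
          gcongr
          exact_mod_cast hln
        · have := hgood l hln
          simp only [hbad, busySet, Set.mem_preimage, Set.mem_ofPred_eq, not_le] at this
          exact Nat.lt_succ_iff.1 this
      have hgrid : ∀ l ≤ n + 1, ∃ i : Fin (m + 1), solZ lam N.1 k (l * h) = (i : ℕ) := by
        intro l
        induction l with
        | zero => intro _; exact ⟨k, by simp [solZ, posZ, shiftZ, N.2.zero]⟩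
        | succ l ih =>
          intro hl'
          have := hwin l (by omega) (ih (by omega)) h le_rfl
          rwa [← add_one_mul, ← Nat.cast_add_one] at this
      intro t ht
      by_cases hh0 : h = 0
      · have hT0 : (T : ℝ≥0) = 0 := by rw [← hnh, hh0, mul_zero]
        have ht0 : t = 0 := by rw [hT0] at ht; exact nonpos_iff_eq_zero.1 ht
        rw [ht0]
        simpa using hgrid 0 (by omega)
      have hhpos : 0 < h := pos_iff_ne_zero.2 hh0
      -- The minimum assigns the right end point `t = T` to the last window, the one with index `n`.
      set l := min ⌊t / h⌋₊ n with hl'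
      have h1 : (l : ℝ≥0) * h ≤ t := by
        have : (l : ℝ≥0) ≤ t / h :=
          (Nat.cast_le.2 (min_le_left _ _)).trans (Nat.floor_le zero_le)
        rwa [le_div_iff₀ hhpos] at this
      have h2 : t ≤ l * h + h := by
        rcases le_total ⌊t / h⌋₊ n with h3 | h3
        · rw [hl', min_eq_left h3, ← add_one_mul]
          have := (Nat.lt_floor_add_one (t / h)).le
          rwa [div_le_iff₀ hhpos] at this
        · rw [hl', min_eq_right h3, ← add_one_mul, ← Nat.cast_add_one, hnh]
          exact ht
      have hln : l < n + 1 := Nat.lt_succ_of_le (min_le_right _ _)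
      have := hwin l hln (hgrid l hln.le) (t - l * h) (tsub_le_iff_left.2 h2)
      rwa [add_tsub_cancel_of_le h1] at this
    refine (measureReal_mono hsub (measure_ne_top _ _)).trans
      ((measureReal_biUnion_finset_le _ _).trans ?_)
    have hbl : ∀ l ∈ Finset.range (n + 1), (countMeasure m).real (bad l) ≤
        d ^ 2 * (L * h : ℝ≥0) ^ 2 := by
      intro l _
      have h1 := map_shift_solClk (z := k) hl (Determined.univ (lam := lam) (z := k) (l * h))
      rw [Measure.restrict_univ, measure_univ, one_smul] at h1
      have h2 : (countMeasure m).real (bad l) = (countMeasure m).real (busySet m (L * h)) := by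
        rw [hbad, ← map_measureReal_apply (measurable_shift_solClk hl _) (measurableSet_busySet _),
          h1]
      rw [h2]
      exact countMeasure_busySet_le _
    refine (Finset.sum_le_sum hbl).trans (le_of_eq ?_)
    rw [Finset.sum_const, Finset.card_range, nsmul_eq_mul, hh]
    push_cast
    field_simp
  have hlim : Tendsto (fun n : ℕ => d ^ 2 * (L * T) ^ 2 / ((n : ℝ) + 1)) atTop (𝓝 0) :=
    tendsto_const_nhds.div_atTop (tendsto_natCast_atTop_atTop.atTop_add tendsto_const_nhds)
  have h0 : (countMeasure m).real B = 0 :=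
    le_antisymm (ge_of_tendsto hlim (.of_forall key)) measureReal_nonneg
  rw [measureReal_eq_zero_iff] at h0
  exact h0

lemma ae_solZ_eq_sol (k : Fin (m + 1)) :
    ∀ᵐ N ∂(countMeasure m), ∀ t, solZ lam N.1 k t = ((sol lam N.1 k t : ℕ) : ℤ) := by
  filter_upwards [ae_solZ_mem hl k] with N hN t
  obtain ⟨j, hj⟩ := hN t
  rw [sol_eq_clampFin_solZ hl N.2, hj, clampFin_coe]

end NoTies

/-! ### The compensated chain is a martingale -/

section Generator

/-- A function whose increments are bounded by the square of the step is constant. -/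
lemma eq_of_sq_bound {φ : ℝ≥0 → ℝ} {s t : ℝ≥0} (hst : s ≤ t) {C : ℝ}
    (h : ∀ u r, s ≤ u → u + r ≤ t → |φ (u + r) - φ u| ≤ C * (r : ℝ) ^ 2) : φ s = φ t := by
  have key : ∀ n : ℕ, |φ t - φ s| ≤ C * ((t - s : ℝ≥0) : ℝ) ^ 2 / (n + 1) := by
    intro n
    set r : ℝ≥0 := (t - s) / (n + 1) with hr
    have hnr : ((n + 1 : ℕ) : ℝ≥0) * r = t - s := by rw [hr]; push_cast; field_simp
    have hstep : ∀ l ≤ n + 1, |φ (s + l * r) - φ s| ≤ l * (C * (r : ℝ) ^ 2) := by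
      intro l
      induction l with
      | zero => simp
      | succ l ih =>
        intro hl
        have h1 := h (s + l * r) r le_self_add (by
          rw [add_assoc, ← add_one_mul, ← Nat.cast_add_one]
          calc s + ((l + 1 : ℕ) : ℝ≥0) * r ≤ s + ((n + 1 : ℕ) : ℝ≥0) * r := by gcongr
            _ = t := by rw [hnr, add_tsub_cancel_of_le hst])
        have h2 := ih (by omega)
        rw [add_assoc, ← add_one_mul, ← Nat.cast_add_one] at h1
        have h3 := abs_sub_le (φ (s + ((l + 1 : ℕ) : ℝ≥0) * r)) (φ (s + l * r)) (φ s)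
        push_cast at *
        linarith
    have h4 := hstep (n + 1) le_rfl
    rw [hnr, add_tsub_cancel_of_le hst] at h4
    refine h4.trans (le_of_eq ?_)
    rw [hr]
    push_cast
    field_simp
  have hlim : Tendsto (fun n : ℕ => C * ((t - s : ℝ≥0) : ℝ) ^ 2 / ((n : ℝ) + 1)) atTop (𝓝 0) :=
    tendsto_const_nhds.div_atTop (tendsto_natCast_atTop_atTop.atTop_add tendsto_const_nhds)
  have h0 : |φ t - φ s| ≤ 0 := ge_of_tendsto hlim (.of_forall key)
  have := abs_nonpos_iff.1 h0
  linarith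

lemma abs_integral_le_of_indicator {Ω : Type*} [MeasurableSpace Ω] {μ : Measure Ω}
    [IsFiniteMeasure μ] {g : Ω → ℝ} {S : Set Ω} (hS : MeasurableSet S) {c : ℝ}
    (h : ∀ x, |g x| ≤ S.indicator (fun _ => c) x) : |∫ x, g x ∂μ| ≤ c * μ.real S := by
  have h1 := norm_integral_le_of_norm_le (μ := μ) (f := g)
    ((integrable_const c).indicator hS) (.of_forall h)
  rw [integral_indicator_const c hS] at h1
  simpa [mul_comm] using h1

lemma integrable_of_abs_le {Ω : Type*} [MeasurableSpace Ω] {μ : Measure Ω}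
    [IsFiniteMeasure μ] {g : Ω → ℝ} (hg : Measurable g) {c : ℝ} (h : ∀ x, |g x| ≤ c) :
    Integrable g μ :=
  Integrable.of_bound hg.aestronglyMeasurable c (.of_forall h)

variable {m : ℕ} {lam : Rates m} (hl : RatePath lam)

/-- The generator of the chain with rates `lam p r` at time `r`, applied to `f` at `y r`. -/
noncomputable def genRate (lam : Rates m) (f : Fin (m + 1) → ℝ)
    (y : ℝ≥0 → Fin (m + 1)) (r : ℝ≥0) : ℝ :=
  ∑ p : OffDiag m, (if y r = p.1.1 then lam p r else 0) * (f p.1.2 - f p.1.1)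

/-- The process `f(Y)` minus its compensator. -/
noncomputable def compens (lam : Rates m) (f : Fin (m + 1) → ℝ)
    (y : ℝ≥0 → Fin (m + 1)) (t : ℝ≥0) : ℝ :=
  f (y t) - ∫ r in (0 : ℝ)..t, genRate lam f y r.toNNReal

lemma measurable_genRate {Θ : Type*} [MeasurableSpace Θ] {lam : Θ → Rates m}
    {y : Θ → ℝ≥0 → Fin (m + 1)} (hlm : ∀ p, Measurable fun q : ℝ≥0 × Θ => lam q.2 p q.1)
    (hym : Measurable fun q : ℝ≥0 × Θ => y q.2 q.1) (f : Fin (m + 1) → ℝ) :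
    Measurable fun q : ℝ≥0 × Θ => genRate (lam q.2) f (y q.2) q.1 := by
  unfold genRate
  refine Finset.measurable_sum _ fun p _ => Measurable.mul_const ?_ _
  exact Measurable.ite (hym (measurableSet_singleton _)) (hlm p) measurable_const

lemma measurable_compens {Θ : Type*} [MeasurableSpace Θ] {lam : Θ → Rates m}
    {y : Θ → ℝ≥0 → Fin (m + 1)} (hlm : ∀ p, Measurable fun q : ℝ≥0 × Θ => lam q.2 p q.1)
    (hym : Measurable fun q : ℝ≥0 × Θ => y q.2 q.1) (f : Fin (m + 1) → ℝ) (t : ℝ≥0) :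
    Measurable fun θ => compens (lam θ) f (y θ) t := by
  refine Measurable.sub ?_ (measurable_integral_path
    (x := fun r θ => genRate (lam θ) f (y θ) r) (measurable_genRate hlm hym f) 0 t)
  exact (measurable_of_countable f).comp (hym.comp (measurable_const.prodMk measurable_id))

include hl

lemma locBdd_genRate (f : Fin (m + 1) → ℝ) {y : ℝ≥0 → Fin (m + 1)}
    (hy : Measurable y) : LocBdd (genRate lam f y) := by
  unfold genRate
  refine LocBdd.sum fun p _ => (hl.locBdd_ite hy p).mul ?_
  exact LocBdd.of_bound (x := fun _ => f p.1.2 - f p.1.1) measurable_const fun _ => le_rfl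

lemma abs_genRate_le {f : Fin (m + 1) → ℝ} {F : ℝ} (hF : ∀ j, |f j| ≤ F)
    {L : ℝ≥0} {r : ℝ≥0} (hL : ∀ p, lam p r ≤ L) (y : ℝ≥0 → Fin (m + 1)) :
    |genRate lam f y r| ≤ Fintype.card (OffDiag m) * (L * (2 * F)) := by
  refine (Finset.abs_sum_le_sum_abs _ _).trans ?_
  have h1 : ∀ p ∈ (Finset.univ : Finset (OffDiag m)),
      |(if y r = p.1.1 then lam p r else 0) * (f p.1.2 - f p.1.1)| ≤ L * (2 * F) := by
    intro p _
    rw [abs_mul]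
    have h2 : |f p.1.2 - f p.1.1| ≤ 2 * F := by
      have := abs_sub (f p.1.2) (f p.1.1)
      linarith [hF p.1.2, hF p.1.1]
    refine mul_le_mul ?_ h2 (abs_nonneg _) L.coe_nonneg
    rw [abs_of_nonneg (hl.ite_nonneg p r)]
    split_ifs
    · exact hL p
    · exact L.coe_nonneg
  refine (Finset.sum_le_sum h1).trans (le_of_eq ?_)
  simp

lemma abs_integral_genRate_le {f : Fin (m + 1) → ℝ} {F : ℝ}
    (hF : ∀ j, |f j| ≤ F) {L : ℝ≥0} {h : ℝ≥0} (hL : ∀ p, ∀ s ≤ h, lam p s ≤ L)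
    (y : ℝ≥0 → Fin (m + 1)) : |∫ r in (0 : ℝ)..h, genRate lam f y r.toNNReal| ≤
      Fintype.card (OffDiag m) * (L * (2 * F)) * h := by
  have := intervalIntegral.norm_integral_le_of_norm_le_const (a := (0 : ℝ)) (b := h)
    (f := fun r => genRate lam f y r.toNNReal)
    (C := Fintype.card (OffDiag m) * (L * (2 * F))) fun r hr => ?_
  · simpa using this
  · rw [Set.uIoc_of_le h.coe_nonneg] at hr
    exact abs_genRate_le hl hF (fun p => hL p _ (Real.toNNReal_le_iff_le_coe.2 hr.2)) y

lemma measurable_compens_count (z : ℤ) (f : Fin (m + 1) → ℝ) (t : ℝ≥0) :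
    Measurable fun N : CountSpace m => compens lam f (sol lam N.1 z) t :=
  measurable_compens (lam := fun _ => lam) (y := fun (N : CountSpace m) t => sol lam N.1 z t)
    (fun p => (hl.locBdd p).measurable.comp measurable_fst) (measurable_sol_count_uncurry hl) f t

lemma abs_compens_le {f : Fin (m + 1) → ℝ} {F : ℝ}
    (hF : ∀ j, |f j| ≤ F) {L : ℝ≥0} {h : ℝ≥0} (hL : ∀ p, ∀ s ≤ h, lam p s ≤ L)
    (y : ℝ≥0 → Fin (m + 1)) : |compens lam f y h| ≤
      F + Fintype.card (OffDiag m) * (L * (2 * F)) * h :=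
  (abs_sub _ _).trans (add_le_add (hF _) (abs_integral_genRate_le hl hF hL y))

/-- The expected error of the first order expansion over a time step `h` is of second order. -/
lemma abs_integral_step_le {f : Fin (m + 1) → ℝ} {F : ℝ}
    (hF : ∀ j, |f j| ≤ F) {L h : ℝ≥0} (hL : ∀ p, ∀ s ≤ h, lam p s ≤ L) (i : Fin (m + 1)) :
    |∫ N, (compens lam f (sol lam N.1 i) h - f i) ∂(countMeasure m)| ≤
      (2 * F * (Fintype.card (OffDiag m) + 3) ^ 3) * (L * h) ^ 2 := by
  set d : ℝ := (Fintype.card (OffDiag m) : ℝ) with hd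
  have hd0 : 0 ≤ d := Nat.cast_nonneg _
  have hF0 : 0 ≤ F := (abs_nonneg _).trans (hF i)
  set a : ℝ≥0 := L * h with ha
  have hb : ClkBound lam h a := by
    have := clkBound_shift hl hL (t := 0) (h := h) (by simp)
    simpa using this
  have hdiff : ∀ j, |f j - f i| ≤ 2 * F := fun j => by
    have := abs_sub (f j) (f i)
    linarith [hF j, hF i]
  -- `R` is the change of `f` predicted by the potential jumps out of `i` at the full clock values,
  -- `c` its mean to first order, and `I` the compensator. The prediction is exact off `busySet`,
  -- and `I = c` off `activeSet`, where the chain does not move.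
  set R : CountSpace m → ℝ := fun N => ∑ p : OffDiag m, if p.1.1 = i then
      (f p.1.2 - f i) * (if 1 ≤ N.1 p (fullClk lam h p) then 1 else 0) else 0 with hR
  set c : ℝ := ∑ p : OffDiag m, if p.1.1 = i then (f p.1.2 - f i) * (fullClk lam h p : ℝ) else 0
    with hc
  set I : CountSpace m → ℝ := fun N =>
    ∫ r in (0 : ℝ)..h, genRate lam f (sol lam N.1 i) r.toNNReal with hI
  have hRle : ∀ N, |R N| ≤ d * (2 * F) := by
    intro N
    refine (Finset.abs_sum_le_sum_abs _ _).trans ((Finset.sum_le_sum fun p _ => ?_).trans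
      (le_of_eq (by simp [hd] : ∑ _p : OffDiag m, 2 * F = d * (2 * F))))
    split_ifs
    · simpa using hdiff _
    · simpa using hF0
    · simpa using hF0
  have hcle : |c| ≤ d * (2 * F * a) := by
    refine (Finset.abs_sum_le_sum_abs _ _).trans ((Finset.sum_le_sum fun p _ => ?_).trans
      (le_of_eq (by simp [hd] : ∑ _p : OffDiag m, 2 * F * (a : ℝ) = d * (2 * F * a))))
    split_ifs
    · rw [abs_mul, abs_of_nonneg (fullClk lam h p).coe_nonneg]
      exact mul_le_mul (hdiff _) (by exact_mod_cast hb.fullClk_le hl p) (NNReal.coe_nonneg _)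
        (by positivity)
    · simpa using by positivity
  have hIle : ∀ N, |I N| ≤ d * (2 * F * a) := fun N => by
    have := abs_integral_genRate_le hl hF hL (sol lam N.1 i)
    refine this.trans (le_of_eq ?_)
    rw [ha]; push_cast; ring
  have hSm : ∀ p : OffDiag m, MeasurableSet {N : CountSpace m | 1 ≤ N.1 p (fullClk lam h p)} :=
    fun p => (measurable_count p _) (MeasurableSet.of_discrete (s := Set.Ici 1))
  have hRm : Measurable R := by
    refine Finset.measurable_sum _ fun p _ => ?_
    split_ifs
    · exact (Measurable.ite (hSm p) measurable_const measurable_const).const_mul _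
    · exact measurable_const
  have hIm : Measurable I := measurable_integral_path
    (x := fun r (N : CountSpace m) => genRate lam f (sol lam N.1 i) r)
    (measurable_genRate (lam := fun _ => lam) (y := fun (N : CountSpace m) t => sol lam N.1 i t)
      (fun p => (hl.locBdd p).measurable.comp measurable_fst) (measurable_sol_count_uncurry hl) f)
      0 h
  have hfm : Measurable fun N : CountSpace m => f (sol lam N.1 i h) :=
    (measurable_of_countable f).comp (measurable_sol_count hl h)
  -- the three errors
  have e1 : |∫ N, (f (sol lam N.1 i h) - f i - R N) ∂(countMeasure m)| ≤
      (2 * F + d * (2 * F)) * (countMeasure m).real (busySet m a) := by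
    refine abs_integral_le_of_indicator (measurableSet_busySet a) fun N => ?_
    by_cases hN : N ∈ busySet m a
    · rw [Set.indicator_of_mem hN]
      exact (abs_sub _ _).trans (add_le_add (hdiff _) (hRle N))
    · rw [Set.indicator_of_notMem hN, sol_sub_eq hl N.2 hb ?_ f]
      · simp [hR]
      · simp only [busySet, Set.mem_ofPred_eq, not_le] at hN
        omega
  have e2 : |∫ N, (I N - c) ∂(countMeasure m)| ≤
      (d * (2 * F * a) + d * (2 * F * a)) * (countMeasure m).real (activeSet m a) := by
    refine abs_integral_le_of_indicator (measurableSet_activeSet a) fun N => ?_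
    by_cases hN : N ∈ activeSet m a
    · rw [Set.indicator_of_mem hN]
      exact (abs_sub _ _).trans (add_le_add (hIle N) hcle)
    · rw [Set.indicator_of_notMem hN]
      have hz : ∀ p, N.1 p a = 0 := by
        simp only [activeSet, Set.mem_ofPred_eq, not_le, Nat.lt_one_iff,
          Finset.sum_eq_zero_iff, Finset.mem_univ, true_imp_iff] at hN
        exact hN
      have h1 : I N = ∫ r in (0 : ℝ)..h, genRate lam f (fun _ => i) r.toNNReal := by
        refine intervalIntegral.integral_congr fun r hr => ?_
        rw [Set.uIcc_of_le h.coe_nonneg] at hr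
        simp only [genRate, sol_eq_of_inactive hl N.2 hb hz (Real.toNNReal_le_iff_le_coe.2 hr.2)]
      have h2 : ∫ r in (0 : ℝ)..h, genRate lam f (fun _ => i) r.toNNReal = c := by
        unfold genRate
        rw [intervalIntegral.integral_finsetSum]
        · rw [hc]
          refine Finset.sum_congr rfl fun p _ => ?_
          rw [intervalIntegral.integral_mul_const]
          by_cases hp : p.1.1 = i
          · simp only [hp, if_true, coe_fullClk hl, mul_comm]
          · rw [if_neg hp]
            simp [Ne.symm hp]
        · intro p _
          exact ((hl.locBdd_ite (y := fun _ => i) measurable_const p).intervalIntegrable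
            _ _).mul_const _
      rw [h1, h2, sub_self, abs_zero]
  have e3 : |∫ N, (R N - c) ∂(countMeasure m)| ≤ d * (2 * F * (a : ℝ) ^ 2) := by
    have h1 : ∫ N, R N ∂(countMeasure m) = ∑ p : OffDiag m, if p.1.1 = i then
        (f p.1.2 - f i) * (countMeasure m).real {N | 1 ≤ N.1 p (fullClk lam h p)} else 0 := by
      have hint : ∀ p : OffDiag m, (∫ N : CountSpace m, (if 1 ≤ N.1 p (fullClk lam h p) then
          (1 : ℝ) else 0) ∂(countMeasure m)) =
          (countMeasure m).real {N | 1 ≤ N.1 p (fullClk lam h p)} := by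
        intro p
        rw [← integral_indicator_one (hSm p)]
        congr 1
        ext N
        simp [Set.indicator]
      rw [hR, integral_finsetSum]
      · refine Finset.sum_congr rfl fun p _ => ?_
        split_ifs
        · rw [integral_const_mul, hint]
        · simp
      · intro p _
        split_ifs
        · refine integrable_of_abs_le (c := 2 * F) ?_ fun N => ?_
          · exact (Measurable.ite (hSm p) measurable_const measurable_const).const_mul _
          · split_ifs
            · simpa using hdiff _
            · simpa using hF0
        · exact integrable_const _
    rw [integral_sub (integrable_of_abs_le hRm hRle) (integrable_const _), h1,
      integral_const, probReal_univ, one_smul, hc, ← Finset.sum_sub_distrib]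
    refine (Finset.abs_sum_le_sum_abs _ _).trans ((Finset.sum_le_sum fun p _ => ?_).trans
      (le_of_eq (by simp [hd] : ∑ _p : OffDiag m, 2 * F * (a : ℝ) ^ 2 = d * (2 * F * (a:ℝ) ^ 2))))
    split_ifs
    · rw [← mul_sub, abs_mul]
      refine mul_le_mul (hdiff _) ((abs_countMeasure_one_le_sub p _).trans ?_) (abs_nonneg _)
        (by positivity)
      have : (fullClk lam h p : ℝ) ≤ a := by exact_mod_cast hb.fullClk_le hl p
      gcongr
    · simpa using by positivity
  have hsplit : ∫ N, (compens lam f (sol lam N.1 i) h - f i) ∂(countMeasure m) =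
      ∫ N, (f (sol lam N.1 i h) - f i - R N) ∂(countMeasure m) +
        ∫ N, (R N - c) ∂(countMeasure m) - ∫ N, (I N - c) ∂(countMeasure m) := by
    rw [← integral_add, ← integral_sub]
    · congr 1
      ext N
      simp only [compens, hI]
      ring
    · refine integrable_of_abs_le (c := 2 * F + d * (2 * F) + (d * (2 * F) + d * (2 * F * a)))
        (((hfm.sub_const _).sub hRm).add (hRm.sub_const _)) fun N => ?_
      refine (abs_add_le _ _).trans (add_le_add ((abs_sub _ _).trans (add_le_add (hdiff _)
        (hRle N))) ((abs_sub _ _).trans (add_le_add (hRle N) hcle)))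
    · exact integrable_of_abs_le (hIm.sub_const _) fun N =>
        (abs_sub _ _).trans (add_le_add (hIle N) hcle)
    · exact integrable_of_abs_le ((hfm.sub_const _).sub hRm) fun N =>
        (abs_sub _ _).trans (add_le_add (hdiff _) (hRle N))
    · exact integrable_of_abs_le (hRm.sub_const _) fun N =>
        (abs_sub _ _).trans (add_le_add (hRle N) hcle)
  have hB := countMeasure_busySet_le (m := m) a
  have hA := countMeasure_activeSet_le (m := m) a
  rw [← hd] at hB hA
  have e1' := e1.trans (mul_le_mul_of_nonneg_left hB (by positivity))
  have e2' := e2.trans (mul_le_mul_of_nonneg_left hA (by positivity))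
  rw [hsplit]
  refine (abs_sub _ _).trans ((add_le_add ((abs_add_le _ _).trans (add_le_add e1' e3)) e2').trans ?_)
  have hLh : ((L : ℝ) * h) = a := by rw [ha]; push_cast; rfl
  rw [hLh]
  have ha0 : (0 : ℝ) ≤ (a : ℝ) ^ 2 := by positivity
  -- The three errors add up to `2F(d³ + 3d² + d)a²`; the cube of `d + 3` is a convenient majorant.
  have : 2 * F * (d + 3) ^ 3 * (a : ℝ) ^ 2 - ((2 * F + d * (2 * F)) * (d ^ 2 * (a : ℝ) ^ 2) +
      d * (2 * F * (a : ℝ) ^ 2) + (d * (2 * F * a) + d * (2 * F * a)) * (d * a)) =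
      2 * F * (a : ℝ) ^ 2 * (6 * d ^ 2 + 26 * d + 27) := by ring
  have : 0 ≤ 2 * F * (a : ℝ) ^ 2 * (6 * d ^ 2 + 26 * d + 27) := by positivity
  linarith

lemma compens_restart {N : Counts m} (hN : CountPath N) (z : ℤ) (f : Fin (m + 1) → ℝ) (t r : ℝ≥0) :
    compens lam f (sol lam N z) (t + r) - compens lam f (sol lam N z) t =
      compens (fun p s => lam p (t + s)) f (sol (fun p s => lam p (t + s))
        (shiftN N fun p => clk lam (sol lam N z) p t) (solZ lam N z t)) r - f (sol lam N z t) := by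
  have hy := measurable_sol_path (z := z) hl hN
  have h1 : sol (fun p s => lam p (t + s)) (shiftN N fun p => clk lam (sol lam N z) p t)
      (solZ lam N z t) = fun r => sol lam N z (t + r) := by
    ext1 r
    rw [sol_restart hl hN]
  have hlb := locBdd_genRate hl f hy
  have h2 : ∫ s in (0 : ℝ)..r, genRate (fun p s => lam p (t + s)) f
      (fun r => sol lam N z (t + r)) s.toNNReal =
      ∫ s in (t : ℝ)..(t + r : ℝ≥0), genRate lam f (sol lam N z) s.toNNReal := by
    have h3 := intervalIntegral.integral_comp_add_left (a := 0) (b := r)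
      (fun s : ℝ => genRate lam f (sol lam N z) s.toNNReal) (t : ℝ)
    rw [add_zero] at h3
    rw [NNReal.coe_add, ← h3]
    refine intervalIntegral.integral_congr fun s hs => ?_
    rw [Set.uIcc_of_le r.coe_nonneg] at hs
    simp only [genRate, Real.toNNReal_add t.coe_nonneg hs.1, Real.toNNReal_coe]
  rw [h1]
  unfold compens
  rw [h2, ← intervalIntegral.integral_add_adjacent_intervals
    (hlb.intervalIntegrable 0 t) (hlb.intervalIntegrable t (t + r : ℝ≥0))]
  ring

/-- The compensated process is a martingale with respect to the filtration of the events
determined by the counting paths up to the values of the clocks. -/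
theorem setIntegral_compens_eq (k : Fin (m + 1)) (f : Fin (m + 1) → ℝ)
    {s t : ℝ≥0} (hst : s ≤ t) {A : Set (CountSpace m)} (hA : Determined lam k s A) :
    ∫ N in A, compens lam f (sol lam N.1 k) s ∂(countMeasure m) =
      ∫ N in A, compens lam f (sol lam N.1 k) t ∂(countMeasure m) := by
  obtain ⟨L, hL⟩ := hl.exists_bound t
  obtain ⟨F, hF⟩ : ∃ F, ∀ j, |f j| ≤ F := by
    refine ⟨∑ j, |f j|, fun j => ?_⟩
    exact Finset.single_le_sum (f := fun j => |f j|) (fun _ _ => abs_nonneg _) (Finset.mem_univ j)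
  set c : ℝ := 2 * F * (Fintype.card (OffDiag m) + 3) ^ 3 with hc
  have hF0 : 0 ≤ F := (abs_nonneg _).trans (hF k)
  have hint : ∀ u ≤ t, ∀ μ : Measure (CountSpace m), IsFiniteMeasure μ →
      Integrable (fun N : CountSpace m => compens lam f (sol lam N.1 k) u) μ := fun u hu μ _ =>
    integrable_of_abs_le (measurable_compens_count hl k f u) fun N =>
      abs_compens_le hl hF (fun p s hs => hL p s (hs.trans hu)) _
  -- It suffices that the increments over a step `r` are of order `r²`. On each of the `m + 1`
  -- events fixing the state at time `u`, the chain restarts with fresh counting paths and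
  -- `abs_integral_step_le` applies.
  refine eq_of_sq_bound (φ := fun u => ∫ N in A, compens lam f (sol lam N.1 k) u ∂(countMeasure m))
    hst (C := ((m : ℝ) + 1) * (c * (L : ℝ) ^ 2)) fun u r hu hr => ?_
  have hlu := hl.shift u
  set g : Fin (m + 1) → CountSpace m → ℝ := fun i N =>
    compens (fun p s => lam p (u + s)) f (sol (fun p s => lam p (u + s)) N.1 i) r - f i with hg
  have hgm : ∀ i, Measurable (g i) := fun i => (measurable_compens_count hlu i f r).sub_const _
  have hgle : ∀ i, |∫ N, g i N ∂(countMeasure m)| ≤ c * (L * r) ^ 2 := fun i =>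
    abs_integral_step_le hlu hF (fun p s hs => hL p _ (le_trans (by gcongr) hr)) i
  set S : Fin (m + 1) → Set (CountSpace m) := fun i => A ∩ {N | sol lam N.1 k u = i} with hS
  have hSd : ∀ i, Determined lam k u (S i) := fun i =>
    (hA.mono hl hu).inter (determined_sol_eq hl u i)
  have hAS : A = ⋃ i, S i := by
    ext N
    simp [hS]
  have hSdisj : Pairwise (Function.onFun Disjoint S) := fun i j hij =>
    Set.disjoint_left.2 fun N h1 h2 => hij (h1.2.symm.trans h2.2)
  have h1 : ∀ i, ∫ N in S i, (compens lam f (sol lam N.1 k) (u + r) -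
      compens lam f (sol lam N.1 k) u) ∂(countMeasure m) =
        (countMeasure m).real (S i) * ∫ N, g i N ∂(countMeasure m) := by
    intro i
    rw [← setIntegral_shift_solClk hl (hSd i) (hgm i)]
    refine setIntegral_congr_ae (hSd i).1 ?_
    filter_upwards [ae_solZ_eq_sol hl k] with N hN hNS
    rw [compens_restart hl N.2, hN u]
    have hi : sol lam N.1 k u = i := hNS.2
    simp only [hi, hg]
    rfl
  rw [← integral_sub (hint _ hr _ inferInstance) (hint _ (le_self_add.trans hr) _ inferInstance)]
  conv_lhs => rw [hAS]
  have hsub : ∀ i, IntegrableOn (fun N : CountSpace m => compens lam f (sol lam N.1 k) (u + r) -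
      compens lam f (sol lam N.1 k) u) (S i) (countMeasure m) := fun i =>
    (hint _ hr _ inferInstance).sub (hint _ (le_self_add.trans hr) _ inferInstance)
  rw [integral_iUnion_fintype (fun i => (hSd i).1) hSdisj hsub]
  refine (Finset.abs_sum_le_sum_abs _ _).trans ((Finset.sum_le_sum fun i _ => ?_).trans
    (le_of_eq (?_ : ∑ _i : Fin (m + 1), c * (L * (r : ℝ)) ^ 2 = _)))
  · rw [h1 i, abs_mul, abs_of_nonneg measureReal_nonneg]
    exact (mul_le_of_le_one_left (abs_nonneg _) measureReal_le_one).trans (hgle i)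
  · simp
    ring

end Generator

/-! ### Hitting times of additive functionals -/

section Hit

/-- The first time at which the nondecreasing function `C` reaches the level `n`. -/
noncomputable def hit (C : ℝ≥0 → ℝ) (n : ℕ) : WithTop ℝ≥0 :=
  open Classical in
  if ∃ t, (n : ℝ) ≤ C t then ((sInf {t | (n : ℝ) ≤ C t} : ℝ≥0) : WithTop ℝ≥0) else ⊤

/-- The time `t`, stopped at the hitting time of the level `n`, but not before time `s`. -/
noncomputable def capT (C : ℝ≥0 → ℝ) (n : ℕ) (s t : ℝ≥0) : ℝ≥0 :=
  max s (min (t : WithTop ℝ≥0) (hit C n)).untopA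

variable {C : ℝ≥0 → ℝ} {n : ℕ} {s t : ℝ≥0}

/-- Continuity makes the set of times at or above the level closed, so that its infimum is attained;
monotonicity does the rest. -/
lemma hit_le_iff (hc : Continuous C) (hm : Monotone C) : hit C n ≤ t ↔ (n : ℝ) ≤ C t := by
  unfold hit
  split_ifs with h
  · rw [WithTop.coe_le_coe]
    constructor
    · intro hle
      have hcl : IsClosed {t | (n : ℝ) ≤ C t} := isClosed_le continuous_const hc
      have := hcl.csInf_mem h (OrderBot.bddBelow _)
      exact this.trans (hm hle)
    · exact fun hle => csInf_le (OrderBot.bddBelow _) hle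
  · simp only [top_le_iff, WithTop.coe_ne_top, false_iff]
    exact fun hle => h ⟨t, hle⟩

lemma coe_untopA_min (w : WithTop ℝ≥0) :
    (((min (t : WithTop ℝ≥0) w).untopA : ℝ≥0) : WithTop ℝ≥0) = min (t : WithTop ℝ≥0) w := by
  rw [WithTop.untopA_eq_untop (ne_top_of_le_ne_top WithTop.coe_ne_top (min_le_left _ _)),
    WithTop.coe_untop]

lemma untopA_min_le_iff (w : WithTop ℝ≥0) {r : ℝ≥0} :
    (min (t : WithTop ℝ≥0) w).untopA ≤ r ↔ t ≤ r ∨ w ≤ r := by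
  rw [← WithTop.coe_le_coe, coe_untopA_min, min_le_iff, WithTop.coe_le_coe]

lemma capT_le_iff (hc : Continuous C) (hm : Monotone C) {r : ℝ≥0} :
    capT C n s t ≤ r ↔ s ≤ r ∧ (t ≤ r ∨ (n : ℝ) ≤ C r) := by
  rw [capT, max_le_iff, untopA_min_le_iff, hit_le_iff hc hm]

lemma le_capT : s ≤ capT C n s t := le_max_left _ _

lemma capT_le (hst : s ≤ t) : capT C n s t ≤ t :=
  max_le hst ((untopA_min_le_iff _).2 (.inl le_rfl))

lemma lt_of_lt_capT (hc : Continuous C) (hm : Monotone C) {r : ℝ≥0} (hsr : s ≤ r)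
    (hr : r < capT C n s t) : C r < n := by
  have h := mt (capT_le_iff (n := n) (s := s) (t := t) hc hm).2 (not_le.2 hr)
  push Not at h
  exact (h hsr).2

/-- If the capped time exceeds `s` then `C` is below `n` before it, hence at most `n` at it by
continuity; if not, the increment vanishes. The bound thus holds even when `C s` is already larger
than `n`. -/
lemma apply_capT_sub_le (hc : Continuous C) (hm : Monotone C) (h0 : ∀ r, 0 ≤ C r) :
    C (capT C n s t) - C s ≤ n := by
  rcases eq_or_lt_of_le (le_capT : s ≤ capT C n s t) with h | h
  · rw [← h, sub_self]
    exact Nat.cast_nonneg n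
  · have h1 : C (capT C n s t) ≤ n := by
      have hne : (𝓝[<] capT C n s t).NeBot := nhdsLT_neBot_of_exists_lt ⟨s, h⟩
      refine le_of_tendsto (x := 𝓝[<] capT C n s t) ((hc.tendsto (capT C n s t)).mono_left nhdsWithin_le_nhds) ?_
      filter_upwards [Ico_mem_nhdsLT h] with r hr
      exact (lt_of_lt_capT hc hm hr.1 hr.2).le
    linarith [h0 s]

end Hit

/-! ### Integrals over random time intervals -/

section Swap

variable {Ω : Type*} [MeasurableSpace Ω] {P : Measure Ω} [IsProbabilityMeasure P]

lemma setIntegral_Ioc_eq_stopped {x : ℝ≥0 → ℝ} {s σ t : ℝ≥0} (hs : s ≤ σ) (ht : σ ≤ t) :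
    ∫ r in (s : ℝ)..σ, x r.toNNReal =
      ∫ r in Set.Ioc (s : ℝ) t, (if r.toNNReal < σ then x r.toNNReal else 0) := by
  rw [intervalIntegral.integral_of_le (by exact_mod_cast hs)]
  have h1 : ∀ᵐ r : ℝ, r ≠ σ := by simp [ae_iff]
  rw [← integral_indicator measurableSet_Ioc, ← integral_indicator measurableSet_Ioc]
  refine integral_congr_ae ?_
  filter_upwards [h1] with r hr
  by_cases h2 : r ∈ Set.Ioc (s : ℝ) σ
  · have h3 : r ∈ Set.Ioc (s : ℝ) t := ⟨h2.1, h2.2.trans (by exact_mod_cast ht)⟩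
    rw [Set.indicator_of_mem h2, Set.indicator_of_mem h3, if_pos]
    rw [Real.toNNReal_lt_iff_lt_coe (s.coe_nonneg.trans h2.1.le)]
    exact lt_of_le_of_ne h2.2 hr
  · rw [Set.indicator_of_notMem h2]
    by_cases h3 : r ∈ Set.Ioc (s : ℝ) t
    · rw [Set.indicator_of_mem h3, if_neg]
      rw [Real.toNNReal_lt_iff_lt_coe (s.coe_nonneg.trans h3.1.le)]
      exact fun h4 => h2 ⟨h3.1, h4.le⟩
    · rw [Set.indicator_of_notMem h3]

lemma integrable_uncurry_stopped {Φ : ℝ≥0 → Ω → ℝ}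
    (hΦ : Measurable fun p : ℝ≥0 × Ω => Φ p.1 p.2) (hl : ∀ ω, LocBdd fun r => Φ r ω)
    {σ : Ω → ℝ≥0} (hσ : Measurable σ) {s t : ℝ≥0} (hs : ∀ ω, s ≤ σ ω) (ht : ∀ ω, σ ω ≤ t) {C : ℝ}
    (hb : ∀ ω, ∫ r in (s : ℝ)..σ ω, |Φ r.toNNReal ω| ≤ C) :
    Integrable (Function.uncurry fun (ω : Ω) (r : ℝ) =>
        if r.toNNReal < σ ω then Φ r.toNNReal ω else 0)
      (P.prod (volume.restrict (Set.Ioc (s : ℝ) t))) := by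
  set Ψ : Ω → ℝ → ℝ := fun ω r => if r.toNNReal < σ ω then Φ r.toNNReal ω else 0 with hΨ
  have hΨm : Measurable (Function.uncurry Ψ) := by
    have h1 : Measurable fun q : Ω × ℝ => Φ q.2.toNNReal q.1 :=
      hΦ.comp ((measurable_real_toNNReal.comp measurable_snd).prodMk measurable_fst)
    exact Measurable.ite (measurableSet_lt (measurable_real_toNNReal.comp measurable_snd)
      (hσ.comp measurable_fst)) h1 measurable_const
  have hsec : ∀ ω, IntegrableOn (Ψ ω) (Set.Ioc (s : ℝ) t) := by
    intro ω
    have h1 : LocBdd fun r => if r < σ ω then Φ r ω else 0 := by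
      have := (hl ω).indicator (measurableSet_Iio (a := σ ω))
      refine (by ext r; simp [Set.indicator] : ((Set.Iio (σ ω)).indicator fun r => Φ r ω) =
        fun r => if r < σ ω then Φ r ω else 0) ▸ this
    have h2 := h1.intervalIntegrable s t
    rwa [intervalIntegrable_iff_integrableOn_Ioc_of_le
      (by exact_mod_cast (hs ω).trans (ht ω))] at h2
  refine (integrable_prod_iff hΨm.aestronglyMeasurable).2 ⟨.of_forall hsec, ?_⟩
  refine Integrable.of_bound (hΨm.stronglyMeasurable.norm.integral_prod_right'
    (f := fun q => ‖Function.uncurry Ψ q‖)).aestronglyMeasurable C (.of_forall fun ω => ?_)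
  rw [Real.norm_of_nonneg (integral_nonneg fun _ => norm_nonneg _)]
  refine le_trans (le_of_eq ?_) (hb ω)
  rw [setIntegral_Ioc_eq_stopped (x := fun r => |Φ r ω|) (hs ω) (ht ω)]
  congr 1
  ext r
  simp only [hΨ, Function.uncurry, Real.norm_eq_abs]
  split_ifs <;> simp

/-- Fubini's theorem after the random interval is replaced by a cut-off integrand on `(s, t]`. The
hypothesis `hz` may assume integrability at time `r`, since Fubini provides it for almost every `r`.
-/
lemma integral_integral_stopped_eq_zero {Φ : ℝ≥0 → Ω → ℝ}
    (hΦ : Measurable fun p : ℝ≥0 × Ω => Φ p.1 p.2) (hl : ∀ ω, LocBdd fun r => Φ r ω)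
    {σ : Ω → ℝ≥0} (hσ : Measurable σ) {s t : ℝ≥0} (hs : ∀ ω, s ≤ σ ω) (ht : ∀ ω, σ ω ≤ t) {C : ℝ}
    (hb : ∀ ω, ∫ r in (s : ℝ)..σ ω, |Φ r.toNNReal ω| ≤ C)
    (hz : ∀ r, s ≤ r → r ≤ t → Integrable (fun ω => if r < σ ω then Φ r ω else 0) P →
      ∫ ω, (if r < σ ω then Φ r ω else 0) ∂P = 0) :
    Integrable (fun ω => ∫ r in (s : ℝ)..σ ω, Φ r.toNNReal ω) P ∧
      ∫ ω, (∫ r in (s : ℝ)..σ ω, Φ r.toNNReal ω) ∂P = 0 := by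
  have hint := integrable_uncurry_stopped (P := P) hΦ hl hσ hs ht hb
  simp only [fun ω => setIntegral_Ioc_eq_stopped (x := fun r => Φ r ω) (hs ω) (ht ω)]
  refine ⟨hint.integral_prod_left, ?_⟩
  rw [integral_integral_swap hint]
  refine integral_eq_zero_of_ae ?_
  filter_upwards [hint.prod_left_ae, ae_restrict_mem measurableSet_Ioc] with r hr hrm
  exact hz r.toNNReal (NNReal.le_toNNReal_of_coe_le hrm.1.le)
    (Real.toNNReal_le_iff_le_coe.2 hrm.2) hr

end Swap

section Primitive

lemma hasDerivWithinAt_primitive {x : ℝ≥0 → ℝ} (hx : LocBdd x) (hr : RightCont x) (a t : ℝ) :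
    HasDerivWithinAt (fun u => ∫ r in a..u, x r.toNNReal) (x t.toNNReal) (Set.Ioi t) t := by
  have hc : ContinuousWithinAt (fun r : ℝ => x r.toNNReal) (Set.Ioi t) t := by
    have h1 : ContinuousWithinAt x (Set.Ici t.toNNReal) t.toNNReal := hr _
    refine h1.comp continuous_real_toNNReal.continuousWithinAt fun r hr => ?_
    exact Real.toNNReal_le_toNNReal (le_of_lt hr)
  have hm : Measurable fun r : ℝ => x r.toNNReal := hx.measurable.comp measurable_real_toNNReal
  exact (intervalIntegral.integral_hasDerivWithinAt_right (s := Set.Ici t) (t := Set.Ioi t)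
    (hx.intervalIntegrable a t) (hm.stronglyMeasurable.stronglyMeasurableAtFilter) hc).mono
    Set.Ioi_subset_Ici_self

/-- Product rule for primitives of right continuous functions. -/
lemma primitive_mul_primitive {x y : ℝ≥0 → ℝ} (hx : LocBdd x) (hxr : RightCont x) (hy : LocBdd y)
    (hyr : RightCont y) (s t : ℝ≥0) :
    (∫ r in (s : ℝ)..t, x r.toNNReal) * ∫ r in (s : ℝ)..t, y r.toNNReal =
      ∫ r in (s : ℝ)..t, (x r.toNNReal * (∫ u in (s : ℝ)..r, y u.toNNReal) +
        (∫ u in (s : ℝ)..r, x u.toNNReal) * y r.toNNReal) := by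
  have h := intervalIntegral.integral_deriv_mul_eq_sub_of_hasDeriv_right (a := (s : ℝ)) (b := t)
    (u := fun r => ∫ u in (s : ℝ)..r, x u.toNNReal) (v := fun r => ∫ u in (s : ℝ)..r, y u.toNNReal)
    (u' := fun r => x r.toNNReal) (v' := fun r => y r.toNNReal)
    (intervalIntegral.continuous_primitive (fun a b => hx.intervalIntegrable a b) _).continuousOn
    (intervalIntegral.continuous_primitive (fun a b => hy.intervalIntegrable a b) _).continuousOn
    (fun r _ => hasDerivWithinAt_primitive hx hxr _ r)
    (fun r _ => hasDerivWithinAt_primitive hy hyr _ r)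
    (hx.intervalIntegrable _ _) (hy.intervalIntegrable _ _)
  simp only [intervalIntegral.integral_same, mul_zero, sub_zero] at h
  exact h.symm

end Primitive

section PullOut

variable {Ω : Type*} [MeasurableSpace Ω] {P : Measure Ω} [IsProbabilityMeasure P]
  {ℱ : Filtration ℝ≥0 ‹MeasurableSpace Ω›}

lemma integral_mul_martingale_sub_eq_zero {M : ℝ≥0 → Ω → ℝ} (hM : Martingale M ℱ P) {r t : ℝ≥0}
    (hrt : r ≤ t) {U : Ω → ℝ} (hU : Measurable[ℱ r] U)
    (hint : Integrable (fun ω => U ω * (M t ω - M r ω)) P) : ∫ ω, U ω * (M t ω - M r ω) ∂P = 0 := by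
  have h1 : P[M t - M r | ℱ r] =ᵐ[P] 0 := by
    refine (condExp_sub (hM.integrable t) (hM.integrable r) _).trans ?_
    filter_upwards [hM.condExp_ae_eq hrt, hM.condExp_ae_eq (le_refl r)] with ω h2 h3
    simp [h2, h3]
  have h2 : P[U * (M t - M r) | ℱ r] =ᵐ[P] U * P[M t - M r | ℱ r] :=
    condExp_mul_of_stronglyMeasurable_left hU.stronglyMeasurable hint
      ((hM.integrable t).sub (hM.integrable r))
  calc ∫ ω, U ω * (M t ω - M r ω) ∂P = ∫ ω, (P[U * (M t - M r) | ℱ r]) ω ∂P :=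
        (integral_condExp (ℱ.le r)).symm
    _ = ∫ _, 0 ∂P := by
        refine integral_congr_ae ?_
        filter_upwards [h1, h2] with ω h3 h4
        rw [h4, Pi.mul_apply, h3]
        simp
    _ = 0 := by simp

end PullOut

/-! ### Cadlag processes -/

section Cadlag

variable {S T Θ : Type*} [TopologicalSpace S] [TopologicalSpace T]

lemma IsCadlag.prodMk {x : ℝ≥0 → S} {y : ℝ≥0 → T} (hx : IsCadlag x) (hy : IsCadlag y) :
    IsCadlag fun t => (x t, y t) := by
  intro t
  obtain ⟨l, hl⟩ := (hx t).2
  obtain ⟨l', hl'⟩ := (hy t).2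
  exact ⟨(hx t).1.prodMk (hy t).1, (l, l'), hl.prodMk_nhds hl'⟩

lemma isCadlag_of_continuous {x : ℝ≥0 → S} (hx : Continuous x) : IsCadlag x := fun t =>
  ⟨hx.continuousWithinAt, x t, (hx.tendsto t).mono_left nhdsWithin_le_nhds⟩

lemma IsCadlag.mul {x y : ℝ≥0 → ℝ} (hx : IsCadlag x) (hy : IsCadlag y) :
    IsCadlag fun t => x t * y t := (hx.prodMk hy).comp continuous_mul

lemma IsCadlag.sub {x y : ℝ≥0 → ℝ} (hx : IsCadlag x) (hy : IsCadlag y) :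
    IsCadlag fun t => x t - y t := (hx.prodMk hy).comp continuous_sub

lemma IsCadlag.intervalIntegrable {x : ℝ≥0 → ℝ} (hx : IsCadlag x) (a b : ℝ) :
    IntervalIntegrable (fun r : ℝ => x r.toNNReal) volume a b := hx.locBdd.intervalIntegrable a b

lemma IsCadlag.continuous_primitive {x : ℝ≥0 → ℝ} (hx : IsCadlag x) (s : ℝ) :
    Continuous fun t : ℝ≥0 => ∫ r in s..t, x r.toNNReal :=
  (intervalIntegral.continuous_primitive (fun a b => hx.locBdd.intervalIntegrable a b) s).comp
    NNReal.continuous_coe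

structure CadlagProc [MeasurableSpace S] [MeasurableSpace Θ] (x : ℝ≥0 → Θ → S) : Prop where
  measurable : ∀ t, Measurable (x t)
  cadlag : ∀ θ, IsCadlag fun t => x t θ

variable [MeasurableSpace S] [MeasurableSpace T] [MeasurableSpace Θ]

lemma CadlagProc.prodMk {x : ℝ≥0 → Θ → S} {y : ℝ≥0 → Θ → T} (hx : CadlagProc x)
    (hy : CadlagProc y) : CadlagProc fun t θ => (x t θ, y t θ) :=
  ⟨fun t => (hx.1 t).prodMk (hy.1 t), fun θ => (hx.2 θ).prodMk (hy.2 θ)⟩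

lemma CadlagProc.comp [OpensMeasurableSpace S] [BorelSpace T] {x : ℝ≥0 → Θ → S}
    (hx : CadlagProc x) {f : S → T} (hf : Continuous f) : CadlagProc fun t θ => f (x t θ) :=
  ⟨fun t => hf.measurable.comp (hx.1 t), fun θ => (hx.2 θ).comp hf⟩

lemma CadlagProc.comp_left {Θ' : Type*} [MeasurableSpace Θ'] {x : ℝ≥0 → Θ → S}
    (hx : CadlagProc x) {g : Θ' → Θ} (hg : Measurable g) : CadlagProc fun t θ => x t (g θ) :=
  ⟨fun t => (hx.1 t).comp hg, fun _ => hx.2 _⟩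

/-- A path frozen at time `r` has all its values measurable with respect to the information up to
`r`. Statements about measurable processes thereby become statements about adaptedness. -/
lemma CadlagProc.capped {x : ℝ≥0 → Θ → S} {r : ℝ≥0} (hm : ∀ u ≤ r, Measurable (x u))
    (hc : ∀ θ, RightCont fun t => x t θ) :
    (∀ u, Measurable fun θ => x (min u r) θ) ∧ ∀ θ, RightCont fun u => x (min u r) θ :=
  ⟨fun u => hm _ (min_le_right _ _), fun θ => (hc θ).comp_monotone (a := fun u => min u r)
    (by fun_prop) fun _ _ h => min_le_min_right _ h⟩

variable {x y : ℝ≥0 → Θ → ℝ}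

lemma CadlagProc.const {g : Θ → ℝ} (hg : Measurable g) : CadlagProc fun _ : ℝ≥0 => g :=
  ⟨fun _ => hg, fun _ => isCadlag_of_continuous continuous_const⟩

lemma CadlagProc.mul (hx : CadlagProc x) (hy : CadlagProc y) :
    CadlagProc fun t θ => x t θ * y t θ := (hx.prodMk hy).comp continuous_mul

lemma CadlagProc.sub (hx : CadlagProc x) (hy : CadlagProc y) :
    CadlagProc fun t θ => x t θ - y t θ := (hx.prodMk hy).comp continuous_sub

lemma CadlagProc.uncurry (hx : CadlagProc x) : Measurable fun p : ℝ≥0 × Θ => x p.1 p.2 :=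
  measurable_uncurry_of_rightCont hx.1 fun θ => (hx.2 θ).rightCont

lemma CadlagProc.eval (hx : CadlagProc x) {σ : Θ → ℝ≥0} (hσ : Measurable σ) :
    Measurable fun θ => x (σ θ) θ :=
  measurable_eval_of_rightCont hx.1 (fun θ => (hx.2 θ).rightCont) hσ

lemma CadlagProc.primitive (hx : CadlagProc x) (s : ℝ) :
    CadlagProc fun t θ => ∫ r in s..(t : ℝ), x r.toNNReal θ :=
  ⟨fun t => measurable_integral_path hx.uncurry s t,
    fun θ => isCadlag_of_continuous ((hx.2 θ).continuous_primitive s)⟩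

lemma measurable_integral_of_le {r : ℝ≥0} (hm : ∀ u ≤ r, Measurable (x u))
    (hc : ∀ θ, RightCont fun t => x t θ) : Measurable fun θ => ∫ u in (0 : ℝ)..r, x u.toNNReal θ := by
  obtain ⟨h1, h2⟩ := CadlagProc.capped hm hc
  have h3 := measurable_integral_path (measurable_uncurry_of_rightCont h1 h2) 0 r
  refine (funext fun θ => ?_ : (fun θ => ∫ u in (0 : ℝ)..r, x u.toNNReal θ) = _) ▸ h3
  refine intervalIntegral.integral_congr fun u hu => ?_
  rw [Set.uIcc_of_le r.coe_nonneg] at hu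
  simp only [min_eq_left (Real.toNNReal_le_iff_le_coe.2 hu.2)]

end Cadlag

/-! ### The chain driven by a process in a random environment -/

section Driven

variable {E : Type*} [TopologicalSpace E] {m : ℕ}

structure RateFun (q : OffDiag m → E → ℝ) : Prop where
  continuous : ∀ p, Continuous (q p)
  nonneg : ∀ p x, 0 ≤ q p x

def pathRate (q : OffDiag m → E → ℝ) (x : ℝ≥0 → E) (p : OffDiag m) (s : ℝ≥0) : ℝ := q p (x s)

noncomputable def totRate (q : OffDiag m → E → ℝ) (x : E) : ℝ := ∑ p, q p x

noncomputable def totClk (q : OffDiag m → E → ℝ) (x : ℝ≥0 → E) (t : ℝ≥0) : ℝ :=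
  ∫ r in (0 : ℝ)..t, totRate q (x r.toNNReal)

variable {q : OffDiag m → E → ℝ} (hq : RateFun q)

include hq

lemma RateFun.ratePath {x : ℝ≥0 → E} (hx : IsCadlag x) : RatePath (pathRate q x) :=
  ⟨fun p _ => hq.nonneg p _, fun p => (hx.comp (hq.continuous p)).locBdd⟩

lemma RateFun.continuous_totRate : Continuous (totRate q) :=
  continuous_finsetSum _ fun p _ => hq.continuous p

lemma RateFun.totRate_nonneg (x : E) : 0 ≤ totRate q x :=
  Finset.sum_nonneg fun p _ => hq.nonneg p x

lemma RateFun.continuous_totClk {x : ℝ≥0 → E} (hx : IsCadlag x) : Continuous (totClk q x) :=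
  (hx.comp hq.continuous_totRate).continuous_primitive 0

lemma RateFun.totClk_sub {x : ℝ≥0 → E} (hx : IsCadlag x) (s t : ℝ≥0) :
    totClk q x t - totClk q x s = ∫ r in (s : ℝ)..t, totRate q (x r.toNNReal) := by
  have h := (hx.comp hq.continuous_totRate).locBdd
  exact intervalIntegral.integral_interval_sub_left (h.intervalIntegrable 0 t)
    (h.intervalIntegrable 0 s)

lemma RateFun.monotone_totClk {x : ℝ≥0 → E} (hx : IsCadlag x) : Monotone (totClk q x) := by
  intro s t hst
  rw [← sub_nonneg, hq.totClk_sub hx]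
  exact intervalIntegral.integral_nonneg (by exact_mod_cast hst) fun _ _ => hq.totRate_nonneg _

lemma RateFun.totClk_nonneg (x : ℝ≥0 → E) (t : ℝ≥0) : 0 ≤ totClk q x t :=
  intervalIntegral.integral_nonneg t.coe_nonneg fun _ _ => hq.totRate_nonneg _

lemma RateFun.abs_genRate_le {f : Fin (m + 1) → ℝ} {F : ℝ} (hF : ∀ j, |f j| ≤ F)
    (x : ℝ≥0 → E) (y : ℝ≥0 → Fin (m + 1)) (r : ℝ≥0) :
    |genRate (pathRate q x) f y r| ≤ 2 * F * totRate q (x r) := by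
  rw [totRate, Finset.mul_sum]
  refine (Finset.abs_sum_le_sum_abs _ _).trans (Finset.sum_le_sum fun p _ => ?_)
  rw [abs_mul, mul_comm]
  have h2 : |f p.1.2 - f p.1.1| ≤ 2 * F := by
    have := abs_sub (f p.1.2) (f p.1.1)
    linarith [hF p.1.2, hF p.1.1]
  have h3 := hq.nonneg p (x r)
  refine mul_le_mul h2 ?_ (abs_nonneg _) ((abs_nonneg _).trans h2)
  split_ifs
  · exact (abs_of_nonneg h3).le
  · simpa using h3

variable {Θ : Type*} [MeasurableSpace Θ] [TopologicalSpace.MetrizableSpace E] [MeasurableSpace E]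
  [BorelSpace E] {X : ℝ≥0 → Θ → E} (hXc : ∀ θ, IsCadlag fun t => X t θ)

include hXc

/-- The driven chain at time `r` is measurable with respect to the environment up to time `r`. -/
lemma RateFun.measurable_sol_of_le {r : ℝ≥0} (hXm : ∀ u ≤ r, Measurable (X u))
    {N : Θ → CountSpace m} (hN : Measurable N) {z : Θ → ℤ} (hz : Measurable z) :
    Measurable fun θ => sol (pathRate q fun s => X s θ) (N θ).1 (z θ) r := by
  obtain ⟨h1, h2⟩ := CadlagProc.capped hXm fun θ => (hXc θ).rightCont
  have h3 := measurable_uncurry_of_rightCont h1 h2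
  have hl : ∀ θ, RatePath (pathRate q fun s => X (min s r) θ) := fun θ => by
    refine ⟨fun p _ => hq.nonneg p _, fun p => ⟨?_, fun T => ?_⟩⟩
    · exact ((h2 θ).comp (hq.continuous p)).measurable
    · obtain ⟨C, hC⟩ := ((hXc θ).comp (hq.continuous p)).locBdd.bdd r
      exact ⟨C, fun s _ => hC _ (min_le_right _ _)⟩
  have h4 := measurable_sol (lam := fun θ => pathRate q fun s => X (min s r) θ)
    (N := fun θ => (N θ).1) (z := z) hl (fun θ => (N θ).2)
    (fun p => (hq.continuous p).measurable.comp h3)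
    (fun p v => (measurable_count p v).comp hN) hz r
  refine (funext fun θ => ?_ : (fun θ => sol (pathRate q fun s => X s θ) (N θ).1 (z θ) r) = _) ▸ h4
  exact sol_congr_rate (hq.ratePath (hXc θ)) (N θ).2 (hl θ)
    (fun p s hs => by simp only [pathRate, min_eq_left hs]) r le_rfl

lemma RateFun.cadlagProc_sol (hXm : ∀ u, Measurable (X u)) {N : Θ → CountSpace m}
    (hN : Measurable N) {z : Θ → ℤ} (hz : Measurable z) :
    CadlagProc fun r θ => sol (pathRate q fun s => X s θ) (N θ).1 (z θ) r :=
  ⟨fun _ => hq.measurable_sol_of_le hXc (fun u _ => hXm u) hN hz,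
    fun θ => isCadlag_sol (hq.ratePath (hXc θ)) (N θ).2⟩

lemma RateFun.measurable_totClk_of_le {r : ℝ≥0} (hXm : ∀ u ≤ r, Measurable (X u)) :
    Measurable fun θ => totClk q (fun s => X s θ) r :=
  measurable_integral_of_le (x := fun s θ => totRate q (X s θ))
    (fun u hu => hq.continuous_totRate.measurable.comp (hXm u hu))
    fun θ => (hXc θ).rightCont.comp hq.continuous_totRate

omit hq hXc

/-- The rate part of the generator, at a point of the product space. -/
noncomputable def jumpOp (q : OffDiag m → E → ℝ) (f : Fin (m + 1) → ℝ) (z : E × Fin (m + 1)) : ℝ :=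
  ∑ p : OffDiag m, (if z.2 = p.1.1 then q p z.1 else 0) * (f p.1.2 - f p.1.1)

lemma RateFun.continuous_jumpOp (hq : RateFun q) (f : Fin (m + 1) → ℝ) :
    Continuous (jumpOp q f) := by
  rw [continuous_prod_of_discrete_right]
  intro i
  refine continuous_finsetSum _ fun p _ => Continuous.mul ?_ continuous_const
  by_cases h : i = p.1.1
  · simpa [h] using hq.continuous p
  · simpa [h] using continuous_const

/-- The coupled generator applied to `f₁ ⊗ f₂` for a pair `a = (f₁, g₁)`. -/
noncomputable def couplOp (q : OffDiag m → E → ℝ) (a : (E → ℝ) × (E → ℝ)) (f : Fin (m + 1) → ℝ)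
    (z : E × Fin (m + 1)) : ℝ := f z.2 * a.2 z.1 + a.1 z.1 * jumpOp q f z

/-- The increment of the test process for `f₁ ⊗ f₂` between the times `s` and `t`, stopped when
the total clock reaches the level `n`. -/
noncomputable def stoppedIncr (q : OffDiag m → E → ℝ) (a : (E → ℝ) × (E → ℝ))
    (f : Fin (m + 1) → ℝ) (n : ℕ) (s t : ℝ≥0) (z : ℝ≥0 → E × Fin (m + 1)) : ℝ :=
  a.1 (z (capT (totClk q fun r => (z r).1) n s t)).1 *
      f (z (capT (totClk q fun r => (z r).1) n s t)).2 - a.1 (z s).1 * f (z s).2 -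
    ∫ r in (s : ℝ)..capT (totClk q fun r => (z r).1) n s t, couplOp q a f (z r.toNNReal)

/-- The stopped increments of the test processes are orthogonal to the past. -/
def StoppedId {Ω : Type*} [MeasurableSpace Ω] (A : Set ((E → ℝ) × (E → ℝ)))
    (q : OffDiag m → E → ℝ) (Z : ℝ≥0 → Ω → E × Fin (m + 1)) (P : Measure Ω) : Prop :=
  ∀ a ∈ A, ∀ (f : Fin (m + 1) → ℝ) (n : ℕ) (s t : ℝ≥0), s ≤ t →
    ∀ B : Set (Set.Iic s → E × Fin (m + 1)), MeasurableSet B →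
      ∫ ω in {ω | (fun r : Set.Iic s => Z r ω) ∈ B},
        stoppedIncr q a f n s t (fun r => Z r ω) ∂P = 0

end Driven

/-! ### Integration by parts for two compensated processes -/

section ProductFormula

/-- Decomposition of the increment of a product, minus the formal compensator, into increments of
the two compensated factors. -/
lemma product_increment_eq {u g v b : ℝ≥0 → ℝ} (hu : IsCadlag u) (hg : IsCadlag g)
    (hv : IsCadlag v) (hb : IsCadlag b) {M c : ℝ≥0 → ℝ}
    (hM : ∀ r, M r = u r - u 0 - ∫ r in (0 : ℝ)..r, g r.toNNReal)
    (hc : ∀ r, c r = v r - ∫ r in (0 : ℝ)..r, b r.toNNReal) {s σ : ℝ≥0} (hs : s ≤ σ) (t : ℝ≥0) :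
    u σ * v σ - u s * v s - ∫ r in (s : ℝ)..σ, (v r.toNNReal * g r.toNNReal +
        u r.toNNReal * b r.toNNReal) = -(v σ * (M t - M σ)) + v s * (M t - M s) +
        (M t + (u 0 + ∫ r in (0 : ℝ)..s, g r.toNNReal)) * (c σ - c s) +
        (∫ r in (s : ℝ)..σ, b r.toNNReal * (M t - M r.toNNReal)) +
        ∫ r in (s : ℝ)..σ, g r.toNNReal * (c σ - c r.toNNReal) := by
  -- On the right hand side the increments of `M` run up to the fixed time `t` and multiply values
  -- of `v` and `b` at their starting time, while the increments of `c` multiply functionals of `u`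
  -- and `g`. The two factors can thus be averaged separately, and no covariation has to be defined.
  have hMc : IsCadlag M := by
    have : M = fun r => u r - u 0 - ∫ r in (0 : ℝ)..r, g r.toNNReal := funext hM
    rw [this]
    exact (hu.sub (isCadlag_of_continuous continuous_const)).sub
      (isCadlag_of_continuous (hg.continuous_primitive 0))
  have hcc : IsCadlag c := by
    have : c = fun r => v r - ∫ r in (0 : ℝ)..r, b r.toNNReal := funext hc
    rw [this]
    exact hv.sub (isCadlag_of_continuous (hb.continuous_primitive 0))
  set G := ∫ r in (s : ℝ)..σ, g r.toNNReal with hG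
  set J := ∫ r in (s : ℝ)..σ, b r.toNNReal with hJ
  set G₀ := ∫ r in (0 : ℝ)..s, g r.toNNReal with hG₀
  set J₀ := ∫ r in (0 : ℝ)..s, b r.toNNReal with hJ₀
  have hPR := primitive_mul_primitive hg.locBdd hg.rightCont hb.locBdd hb.rightCont s σ
  have hadd : ∀ {x : ℝ≥0 → ℝ}, IsCadlag x → ∀ r : ℝ, (∫ u in (0 : ℝ)..r, x u.toNNReal) =
      (∫ u in (0 : ℝ)..s, x u.toNNReal) + ∫ u in (s : ℝ)..r, x u.toNNReal := fun hx r =>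
    (intervalIntegral.integral_add_adjacent_intervals (hx.intervalIntegrable _ _)
      (hx.intervalIntegrable _ _)).symm
  have hiMb := (hMc.mul hb).intervalIntegrable s σ
  have hicg := (hcc.mul hg).intervalIntegrable s σ
  have hig := hg.intervalIntegrable s σ
  have hib := hb.intervalIntegrable s σ
  have hiPR : IntervalIntegrable (fun r : ℝ => g r.toNNReal * (∫ u in (s : ℝ)..r, b u.toNNReal) +
      (∫ u in (s : ℝ)..r, g u.toNNReal) * b r.toNNReal) volume s σ := by
    have h1 : Continuous fun r : ℝ => ∫ u in (s : ℝ)..r, b u.toNNReal :=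
      intervalIntegral.continuous_primitive (fun _ _ => hb.intervalIntegrable _ _) _
    have h2 : Continuous fun r : ℝ => ∫ u in (s : ℝ)..r, g u.toNNReal :=
      intervalIntegral.continuous_primitive (fun _ _ => hg.intervalIntegrable _ _) _
    exact (hig.mul_continuousOn h1.continuousOn).add (hib.continuousOn_mul h2.continuousOn)
  have e1 : ∫ r in (s : ℝ)..σ, (v r.toNNReal * g r.toNNReal + u r.toNNReal * b r.toNNReal) =
      (∫ r in (s : ℝ)..σ, c r.toNNReal * g r.toNNReal) + J₀ * G +
        (∫ r in (s : ℝ)..σ, M r.toNNReal * b r.toNNReal) + (u 0 + G₀) * J + G * J := by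
    rw [hPR, hG, hJ, ← intervalIntegral.integral_const_mul, ← intervalIntegral.integral_const_mul,
      ← intervalIntegral.integral_add hicg (hig.const_mul _),
      ← intervalIntegral.integral_add (hicg.add (hig.const_mul _)) hiMb,
      ← intervalIntegral.integral_add ((hicg.add (hig.const_mul _)).add hiMb) (hib.const_mul _),
      ← intervalIntegral.integral_add
        (((hicg.add (hig.const_mul _)).add hiMb).add (hib.const_mul _)) hiPR]
    refine intervalIntegral.integral_congr fun r hr => ?_
    rw [Set.uIcc_of_le (by exact_mod_cast hs)] at hr
    have hr0 : (0 : ℝ) ≤ r := s.coe_nonneg.trans hr.1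
    simp only [hM, hc, Real.coe_toNNReal r hr0, hadd hg r, hadd hb r, ← hJ₀, ← hG₀]
    ring
  have e2 : ∫ r in (s : ℝ)..σ, b r.toNNReal * (M t - M r.toNNReal) =
      M t * J - ∫ r in (s : ℝ)..σ, M r.toNNReal * b r.toNNReal := by
    rw [hJ, ← intervalIntegral.integral_const_mul,
      ← intervalIntegral.integral_sub (hib.const_mul _) hiMb]
    congr 1
    ext r
    ring
  have e3 : ∫ r in (s : ℝ)..σ, g r.toNNReal * (c σ - c r.toNNReal) =
      c σ * G - ∫ r in (s : ℝ)..σ, c r.toNNReal * g r.toNNReal := by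
    rw [hG, ← intervalIntegral.integral_const_mul,
      ← intervalIntegral.integral_sub (hig.const_mul _) hicg]
    congr 1
    ext r
    ring
  have f1 : u σ = M σ + u 0 + (G₀ + G) := by rw [hM σ, hadd hg]; ring
  have f2 : u s = M s + u 0 + G₀ := by rw [hM s]; ring
  have f3 : v σ = c σ + (J₀ + J) := by rw [hc σ, hadd hb]; ring
  have f4 : v s = c s + J₀ := by rw [hc s]; ring
  rw [e1, e2, e3, f1, f2, f3, f4]
  ring

end ProductFormula

section Coupling

variable {E : Type*} [MetricSpace E] [SecondCountableTopology E] [MeasurableSpace E] [BorelSpace E]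
  {m : ℕ} {A : Set ((E → ℝ) × (E → ℝ))} {q : OffDiag m → E → ℝ} (hq : RateFun q)
  {Ω : Type*} [MeasurableSpace Ω] {P : Measure Ω} [IsProbabilityMeasure P] {X : ℝ≥0 → Ω → E}
  (hXm : ∀ t, Measurable (X t)) (hXc : ∀ ω, IsCadlag fun t => X t ω)
  {Z : ℝ≥0 → Ω → E × Fin (m + 1)} {i k : Fin (m + 1)} {n : ℝ} {s t : ℝ≥0} {K : Set Ω}
  {S τ σ : Ω → ℝ≥0} {f : Fin (m + 1) → ℝ} {a : (E → ℝ) × (E → ℝ)}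
  {z : ℝ≥0 → E × Fin (m + 1)}

/-! ### Reduction of the product identity to the compensated chain -/

section CompensatedChain

lemma IsCadlag.fst (hz : IsCadlag z) : IsCadlag fun r => (z r).1 :=
  hz.comp continuous_fst

/-- A common bound of a pair in the operator. -/
lemma exists_bound_pair (hA : A ⊆ boundedContinuous E ×ˢ boundedContinuous E)
    (ha : a ∈ A) : ∃ D, 0 ≤ D ∧ (∀ x, |a.1 x| ≤ D) ∧ ∀ x, |a.2 x| ≤ D := by
  obtain ⟨⟨_, D₁, hD₁⟩, _, D₂, hD₂⟩ := hA ha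
  refine ⟨max |D₁| |D₂|, (abs_nonneg _).trans (le_max_left _ _), fun x => ?_, fun x => ?_⟩
  · exact (hD₁ x).trans ((le_abs_self _).trans (le_max_left _ _))
  · exact (hD₂ x).trans ((le_abs_self _).trans (le_max_right _ _))

lemma exists_bound_fin (f : Fin (m + 1) → ℝ) : ∃ F, 0 ≤ F ∧ ∀ j, |f j| ≤ F :=
  ⟨∑ j, |f j|, Finset.sum_nonneg fun _ _ => abs_nonneg _, fun j =>
    Finset.single_le_sum (f := fun j => |f j|) (fun _ _ => abs_nonneg _) (Finset.mem_univ j)⟩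

lemma cadlagProc_testProcess {S : Type*} [TopologicalSpace S] [MeasurableSpace S] [BorelSpace S]
    {Z : ℝ≥0 → Ω → S} (hZ : CadlagProc Z) {f g : S → ℝ} (hf : Continuous f) (hg : Continuous g) :
    CadlagProc (testProcess f g Z) :=
  ((hZ.comp hf).sub (CadlagProc.const (hf.measurable.comp (hZ.1 0)))).sub
    ((hZ.comp hg).primitive 0)

lemma abs_testProcess_le {S : Type*} {Z : ℝ≥0 → Ω → S} {f g : S → ℝ} {D : ℝ}
    (hf : ∀ x, |f x| ≤ D) (hg : ∀ x, |g x| ≤ D) (t : ℝ≥0) (ω : Ω) :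
    |(testProcess f g Z t ω)| ≤ 2 * D + D * t := by
  have h1 := intervalIntegral.norm_integral_le_of_norm_le_const (a := (0 : ℝ)) (b := t)
    (f := fun r => g (Z r.toNNReal ω)) (C := D) fun r _ => hg _
  simp only [Real.norm_eq_abs, sub_zero, NNReal.abs_eq] at h1
  have h2 := abs_sub (f (Z t ω) - f (Z 0 ω)) (∫ s in (0 : ℝ)..t, g (Z s.toNNReal ω))
  have h3 := abs_sub (f (Z t ω)) (f (Z 0 ω))
  unfold testProcess
  linarith [hf (Z t ω), hf (Z 0 ω)]

lemma integral_neg_add_eq {Θ : Type*} [MeasurableSpace Θ] {μ : Measure Θ}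
    {f₁ f₂ f₃ f₄ f₅ : Θ → ℝ} (i₁ : Integrable f₁ μ) (i₂ : Integrable f₂ μ) (i₃ : Integrable f₃ μ)
    (i₄ : Integrable f₄ μ) (i₅ : Integrable f₅ μ) (e₁ : ∫ w, f₁ w ∂μ = 0) (e₂ : ∫ w, f₂ w ∂μ = 0)
    (e₄ : ∫ w, f₄ w ∂μ = 0) (e₅ : ∫ w, f₅ w ∂μ = 0) :
    ∫ w, (-f₁ w + f₂ w + f₃ w + f₄ w + f₅ w) ∂μ = ∫ w, f₃ w ∂μ := by
  have h₁ : Integrable (fun w => -f₁ w) μ := i₁.neg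
  have h₂ : Integrable (fun w => -f₁ w + f₂ w) μ := h₁.add i₂
  have h₃ : Integrable (fun w => -f₁ w + f₂ w + f₃ w) μ := h₂.add i₃
  have h₄ : Integrable (fun w => -f₁ w + f₂ w + f₃ w + f₄ w) μ := h₃.add i₄
  rw [integral_add h₄ i₅, integral_add h₃ i₄, integral_add h₂ i₃, integral_add h₁ i₂, integral_neg,
    e₁, e₂, e₄, e₅]
  simp

lemma abs_indicator_one_mul_le {Θ : Type*} (K : Set Θ) (w : Θ) (x : ℝ) :
    |K.indicator (fun _ => (1 : ℝ)) w * x| ≤ |x| := by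
  by_cases h : w ∈ K <;> simp [h]

omit [MeasurableSpace Ω] in
lemma IsStop.measurableSet_lt {mΩ : MeasurableSpace Ω} {ℱ : Filtration ℝ≥0 mΩ}
    (h : IsStop ℱ σ) (r : ℝ≥0) : MeasurableSet[ℱ r] {ω | r < σ ω} := by
  refine (Set.ext fun ω => ?_ : {ω | r < σ ω} = _) ▸ (h r).compl
  change r < σ ω ↔ ¬ ((σ ω : WithTop ℝ≥0) ≤ r)
  rw [WithTop.coe_le_coe, not_le]

/-- The compensated increments of the chain: their orthogonality to path functionals of the first
component is what both the construction and the uniqueness proof are about. -/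
noncomputable def compIncr (q : OffDiag m → E → ℝ) (f : Fin (m + 1) → ℝ) (s σ : ℝ≥0)
    (z : ℝ≥0 → E × Fin (m + 1)) : ℝ :=
  f (z σ).2 - f (z s).2 - ∫ r in (s : ℝ)..σ, jumpOp q f (z r.toNNReal)

include hq

lemma totRate_intervalIntegrable (hz : IsCadlag z) (a b : ℝ) :
    IntervalIntegrable (fun r : ℝ => totRate q (z r.toNNReal).1) volume a b :=
  (hz.fst.comp hq.continuous_totRate).intervalIntegrable a b

lemma integral_totRate_le (hz : IsCadlag z) {a b c d : ℝ≥0}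
    (hab : a ≤ b) (hbc : b ≤ c) (hcd : c ≤ d)
    (hn : ∫ u in (a : ℝ)..d, totRate q (z u.toNNReal).1 ≤ n) :
    ∫ u in (b : ℝ)..c, totRate q (z u.toNNReal).1 ≤ n :=
  (intervalIntegral.integral_mono_interval (by exact_mod_cast hab) (by exact_mod_cast hbc)
    (by exact_mod_cast hcd) (.of_forall fun _ => hq.totRate_nonneg _)
    (totRate_intervalIntegrable hq hz _ _)).trans hn

lemma integral_abs_jumpOp_le {F : ℝ} (hF : ∀ j, |f j| ≤ F)
    (hz : IsCadlag z) {s σ : ℝ≥0} (hs : s ≤ σ) : ∫ r in (s : ℝ)..σ, |jumpOp q f (z r.toNNReal)| ≤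
      2 * F * ∫ r in (s : ℝ)..σ, totRate q (z r.toNNReal).1 := by
  rw [← intervalIntegral.integral_const_mul]
  exact intervalIntegral.integral_mono_on (by exact_mod_cast hs)
    ((hz.comp (hq.continuous_jumpOp f)).intervalIntegrable _ _).abs
    ((totRate_intervalIntegrable hq hz _ _).const_mul _)
    fun r _ => hq.abs_genRate_le hF (fun u => (z u).1) (fun u => (z u).2) r.toNNReal

lemma abs_compIncr_le {F : ℝ} (hF : ∀ j, |f j| ≤ F)
    (hz : IsCadlag z) {s σ : ℝ≥0} (hs : s ≤ σ) {n : ℝ}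
    (hn : ∫ r in (s : ℝ)..σ, totRate q (z r.toNNReal).1 ≤ n) :
    |compIncr q f s σ z| ≤ 2 * F + 2 * F * n := by
  have hF0 : 0 ≤ F := (abs_nonneg _).trans (hF 0)
  have h1 : |∫ r in (s : ℝ)..σ, jumpOp q f (z r.toNNReal)| ≤ 2 * F * n :=
    (intervalIntegral.abs_integral_le_integral_abs (by exact_mod_cast hs)).trans
      ((integral_abs_jumpOp_le hq hF hz hs).trans (by gcongr))
  refine (abs_sub _ _).trans (add_le_add ((abs_sub _ _).trans ?_) h1)
  linarith [hF (z σ).2, hF (z s).2]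

lemma measurable_compIncr (hZp : CadlagProc Z) (f : Fin (m + 1) → ℝ) {σ τ : Ω → ℝ≥0}
    (hτ : Measurable τ) (hσ : Measurable σ) :
    Measurable fun ω => compIncr q f (τ ω) (σ ω) fun r => Z r ω := by
  have h1 : CadlagProc fun r ω => f (Z r ω).2 :=
    hZp.comp (continuous_of_discreteTopology.comp continuous_snd)
  have h2 := (hZp.comp (hq.continuous_jumpOp f)).primitive 0
  refine ((h1.eval hσ).sub (h1.eval hτ)).sub ?_
  have h3 : ∀ ω, ∫ r in (τ ω : ℝ)..σ ω, jumpOp q f (Z r.toNNReal ω) =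
      (∫ r in (0 : ℝ)..σ ω, jumpOp q f (Z r.toNNReal ω)) -
        ∫ r in (0 : ℝ)..τ ω, jumpOp q f (Z r.toNNReal ω) := fun ω =>
    (intervalIntegral.integral_interval_sub_left
      (((hZp.2 ω).comp (hq.continuous_jumpOp f)).intervalIntegrable _ _)
      (((hZp.2 ω).comp (hq.continuous_jumpOp f)).intervalIntegrable _ _)).symm
  simp only [h3]
  exact (h2.eval hσ).sub (h2.eval hτ)

lemma measurable_indicator_mul_compIncr (hZp : CadlagProc Z) (f : Fin (m + 1) → ℝ)
    {σ τ : Ω → ℝ≥0} (hτ : Measurable τ) (hσ : Measurable σ) (hK : MeasurableSet K) :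
    Measurable fun ω => K.indicator (fun _ => (1 : ℝ)) ω *
      compIncr q f (τ ω) (σ ω) fun r => Z r ω :=
  (measurable_const.indicator hK).mul (measurable_compIncr hq hZp f hτ hσ)

lemma abs_indicator_mul_compIncr_le {F : ℝ} (hF : ∀ j, |f j| ≤ F)
    (hz : IsCadlag z) {s σ : ℝ≥0} (hs : s ≤ σ) (ω : Ω)
    (hn : ∫ r in (s : ℝ)..σ, totRate q (z r.toNNReal).1 ≤ n) :
    |K.indicator (fun _ => (1 : ℝ)) ω * compIncr q f s σ z| ≤ 2 * F + 2 * F * n :=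
  (abs_indicator_one_mul_le K ω _).trans (abs_compIncr_le hq hF hz hs hn)

lemma integrable_compIncr (hZp : CadlagProc Z) (hσ : Measurable σ) (hs : ∀ ω, s ≤ σ ω)
    (hn : ∀ ω, ∫ r in (s : ℝ)..σ ω, totRate q (Z r.toNNReal ω).1 ≤ n) (f : Fin (m + 1) → ℝ) :
    Integrable (fun ω => compIncr q f s (σ ω) fun r => Z r ω) P := by
  obtain ⟨F, -, hF⟩ := exists_bound_fin f
  exact integrable_of_abs_le (measurable_compIncr hq hZp f measurable_const hσ) fun ω =>
    abs_compIncr_le hq hF (hZp.2 ω) (hs ω) (hn ω)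

/-- The increment of the test process of `a.1 ⊗ f`, on the event `K` and between `s` and `σ`,
reduces to that of the compensated chain, if the martingale of the first component and the
compensated chain are orthogonal to each other's integrands. -/
lemma setIntegral_couplOp_eq (hZ : CadlagProc Z) (ha1 : Continuous a.1)
    (ha2 : Continuous a.2) {D : ℝ} (hD0 : 0 ≤ D) (h1 : ∀ x, |a.1 x| ≤ D) (h2 : ∀ x, |a.2 x| ≤ D)
    {M : ℝ≥0 → Ω → ℝ} (hM : testProcess a.1 a.2 (fun t ω => (Z t ω).1) = M) (hK : MeasurableSet K)
    {κ : Ω → ℝ} (hκ : K.indicator (fun _ => 1) = κ) (hσ : Measurable σ) (hs : ∀ ω, s ≤ σ ω)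
    (ht : ∀ ω, σ ω ≤ t) {T : ℝ≥0} (hT : t ≤ T) (hn0 : 0 ≤ n)
    (hn : ∀ ω, ∫ r in (s : ℝ)..σ ω, totRate q (Z r.toNNReal ω).1 ≤ n)
    (e1 : ∫ w, κ w * (f (Z (σ w) w).2 * (M T w - M (σ w) w)) ∂P = 0)
    (e2 : ∫ w, κ w * (f (Z s w).2 * (M T w - M s w)) ∂P = 0) (e4 : ∀ r, s ≤ r → r ≤ t →
      Integrable (fun w => (if r < σ w then κ w * jumpOp q f (Z r w) else 0) * (M T w - M r w)) P →
      ∫ w, (if r < σ w then κ w * jumpOp q f (Z r w) else 0) * (M T w - M r w) ∂P = 0)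
    (e5 : ∀ r, s ≤ r → r ≤ t → Integrable (fun w => if r < σ w then κ w * (a.2 (Z r w).1 *
        compIncr q f r (σ w) fun u => Z u w) else 0) P →
      ∫ w, (if r < σ w then κ w * (a.2 (Z r w).1 *
        compIncr q f r (σ w) fun u => Z u w) else 0) ∂P = 0) :
    Integrable (fun w => κ w * ((M T w + (a.1 (Z 0 w).1 + ∫ r in (0 : ℝ)..s,
      a.2 (Z r.toNNReal w).1)) * compIncr q f s (σ w) fun u => Z u w)) P ∧
    ∫ w in K, (a.1 (Z (σ w) w).1 * f (Z (σ w) w).2 - a.1 (Z s w).1 * f (Z s w).2 -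
      ∫ r in (s : ℝ)..σ w, couplOp q a f (Z r.toNNReal w)) ∂P =
    ∫ w, κ w * ((M T w + (a.1 (Z 0 w).1 + ∫ r in (0 : ℝ)..s,
      a.2 (Z r.toNNReal w).1)) * compIncr q f s (σ w) fun u => Z u w) ∂P := by
  obtain ⟨F, hF0, hF⟩ := exists_bound_fin f
  have hXp : CadlagProc fun t ω => (Z t ω).1 := hZ.comp continuous_fst
  have hMp : CadlagProc M := hM ▸ cadlagProc_testProcess hXp ha1 ha2
  have hκm : Measurable κ := hκ ▸ measurable_const.indicator hK
  have hκle : ∀ w x, |κ w * x| ≤ |x| := fun w x => hκ ▸ abs_indicator_one_mul_le _ _ _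
  have hMb : ∀ r ≤ T, ∀ ω, |M r ω| ≤ 2 * D + D * T := fun r hr ω => by
    rw [← hM]
    refine (abs_testProcess_le h1 h2 r ω).trans ?_
    gcongr
  have hMd : ∀ r ≤ T, ∀ ω, |M T ω - M r ω| ≤ 2 * D + D * T + (2 * D + D * T) := fun r hr ω =>
    (abs_sub _ _).trans (add_le_add (hMb T le_rfl ω) (hMb r hr ω))
  have hσT := fun ω => (ht ω).trans hT
  have hfY : CadlagProc fun r w => f (Z r w).2 :=
    hZ.comp (continuous_of_discreteTopology.comp continuous_snd)
  have hgX : CadlagProc fun r w => a.2 (Z r w).1 := hXp.comp ha2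
  set gen : ℝ≥0 → Ω → ℝ := fun r w => jumpOp q f (Z r w) with hgen
  have hgenp : CadlagProc gen := hZ.comp (hq.continuous_jumpOp f)
  set c : ℝ≥0 → Ω → ℝ := fun r w => f (Z r w).2 - ∫ u in (0 : ℝ)..r, gen u.toNNReal w with hc
  have hcp : CadlagProc c := hfY.sub (hgenp.primitive 0)
  have hcd : ∀ u r w, compIncr q f u r (fun v => Z v w) = c r w - c u w := fun u r w => by
    have hi := fun x y : ℝ => (hgenp.2 w).intervalIntegrable x y
    simp only [compIncr, hc]
    rw [← intervalIntegral.integral_interval_sub_left (hi 0 r) (hi 0 u)]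
    ring
  have hcdiff : ∀ w r, s ≤ r → r ≤ σ w → |c (σ w) w - c r w| ≤ 2 * F + 2 * F * n :=
    fun w r hsr hr => by
      rw [← hcd]
      exact abs_compIncr_le hq hF (hZ.2 w) hr
        (integral_totRate_le hq (hZ.2 w) hsr hr le_rfl (hn w))
  have hMu : ∀ {τ : Ω → ℝ≥0}, Measurable τ → (∀ ω, τ ω ≤ T) →
      Integrable (fun w => κ w * (f (Z (τ w) w).2 * (M T w - M (τ w) w))) P := fun {τ} hτ hτT =>
    integrable_of_abs_le (c := F * (2 * D + D * T + (2 * D + D * T)))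
      (hκm.mul ((hfY.eval hτ).mul ((hMp.1 T).sub (hMp.eval hτ)))) fun w => by
        refine (hκle _ _).trans ?_
        rw [abs_mul]
        exact mul_le_mul (hF _) (hMd _ (hτT w) w) (abs_nonneg _) hF0
  have hΦ4 : CadlagProc fun r w => κ w * (gen r w * (M T w - M r w)) :=
    (CadlagProc.const hκm).mul (hgenp.mul ((CadlagProc.const (hMp.1 T)).sub hMp))
  obtain ⟨i4, e4⟩ := integral_integral_stopped_eq_zero (P := P) hΦ4.uncurry
    (fun w => (hΦ4.2 w).locBdd) hσ hs ht
    (C := 2 * F * n * (2 * D + D * T + (2 * D + D * T))) (fun w => by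
      have h3 : ∫ r in (s : ℝ)..σ w, |κ w * (gen r.toNNReal w * (M T w - M r.toNNReal w))| ≤
          ∫ r in (s : ℝ)..σ w, |gen r.toNNReal w| * (2 * D + D * T + (2 * D + D * T)) := by
        refine intervalIntegral.integral_mono_on (by exact_mod_cast hs w)
          ((hΦ4.2 w).intervalIntegrable _ _).abs
          (((hgenp.2 w).intervalIntegrable _ _).abs.mul_const _) fun r hr => ?_
        refine (hκle _ _).trans ?_
        rw [abs_mul]
        exact mul_le_mul_of_nonneg_left (hMd _
          ((Real.toNNReal_le_iff_le_coe.2 hr.2).trans (hσT _)) w) (abs_nonneg _)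
      refine h3.trans ?_
      rw [intervalIntegral.integral_mul_const]
      exact mul_le_mul_of_nonneg_right ((integral_abs_jumpOp_le hq hF (hZ.2 w) (hs w)).trans
        (mul_le_mul_of_nonneg_left (hn w) (by positivity))) (by positivity))
    (fun r hsr hrt hint => by
      have hrw : ∀ w, (if r < σ w then κ w * (gen r w * (M T w - M r w)) else 0) =
          (if r < σ w then κ w * gen r w else 0) * (M T w - M r w) := fun w => by
        split_ifs <;> ring
      simp only [hrw] at hint ⊢
      exact e4 r hsr hrt hint)
  have hΦ5 : CadlagProc fun r w => κ w * (a.2 (Z r w).1 * (c (σ w) w - c r w)) :=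
    (CadlagProc.const hκm).mul (hgX.mul ((CadlagProc.const (hcp.eval hσ)).sub hcp))
  simp only [hcd] at e5 ⊢
  obtain ⟨i5, e5⟩ := integral_integral_stopped_eq_zero (P := P) hΦ5.uncurry
    (fun w => (hΦ5.2 w).locBdd) hσ hs ht (C := D * (2 * F + 2 * F * n) * t) (fun w => by
      have h3 := intervalIntegral.norm_integral_le_of_norm_le_const (a := (s : ℝ)) (b := σ w)
        (f := fun r => |κ w * (a.2 (Z r.toNNReal w).1 * (c (σ w) w - c r.toNNReal w))|)
        (C := D * (2 * F + 2 * F * n)) fun r hr => by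
          rw [Set.uIoc_of_le (by exact_mod_cast hs w)] at hr
          rw [Real.norm_eq_abs, abs_abs]
          refine (hκle _ _).trans ?_
          rw [abs_mul]
          exact mul_le_mul (h2 _) (hcdiff w _ (NNReal.le_toNNReal_of_coe_le hr.1.le)
            (Real.toNNReal_le_iff_le_coe.2 hr.2)) (abs_nonneg _) hD0
      refine (le_abs_self _).trans (h3.trans ?_)
      have h6 : |(σ w : ℝ) - s| ≤ t := by
        rw [abs_of_nonneg (sub_nonneg.2 (by exact_mod_cast hs w))]
        exact (sub_le_self _ s.coe_nonneg).trans (NNReal.coe_le_coe.2 (ht w))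
      gcongr) e5
  have hW : Measurable fun w => M T w + (a.1 (Z 0 w).1 + ∫ r in (0 : ℝ)..s, a.2 (Z r.toNNReal w).1) :=
    (hMp.1 T).add ((ha1.measurable.comp (hXp.1 0)).add ((hgX.primitive 0).1 s))
  have i3 : Integrable (fun w => κ w * ((M T w + (a.1 (Z 0 w).1 + ∫ r in (0 : ℝ)..s,
      a.2 (Z r.toNNReal w).1)) * (c (σ w) w - c s w))) P := by
    refine integrable_of_abs_le (c := (2 * D + D * T + (D + D * s)) * (2 * F + 2 * F * n))
      (hκm.mul (hW.mul ((hcp.eval hσ).sub (hcp.1 s)))) fun w => ?_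
    refine (hκle _ _).trans ?_
    rw [abs_mul]
    have h5 := intervalIntegral.norm_integral_le_of_norm_le_const (a := (0 : ℝ)) (b := s)
      (f := fun r => a.2 (Z r.toNNReal w).1) (C := D) fun r _ => h2 _
    simp only [Real.norm_eq_abs, sub_zero, NNReal.abs_eq] at h5
    exact mul_le_mul ((abs_add_le _ _).trans (add_le_add (hMb T le_rfl _)
      ((abs_add_le _ _).trans (add_le_add (h1 _) h5)))) (hcdiff w s le_rfl (hs _)) (abs_nonneg _)
      (by positivity)
  refine ⟨i3, ?_⟩
  have i1 := hMu hσ hσT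
  have i2 := hMu measurable_const fun w => (hs w).trans (hσT w)
  -- Of the five terms of the pathwise decomposition, the three with increments of `M` and the time
  -- integral with increments of `c` have mean zero; the one that remains is the right hand side of
  -- the claim.
  have hpath := fun w => product_increment_eq ((hXp.comp ha1).2 w) (hgX.2 w) (hfY.2 w) (hgenp.2 w)
    (M := fun r => M r w) (c := fun r => c r w) (fun r => by rw [← hM]; rfl) (fun _ => rfl) (hs w) T
  rw [← integral_indicator hK, ← integral_neg_add_eq i1 i2 i3 i4 i5 e1 e2 e4 e5]
  congr 1
  ext w
  simp only [intervalIntegral.integral_const_mul, ← hκ]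
  by_cases hw : w ∈ K
  · simp only [Set.indicator_of_mem hw, one_mul]
    exact hpath w
  · simp [hw]

end CompensatedChain

/-! ### The chain driven by a process and independent Poisson clocks -/

section DrivenProcess

/-- The chain driven by `X` and a family of counting paths. -/
noncomputable def drivenY (q : OffDiag m → E → ℝ) (X : ℝ≥0 → Ω → E) (k : Fin (m + 1)) (t : ℝ≥0)
    (w : Ω × CountSpace m) : Fin (m + 1) := sol (pathRate q fun s => X s w.1) w.2.1 k t

/-- The driving process together with the driven chain. -/
noncomputable def drivenZ (q : OffDiag m → E → ℝ) (X : ℝ≥0 → Ω → E) (k : Fin (m + 1)) (t : ℝ≥0)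
    (w : Ω × CountSpace m) : E × Fin (m + 1) := (X t w.1, drivenY q X k t w)

/-- The event that the path of the coupled process up to time `s` belongs to `B`. -/
def pastSet (q : OffDiag m → E → ℝ) (X : ℝ≥0 → Ω → E) (k : Fin (m + 1)) (s : ℝ≥0)
    (B : Set (Set.Iic s → E × Fin (m + 1))) : Set (Ω × CountSpace m) :=
  {w | (fun r : Set.Iic s => drivenZ q X k r w) ∈ B}

include hq hXc

lemma cadlagProc_drivenY (hXm : ∀ t, Measurable (X t)) : CadlagProc (drivenY q X k) :=
  hq.cadlagProc_sol (X := fun t (w : Ω × CountSpace m) => X t w.1) (fun w => hXc w.1)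
    (fun u => (hXm u).comp measurable_fst) measurable_snd measurable_const

lemma cadlagProc_drivenZ (hXm : ∀ t, Measurable (X t)) : CadlagProc (drivenZ q X k) :=
  (CadlagProc.comp_left ⟨hXm, hXc⟩ measurable_fst).prodMk (cadlagProc_drivenY hq hXc hXm)

lemma measurableSet_pastSet (hXm : ∀ t, Measurable (X t)) {s : ℝ≥0}
    {B : Set (Set.Iic s → E × Fin (m + 1))} (hB : MeasurableSet B) :
    MeasurableSet (pastSet q X k s B) :=
  (measurable_pi_iff.2 fun r : Set.Iic s => (cadlagProc_drivenZ hq hXc hXm).1 r :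
    Measurable fun w (r : Set.Iic s) => drivenZ q X k r w) hB

lemma determined_pastSet {s : ℝ≥0} {B : Set (Set.Iic s → E × Fin (m + 1))} (hB : MeasurableSet B)
    (ω : Ω) : Determined (pathRate q fun s => X s ω) k s {N | (ω, N) ∈ pastSet q X k s B} := by
  have h1 : Measurable fun (y : Set.Iic s → Fin (m + 1)) (r : Set.Iic s) => (X r ω, y r) :=
    measurable_pi_iff.2 fun r => measurable_const.prodMk (measurable_pi_apply r)
  exact determined_sol (hq.ratePath (hXc ω)) s (h1 hB)

omit [MeasurableSpace Ω] in
/-- The driven chain at time `r` is adapted for fixed counting paths. -/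
lemma measurable_drivenY_section {mΩ : MeasurableSpace Ω} {r : ℝ≥0}
    (h : ∀ u ≤ r, Measurable[mΩ] (X u)) (N : CountSpace m) :
    Measurable[mΩ] fun ω => drivenY q X k r (ω, N) :=
  hq.measurable_sol_of_le hXc h measurable_const measurable_const

omit [MeasurableSpace Ω] in
lemma measurableSet_pastSet_section {mΩ : MeasurableSpace Ω} {s : ℝ≥0}
    (h : ∀ u ≤ s, Measurable[mΩ] (X u)) {B : Set (Set.Iic s → E × Fin (m + 1))}
    (hB : MeasurableSet B) (N : CountSpace m) :
    MeasurableSet[mΩ] {ω | (ω, N) ∈ pastSet q X k s B} := by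
  have h1 : Measurable fun ω (r : Set.Iic s) => drivenZ q X k r (ω, N) :=
    measurable_pi_iff.2 fun r => (h r r.2).prodMk
      (measurable_drivenY_section hq hXc (fun u hu => h u (hu.trans r.2)) N)
  exact h1 hB

omit [MeasurableSpace Ω] in
lemma measurable_totClk_section {mΩ : MeasurableSpace Ω} {r : ℝ≥0}
    (h : ∀ u ≤ r, Measurable[mΩ] (X u)) : Measurable[mΩ] fun ω => totClk q (fun s => X s ω) r :=
  hq.measurable_totClk_of_le hXc h

omit hq hXc

omit [IsProbabilityMeasure P] in
lemma measurable_natural {u r : ℝ≥0} (hXm : ∀ t, Measurable (X t)) (hur : u ≤ r) :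
    Measurable[naturalFiltration X hXm r] (X u) :=
  ((Filtration.stronglyAdapted_natural fun t => (hXm t).stronglyMeasurable) u).measurable.mono
    ((naturalFiltration X hXm).mono hur) le_rfl

include hq hXc

lemma isStoppingTime_capT (n : ℕ) (s t : ℝ≥0) : IsStoppingTime (naturalFiltration X hXm)
      fun ω => (capT (totClk q fun r => X r ω) n s t : WithTop ℝ≥0) := by
  intro r
  simp only [WithTop.coe_le_coe,
    capT_le_iff (hq.continuous_totClk (hXc _)) (hq.monotone_totClk (hXc _))]
  exact (MeasurableSet.const _).inter ((MeasurableSet.const _).union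
    (measurableSet_le measurable_const
      (measurable_totClk_section hq hXc fun u hu => measurable_natural hXm hu)))

/-- The compensated chain has orthogonal increments given the driving process. -/
lemma integral_past_compIncr_eq_zero (f : Fin (m + 1) → ℝ) {s : ℝ≥0}
    {B : Set (Set.Iic s → E × Fin (m + 1))} (hB : MeasurableSet B) {W : Ω → ℝ}
    {τ₁ τ₂ : Ω → ℝ≥0} (h₁ : ∀ ω, s ≤ τ₁ ω) (h₂ : ∀ ω, s ≤ τ₂ ω)
    (hint : Integrable (fun w : Ω × CountSpace m => (pastSet q X k s B).indicator (fun _ => 1) w *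
      (W w.1 * compIncr q f (τ₁ w.1) (τ₂ w.1) fun r => drivenZ q X k r w))
      (P.prod (countMeasure m))) :
    ∫ w : Ω × CountSpace m, (pastSet q X k s B).indicator (fun _ => 1) w *
      (W w.1 * compIncr q f (τ₁ w.1) (τ₂ w.1) fun r => drivenZ q X k r w)
      ∂(P.prod (countMeasure m)) = 0 := by
  -- The counting paths are integrated first, with the driving path fixed. The times `τ₁`, `τ₂` and
  -- the weight `W` are then constants, and the past event is determined by the counting paths up to
  -- the clocks at time `s`.
  rw [integral_prod _ hint]
  refine integral_eq_zero_of_ae (.of_forall fun ω => ?_)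
  have hl := hq.ratePath (hXc ω)
  have hA := determined_pastSet (k := k) hq hXc hB ω
  set c : ℝ≥0 → CountSpace m → ℝ := fun r N =>
    compens (pathRate q fun r => X r ω) f (sol (pathRate q fun r => X r ω) N.1 k) r with hc
  have h3 : ∀ r, s ≤ r → ∫ N in {N | (ω, N) ∈ pastSet q X k s B}, c s N ∂(countMeasure m) =
      ∫ N in {N | (ω, N) ∈ pastSet q X k s B}, c r N ∂(countMeasure m) :=
    fun r hr => setIntegral_compens_eq hl k f hr hA
  have hbd : ∀ r, Integrable (c r)
      ((countMeasure m).restrict {N | (ω, N) ∈ pastSet q X k s B}) := fun r => by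
    obtain ⟨L, hL⟩ := hl.exists_bound r
    obtain ⟨F, -, hF⟩ := exists_bound_fin f
    exact integrable_of_abs_le (measurable_compens_count hl k f r) fun N => abs_compens_le hl hF hL _
  have h4 : ∀ N : CountSpace m, (pastSet q X k s B).indicator (fun _ => (1 : ℝ)) (ω, N) * (W ω *
        compIncr q f (τ₁ ω) (τ₂ ω) fun r => drivenZ q X k r (ω, N)) =
      {N | (ω, N) ∈ pastSet q X k s B}.indicator (fun N => W ω * (c (τ₂ ω) N - c (τ₁ ω) N)) N := by
    intro N
    have hi := fun u v : ℝ => (locBdd_genRate hl f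
      (measurable_sol_path (z := ((k : ℕ) : ℤ)) hl N.2)).intervalIntegrable u v
    have h6 : compIncr q f (τ₁ ω) (τ₂ ω) (fun r => drivenZ q X k r (ω, N)) =
        c (τ₂ ω) N - c (τ₁ ω) N := by
      simp only [hc, compens]
      rw [sub_sub_sub_comm, intervalIntegral.integral_interval_sub_left (hi 0 _) (hi 0 _)]
      rfl
    by_cases h5 : (ω, N) ∈ pastSet q X k s B <;> simp [h5, h6]
  simp only [h4]
  rw [integral_indicator hA.1, integral_const_mul, integral_sub (hbd _) (hbd _),
    ← h3 _ (h₁ ω), ← h3 _ (h₂ ω), sub_self, mul_zero]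
  rfl

end DrivenProcess

/-! ### The stopped product identities for the driven process -/

section DrivenStoppedId

include hq hXc

/-- With the counting paths fixed, the chain is a right continuous process adapted to the filtration
of `X`, and so is the past event. Optional stopping on `Ω` applies for every choice of counting
paths, and these are integrated last. -/
lemma integral_past_mul_martingale_eq_zero {M : ℝ≥0 → Ω → ℝ}
    (hM : Martingale M (naturalFiltration X hXm) P) (hMc : CadlagProc M) {b : ℝ} {t : ℝ≥0}
    (hMb : ∀ r ≤ t, ∀ ω, |M r ω| ≤ b) (f : Fin (m + 1) → ℝ) {s : ℝ≥0}
    {B : Set (Set.Iic s → E × Fin (m + 1))} (hB : MeasurableSet B) {σ : Ω → ℝ≥0}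
    (hσ : IsStop (naturalFiltration X hXm) σ) (hs : ∀ ω, s ≤ σ ω) (ht : ∀ ω, σ ω ≤ t) :
    ∫ w : Ω × CountSpace m, (pastSet q X k s B).indicator (fun _ => (1 : ℝ)) w *
      (f (drivenY q X k (σ w.1) w) * (M t w.1 - M (σ w.1) w.1)) ∂(P.prod (countMeasure m)) = 0 := by
  obtain ⟨F, hF0, hF⟩ := exists_bound_fin f
  have hσm : Measurable σ := measurable_of_isStoppingTime hσ
  have hK := measurableSet_pastSet (k := k) hq hXc hXm hB
  have hY : CadlagProc fun r w => f (drivenY q X k r w) :=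
    (cadlagProc_drivenY hq hXc hXm).comp continuous_of_discreteTopology
  have hfm : Measurable fun w : Ω × CountSpace m => f (drivenY q X k (σ w.1) w) :=
    hY.eval (σ := fun w => σ w.1) (hσm.comp measurable_fst)
  have hint : Integrable (fun w : Ω × CountSpace m =>
      (pastSet q X k s B).indicator (fun _ => (1 : ℝ)) w *
        (f (drivenY q X k (σ w.1) w) * (M t w.1 - M (σ w.1) w.1))) (P.prod (countMeasure m)) := by
    refine integrable_of_abs_le (c := F * (b + b)) ((measurable_const.indicator hK).mul
      (hfm.mul (((hMc.1 t).sub (hMc.eval hσm)).comp measurable_fst))) fun w => ?_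
    refine (abs_indicator_one_mul_le _ _ _).trans ?_
    rw [abs_mul]
    exact mul_le_mul (hF _) ((abs_sub _ _).trans (add_le_add (hMb t le_rfl _) (hMb _ (ht _) _)))
      (abs_nonneg _) hF0
  rw [integral_prod_symm _ hint]
  refine integral_eq_zero_of_ae (.of_forall fun N => ?_)
  have h1 := (integral_mul_sub_stopped_eq_zero hM (fun ω => (hMc.2 ω).rightCont) hσ hs ht
    (G := fun r ω => (pastSet q X k s B).indicator (fun _ => (1 : ℝ)) (ω, N) *
      f (drivenY q X k r (ω, N))) (fun r hr => ?_) (fun ω r _ => ?_) (C := F) fun r ω => ?_).2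
  · simp only [mul_assoc] at h1
    exact h1
  · have hs1 : MeasurableSet[naturalFiltration X hXm r] {ω | (ω, N) ∈ pastSet q X k s B} :=
      measurableSet_pastSet_section hq hXc
        (fun u hu => measurable_natural hXm (hu.trans hr)) hB N
    have hs2 : Measurable[naturalFiltration X hXm r] fun ω => drivenY q X k r (ω, N) :=
      measurable_drivenY_section hq hXc (fun u hu => measurable_natural hXm hu) N
    exact (measurable_const.indicator hs1).mul ((measurable_of_countable f).comp hs2)
  · exact continuousWithinAt_const.mul ((hY.2 (ω, N)).rightCont r)
  · exact (abs_indicator_one_mul_le _ _ _).trans (hF _)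

lemma integral_past_mul_adapted_eq_zero {M : ℝ≥0 → Ω → ℝ}
    (hM : Martingale M (naturalFiltration X hXm) P) {r t : ℝ≥0} (hrt : r ≤ t)
    {U : Ω × CountSpace m → ℝ} (hU : ∀ N, Measurable[naturalFiltration X hXm r] fun ω => U (ω, N))
    (hint : Integrable (fun w => U w * (M t w.1 - M r w.1)) (P.prod (countMeasure m))) :
    ∫ w, U w * (M t w.1 - M r w.1) ∂(P.prod (countMeasure m)) = 0 := by
  rw [integral_prod_symm _ hint]
  refine integral_eq_zero_of_ae ?_
  filter_upwards [hint.prod_left_ae] with N hN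
  exact integral_mul_martingale_sub_eq_zero hM hrt (hU N) hN

/-- The coupled process satisfies the stopped martingale identities. -/
theorem stoppedId_drivenZ {A : Set ((E → ℝ) × (E → ℝ))}
    (hA : A ⊆ boundedContinuous E ×ˢ boundedContinuous E)
    (hM : ∀ a ∈ A, Martingale (testProcess a.1 a.2 X) (naturalFiltration X hXm) P) :
    StoppedId A q (drivenZ q X k) (P.prod (countMeasure m)) := by
  intro a ha f n s t hst B hB
  obtain ⟨⟨ha1, -⟩, ha2, -⟩ := hA ha
  obtain ⟨D, hD0, h1, h2⟩ := exists_bound_pair hA ha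
  have hMm := hM a ha
  have hMp : CadlagProc (testProcess a.1 a.2 X) := cadlagProc_testProcess ⟨hXm, hXc⟩ ha1 ha2
  have hMb : ∀ r ≤ t, ∀ ω, |(testProcess a.1 a.2 X r ω)| ≤ 2 * D + D * t := fun r hr ω => by
    refine (abs_testProcess_le h1 h2 r ω).trans ?_
    gcongr
  set σ : Ω → ℝ≥0 := fun ω => capT (totClk q fun r => X r ω) n s t with hσdef
  have hσ : IsStop (naturalFiltration X hXm) σ :=
    isStoppingTime_capT hq hXm hXc n s t
  have hσs : ∀ ω, s ≤ σ ω := fun ω => le_capT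
  have hσt : ∀ ω, σ ω ≤ t := fun ω => capT_le hst
  obtain ⟨i3, e⟩ := setIntegral_couplOp_eq (P := P.prod (countMeasure m)) (f := f) (σ := fun w => σ w.1)
    (n := n) hq (cadlagProc_drivenZ (k := k) hq hXc hXm) ha1 ha2 hD0 h1 h2
    (M := fun r w => testProcess a.1 a.2 X r w.1) rfl
    (measurableSet_pastSet (k := k) hq hXc hXm hB) rfl
    ((measurable_of_isStoppingTime hσ).comp measurable_fst) (fun w => hσs w.1) (fun w => hσt w.1)
    le_rfl n.cast_nonneg (fun w => by
      refine (hq.totClk_sub (hXc w.1) _ _).symm.trans_le ?_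
      exact apply_capT_sub_le (hq.continuous_totClk (hXc w.1)) (hq.monotone_totClk (hXc w.1))
        (hq.totClk_nonneg _))
    (integral_past_mul_martingale_eq_zero hq hXm hXc hMm hMp hMb f hB hσ hσs hσt)
    (integral_past_mul_martingale_eq_zero (σ := fun _ => s) hq hXm hXc hMm hMp hMb f hB
      (isStoppingTime_const _ s) (fun _ => le_rfl) fun _ => hst)
    (fun r hsr hrt hint => by
      refine integral_past_mul_adapted_eq_zero hq hXm hXc hMm hrt (fun N => ?_) hint
      have hs1 : MeasurableSet[naturalFiltration X hXm r] {ω | (ω, N) ∈ pastSet q X k s B} :=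
        measurableSet_pastSet_section hq hXc
          (fun u hu => measurable_natural hXm (hu.trans hsr)) hB N
      have hs2 : Measurable[naturalFiltration X hXm r] fun ω => drivenY q X k r (ω, N) :=
        measurable_drivenY_section hq hXc (fun u hu => measurable_natural hXm hu) N
      exact Measurable.ite (hσ.measurableSet_lt r)
        ((measurable_const.indicator hs1).mul ((hq.continuous_jumpOp f).measurable.comp
          ((measurable_natural hXm le_rfl).prodMk hs2))) measurable_const)
    (fun r hsr hrt hint => by
      have hrw : ∀ w : Ω × CountSpace m, (if r < σ w.1 then
          (pastSet q X k s B).indicator (fun _ => 1) w * (a.2 (drivenZ q X k r w).1 *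
            compIncr q f r (σ w.1) fun u => drivenZ q X k u w) else 0) =
          (pastSet q X k s B).indicator (fun _ => 1) w * ((if r < σ w.1 then a.2 (X r w.1) else 0) *
            compIncr q f (min r (σ w.1)) (σ w.1) fun u => drivenZ q X k u w) := fun w => by
        split_ifs with h
        · rw [min_eq_left h.le]
          rfl
        · simp
      simp only [hrw] at hint ⊢
      exact integral_past_compIncr_eq_zero (W := fun ω => if r < σ ω then a.2 (X r ω) else 0)
        (τ₁ := fun ω => min r (σ ω)) hq hXc f hB (fun ω => le_min hsr (hσs ω)) hσs hint)
  -- What is left is the compensated increment weighted by a functional of `X` alone, which vanishes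
  -- once the counting paths are integrated.
  exact e.trans (integral_past_compIncr_eq_zero (τ₁ := fun _ => s) (W := fun ω =>
    testProcess a.1 a.2 X t ω + (a.1 (X 0 ω) + ∫ r in (0 : ℝ)..s, a.2 (X r.toNNReal ω))) hq hXc f hB
    (fun _ => le_rfl) hσs i3)

end DrivenStoppedId

/-! ### Natural filtrations and a criterion for martingales -/

section NaturalFiltration

variable {S : Type*} [TopologicalSpace S] [TopologicalSpace.MetrizableSpace S]
  [SecondCountableTopology S] [MeasurableSpace S] [BorelSpace S]
  {Ω : Type*} [MeasurableSpace Ω] {Z : ℝ≥0 → Ω → S}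

lemma measurableSet_natural_iff (hZ : ∀ t, Measurable (Z t)) {s : ℝ≥0} {K : Set Ω} :
    MeasurableSet[naturalFiltration Z hZ s] K ↔
      ∃ B : Set (Set.Iic s → S), MeasurableSet B ∧ {ω | (fun r : Set.Iic s => Z r ω) ∈ B} = K := by
  rw [naturalFiltration, Filtration.natural_eq_comap]
  exact Iff.rfl

lemma measurable_natural' (hZ : ∀ t, Measurable (Z t)) {u r : ℝ≥0} (hur : u ≤ r) :
    Measurable[naturalFiltration Z hZ r] (Z u) :=
  ((Filtration.stronglyAdapted_natural fun t => (hZ t).stronglyMeasurable) u).measurable.mono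
    ((naturalFiltration Z hZ).mono hur) le_rfl

end NaturalFiltration

section MartingaleCriterion

variable {Ω : Type*} {mΩ : MeasurableSpace Ω} {P : Measure Ω} [IsFiniteMeasure P]
  {ℱ : Filtration ℝ≥0 mΩ} {M : ℝ≥0 → Ω → ℝ}

lemma martingale_of_setIntegral_eq (had : ∀ t, Measurable[ℱ t] (M t))
    (hint : ∀ t, Integrable (M t) P)
    (h : ∀ s t, s ≤ t → ∀ K, MeasurableSet[ℱ s] K → ∫ ω in K, M s ω ∂P = ∫ ω in K, M t ω ∂P) :
    Martingale M ℱ P := by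
  refine ⟨fun t => (had t).stronglyMeasurable, fun s t hst => ?_⟩
  exact (ae_eq_condExp_of_forall_setIntegral_eq (ℱ.le s) (hint t)
    (fun _ _ _ => (hint s).integrableOn) (fun K hK _ => h s t hst K hK)
    (had s).stronglyMeasurable.aestronglyMeasurable).symm

lemma Martingale.setIntegral_sub_eq_zero (hM : Martingale M ℱ P) {s t : ℝ≥0} (hst : s ≤ t)
    {K : Set Ω} (hK : MeasurableSet[ℱ s] K) : ∫ ω in K, (M t ω - M s ω) ∂P = 0 := by
  rw [integral_sub (hM.integrable t).integrableOn (hM.integrable s).integrableOn,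
    hM.setIntegral_eq hst hK, sub_self]

end MartingaleCriterion

/-! ### From the stopped identities to the local martingale problem -/

section StoppedId

/-- The coupled generator for general rate functions. -/
def couplGen (A : Set ((E → ℝ) × (E → ℝ))) (q : OffDiag m → E → ℝ) :
    Set ((E × Fin (m + 1) → ℝ) × (E × Fin (m + 1) → ℝ)) :=
  {p | ∃ a ∈ A, ∃ f : Fin (m + 1) → ℝ, p = (fun z => a.1 z.1 * f z.2, couplOp q a f)}

lemma hit_mono_level {C : ℝ≥0 → ℝ} (hc : Continuous C) (hm : Monotone C) :
    Monotone fun n => hit C n := by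
  intro n n' hn
  change hit C n ≤ hit C n'
  cases h : hit C n' with
  | top => exact le_top
  | coe r =>
    rw [hit_le_iff hc hm]
    exact (Nat.cast_le.2 hn).trans ((hit_le_iff hc hm).1 h.le)

lemma tendsto_hit_top {C : ℝ≥0 → ℝ} (hc : Continuous C) (hm : Monotone C) :
    Tendsto (fun n => hit C n) atTop (𝓝 ⊤) := by
  refine tendsto_order.2 ⟨fun w hw => ?_, fun w hw => absurd hw not_top_lt⟩
  lift w to ℝ≥0 using hw.ne
  obtain ⟨n₀, hn₀⟩ := exists_nat_gt (C w)
  filter_upwards [eventually_ge_atTop n₀] with n hn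
  rw [← not_le, hit_le_iff hc hm, not_le]
  exact hn₀.trans_le (Nat.cast_le.2 hn)

lemma LocBdd.capped {x : ℝ≥0 → ℝ} (hx : LocBdd x) (t : ℝ≥0) : LocBdd fun r => x (min r t) := by
  refine ⟨hx.measurable.comp (by fun_prop), fun T => ?_⟩
  obtain ⟨C, hC⟩ := hx.bdd t
  exact ⟨C, fun s _ => hC _ (min_le_right _ _)⟩

include hq

lemma continuous_couplOp (ha₁ : Continuous a.1) (ha₂ : Continuous a.2)
    (f : Fin (m + 1) → ℝ) : Continuous (couplOp q a f) :=
  ((continuous_of_discreteTopology.comp continuous_snd).mul (ha₂.comp continuous_fst)).add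
    ((ha₁.comp continuous_fst).mul (hq.continuous_jumpOp f))

lemma abs_couplOp_le {f : Fin (m + 1) → ℝ} {D F : ℝ}
    (h₁ : ∀ x, |a.1 x| ≤ D) (h₂ : ∀ x, |a.2 x| ≤ D) (hF : ∀ j, |f j| ≤ F) (z : E × Fin (m + 1)) :
    |couplOp q a f z| ≤ F * D + 2 * F * D * totRate q z.1 := by
  have h3 : |jumpOp q f z| ≤ 2 * F * totRate q z.1 :=
    hq.abs_genRate_le hF (fun _ => z.1) (fun _ => z.2) 0
  have hF0 := (abs_nonneg _).trans (hF z.2)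
  have hD0 := (abs_nonneg _).trans (h₁ z.1)
  refine (abs_add_le _ _).trans (add_le_add ?_ ?_)
  · rw [abs_mul]
    exact mul_le_mul (hF _) (h₂ _) (abs_nonneg _) hF0
  · rw [abs_mul]
    refine (mul_le_mul (h₁ _) h3 (abs_nonneg _) hD0).trans_eq ?_
    ring

lemma integral_abs_couplOp_le {f : Fin (m + 1) → ℝ} {D F n : ℝ}
    (hD : 0 ≤ D) (hF0 : 0 ≤ F) (ha₁ : Continuous a.1) (ha₂ : Continuous a.2)
    (h₁ : ∀ x, |a.1 x| ≤ D) (h₂ : ∀ x, |a.2 x| ≤ D) (hF : ∀ j, |f j| ≤ F) {s t σ : ℝ≥0}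
    (hs : s ≤ σ) (ht : σ ≤ t) (hz : IsCadlag z)
    (hn : ∫ r in (s : ℝ)..σ, totRate q (z r.toNNReal).1 ≤ n) :
    ∫ r in (s : ℝ)..σ, |couplOp q a f (z r.toNNReal)| ≤ F * D * t + 2 * F * D * n := by
  have hi := totRate_intervalIntegrable hq hz s σ
  refine (intervalIntegral.integral_mono_on (by exact_mod_cast hs)
    ((hz.comp (continuous_couplOp hq ha₁ ha₂ f)).intervalIntegrable s σ).abs
    (intervalIntegrable_const.add (hi.const_mul _))
    fun r _ => abs_couplOp_le hq h₁ h₂ hF (z r.toNNReal)).trans ?_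
  rw [intervalIntegral.integral_add intervalIntegrable_const (hi.const_mul _),
    intervalIntegral.integral_const, intervalIntegral.integral_const_mul, smul_eq_mul, mul_comm]
  have h6 : (σ : ℝ) - s ≤ t := (sub_le_self _ s.coe_nonneg).trans (NNReal.coe_le_coe.2 ht)
  gcongr

/-- A continuous functional of the coupled process, integrated until the clock rings, is bounded. -/
lemma abs_stoppedIncr_le {f : Fin (m + 1) → ℝ} {D F : ℝ}
    (hD : 0 ≤ D) (hF0 : 0 ≤ F) (ha₁ : Continuous a.1) (ha₂ : Continuous a.2)
    (h₁ : ∀ x, |a.1 x| ≤ D) (h₂ : ∀ x, |a.2 x| ≤ D) (hF : ∀ j, |f j| ≤ F) (n : ℕ) {s t : ℝ≥0}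
    (hst : s ≤ t) (hz : IsCadlag z) :
    |stoppedIncr q a f n s t z| ≤ 2 * (D * F) + (F * D * t + 2 * F * D * n) := by
  set C := totClk q fun r => (z r).1 with hC
  have hc := hq.continuous_totClk hz.fst
  have hm := hq.monotone_totClk hz.fst
  have hs : s ≤ capT C n s t := le_capT
  have ht : capT C n s t ≤ t := capT_le hst
  have hb : ∀ z : E × Fin (m + 1), |a.1 z.1 * f z.2| ≤ D * F := fun z => by
    rw [abs_mul]
    exact mul_le_mul (h₁ _) (hF _) (abs_nonneg _) hD
  have h4 := (intervalIntegral.abs_integral_le_integral_abs (by exact_mod_cast hs)).trans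
    (integral_abs_couplOp_le (n := n) hq hD hF0 ha₁ ha₂ h₁ h₂ hF hs ht hz (by
      rw [← hq.totClk_sub hz.fst]
      exact apply_capT_sub_le hc hm (hq.totClk_nonneg _)))
  have h8 := abs_sub (a.1 (z (capT C n s t)).1 * f (z (capT C n s t)).2 - a.1 (z s).1 * f (z s).2)
    (∫ r in (s : ℝ)..capT C n s t, couplOp q a f (z r.toNNReal))
  have h9 := abs_sub (a.1 (z (capT C n s t)).1 * f (z (capT C n s t)).2) (a.1 (z s).1 * f (z s).2)
  have := hb (z (capT C n s t))
  have := hb (z s)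
  unfold stoppedIncr
  linarith

/-- If the total clock has reached `n` by time `s`, both stopped paths are frozen from `s` on and
the second increment is zero; if not, the capped times seen from `0` and from `s` coincide. -/
lemma stoppedIncr_add {f : Fin (m + 1) → ℝ} (ha₁ : Continuous a.1)
    (ha₂ : Continuous a.2) (n : ℕ) {s t : ℝ≥0} (hst : s ≤ t) (hz : IsCadlag z) :
    stoppedIncr q a f n 0 t z = stoppedIncr q a f n 0 s z + stoppedIncr q a f n s t z := by
  set C := totClk q fun r => (z r).1 with hC
  have hc := hq.continuous_totClk hz.fst
  have hm := hq.monotone_totClk hz.fst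
  have hi := fun u v : ℝ => (hz.comp (continuous_couplOp hq ha₁ ha₂ f)).intervalIntegrable u v
  rcases le_or_gt (n : ℝ) (C s) with h | h
  · have e1 : capT C n s t = s := le_antisymm
      ((capT_le_iff hc hm).2 ⟨le_rfl, .inr h⟩) le_capT
    have e2 : capT C n 0 t = capT C n 0 s := by
      refine le_antisymm ((capT_le_iff hc hm).2 ⟨zero_le, .inr ?_⟩)
        ((capT_le_iff hc hm).2 ⟨zero_le, ?_⟩)
      · rcases ((capT_le_iff (n := n) (s := 0) (t := s) hc hm).1 le_rfl).2 with h' | h'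
        · exact h.trans (hm h')
        · exact h'
      · rcases ((capT_le_iff (n := n) (s := 0) (t := t) hc hm).1 le_rfl).2 with h' | h'
        · exact .inl (hst.trans h')
        · exact .inr h'
    simp only [stoppedIncr, ← hC, e1, e2]
    simp
  · have e0 : capT C n 0 s = s := by
      refine le_antisymm (capT_le zero_le) (le_of_not_gt fun h' => ?_)
      rcases ((capT_le_iff (n := n) (s := 0) (t := s) hc hm).1 le_rfl).2 with h'' | h''
      · exact absurd h' (not_lt.2 h'')
      · exact absurd (h''.trans (hm h'.le)) (not_le.2 h)
    have e1 : capT C n s t = capT C n 0 t := by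
      refine le_antisymm ((capT_le_iff hc hm).2 ⟨?_, ?_⟩) ((capT_le_iff hc hm).2 ⟨zero_le, ?_⟩)
      · refine le_of_not_gt fun h' => ?_
        rcases ((capT_le_iff (n := n) (s := 0) (t := t) hc hm).1 le_rfl).2 with h'' | h''
        · exact absurd (hst.trans h'') (not_le.2 h')
        · exact absurd (h''.trans (hm h'.le)) (not_le.2 h)
      · exact ((capT_le_iff (n := n) (s := 0) (t := t) hc hm).1 le_rfl).2
      · exact ((capT_le_iff (n := n) (s := s) (t := t) hc hm).1 le_rfl).2
    simp only [stoppedIncr, ← hC, e0, e1, NNReal.coe_zero]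
    rw [← intervalIntegral.integral_add_adjacent_intervals (hi 0 s) (hi s _)]
    ring

omit [MeasurableSpace Ω] in
lemma measurable_stoppedIncr_of_le {mΩ : MeasurableSpace Ω}
    {f : Fin (m + 1) → ℝ} (ha₁ : Continuous a.1) (ha₂ : Continuous a.2) (n : ℕ) {s t : ℝ≥0}
    (hst : s ≤ t) (hZm : ∀ u ≤ t, Measurable[mΩ] (Z u)) (hZc : ∀ ω, IsCadlag fun t => Z t ω) :
    Measurable[mΩ] fun ω => stoppedIncr q a f n s t fun r => Z r ω := by
  have hcap : Measurable[mΩ] fun ω => capT (totClk q fun r => (Z r ω).1) n s t := by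
    refine measurable_of_Iic fun r => ?_
    have h1 : (fun ω => capT (totClk q fun r => (Z r ω).1) n s t) ⁻¹' Set.Iic r =
        {ω | s ≤ r ∧ (t ≤ r ∨ (n : ℝ) ≤ totClk q (fun r => (Z r ω).1) r)} := by
      ext ω
      exact capT_le_iff (hq.continuous_totClk (hZc ω).fst) (hq.monotone_totClk (hZc ω).fst)
    rw [h1]
    rcases le_or_gt t r with h | h
    · simp [h]
    · exact (MeasurableSet.const _).inter ((MeasurableSet.const _).union
        (measurableSet_le measurable_const (hq.measurable_totClk_of_le (fun ω => (hZc ω).fst)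
          fun u hu => (hZm u (hu.trans h.le)).fst)))
  obtain ⟨h1, h2⟩ := CadlagProc.capped hZm fun ω => (hZc ω).rightCont
  have hu1 : Continuous fun z : E × Fin (m + 1) => a.1 z.1 * f z.2 :=
    (ha₁.comp continuous_fst).mul (continuous_of_discreteTopology.comp continuous_snd)
  have hu2 := continuous_couplOp hq ha₁ ha₂ f
  have hu3 := measurable_eval_of_rightCont (fun u => hu1.measurable.comp (h1 u))
    (fun ω => (h2 ω).comp hu1) hcap
  have hu4 : Measurable[mΩ] fun ω => ∫ r in (s : ℝ)..capT (totClk q fun r => (Z r ω).1) n s t,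
      couplOp q a f (Z (min r.toNNReal t) ω) := by
    have h3 := measurable_uncurry_of_rightCont (fun u => hu2.measurable.comp (h1 u))
      fun ω => (h2 ω).comp hu2
    refine measurable_eval_of_rightCont (x := fun u ω => ∫ r in (s : ℝ)..u,
      couplOp q a f (Z (min r.toNNReal t) ω)) (fun u => measurable_integral_path
        (x := fun r ω => couplOp q a f (Z (min r t) ω)) h3 s u)
      (fun ω u => ?_) hcap
    have h4 : LocBdd fun r => couplOp q a f (Z (min r t) ω) :=
      ((hZc ω).comp hu2).locBdd.capped t
    exact ((intervalIntegral.continuous_primitive (fun a b => h4.intervalIntegrable a b) s).comp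
      NNReal.continuous_coe).continuousWithinAt
  refine (funext fun ω => ?_ : (fun ω => stoppedIncr q a f n s t fun r => Z r ω) = _) ▸
    (hu3.sub (hu1.measurable.comp (hZm s hst))).sub hu4
  have hcs : s ≤ capT (totClk q fun r => (Z r ω).1) n s t := le_capT
  have hct : capT (totClk q fun r => (Z r ω).1) n s t ≤ t := capT_le hst
  simp only [stoppedIncr, Pi.sub_apply, Function.comp_apply, min_eq_left hct]
  congr 1
  refine intervalIntegral.integral_congr fun r hr => ?_
  rw [Set.uIcc_of_le (by exact_mod_cast hcs)] at hr
  simp only [min_eq_left ((Real.toNNReal_le_iff_le_coe.2 hr.2).trans hct)]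

/-- The stopped martingale identities imply the local martingale problem. -/
theorem StoppedId.solvesLocalMP {A : Set ((E → ℝ) × (E → ℝ))}
    (hA : A ⊆ boundedContinuous E ×ˢ boundedContinuous E) (hZm : ∀ t, Measurable (Z t))
    (hZc : ∀ ω, IsCadlag fun t => Z t ω) (hS : StoppedId A q Z P) :
    SolvesLocalMP (couplGen A q) Z P := by
  refine ⟨hZm, hZc, ?_⟩
  rintro p ⟨a, ha, f, rfl⟩
  obtain ⟨⟨ha1, -⟩, ha2, -⟩ := hA ha
  obtain ⟨D, hD0, h1, h2⟩ := exists_bound_pair hA ha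
  obtain ⟨F, hF0, hF⟩ := exists_bound_fin f
  have hc := fun ω => hq.continuous_totClk (hZc ω).fst
  have hm := fun ω => hq.monotone_totClk (hZc ω).fst
  -- The localising times are those at which the integrated total rate reaches the level `n`. Up to
  -- them the integral of the generator is bounded, because `couplOp` is bounded by a constant plus
  -- a multiple of the total rate.
  refine ⟨fun n ω => hit (totClk q fun r => (Z r ω).1) n, ⟨⟨fun n t => ?_, ?_⟩, ?_⟩, fun n => ?_⟩
  · simp only [hit_le_iff (hc _) (hm _)]
    exact measurableSet_le measurable_const (measurable_totClk_section hq
      (X := fun r ω => (Z r ω).1) (fun ω => (hZc ω).fst)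
      fun u hu => measurable_fst.comp (measurable_natural' hZm hu))
  · exact .of_forall fun ω => tendsto_hit_top (hc ω) (hm ω)
  · exact .of_forall fun ω => hit_mono_level (hc ω) (hm ω)
  -- `Locally` sets the process to zero where the localising time is `⊥`. This concerns the level
  -- zero, where the capped time is `0` and the stopped increment vanishes too.
  have key : stoppedProcess (fun i => {ω | ⊥ < hit (totClk q fun r => (Z r ω).1) n}.indicator
      (testProcess (fun z : E × Fin (m + 1) => a.1 z.1 * f z.2) (couplOp q a f) Z i))
      (fun ω => hit (totClk q fun r => (Z r ω).1) n) =
      fun t ω => stoppedIncr q a f n 0 t fun r => Z r ω := by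
    ext t ω
    have h3 : capT (totClk q fun r => (Z r ω).1) n 0 t =
        (min (t : WithTop ℝ≥0) (hit (totClk q fun r => (Z r ω).1) n)).untopA := by
      simp [capT]
    by_cases h4 : ⊥ < hit (totClk q fun r => (Z r ω).1) n
    · simp only [stoppedProcess]
      rw [Set.indicator_of_mem (by exact h4), ← h3]
      simp [testProcess, stoppedIncr]
    · have h5 : hit (totClk q fun r => (Z r ω).1) n = ⊥ := not_bot_lt_iff.1 h4
      simp only [stoppedProcess]
      rw [Set.indicator_of_notMem (by exact h4)]
      have h6 : capT (totClk q fun r => (Z r ω).1) n 0 t = 0 := by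
        refine le_antisymm ((capT_le_iff (hc ω) (hm ω)).2 ⟨le_rfl, .inr ?_⟩) zero_le
        rw [← hit_le_iff (hc ω) (hm ω), h5]
        exact bot_le
      simp [stoppedIncr, h6]
  rw [key]
  have hint : ∀ s t, s ≤ t → Integrable (fun ω => stoppedIncr q a f n s t fun r => Z r ω) P :=
    fun s t hst => integrable_of_abs_le
      (measurable_stoppedIncr_of_le hq ha1 ha2 n hst (fun u _ => hZm u) hZc)
      fun ω => abs_stoppedIncr_le hq hD0 hF0 ha1 ha2 h1 h2 hF n hst (hZc ω)
  refine martingale_of_setIntegral_eq (fun t => ?_) (fun t => hint 0 t zero_le)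
    fun s t hst K hK => ?_
  · exact measurable_stoppedIncr_of_le hq ha1 ha2 n zero_le
      (fun u hu => measurable_natural' hZm hu) hZc
  · obtain ⟨B, hB, rfl⟩ := (measurableSet_natural_iff hZm).1 hK
    simp only [fun ω => stoppedIncr_add hq (f := f) ha1 ha2 n hst (hZc ω)]
    rw [integral_add (hint 0 s zero_le).integrableOn (hint s t hst).integrableOn,
      hS a ha f n s t hst B hB, add_zero]

end StoppedId

/-! ### The time change equation holds for almost every path -/

section PoissonDriven

lemma RightCont.eq_of_rat {S : Type*} [TopologicalSpace S] [T2Space S] {x y : ℝ≥0 → S}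
    (hx : RightCont x) (hy : RightCont y) (h : ∀ n l : ℕ, x (l / 2 ^ n) = y (l / 2 ^ n)) (t : ℝ≥0) :
    x t = y t := by
  refine tendsto_nhds_unique (hx.tendsto_gridUp t)
    ((hy.tendsto_gridUp t).congr fun n => ?_)
  have := h n (⌊t * 2 ^ n⌋₊ + 1)
  simp only [gridUp]
  exact_mod_cast this.symm

include hq hXm hXc

/-- At a fixed time the two sides are measurable, so the almost sure statement for a frozen
environment integrates by Fubini's theorem. The dyadic times are countable, and right continuity
extends the identity to all times at once. -/
lemma ae_drivenY_eq : ∀ᵐ w ∂(P.prod (countMeasure m)), ∀ t, ((drivenY q X k t w : ℕ) : ℤ) =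
      solZ (pathRate q fun s => X s w.1) w.2.1 k t := by
  have hl : ∀ w : Ω × CountSpace m, RatePath (pathRate q fun s => X s w.1) :=
    fun w => hq.ratePath (hXc w.1)
  have h1 : ∀ t, ∀ᵐ w ∂(P.prod (countMeasure m)), ((drivenY q X k t w : ℕ) : ℤ) =
      solZ (pathRate q fun s => X s w.1) w.2.1 k t := by
    intro t
    have h2 : Measurable fun w : Ω × CountSpace m =>
        solZ (pathRate q fun s => X s w.1) w.2.1 k t := by
      refine measurable_solZ (z := fun _ => ((k : ℕ) : ℤ)) hl (fun w => w.2.2) (fun p => ?_)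
        (fun p v => (measurable_count p v).comp measurable_snd) measurable_const t
      exact (CadlagProc.uncurry (x := fun r (w : Ω × CountSpace m) => q p (X r w.1))
        ((CadlagProc.comp_left ⟨hXm, hXc⟩ measurable_fst).comp (hq.continuous p)))
    have h3 : Measurable fun w : Ω × CountSpace m => ((drivenY q X k t w : ℕ) : ℤ) :=
      (measurable_of_countable fun j : Fin (m + 1) => ((j : ℕ) : ℤ)).comp
        ((cadlagProc_drivenY hq hXc hXm).1 t)
    refine (Measure.ae_prod_iff_ae_ae (measurableSet_eq_fun h3 h2)).2 (.of_forall fun ω => ?_)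
    filter_upwards [ae_solZ_eq_sol (hq.ratePath (hXc ω)) k] with N hN
    exact (hN t).symm
  have h4 : ∀ᵐ w ∂(P.prod (countMeasure m)), ∀ n l : ℕ,
      ((drivenY q X k (l / 2 ^ n) w : ℕ) : ℤ) =
        solZ (pathRate q fun s => X s w.1) w.2.1 k (l / 2 ^ n) := by
    simp only [ae_all_iff]
    exact fun n l => h1 _
  filter_upwards [h4] with w hw
  refine RightCont.eq_of_rat ?_ ?_ hw
  · exact (rightCont_sol (hl w) w.2.2).comp
      (continuous_of_discreteTopology (f := fun j : Fin (m + 1) => ((j : ℕ) : ℤ)))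
  · exact rightCont_posZ (hl w) w.2.2 (measurable_sol_path (hl w) w.2.2)

/-- The driven chain solves the time change equation with independent Poisson processes. -/
theorem isPoissonDriven_drivenY {r : Fin (m + 1) → Fin (m + 1) → E → ℝ}
    (hr : ∀ p : OffDiag m, r p.1.1 p.1.2 = q p) :
    IsPoissonDriven r k (fun t (w : Ω × CountSpace m) => X t w.1) (drivenY q X k)
      (fun p t w => w.2.1 p t) (P.prod (countMeasure m)) where
  poisson p := (isUnitPoisson_count p).comp measurePreserving_snd
  indep := (iIndepFun_comp_iff (measurePreserving_snd (μ := P) (ν := countMeasure m))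
    fun p => measurable_pi_iff.2 fun t => measurable_count p t).2 iIndepFun_count
  indep_X := indepFun_prod (X := fun ω (t : ℝ≥0) => X t ω)
    (Y := fun (N : CountSpace m) (p : OffDiag m) (t : ℝ≥0) => N.1 p t)
    (measurable_pi_iff.2 hXm)
    (measurable_pi_iff.2 fun p => measurable_pi_iff.2 fun t => measurable_count p t)
  equation := by
    filter_upwards [ae_drivenY_eq (P := P) (k := k) hq hXm hXc] with w hw t
    rw [hw t]
    simp only [solZ, posZ, shiftZ, clk, clock, hr]
    rfl

end PoissonDriven

/-! ### Orthogonality tested on cylinders and on sub-σ-algebras -/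

section CylinderInduction

variable {Ω : Type*} [MeasurableSpace Ω] {P : Measure Ω} {S : Type*} [MeasurableSpace S]

/-- A function integrating to zero over all cylinders integrates to zero over all path events. -/
lemma setIntegral_path_eq_zero {T : Type*} {X : T → Ω → S} (hX : ∀ t, Measurable (X t)) {U : Ω → ℝ}
    (hU : Integrable U P) (h : ∀ (I : Finset T) (Γ : T → Set S), (∀ t, MeasurableSet (Γ t)) →
      ∫ ω in {ω | ∀ t ∈ I, X t ω ∈ Γ t}, U ω ∂P = 0)
    {B : Set (T → S)} (hB : MeasurableSet B) : ∫ ω in {ω | (fun t => X t ω) ∈ B}, U ω ∂P = 0 := by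
  have hXm : Measurable fun ω t => X t ω := measurable_pi_iff.2 hX
  have h0 : ∫ ω, U ω ∂P = 0 := by simpa using h ∅ (fun _ => Set.univ) fun _ => .univ
  refine MeasurableSpace.induction_on_inter
    (C := fun B _ => ∫ ω in {ω | (fun t => X t ω) ∈ B}, U ω ∂P = 0)
    generateFrom_squareCylinders.symm
    (isPiSystem_squareCylinders (fun _ => MeasurableSpace.isPiSystem_measurableSet)
      fun _ => MeasurableSet.univ) ?_ ?_ ?_ ?_ B hB
  · simp
  · rintro _ ⟨I, Γ, hΓ, rfl⟩
    exact h I Γ fun t => hΓ t (Set.mem_univ t)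
  · intro B hB hB0
    have := integral_add_compl (hXm hB) hU
    rw [h0] at this
    change (∫ ω in {ω | (fun t => X t ω) ∈ B}, U ω ∂P) +
      (∫ ω in {ω | (fun t => X t ω) ∈ Bᶜ}, U ω ∂P) = 0 at this
    rwa [hB0, zero_add] at this
  · intro f hd hf hf0
    have h2 : {ω | (fun t => X t ω) ∈ ⋃ i, f i} = ⋃ i, {ω | (fun t => X t ω) ∈ f i} := by
      ext ω
      simp
    rw [h2]
    refine (integral_iUnion (f := U) (μ := P) (s := fun i => {ω | (fun t => X t ω) ∈ f i}) (fun i => hXm (hf i)) (fun i j hij => ?_)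
      hU.integrableOn).trans ?_
    · exact Disjoint.preimage (fun ω t => X t ω) (hd hij)
    · simp [hf0]

omit [MeasurableSpace Ω] in
/-- A function integrating to zero over the events of a sub-`σ`-algebra is orthogonal to the
measurable functions. -/
lemma integral_mul_eq_zero_of_setIntegral {m₀ mΩ : MeasurableSpace Ω} {P : Measure Ω}
    [IsFiniteMeasure P] (hm : m₀ ≤ mΩ) {U : Ω → ℝ} (hU : Integrable U P)
    (h : ∀ K, MeasurableSet[m₀] K → ∫ ω in K, U ω ∂P = 0) {Φ : Ω → ℝ} (hΦ : Measurable[m₀] Φ)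
    (hint : Integrable (fun ω => Φ ω * U ω) P) : ∫ ω, Φ ω * U ω ∂P = 0 := by
  have h1 : P[U | m₀] =ᵐ[P] 0 := by
    refine (ae_eq_condExp_of_forall_setIntegral_eq hm hU (fun _ _ _ => integrableOn_zero)
      (fun K hK _ => ?_) aestronglyMeasurable_zero).symm
    simp [h K hK]
  have h2 : P[Φ * U | m₀] =ᵐ[P] Φ * P[U | m₀] :=
    condExp_mul_of_stronglyMeasurable_left hΦ.stronglyMeasurable hint hU
  calc ∫ ω, Φ ω * U ω ∂P = ∫ ω, (P[Φ * U | m₀]) ω ∂P := (integral_condExp hm).symm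
    _ = ∫ _, 0 ∂P := by
        refine integral_congr_ae ?_
        filter_upwards [h1, h2] with ω h3 h4
        rw [h4, Pi.mul_apply, h3]
        simp
    _ = 0 := by simp

end CylinderInduction

/-! ### The Markov property for functionals of the whole future -/

section MarkovFuture

variable {S : Type*} [TopologicalSpace S] [TopologicalSpace.MetrizableSpace S]
  [SecondCountableTopology S] [MeasurableSpace S] [BorelSpace S]
  {Ω : Type*} [MeasurableSpace Ω] {P : Measure Ω} [IsProbabilityMeasure P] {X : ℝ≥0 → Ω → S}

/-- If the value at time `u` carries no information on `W`, neither does any later value. -/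
lemma IsMarkov.setIntegral_eq_zero_of_le (hX : IsMarkov X P) {u v : ℝ≥0} (huv : u ≤ v) {W : Ω → ℝ}
    (hWm : Measurable[naturalFiltration X hX.measurable u] W) {C : ℝ} (hWb : ∀ ω, |W ω| ≤ C)
    (h : ∀ Γ, MeasurableSet Γ → ∫ ω in X u ⁻¹' Γ, W ω ∂P = 0) {Γ : Set S} (hΓ : MeasurableSet Γ) :
    ∫ ω in X v ⁻¹' Γ, W ω ∂P = 0 := by
  have hXm := hX.measurable
  have hle := (naturalFiltration X hXm).le u
  have hle' : MeasurableSpace.comap (X u) inferInstance ≤ ‹MeasurableSpace Ω› :=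
    measurable_iff_comap_le.1 (hXm u)
  have hWi : Integrable W P := integrable_of_abs_le (hWm.mono hle le_rfl) hWb
  set I : Ω → ℝ := (X v ⁻¹' Γ).indicator fun _ => (1 : ℝ) with hI
  have hIi : Integrable I P := (integrable_const _).indicator (hXm v hΓ)
  have hWI : Integrable (W * I) P := hIi.bdd_mul (c := C)
    (hWm.mono hle le_rfl).aestronglyMeasurable (.of_forall fun ω => hWb ω)
  have hWc : Integrable (fun ω =>
      (P[I | MeasurableSpace.comap (X u) inferInstance]) ω * W ω) P := by
    have := integrable_condExp (μ := P) (f := I) (m := MeasurableSpace.comap (X u) inferInstance)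
    refine (this.bdd_mul (c := C) (hWm.mono hle le_rfl).aestronglyMeasurable
      (.of_forall fun ω => hWb ω)).congr (.of_forall fun ω => ?_)
    exact mul_comm _ _
  calc ∫ ω in X v ⁻¹' Γ, W ω ∂P = ∫ ω, (W * I) ω ∂P := by
        rw [← integral_indicator (hXm v hΓ)]
        congr 1
        ext ω
        by_cases hω : ω ∈ X v ⁻¹' Γ
        · simp [hI, Set.indicator_of_mem hω]
        · simp [hI, Set.indicator_of_notMem hω]
    _ = ∫ ω, (P[W * I | naturalFiltration X hXm u]) ω ∂P := (integral_condExp hle).symm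
    _ = ∫ ω, (P[I | MeasurableSpace.comap (X u) inferInstance]) ω * W ω ∂P := by
        refine integral_congr_ae ?_
        filter_upwards [condExp_mul_of_stronglyMeasurable_left hWm.stronglyMeasurable hWI hIi,
          hX.markov u v huv Γ hΓ] with ω h1 h2
        rw [h1, Pi.mul_apply, h2, mul_comm]
    _ = 0 := by
        refine integral_mul_eq_zero_of_setIntegral hle' hWi ?_
          stronglyMeasurable_condExp.measurable hWc
        rintro _ ⟨Γ', hΓ', rfl⟩
        exact h Γ' hΓ'

/-- The Markov property for path events of the future. -/
lemma IsMarkov.setIntegral_future_eq_zero (hX : IsMarkov X P) {s : ℝ≥0} {W : Ω → ℝ}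
    (hWm : Measurable[naturalFiltration X hX.measurable s] W) {C : ℝ} (hWb : ∀ ω, |W ω| ≤ C)
    (h : ∀ Γ, MeasurableSet Γ → ∫ ω in X s ⁻¹' Γ, W ω ∂P = 0)
    {B : Set (Set.Ici s → S)} (hB : MeasurableSet B) :
    ∫ ω in {ω | (fun r : Set.Ici s => X r ω) ∈ B}, W ω ∂P = 0 := by
  have hXm := hX.measurable
  have hW' : Measurable W := hWm.mono ((naturalFiltration X hXm).le s) le_rfl
  refine setIntegral_path_eq_zero (X := fun (r : Set.Ici s) => X r) (fun r => hXm r)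
    (integrable_of_abs_le hW' hWb) (fun I Γ hΓ => ?_) hB
  -- The claim is strengthened by one additional event at a time `v` after all times of the
  -- cylinder. In the induction on the largest time `a`, the event at `a` takes this place in the
  -- induction hypothesis.
  have key : ∀ v : ℝ≥0, s ≤ v → (∀ t ∈ I, (t : ℝ≥0) ≤ v) → ∀ Γ', MeasurableSet Γ' →
      ∫ ω in X v ⁻¹' Γ', {ω | ∀ t ∈ I, X t ω ∈ Γ t}.indicator W ω ∂P = 0 := by
    induction I using Finset.induction_on_max with
    | empty =>
      intro v hv _ Γ' hΓ'
      simpa using hX.setIntegral_eq_zero_of_le hv hWm hWb h hΓ'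
    | insert a I ha ih =>
      intro v hv hI Γ' hΓ'
      have hav : (a : ℝ≥0) ≤ v := hI a (Finset.mem_insert_self _ _)
      have hms : ∀ {I' : Finset (Set.Ici s)}, (∀ t ∈ I', (t : ℝ≥0) ≤ a) →
          MeasurableSet[naturalFiltration X hXm a] {ω | ∀ t ∈ I', X t ω ∈ Γ t} := by
        intro I' hI'
        have : {ω | ∀ t ∈ I', X t ω ∈ Γ t} = ⋂ t ∈ I', X t ⁻¹' Γ t := by
          ext ω
          simp
        rw [this]
        exact Finset.measurableSet_biInter _ fun t ht =>
          measurable_natural' hXm (hI' t ht) (hΓ t)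
      have hm1 := hms (I' := I) fun t ht => (ha t ht).le
      have hm2 := hms (I' := insert a I) fun t ht => by
        rcases Finset.mem_insert.1 ht with rfl | ht
        · exact le_rfl
        · exact (ha t ht).le
      have hins : {ω | ∀ t ∈ insert a I, X t ω ∈ Γ t} =
          X a ⁻¹' Γ a ∩ {ω | ∀ t ∈ I, X t ω ∈ Γ t} := by
        ext ω
        simp
      refine hX.setIntegral_eq_zero_of_le hav (C := C)
        ((hWm.mono ((naturalFiltration X hXm).mono a.2) le_rfl).indicator hm2) (fun ω => ?_)
        (fun Γ'' hΓ'' => ?_) hΓ'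
      · by_cases hω : ω ∈ {ω | ∀ t ∈ insert a I, X t ω ∈ Γ t}
        · rw [Set.indicator_of_mem hω]
          exact hWb ω
        · rw [Set.indicator_of_notMem hω, abs_zero]
          exact (abs_nonneg _).trans (hWb ω)
      · have h1 := ih a a.2 (fun t ht => (ha t ht).le) (Γ'' ∩ Γ a) (hΓ''.inter (hΓ a))
        have hle := (naturalFiltration X hXm).le a
        rw [hins, Set.inter_comm (X a ⁻¹' Γ a), ← Set.indicator_indicator,
          setIntegral_indicator (hle _ hm1)]
        rw [setIntegral_indicator (hle _ hm1)] at h1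
        rw [setIntegral_indicator (hXm a (hΓ a))]
        convert h1 using 2
        congr 1
        ext ω
        simp only [Set.mem_inter_iff, Set.mem_preimage]
        tauto
  have hv : ∃ v, s ≤ v ∧ ∀ t ∈ I, (t : ℝ≥0) ≤ v := by
    refine ⟨s ⊔ I.sup fun t => (t : ℝ≥0), le_sup_left, fun t ht => ?_⟩
    exact (Finset.le_sup (f := fun t : Set.Ici s => (t : ℝ≥0)) ht).trans le_sup_right
  obtain ⟨v, hv1, hv2⟩ := hv
  have h1 := key v hv1 hv2 Set.univ .univ
  rw [Set.preimage_univ, Measure.restrict_univ, integral_indicator] at h1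
  · exact h1
  · have : {ω | ∀ t ∈ I, X t ω ∈ Γ t} = ⋂ t ∈ I, X t ⁻¹' Γ t := by
      ext ω
      simp
    rw [this]
    exact Finset.measurableSet_biInter _ fun t _ => hXm t (hΓ t)

omit [MeasurableSpace Ω] in
/-- Conditional independence of past and future, in terms of test functions. -/
lemma setIntegral_condExp_eq_of_forall {m₀ m₁ m₂ mΩ : MeasurableSpace Ω} {P : Measure Ω}
    [IsProbabilityMeasure P] (hle₁ : m₀ ≤ m₁) (hle : m₁ ≤ mΩ) (hfut : m₂ ≤ mΩ)
    (h : ∀ W : Ω → ℝ, Measurable[m₁] W → (∀ ω, |W ω| ≤ 1 + 1) →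
      (∀ Γ, MeasurableSet[m₀] Γ → ∫ ω in Γ, W ω ∂P = 0) →
      ∀ B, MeasurableSet[m₂] B → ∫ ω in B, W ω ∂P = 0)
    {Φ : Ω → ℝ} (hΦ : Measurable[m₂] Φ) {C : ℝ} (hΦb : ∀ ω, |Φ ω| ≤ C) {K : Set Ω}
    (hK : MeasurableSet[m₁] K) : ∫ ω in K, (P[Φ | m₀]) ω ∂P = ∫ ω in K, Φ ω ∂P := by
  have hle₀ : m₀ ≤ mΩ := hle₁.trans hle
  have hΦm : Measurable Φ := hΦ.mono hfut le_rfl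
  have hΦi : Integrable Φ P := integrable_of_abs_le hΦm hΦb
  set k : Ω → ℝ := K.indicator fun _ => (1 : ℝ) with hk
  have hki : Integrable k P := (integrable_const _).indicator (hle K hK)
  have hkb : ∀ ω, |k ω| ≤ 1 := fun ω => by
    by_cases hω : ω ∈ K
    · simp [hk, hω]
    · simp [hk, hω]
  have hk0 : ∀ ω, 0 ≤ k ω := Set.indicator_nonneg fun _ _ => zero_le_one
  -- A version of the conditional expectation of `k` with values in `[0, 1]` everywhere, so that `k
  -- - g` is an admissible bounded test function. With `c` the conditional expectation of `Φ`, the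
  -- identity `k(c - Φ) = c(k - g) - Φ(k - g) - g(Φ - c)` then finishes the proof, as each term on
  -- the right has mean zero.
  set g : Ω → ℝ := fun ω => max 0 (min 1 ((P[k | m₀]) ω)) with hg
  have hgm : Measurable[m₀] g :=
    measurable_const.max (measurable_const.min stronglyMeasurable_condExp.measurable)
  have hgb : ∀ ω, |g ω| ≤ 1 := fun ω => by
    rw [abs_of_nonneg (le_max_left _ _)]
    exact max_le zero_le_one (min_le_left _ _)
  have hge : g =ᵐ[P] P[k | m₀] := by
    have h1 : (fun _ => (0 : ℝ)) ≤ᵐ[P] P[k | m₀] := condExp_nonneg (.of_forall hk0)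
    have h2 : P[k | m₀] ≤ᵐ[P] fun _ => 1 := by
      have := condExp_mono (m := m₀) hki (integrable_const (1 : ℝ))
        (.of_forall fun ω => (le_abs_self _).trans (hkb ω))
      exact (condExp_const hle₀ (1 : ℝ) (μ := P)) ▸ this
    filter_upwards [h1, h2] with ω h3 h4
    simp only [hg]
    rw [min_eq_right h4, max_eq_right h3]
  have hgi : Integrable g P := integrable_of_abs_le (hgm.mono hle₀ le_rfl) hgb
  have hbdd : ∀ {u : Ω → ℝ}, Integrable u P → ∀ {v : Ω → ℝ} {b : ℝ}, Measurable v →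
      (∀ ω, |v ω| ≤ b) → Integrable (fun ω => v ω * u ω) P := fun hu v b hv hb =>
    hu.bdd_mul (c := b) hv.aestronglyMeasurable (.of_forall fun ω => hb ω)
  have hkg : ∀ Γ, MeasurableSet[m₀] Γ → ∫ ω in Γ, (k ω - g ω) ∂P = 0 := by
    intro Γ hΓ
    rw [integral_sub hki.integrableOn hgi.integrableOn,
      integral_congr_ae (ae_restrict_of_ae hge), setIntegral_condExp hle₀ hki hΓ, sub_self]
  have e1 : ∫ ω, Φ ω * (k ω - g ω) ∂P = 0 := by
    refine integral_mul_eq_zero_of_setIntegral hfut (hki.sub hgi) ?_ hΦ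
      (hbdd (hki.sub hgi) hΦm hΦb)
    exact h (fun ω => k ω - g ω) ((measurable_const.indicator hK).sub (hgm.mono hle₁ le_rfl))
      (fun ω => (abs_sub _ _).trans (add_le_add (hkb ω) (hgb ω))) hkg
  have hci : Integrable (P[Φ | m₀]) P := integrable_condExp
  have e2 : ∫ ω, g ω * (Φ ω - (P[Φ | m₀]) ω) ∂P = 0 := by
    refine integral_mul_eq_zero_of_setIntegral hle₀ (hΦi.sub hci) (fun Γ hΓ => ?_) hgm
      (hbdd (hΦi.sub hci) (hgm.mono hle₀ le_rfl) hgb)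
    simp only [Pi.sub_apply]
    rw [integral_sub hΦi.integrableOn hci.integrableOn, setIntegral_condExp hle₀ hΦi hΓ, sub_self]
  have i3 : Integrable (fun ω => (P[Φ | m₀]) ω * (k ω - g ω)) P := by
    refine (hbdd hci (v := fun ω => k ω - g ω) (b := 1 + 1)
      ((measurable_const.indicator (hle K hK)).sub (hgm.mono hle₀ le_rfl))
      fun ω => (abs_sub _ _).trans (add_le_add (hkb ω) (hgb ω))).congr (.of_forall fun ω => ?_)
    exact mul_comm _ _
  have e3 : ∫ ω, (P[Φ | m₀]) ω * (k ω - g ω) ∂P = 0 :=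
    integral_mul_eq_zero_of_setIntegral hle₀ (hki.sub hgi) hkg
      stronglyMeasurable_condExp.measurable i3
  have hkind : ∀ u : Ω → ℝ, ∫ ω in K, u ω ∂P = ∫ ω, k ω * u ω ∂P := fun u => by
    rw [← integral_indicator (hle K hK)]
    congr 1
    ext ω
    by_cases hω : ω ∈ K
    · simp [hk, hω]
    · simp [hk, hω]
  rw [hkind, hkind, ← sub_eq_zero, ← integral_sub (hbdd hci (measurable_const.indicator (hle K hK))
    hkb) (hbdd hΦi (measurable_const.indicator (hle K hK)) hkb)]
  have e4 : ∫ ω, ((P[Φ | m₀]) ω * (k ω - g ω) - Φ ω * (k ω - g ω) -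
      g ω * (Φ ω - (P[Φ | m₀]) ω)) ∂P = 0 := by
    have i1 : Integrable (fun ω => Φ ω * (k ω - g ω)) P := hbdd (hki.sub hgi) hΦm hΦb
    have i2 : Integrable (fun ω => g ω * (Φ ω - (P[Φ | m₀]) ω)) P :=
      hbdd (hΦi.sub hci) (hgm.mono hle₀ le_rfl) hgb
    have i31 : Integrable (fun ω => (P[Φ | m₀]) ω * (k ω - g ω) - Φ ω * (k ω - g ω)) P :=
      i3.sub i1
    rw [integral_sub i31 i2, integral_sub i3 i1, e1, e2, e3]
    simp
  rw [← e4]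
  congr 1
  ext ω
  ring

/-- The Markov property for bounded functionals of the future. -/
theorem IsMarkov.setIntegral_condExp_future (hX : IsMarkov X P) {s : ℝ≥0} {Φ : Ω → ℝ}
    (hΦ : Measurable[MeasurableSpace.comap (fun ω (r : Set.Ici s) => X r ω) inferInstance] Φ)
    {C : ℝ} (hΦb : ∀ ω, |Φ ω| ≤ C) {K : Set Ω}
    (hK : MeasurableSet[naturalFiltration X hX.measurable s] K) :
    ∫ ω in K, (P[Φ | MeasurableSpace.comap (X s) inferInstance]) ω ∂P = ∫ ω in K, Φ ω ∂P := by
  have hXm := hX.measurable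
  refine setIntegral_condExp_eq_of_forall
    (m₂ := MeasurableSpace.comap (fun ω (r : Set.Ici s) => X r ω) inferInstance)
    (measurable_iff_comap_le.1 (measurable_natural' hXm le_rfl))
    ((naturalFiltration X hXm).le s)
    (measurable_iff_comap_le.1 (measurable_pi_iff.2 fun r => hXm r)) ?_ hΦ hΦb hK
  rintro W hW hWb h0 _ ⟨B, hB, rfl⟩
  exact hX.setIntegral_future_eq_zero hW hWb (fun Γ hΓ => h0 _ ⟨Γ, hΓ, rfl⟩) hB

end MarkovFuture

/-! ### The Markov property of the coupled process -/

section DrivenMarkov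

/-- The probability that the coupled process, started with chain state `i` at time `s`, belongs to
`Γ` after a further time `r`, given the driving process. -/
noncomputable def futureProb (q : OffDiag m → E → ℝ) (X : ℝ≥0 → Ω → E) (s r : ℝ≥0)
    (Γ : Set (E × Fin (m + 1))) (i : Fin (m + 1)) (ω : Ω) : ℝ :=
  ∫ N, Γ.indicator (fun _ => (1 : ℝ)) (drivenZ q (fun u => X (s + u)) i r (ω, N)) ∂(countMeasure m)

lemma IsCadlag.shift {S : Type*} [TopologicalSpace S] {x : ℝ≥0 → S} (hx : IsCadlag x) (s : ℝ≥0) :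
    IsCadlag fun t => x (s + t) := by
  intro t
  refine ⟨((hx (s + t)).1).comp (continuous_const.add continuous_id).continuousWithinAt
    fun r hr => add_le_add_right (α := ℝ≥0) hr s, ?_⟩
  obtain ⟨l, hl⟩ := (hx (s + t)).2
  refine ⟨l, hl.comp (tendsto_nhdsWithin_iff.2 ⟨?_, ?_⟩)⟩
  · exact ((continuous_const.add continuous_id).tendsto t).mono_left nhdsWithin_le_nhds
  · filter_upwards [self_mem_nhdsWithin] with r hr
    exact (add_lt_add_iff_left s).2 hr

include hq hXc

omit [MeasurableSpace Ω] in
lemma measurable_futureProb {mΩ : MeasurableSpace Ω} {s : ℝ≥0}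
    (h : ∀ u, s ≤ u → Measurable[mΩ] (X u)) (r : ℝ≥0) {Γ : Set (E × Fin (m + 1))}
    (hΓ : MeasurableSet Γ) (i : Fin (m + 1)) : Measurable[mΩ] (futureProb q X s r Γ i) := by
  have h1 : Measurable fun w : Ω × CountSpace m =>
      Γ.indicator (fun _ => (1 : ℝ)) (drivenZ q (fun u => X (s + u)) i r w) :=
    (measurable_const.indicator hΓ).comp ((cadlagProc_drivenZ hq (fun ω => (hXc ω).shift s)
      fun u => h _ le_self_add).1 r)
  exact (h1.stronglyMeasurable.integral_prod_right (ν := countMeasure m)).measurable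

lemma abs_futureProb_le (s r : ℝ≥0) (Γ : Set (E × Fin (m + 1))) (i : Fin (m + 1)) (ω : Ω) :
    |futureProb q X s r Γ i ω| ≤ 1 := by
  have h := norm_integral_le_of_norm_le_const (μ := countMeasure m) (C := 1)
    (f := fun N => Γ.indicator (fun _ => (1 : ℝ)) (drivenZ q (fun u => X (s + u)) i r (ω, N)))
    (.of_forall fun N => by
      simpa using abs_indicator_one_mul_le Γ (drivenZ q (fun u => X (s + u)) i r (ω, N)) 1)
  rw [probReal_univ, mul_one] at h
  exact h

/-- The strong Markov property of the counting paths, for the coupled process. -/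
lemma setIntegral_indicator_drivenZ (s r : ℝ≥0) {Γ : Set (E × Fin (m + 1))} (hΓ : MeasurableSet Γ)
    (i : Fin (m + 1)) (ω : Ω) {K : Set (CountSpace m)}
    (hK : Determined (pathRate q fun u => X u ω) k s K)
    (hKi : ∀ N ∈ K, drivenY q X k s (ω, N) = i) :
    ∫ N in K, Γ.indicator (fun _ => (1 : ℝ)) (drivenZ q X k (s + r) (ω, N)) ∂(countMeasure m) =
      ∫ _ in K, futureProb q X s r Γ i ω ∂(countMeasure m) := by
  have hl := hq.ratePath (hXc ω)
  have hl' : RatePath (pathRate q fun u => X (s + u) ω) := hl.shift s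
  have hh : Measurable fun N : CountSpace m =>
      Γ.indicator (fun _ => (1 : ℝ)) (drivenZ q (fun u => X (s + u)) i r (ω, N)) :=
    (measurable_const.indicator hΓ).comp
      (show Measurable fun N : CountSpace m => drivenZ q (fun u => X (s + u)) i r (ω, N) from
        (measurable_const (a := X (s + r) ω)).prodMk (measurable_sol_count (z := i) hl' r))
  have h1 := setIntegral_shift_solClk hl hK hh
  rw [setIntegral_const, smul_eq_mul]
  refine Eq.trans ?_ h1
  refine setIntegral_congr_ae hK.measurableSet ?_
  filter_upwards [ae_solZ_eq_sol hl k] with N hN hNK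
  have h2 : drivenY q X k (s + r) (ω, N) = drivenY q (fun u => X (s + u)) i r
      (ω, shiftCount (solClk (pathRate q fun u => X u ω) k s N) N) := by
    have h3 := sol_restart (z := k) hl N.2 s r
    rw [hN s] at h3
    have h4 : sol (pathRate q fun u => X u ω) N.1 k s = i := hKi N hNK
    rw [h4] at h3
    exact h3
  simp only [drivenZ, h2]

include hXm

lemma setIntegral_past_indicator_drivenZ {s : ℝ≥0} (r : ℝ≥0) {Γ : Set (E × Fin (m + 1))}
    (hΓ : MeasurableSet Γ) (i : Fin (m + 1)) {B : Set (Set.Iic s → E × Fin (m + 1))}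
    (hB : MeasurableSet B) (hBi : ∀ z ∈ B, (z ⟨s, Set.self_mem_Iic⟩).2 = i) :
    ∫ w in pastSet q X k s B, Γ.indicator (fun _ => (1 : ℝ)) (drivenZ q X k (s + r) w)
        ∂(P.prod (countMeasure m)) =
      ∫ w in pastSet q X k s B, futureProb q X s r Γ i w.1 ∂(P.prod (countMeasure m)) := by
  have hK := measurableSet_pastSet (k := k) hq hXc hXm hB
  have hm1 : Measurable fun w => Γ.indicator (fun _ => (1 : ℝ)) (drivenZ q X k (s + r) w) :=
    (measurable_const.indicator hΓ).comp ((cadlagProc_drivenZ hq hXc hXm).1 _)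
  have hm2 : Measurable fun w : Ω × CountSpace m => futureProb q X s r Γ i w.1 :=
    (measurable_futureProb hq hXc (fun u _ => hXm u) r hΓ i).comp measurable_fst
  have hb1 : ∀ w, |Γ.indicator (fun _ => (1 : ℝ)) (drivenZ q X k (s + r) w)| ≤ 1 := fun w => by
    simpa using abs_indicator_one_mul_le Γ (drivenZ q X k (s + r) w) 1
  have hi1 := (integrable_of_abs_le (μ := P.prod (countMeasure m)) hm1 hb1).indicator hK
  have hi2 := (integrable_of_abs_le (μ := P.prod (countMeasure m)) hm2
    fun w => abs_futureProb_le hq hXc s r Γ i w.1).indicator hK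
  rw [← integral_indicator hK, ← integral_indicator hK, integral_prod _ hi1, integral_prod _ hi2]
  congr 1
  ext ω
  have hA := determined_pastSet (k := k) hq hXc hB ω
  have := setIntegral_indicator_drivenZ hq hXc s r hΓ i ω hA fun N hN => hBi _ hN
  rw [← integral_indicator hA.1, ← integral_indicator hA.1] at this
  exact this

omit hXm

/-- For fixed counting paths a past event of the coupled process is a past event of `X`, to which
the Markov property of `X` applies. -/
lemma setIntegral_past_condExp (hX : IsMarkov X P) {s : ℝ≥0} {Φ : Ω → ℝ}
    (hΦ : Measurable[MeasurableSpace.comap (fun ω (r : Set.Ici s) => X r ω) inferInstance] Φ)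
    {C : ℝ} (hΦb : ∀ ω, |Φ ω| ≤ C) {B : Set (Set.Iic s → E × Fin (m + 1))} (hB : MeasurableSet B) :
    ∫ w in pastSet q X k s B, (P[Φ | MeasurableSpace.comap (X s) inferInstance]) w.1
        ∂(P.prod (countMeasure m)) =
      ∫ w in pastSet q X k s B, Φ w.1 ∂(P.prod (countMeasure m)) := by
  have hXm := hX.measurable
  have hK := measurableSet_pastSet (k := k) hq hXc hXm hB
  have hΦm : Measurable Φ := hΦ.mono
    (measurable_iff_comap_le.1 (measurable_pi_iff.2 fun r : Set.Ici s => hXm r)) le_rfl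
  have hi1 : Integrable (fun w : Ω × CountSpace m =>
      (P[Φ | MeasurableSpace.comap (X s) inferInstance]) w.1) (P.prod (countMeasure m)) :=
    integrable_condExp.comp_fst _
  have hi2 : Integrable (fun w : Ω × CountSpace m => Φ w.1) (P.prod (countMeasure m)) :=
    (integrable_of_abs_le hΦm hΦb).comp_fst _
  rw [← integral_indicator hK, ← integral_indicator hK, integral_prod_symm _ (hi1.indicator hK),
    integral_prod_symm _ (hi2.indicator hK)]
  congr 1
  ext N
  have hA : MeasurableSet[naturalFiltration X hXm s] {ω | (ω, N) ∈ pastSet q X k s B} :=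
    measurableSet_pastSet_section hq hXc (fun u hu => measurable_natural hXm hu) hB N
  have hA' := (naturalFiltration X hXm).le s _ hA
  have h1 := hX.setIntegral_condExp_future hΦ hΦb hA
  rw [← integral_indicator hA', ← integral_indicator hA'] at h1
  exact h1

omit hq hXc [MeasurableSpace Ω] [MetricSpace E] [SecondCountableTopology E] [MeasurableSpace E]
  [BorelSpace E] in
-- A function measurable for the smaller σ-algebra with the right integrals over the larger one is a
-- version of both conditional expectations.
lemma condExp_ae_eq_of_le {m₀ m₁ mΩ : MeasurableSpace Ω} {P : Measure Ω} [IsFiniteMeasure P]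
    (h₀₁ : m₀ ≤ m₁) (h₁ : m₁ ≤ mΩ) {I v : Ω → ℝ} (hI : Integrable I P) (hv : Integrable v P)
    (hvm : Measurable[m₀] v) (h : ∀ K, MeasurableSet[m₁] K → ∫ ω in K, v ω ∂P = ∫ ω in K, I ω ∂P) :
    P[I | m₁] =ᵐ[P] P[I | m₀] :=
  ((ae_eq_condExp_of_forall_setIntegral_eq h₁ hI (fun _ _ _ => hv.integrableOn)
    (fun K hK _ => h K hK) (hvm.mono h₀₁ le_rfl).stronglyMeasurable.aestronglyMeasurable).symm).trans
  (ae_eq_condExp_of_forall_setIntegral_eq (h₀₁.trans h₁) hI (fun _ _ _ => hv.integrableOn)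
    (fun K hK _ => h K (h₀₁ K hK)) hvm.stronglyMeasurable.aestronglyMeasurable)

/-- If the driving process is Markov then so is the coupled process. -/
theorem isMarkov_drivenZ (hX : IsMarkov X P) :
    IsMarkov (drivenZ q X k) (P.prod (countMeasure m)) := by
  have hXm := hX.measurable
  have hZ := cadlagProc_drivenZ (k := k) hq hXc hXm
  refine ⟨hZ.1, fun s t hst Γ hΓ => ?_⟩
  obtain ⟨r, rfl⟩ := exists_add_of_le hst
  set κ : Fin (m + 1) → Ω → ℝ := fun i =>
    P[futureProb q X s r Γ i | MeasurableSpace.comap (X s) inferInstance] with hκ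
  have hκm : ∀ i, Measurable[MeasurableSpace.comap (X s) inferInstance] (κ i) := fun i =>
    stronglyMeasurable_condExp.measurable
  have hκi : ∀ i, Integrable (fun w : Ω × CountSpace m => κ i w.1) (P.prod (countMeasure m)) :=
    fun i => integrable_condExp.comp_fst _
  have hZs : Measurable[MeasurableSpace.comap (drivenZ q X k s) inferInstance]
      (drivenZ q X k s) := comap_measurable _
  have hYi : ∀ i, MeasurableSet[MeasurableSpace.comap (drivenZ q X k s) inferInstance]
      {w | drivenY q X k s w = i} := fun i =>
    (measurable_snd.comp hZs) (measurableSet_singleton i)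
  have hκ₀ : ∀ i, Measurable[MeasurableSpace.comap (drivenZ q X k s) inferInstance]
      fun w : Ω × CountSpace m => κ i w.1 := fun i => by
    intro S hS
    obtain ⟨T, hT, hTS⟩ := hκm i hS
    exact ⟨Prod.fst ⁻¹' T, measurable_fst hT, by ext w; exact Set.ext_iff.1 hTS w.1⟩
  have hI : Integrable ((drivenZ q X k (s + r) ⁻¹' Γ).indicator fun _ => (1 : ℝ))
      (P.prod (countMeasure m)) := (integrable_const _).indicator (hZ.1 _ hΓ)
  have hle := measurable_iff_comap_le.1 (hZ.1 s)
  -- The common version: on `{Y(s) = i}` take the probability of reaching `Γ` from the chain state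
  -- `i` given the driving path, and condition it on `X(s)`. This is a function of `(X(s), Y(s))`.
  refine condExp_ae_eq_of_le (v := fun w => ∑ i,
      {w | drivenY q X k s w = i}.indicator (fun w => κ i w.1) w)
    (measurable_iff_comap_le.1 (measurable_natural' hZ.1 le_rfl))
    ((naturalFiltration _ hZ.1).le s) hI ?_ ?_ fun K hK => ?_
  · exact integrable_finsetSum _ fun i _ => (hκi i).indicator (hle _ (hYi i))
  · exact Finset.measurable_sum _ fun i _ => (hκ₀ i).indicator (hYi i)
  · obtain ⟨B, hB, rfl⟩ := (measurableSet_natural_iff hZ.1).1 hK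
    set Bi : Fin (m + 1) → Set (Set.Iic s → E × Fin (m + 1)) := fun i =>
      B ∩ {z | (z ⟨s, Set.self_mem_Iic⟩).2 = i} with hBi
    have hBim : ∀ i, MeasurableSet (Bi i) := fun i => hB.inter
      ((measurable_snd.comp (measurable_pi_apply _)) (measurableSet_singleton i))
    have hun : {w | (fun u : Set.Iic s => drivenZ q X k u w) ∈ B} = ⋃ i, pastSet q X k s (Bi i) := by
      ext w
      simp [pastSet, hBi]
    have hdis : Pairwise (Function.onFun Disjoint fun i => pastSet q X k s (Bi i)) :=
      fun i j hij => Set.disjoint_left.2 fun w hi hj => hij (hi.2.symm.trans hj.2)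
    have hKm := fun i => measurableSet_pastSet (k := k) hq hXc hXm (hBim i)
    rw [hun, integral_iUnion_fintype hKm hdis fun i => ?_, integral_iUnion_fintype hKm hdis
      fun i => hI.integrableOn]
    · refine Finset.sum_congr rfl fun i _ => ?_
      have e1 := setIntegral_past_indicator_drivenZ (P := P) (k := k) hq hXm hXc r hΓ i (hBim i)
        fun z hz => hz.2
      have e2 := setIntegral_past_condExp (k := k) hq hXc hX (s := s)
        (measurable_futureProb hq hXc (fun u hu => (measurable_pi_apply
          (⟨u, hu⟩ : Set.Ici s)).comp (comap_measurable fun ω (u : Set.Ici s) => X u ω)) r hΓ i)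
        (abs_futureProb_le hq hXc s r Γ i) (hBim i)
      refine Eq.trans ?_ (e2.trans e1.symm)
      refine setIntegral_congr_fun (hKm i) fun w hw => ?_
      have hw2 : drivenY q X k s w = i := hw.2
      simp [Set.indicator_apply, hw2, hκ]
    · exact (integrable_finsetSum _ fun i _ => (hκi i).indicator (hle _ (hYi i))).integrableOn

end DrivenMarkov

/-! ### The rates of the theorem and the existence of the coupling -/

section Setting

variable {ϖ : Measure E} {η : Fin m → E → ℝ} {lam : Fin m → ℝ}
  {Q : Matrix (Fin (m + 1)) (Fin (m + 1)) ℝ} {ξ : Fin m → Fin (m + 1) → ℝ}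

/-- The rates of the coupling, indexed by pairs of distinct states. -/
noncomputable def chainRate (Q : Matrix (Fin (m + 1)) (Fin (m + 1)) ℝ) (η : Fin m → E → ℝ)
    (ξ : Fin m → Fin (m + 1) → ℝ) (p : OffDiag m) : E → ℝ := rate Q η ξ p.1.1 p.1.2

lemma ChainAssumption.rateFun (h : ChainAssumption A m ϖ η lam Q ξ) :
    RateFun (chainRate Q η ξ) := by
  have hc : ∀ i, Continuous (alpha η ξ i) := fun i =>
    continuous_const.add (continuous_finsetSum _ fun k _ =>
      continuous_const.mul (h.eigenmeasure.eta_mem k).1)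
  refine ⟨fun p => ?_, fun p x => ?_⟩
  · exact (continuous_const.mul (hc _)).div (hc _) fun x => (h.alpha_pos _ x).ne'
  · exact div_nonneg (mul_nonneg (h.offDiag_nonneg _ _ p.2) (h.alpha_pos _ x).le)
      (h.alpha_pos _ x).le

lemma jumpOp_chainRate (f : Fin (m + 1) → ℝ) (z : E × Fin (m + 1)) : jumpOp (chainRate Q η ξ) f z =
      ∑ j ∈ Finset.univ.erase z.2, rate Q η ξ z.2 j z.1 * (f j - f z.2) := by
  classical
  have h1 : jumpOp (chainRate Q η ξ) f z = ∑ p : Fin (m + 1) × Fin (m + 1),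
      if p.1 ≠ p.2 ∧ z.2 = p.1 then rate Q η ξ p.1 p.2 z.1 * (f p.2 - f p.1) else 0 := by
    have h2 := Finset.sum_subtype (F := inferInstance) (Finset.univ.filter fun p : Fin (m + 1) × Fin (m + 1) => p.1 ≠ p.2)
      (p := fun p => p.1 ≠ p.2) (by simp)
      fun p => (if z.2 = p.1 then rate Q η ξ p.1 p.2 z.1 else 0) * (f p.2 - f p.1)
    refine h2.symm.trans ?_
    rw [Finset.sum_filter]
    refine Finset.sum_congr rfl fun p _ => ?_
    by_cases hp : p.1 = p.2
    · simp [hp]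
    · by_cases hz : z.2 = p.1
      · simp [hp, hz]
      · simp [hp, hz]
  rw [h1, Fintype.sum_prod_type, Finset.sum_eq_single z.2]
  · rw [← Finset.sum_filter]
    refine Finset.sum_congr ?_ fun _ _ => rfl
    ext j
    simp [eq_comm]
  · intro b _ hb
    refine Finset.sum_eq_zero fun j _ => if_neg fun hj => hb hj.2.symm
  · simp

lemma coupledGenerator_eq : coupledGenerator A Q η ξ = couplGen A (chainRate Q η ξ) := by
  ext p
  refine exists_congr fun a => and_congr_right fun _ => exists_congr fun f => ?_
  have : couplOp (chainRate Q η ξ) a f = fun z => f z.2 * a.2 z.1 +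
      ∑ j ∈ Finset.univ.erase z.2, rate Q η ξ z.2 j z.1 * (a.1 z.1 * f j - a.1 z.1 * f z.2) := by
    ext z
    rw [couplOp, jumpOp_chainRate, Finset.mul_sum]
    congr 1
    refine Finset.sum_congr rfl fun j _ => ?_
    ring
  rw [this]

/-- The coupling exists on an extension of the probability space, and inherits the Markov
property. -/
theorem exists_coupling (h : ChainAssumption A m ϖ η lam Q ξ) {Ω : Type v} [MeasurableSpace Ω]
    (P : Measure Ω) [IsProbabilityMeasure P] (X : ℝ≥0 → Ω → E) (hX : SolvesMP A X P)
    (k : Fin (m + 1)) :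
    ∃ (Ω' : Type v) (_ : MeasurableSpace Ω') (P' : Measure Ω') (_ : IsProbabilityMeasure P')
      (π : Ω' → Ω) (_ : MeasurePreserving π P' P)
      (N : OffDiag m → ℝ≥0 → Ω' → ℕ) (Y : ℝ≥0 → Ω' → Fin (m + 1)),
      IsPoissonDriven (rate Q η ξ) k (fun t ω => X t (π ω)) Y N P' ∧
      SolvesLocalMP (coupledGenerator A Q η ξ) (fun t ω => (X t (π ω), Y t ω)) P' ∧
      (IsMarkov X P → IsMarkov (fun t ω => (X t (π ω), Y t ω)) P') := by
  have hq := h.rateFun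
  have hZ := cadlagProc_drivenZ (k := k) hq hX.cadlag hX.measurable
  refine ⟨Ω × CountSpace m, inferInstance, P.prod (countMeasure m), inferInstance, Prod.fst,
    measurePreserving_fst, fun p t w => w.2.1 p t, drivenY (chainRate Q η ξ) X k,
    isPoissonDriven_drivenY hq hX.measurable hX.cadlag fun _ => rfl, ?_,
    fun hM => isMarkov_drivenZ hq hX.cadlag hM⟩
  rw [coupledGenerator_eq]
  exact StoppedId.solvesLocalMP hq h.eigenmeasure.subset hZ.1 hZ.2
    (stoppedId_drivenZ hq hX.measurable hX.cadlag h.eigenmeasure.subset hX.martingale)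

end Setting

variable (hA : A ⊆ boundedContinuous E ×ˢ boundedContinuous E)
  (hZ : SolvesLocalMP (couplGen A q) Z P) {P' : Measure Ω} [IsProbabilityMeasure P']
  (hZ' : SolvesLocalMP (couplGen A q) Z P') (hD : DeterminesMass (Prod.fst '' A))
  (hW : WellPosedMP A)

/-! ### Optional stopping for local martingales -/

section LocalOptionalStopping

variable {Ω : Type*} {mΩ : MeasurableSpace Ω} {P : Measure Ω} [IsProbabilityMeasure P]
  {ℱ : Filtration ℝ≥0 mΩ} {M : ℝ≥0 → Ω → ℝ}

lemma untopA_min_coe (t r : ℝ≥0) : (min (t : WithTop ℝ≥0) (r : WithTop ℝ≥0)).untopA = min t r := by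
  rw [← WithTop.coe_inj, coe_untopA_min]
  exact (WithTop.coe_min t r).symm

lemma untopA_min_top (t : ℝ≥0) : (min (t : WithTop ℝ≥0) ⊤).untopA = t := by
  rw [← WithTop.coe_inj, coe_untopA_min, min_eq_left le_top]

lemma measurable_integral_of_le_of {Θ : Type*} {mΘ : MeasurableSpace Θ} {x : ℝ≥0 → Θ → ℝ} {r : ℝ≥0}
    (hm : ∀ u ≤ r, Measurable[mΘ] (x u)) (hc : ∀ θ, RightCont fun t => x t θ) :
    Measurable[mΘ] fun θ => ∫ u in (0 : ℝ)..r, x u.toNNReal θ := measurable_integral_of_le hm hc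

lemma rightCont_stoppedProcess {τ : Ω → WithTop ℝ≥0} {ω : Ω} (h : RightCont fun t => M t ω) :
    RightCont fun t => stoppedProcess (fun i => {ω | ⊥ < τ ω}.indicator (M i)) τ t ω := by
  have h1 : RightCont fun t => {ω | ⊥ < τ ω}.indicator (M t) ω := by
    by_cases hω : ω ∈ {ω | ⊥ < τ ω}
    · simpa only [Set.indicator_of_mem hω] using h
    · simp only [Set.indicator_of_notMem hω]
      exact fun _ => continuousWithinAt_const
  simp only [stoppedProcess]
  cases hτ : τ ω with
  | top => simpa only [untopA_min_top] using h1
  | coe r =>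
    simp only [untopA_min_coe]
    exact h1.comp_monotone (a := fun t => min t r) (by fun_prop) fun _ _ h => min_le_min_right _ h

/-- Optional stopping for local martingales whose increments are bounded up to the stopping time. -/
lemma setIntegral_stopped_sub_eq_zero_of_locally
    (hM : Locally (fun V => Martingale V ℱ P) ℱ M P) (hMc : ∀ ω, RightCont fun t => M t ω)
    {σ : Ω → ℝ≥0} {s t : ℝ≥0} (hσ : IsStop ℱ σ) (hs : ∀ ω, s ≤ σ ω) (ht : ∀ ω, σ ω ≤ t) {b : ℝ}
    (hb : ∀ ω r, s ≤ r → r ≤ σ ω → |M r ω - M s ω| ≤ b) {K : Set Ω} (hK : MeasurableSet[ℱ s] K) :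
    ∫ ω in K, (M (σ ω) ω - M s ω) ∂P = 0 := by
  obtain ⟨τ, hτ, hV⟩ := hM
  set V : ℕ → ℝ≥0 → Ω → ℝ := fun n =>
    stoppedProcess (fun i => {ω | ⊥ < τ n ω}.indicator (M i)) (τ n) with hVdef
  have hVc : ∀ n ω, RightCont fun t => V n t ω := fun n ω => rightCont_stoppedProcess (hMc ω)
  have hσm := measurable_of_isStoppingTime hσ
  have hVm : ∀ n r, Measurable (V n r) := fun n r =>
    ((hV n).1 r).measurable.mono (ℱ.le r) le_rfl
  have hVσ : ∀ n, Measurable fun ω => V n (σ ω) ω := fun n =>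
    measurable_eval_of_rightCont (hVm n) (hVc n) hσm
  have hK' := ℱ.le s K hK
  have hb0 : ∀ ω : Ω, 0 ≤ b := fun ω => (abs_nonneg _).trans (hb ω s le_rfl (hs ω))
  -- The bound `b` is inherited by every localised process, so dominated convergence removes the
  -- localisation; for large `n` the localised process agrees with `M` on `[0, t]`.
  have hVb : ∀ n ω, |V n (σ ω) ω - V n s ω| ≤ b := by
    intro n ω
    simp only [hVdef, stoppedProcess]
    by_cases hω : ω ∈ {ω | ⊥ < τ n ω}
    · simp only [Set.indicator_of_mem hω]
      cases hτ' : τ n ω with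
      | top => simpa only [untopA_min_top] using hb ω (σ ω) (hs ω) le_rfl
      | coe r =>
        simp only [untopA_min_coe]
        rcases le_total s r with h | h
        · rw [min_eq_left h]
          exact hb ω _ (le_min (hs ω) h) (min_le_left _ _)
        · rw [min_eq_right h, min_eq_right (h.trans (hs ω)), sub_self, abs_zero]
          exact hb0 ω
    · simp only [Set.indicator_of_notMem hω, sub_self, abs_zero]
      exact hb0 ω
  have h0 : ∀ n, ∫ ω in K, (V n (σ ω) ω - V n s ω) ∂P = 0 := by
    intro n
    have hG : ∀ r, s ≤ r → Measurable[ℱ r] (K.indicator fun _ => (1 : ℝ)) := fun r hr =>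
      measurable_const.indicator (ℱ.mono hr K hK)
    obtain ⟨h1, h2⟩ := integral_mul_sub_stopped_eq_zero (hV n) (hVc n) hσ hs ht
      (G := fun _ => K.indicator fun _ => (1 : ℝ)) hG (fun _ _ _ => continuousWithinAt_const) (C := 1)
      (fun _ ω => by by_cases h : ω ∈ K <;> simp [h])
    have hi := fun r => (hV n).integrable r
    have h3 : ∫ ω in K, (V n t ω - V n (σ ω) ω) ∂P = 0 := by
      rw [← integral_indicator hK', ← h2]
      congr 1
      ext ω
      by_cases h : ω ∈ K <;> simp [h, hVdef]
    have h4 := Martingale.setIntegral_sub_eq_zero (hV n) ((hs (Classical.choice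
      P.nonempty_of_neZero)).trans (ht _)) hK
    rw [integral_sub (hi t).integrableOn h1.integrableOn] at h3
    rw [integral_sub (hi t).integrableOn (hi s).integrableOn] at h4
    rw [integral_sub h1.integrableOn (hi s).integrableOn]
    change (∫ ω in K, V n t ω ∂P) - ∫ ω in K, V n s ω ∂P = 0 at h4
    linarith
  have hlim : ∀ᵐ ω ∂P, Tendsto (fun n => V n (σ ω) ω - V n s ω) atTop (𝓝 (M (σ ω) ω - M s ω)) := by
    filter_upwards [hτ.tendsto_top] with ω hω
    refine tendsto_const_nhds.congr' ?_
    filter_upwards [(tendsto_order.1 hω).1 (t : WithTop ℝ≥0) (WithTop.coe_lt_top t)] with n hn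
    have hpos : ω ∈ {ω | ⊥ < τ n ω} := bot_le.trans_lt hn
    have h1 : ∀ r ≤ t, V n r ω = M r ω := fun r hr => by
      simp only [hVdef, stoppedProcess]
      rw [min_eq_left ((WithTop.coe_le_coe.2 hr).trans hn.le), Set.indicator_of_mem hpos]
      rfl
    rw [h1 _ (ht ω), h1 _ ((hs ω).trans (ht ω))]
  have := tendsto_integral_of_dominated_convergence (μ := P.restrict K) (fun _ => b)
    (fun n => ((hVσ n).sub (hVm n s)).aestronglyMeasurable) (integrable_const _)
    (fun n => .of_forall fun ω => hVb n ω) (ae_restrict_of_ae hlim)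
  refine tendsto_nhds_unique this ?_
  exact (tendsto_const_nhds (x := (0 : ℝ))).congr fun n => (h0 n).symm

end LocalOptionalStopping

/-! ### Arbitrary solutions for the coupled generator -/

section CoupledSolution

abbrev SolvesLocalMP.past : Filtration ℝ≥0 ‹MeasurableSpace Ω› := naturalFiltration Z hZ.measurable

include hZ in
lemma SolvesLocalMP.proc : CadlagProc Z := ⟨hZ.measurable, hZ.cadlag⟩

include hZ in
lemma SolvesLocalMP.fst : CadlagProc fun t ω => (Z t ω).1 := hZ.proc.comp continuous_fst

include hq hA

/-- The martingale identity of the coupled process at a stopping time up to which the clock is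
bounded. -/
lemma SolvesLocalMP.setIntegral_stopped_eq_zero (ha : a ∈ A)
    (f : Fin (m + 1) → ℝ) {s t : ℝ≥0} {σ : Ω → ℝ≥0} (hσ : IsStop hZ.past σ)
    (hs : ∀ ω, s ≤ σ ω) (ht : ∀ ω, σ ω ≤ t) {n : ℝ}
    (hn : ∀ ω, ∫ r in (s : ℝ)..σ ω, |couplOp q a f (Z r.toNNReal ω)| ≤ n) {K : Set Ω}
    (hK : MeasurableSet[hZ.past s] K) :
    ∫ ω in K, (a.1 (Z (σ ω) ω).1 * f (Z (σ ω) ω).2 - a.1 (Z s ω).1 * f (Z s ω).2 -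
      ∫ r in (s : ℝ)..σ ω, couplOp q a f (Z r.toNNReal ω)) ∂P = 0 := by
  obtain ⟨D, hD0, h1, h2⟩ := exists_bound_pair hA ha
  obtain ⟨F, hF0, hF⟩ := exists_bound_fin f
  have ha1 : Continuous a.1 := (hA ha).1.1
  have ha2 : Continuous a.2 := (hA ha).2.1
  have hu : Continuous fun z : E × Fin (m + 1) => a.1 z.1 * f z.2 :=
    (ha1.comp continuous_fst).mul (continuous_of_discreteTopology.comp continuous_snd)
  have hg := continuous_couplOp hq ha1 ha2 f
  have hi := fun ω (u v : ℝ) => ((hZ.cadlag ω).comp hg).intervalIntegrable u v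
  have hincr : ∀ ω r, s ≤ r → testProcess (fun z : E × Fin (m + 1) => a.1 z.1 * f z.2)
      (couplOp q a f) Z r ω - testProcess (fun z : E × Fin (m + 1) => a.1 z.1 * f z.2)
      (couplOp q a f) Z s ω = a.1 (Z r ω).1 * f (Z r ω).2 - a.1 (Z s ω).1 * f (Z s ω).2 -
        ∫ r in (s : ℝ)..r, couplOp q a f (Z r.toNNReal ω) := fun ω r _ => by
    rw [← intervalIntegral.integral_interval_sub_left (hi ω 0 r) (hi ω 0 s)]
    simp only [testProcess]
    ring
  have h3 := setIntegral_stopped_sub_eq_zero_of_locally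
    (hZ.localMartingale _ ⟨a, ha, f, rfl⟩)
    (fun ω => ((cadlagProc_testProcess hZ.proc hu hg).2 ω).rightCont) hσ hs ht
    (b := D * F + D * F + n) (fun ω r hsr hr => ?_) hK
  · rw [← h3]
    congr 1
    ext ω
    exact (hincr ω _ (hs ω)).symm
  · rw [hincr ω r hsr]
    have hb : ∀ z : E × Fin (m + 1), |a.1 z.1 * f z.2| ≤ D * F := fun z => by
      rw [abs_mul]
      exact mul_le_mul (h1 _) (hF _) (abs_nonneg _) hD0
    refine (abs_sub _ _).trans (add_le_add ((abs_sub _ _).trans (add_le_add (hb _) (hb _))) ?_)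
    refine (intervalIntegral.abs_integral_le_integral_abs (by exact_mod_cast hsr)).trans
      (le_trans ?_ (hn ω))
    exact intervalIntegral.integral_mono_interval le_rfl (by exact_mod_cast hsr)
      (by exact_mod_cast hr) (.of_forall fun _ => abs_nonneg _) (hi ω _ _).abs

lemma jumpOp_const (c : ℝ) (z : E × Fin (m + 1)) : jumpOp q (fun _ => c) z = 0 := by
  simp [jumpOp]

/-- The first component solves the martingale problem with respect to the joint filtration. -/
lemma SolvesLocalMP.martingale_fst (ha : a ∈ A) :
    Martingale (testProcess a.1 a.2 fun t ω => (Z t ω).1) (hZ.past) P := by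
  obtain ⟨D, hD0, h1, h2⟩ := exists_bound_pair hA ha
  have ha1 : Continuous a.1 := (hA ha).1.1
  have ha2 : Continuous a.2 := (hA ha).2.1
  have hint : ∀ t, Integrable (testProcess a.1 a.2 (fun t ω => (Z t ω).1) t) P := fun t =>
    integrable_of_abs_le ((cadlagProc_testProcess hZ.fst ha1 ha2).1 t) fun ω =>
      abs_testProcess_le h1 h2 t ω
  refine martingale_of_setIntegral_eq (fun t => ?_) hint fun s t hst K hK => ?_
  · have hm : ∀ u ≤ t, Measurable[hZ.past t] fun ω => (Z u ω).1 :=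
      fun u hu => measurable_fst.comp (measurable_natural' hZ.measurable hu)
    exact ((ha1.measurable.comp (hm t le_rfl)).sub (ha1.measurable.comp (hm 0 zero_le))).sub
      (measurable_integral_of_le_of (x := fun u ω => a.2 (Z u ω).1)
        (fun u hu => ha2.measurable.comp (hm u hu)) fun ω => ((hZ.fst.2 ω).comp ha2).rightCont)
  -- For the constant `f = 1` the jump part disappears and the generator is bounded, so the local
  -- martingale property yields a true martingale, and it does so in the filtration of both
  -- components.
  · have hco : ∀ z : E × Fin (m + 1), couplOp q a (fun _ => 1) z = a.2 z.1 := fun z => by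
      simp [couplOp, jumpOp_const hq hA]
    have hi := fun ω (u v : ℝ) => ((hZ.fst.2 ω).comp ha2).intervalIntegrable u v
    have h3 := hZ.setIntegral_stopped_eq_zero hq hA ha (fun _ => 1) (σ := fun _ => t)
      (isStoppingTime_const _ t) (fun _ => hst) (fun _ => le_rfl) (n := D * |(t : ℝ) - s|)
      (fun ω => ?_) hK
    · rw [← sub_eq_zero, ← integral_sub (hint s).integrableOn (hint t).integrableOn,
        ← neg_eq_zero, ← integral_neg, ← h3]
      congr 1
      ext ω
      simp only [hco, mul_one]
      rw [← intervalIntegral.integral_interval_sub_left (hi ω 0 t) (hi ω 0 s)]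
      simp only [testProcess]
      ring
    · refine (le_abs_self _).trans ?_
      rw [← Real.norm_eq_abs]
      refine intervalIntegral.norm_integral_le_of_norm_le_const fun r _ => ?_
      rw [hco, Real.norm_eq_abs, abs_abs]
      exact h2 _

end CoupledSolution

/-! ### Comparison of total masses -/

section Mass

lemma integral_map_withDensity_ofReal {Θ E : Type*} [MeasurableSpace Θ] [MeasurableSpace E]
    (ρ : Measure Θ) {x : Θ → E} (hx : Measurable x) {w : Θ → ℝ} (hm : Measurable w)
    (hw : ∀ θ, 0 ≤ w θ) {f : E → ℝ} (hf : Measurable f) :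
    ∫ y, f y ∂((ρ.withDensity fun θ => ENNReal.ofReal (w θ)).map x) = ∫ θ, w θ * f (x θ) ∂ρ := by
  rw [integral_map hx.aemeasurable hf.aestronglyMeasurable,
    integral_withDensity_eq_integral_toReal_smul hm.ennreal_ofReal (by simp)]
  simp [ENNReal.toReal_ofReal (hw _)]

/-- If the domain determines the total mass then the total masses of two weighted distributions
agree as soon as the weighted integrals of the functions in the domain do. -/
lemma DeterminesMass.integral_weight_eq {E : Type*} [MeasurableSpace E] {𝒟 : Set (E → ℝ)}
    (hD : DeterminesMass 𝒟) (h𝒟 : ∀ f ∈ 𝒟, Measurable f)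
    {Θ₁ Θ₂ : Type*} [MeasurableSpace Θ₁] [MeasurableSpace Θ₂] {ρ₁ : Measure Θ₁} {ρ₂ : Measure Θ₂}
    {x₁ : Θ₁ → E} {x₂ : Θ₂ → E} (hx₁ : Measurable x₁) (hx₂ : Measurable x₂) {w₁ : Θ₁ → ℝ}
    {w₂ : Θ₂ → ℝ} (hm₁ : Measurable w₁) (hm₂ : Measurable w₂) (hi₁ : Integrable w₁ ρ₁)
    (hi₂ : Integrable w₂ ρ₂) (hw₁ : ∀ θ, 0 ≤ w₁ θ) (hw₂ : ∀ θ, 0 ≤ w₂ θ)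
    (h : ∀ f ∈ 𝒟, ∫ θ, w₁ θ * f (x₁ θ) ∂ρ₁ = ∫ θ, w₂ θ * f (x₂ θ) ∂ρ₂) :
    ∫ θ, w₁ θ ∂ρ₁ = ∫ θ, w₂ θ ∂ρ₂ := by
  have f₁ := isFiniteMeasure_withDensity_ofReal hi₁.2
  have f₂ := isFiniteMeasure_withDensity_ofReal hi₂.2
  have h1 := hD ((ρ₁.withDensity fun θ => ENNReal.ofReal (w₁ θ)).map x₁)
    ((ρ₂.withDensity fun θ => ENNReal.ofReal (w₂ θ)).map x₂) inferInstance inferInstance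
    fun f hf => by
      rw [integral_map_withDensity_ofReal _ hx₁ hm₁ hw₁ (h𝒟 f hf),
        integral_map_withDensity_ofReal _ hx₂ hm₂ hw₂ (h𝒟 f hf), h f hf]
  have h2 := integral_map_withDensity_ofReal ρ₁ hx₁ hm₁ hw₁ (f := fun _ => 1) measurable_const
  have h3 := integral_map_withDensity_ofReal ρ₂ hx₂ hm₂ hw₂ (f := fun _ => 1) measurable_const
  simp only [integral_const, smul_eq_mul, mul_one] at h2 h3
  rw [← h2, ← h3, Measure.real, Measure.real, h1]

end Mass

/-! ### Sojourns of the chain in one state -/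

section Sojourn

/-- On the event `K` of the past of `s`, the chain stays in the state `i` between the time `s` and
the stopping time `σ`, which is bounded by `t` and up to which the clock is bounded. -/
structure Sojourn (q : OffDiag m → E → ℝ) (Z : ℝ≥0 → Ω → E × Fin (m + 1))
    (hm : ∀ t, Measurable (Z t)) (i : Fin (m + 1)) (n : ℝ) (s t : ℝ≥0) (K : Set Ω)
    (σ : Ω → ℝ≥0) : Prop where
  isStop : IsStop (naturalFiltration Z hm) σ
  le : ∀ ω, s ≤ σ ω
  le_right : ∀ ω, σ ω ≤ t
  measurableSet : MeasurableSet[naturalFiltration Z hm s] K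
  start : ∀ ω ∈ K, (Z s ω).2 = i
  const : ∀ ω ∈ K, ∀ r, s ≤ r → r < σ ω → (Z r ω).2 = i
  clock : ∀ ω, ∫ r in (s : ℝ)..σ ω, totRate q (Z r.toNNReal ω).1 ≤ n

lemma isStoppingTime_max {ℱ : Filtration ℝ≥0 ‹MeasurableSpace Ω›} (hS : IsStop ℱ S)
    (hτ : IsStop ℱ τ) : IsStop ℱ fun ω => max (S ω) (τ ω) := by
  simpa only [IsStop, WithTop.coe_max] using hS.max hτ

lemma Sojourn.inter {hm : ∀ t, Measurable (Z t)} (h : Sojourn q Z hm i n s t K σ) {G : Set Ω}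
    (hG : MeasurableSet[naturalFiltration Z hm s] G) : Sojourn q Z hm i n s t (K ∩ G) σ :=
  { h with
    measurableSet := h.measurableSet.inter hG
    start := fun ω hω => h.start ω hω.1
    const := fun ω hω => h.const ω hω.1 }

include hq

lemma compIncr_add (f : Fin (m + 1) → ℝ) (hz : IsCadlag z)
    (s r σ : ℝ≥0) : compIncr q f s σ z = compIncr q f s r z + compIncr q f r σ z := by
  have hi := fun u v : ℝ => (hz.comp (hq.continuous_jumpOp f)).intervalIntegrable u v
  simp only [compIncr]
  rw [← intervalIntegral.integral_add_adjacent_intervals (hi s r) (hi r σ)]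
  ring

/-- A sojourn that is still going on at time `r` is a sojourn started at `r`. Off this event the end
is moved to `r`, which keeps it a stopping time after `r` without using up any clock. -/
lemma Sojourn.restart {hm : ∀ t, Measurable (Z t)} (hZc : ∀ ω, IsCadlag fun t => Z t ω)
    (hn : 0 ≤ n) (h : Sojourn q Z hm i n s t K σ) {r : ℝ≥0} (hsr : s ≤ r) (hrt : r ≤ t) :
    Sojourn q Z hm i n r t (K ∩ {ω | r < σ ω}) fun ω => max r (σ ω) where
  isStop := isStoppingTime_max (isStoppingTime_const _ r) h.isStop
  le ω := le_max_left _ _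
  le_right ω := max_le hrt (h.le_right ω)
  measurableSet := ((naturalFiltration Z hm).mono hsr K h.measurableSet).inter
    (IsStop.measurableSet_lt h.isStop r)
  start ω hω := h.const ω hω.1 r hsr hω.2
  const ω hω u hu hu' := h.const ω hω.1 u (hsr.trans hu) (by
    rwa [max_eq_right (le_of_lt hω.2)] at hu')
  clock ω := by
    rcases le_total r (σ ω) with h' | h'
    · rw [max_eq_right h']
      exact integral_totRate_le hq (hZc ω) hsr h' le_rfl (h.clock ω)
    · rw [max_eq_left h', intervalIntegral.integral_same]
      exact hn

/-- The mass that the exit rates of a sojourn put on a function. -/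
lemma integral_stopped_rate (hZp : CadlagProc Z) (i : Fin (m + 1)) (f : Fin (m + 1) → ℝ)
    (hσ : Measurable σ) (hs : ∀ ω, s ≤ σ ω) (ht : ∀ ω, σ ω ≤ t)
    (hn : ∀ ω, ∫ r in (s : ℝ)..σ ω, totRate q (Z r.toNNReal ω).1 ≤ n) (hK : MeasurableSet K)
    {g : E → ℝ} (hg : Continuous g) {D : ℝ} (hD : ∀ x, |g x| ≤ D) :
    Integrable (fun p : Ω × ℝ => (if p.2.toNNReal < σ p.1 then K.indicator (fun _ => 1) p.1 *
        jumpOp q f ((Z p.2.toNNReal p.1).1, i) else 0) * g (Z p.2.toNNReal p.1).1)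
      (P.prod (volume.restrict (Set.Ioc (s : ℝ) t))) ∧ IntegrableOn (fun ω => ∫ r in (s : ℝ)..σ ω,
      jumpOp q f ((Z r.toNNReal ω).1, i) * g (Z r.toNNReal ω).1) K P ∧
    ∫ p : Ω × ℝ, (if p.2.toNNReal < σ p.1 then K.indicator (fun _ => 1) p.1 *
        jumpOp q f ((Z p.2.toNNReal p.1).1, i) else 0) * g (Z p.2.toNNReal p.1).1
      ∂(P.prod (volume.restrict (Set.Ioc (s : ℝ) t))) = ∫ ω in K, (∫ r in (s : ℝ)..σ ω,
      jumpOp q f ((Z r.toNNReal ω).1, i) * g (Z r.toNNReal ω).1) ∂P := by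
  obtain ⟨F, hF0, hF⟩ := exists_bound_fin f
  have hXp : CadlagProc fun t ω => (Z t ω).1 := hZp.comp continuous_fst
  have hj : CadlagProc fun r ω => jumpOp q f ((Z r ω).1, i) * g (Z r ω).1 :=
    hXp.comp (((hq.continuous_jumpOp f).comp (Continuous.prodMk_left i)).mul hg)
  have hΦ := (CadlagProc.const (measurable_const.indicator hK : Measurable
    (K.indicator fun _ => (1 : ℝ)))).mul hj
  have hint := integrable_uncurry_stopped (P := P) hΦ.uncurry (fun ω => (hΦ.2 ω).locBdd) hσ hs ht
    (C := 2 * F * D * n) fun ω => by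
      have hD0 : 0 ≤ D := (abs_nonneg _).trans (hD (Z 0 ω).1)
      have h1 : ∫ r in (s : ℝ)..σ ω, |K.indicator (fun _ => 1) ω *
          (jumpOp q f ((Z r.toNNReal ω).1, i) * g (Z r.toNNReal ω).1)| ≤
          ∫ r in (s : ℝ)..σ ω, 2 * F * D * totRate q (Z r.toNNReal ω).1 := by
        refine intervalIntegral.integral_mono_on (by exact_mod_cast hs ω)
          ((hΦ.2 ω).intervalIntegrable _ _).abs
          ((totRate_intervalIntegrable hq (hZp.2 ω) _ _).const_mul _) fun r _ => ?_
        refine (abs_indicator_one_mul_le K ω _).trans ?_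
        rw [abs_mul, mul_right_comm]
        exact mul_le_mul (hq.abs_genRate_le hF (fun u => (Z u ω).1) (fun _ => i) r.toNNReal) (hD _)
          (abs_nonneg _) (mul_nonneg (by positivity) (hq.totRate_nonneg _))
      rw [intervalIntegral.integral_const_mul] at h1
      exact h1.trans (mul_le_mul_of_nonneg_left (hn ω) (by positivity))
  have h2 : (fun p : Ω × ℝ => (if p.2.toNNReal < σ p.1 then K.indicator (fun _ => 1) p.1 *
      jumpOp q f ((Z p.2.toNNReal p.1).1, i) else 0) * g (Z p.2.toNNReal p.1).1) =
      Function.uncurry fun (ω : Ω) (r : ℝ) => if r.toNNReal < σ ω then K.indicator (fun _ => 1) ω *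
        (jumpOp q f ((Z r.toNNReal ω).1, i) * g (Z r.toNNReal ω).1) else 0 := by
    ext p
    simp only [Function.uncurry]
    split_ifs <;> ring
  have h3 : ∀ ω, ∫ r in Set.Ioc (s : ℝ) t, (if r.toNNReal < σ ω then K.indicator (fun _ => 1) ω *
        (jumpOp q f ((Z r.toNNReal ω).1, i) * g (Z r.toNNReal ω).1) else 0) =
      K.indicator (fun ω => ∫ r in (s : ℝ)..σ ω,
        jumpOp q f ((Z r.toNNReal ω).1, i) * g (Z r.toNNReal ω).1) ω := fun ω => by
    rw [← setIntegral_Ioc_eq_stopped (x := fun r => K.indicator (fun _ => 1) ω *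
      (jumpOp q f ((Z r ω).1, i) * g (Z r ω).1)) (hs ω) (ht ω), intervalIntegral.integral_const_mul]
    by_cases h : ω ∈ K <;> simp [h]
  rw [h2]
  refine ⟨hint, ?_, ?_⟩
  · rw [← integrable_indicator_iff hK]
    exact hint.integral_prod_left.congr (.of_forall h3)
  · rw [integral_prod _ hint, ← integral_indicator hK]
    exact integral_congr_ae (.of_forall h3)

include hA

lemma Sojourn.integral_abs_couplOp_le {hm : ∀ t, Measurable (Z t)} (h : Sojourn q Z hm i n s t K σ)
    (hZc : ∀ ω, IsCadlag fun t => Z t ω) (ha : a ∈ A) {D F : ℝ}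
    (h1 : ∀ x, |a.1 x| ≤ D) (h2 : ∀ x, |a.2 x| ≤ D) (hF : ∀ j, |f j| ≤ F) (ω : Ω) :
    ∫ r in (s : ℝ)..σ ω, |couplOp q a f (Z r.toNNReal ω)| ≤ F * D * t + 2 * F * D * n := by
  have hD0 : 0 ≤ D := (abs_nonneg _).trans (h1 (Z 0 ω).1)
  have hF0 : 0 ≤ F := (abs_nonneg _).trans (hF 0)
  exact MarkovCoupling.integral_abs_couplOp_le hq hD0 hF0 (hA ha).1.1 (hA ha).2.1 h1 h2 hF (h.le ω)
    (h.le_right ω) (hZc ω) (h.clock ω)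

/-- During a sojourn, the exit distribution has the expected compensator on the domain. -/
lemma Sojourn.setIntegral_exit_eq (h : Sojourn q Z hZ.measurable i n s t K σ) (hf : f i = 0)
    (ha : a ∈ A) : ∫ ω in K, (f (Z (σ ω) ω).2 * a.1 (Z (σ ω) ω).1 -
      ∫ r in (s : ℝ)..σ ω, jumpOp q f ((Z r.toNNReal ω).1, i) * a.1 (Z r.toNNReal ω).1) ∂P = 0 := by
  obtain ⟨D, hD0, h1, h2⟩ := exists_bound_pair hA ha
  obtain ⟨F, hF0, hF⟩ := exists_bound_fin f
  have h3 := hZ.setIntegral_stopped_eq_zero hq hA ha f h.isStop h.le h.le_right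
    (n := F * D * t + 2 * F * D * n) (fun ω => ?_) h.measurableSet
  -- On `K` the chain sits in `i` up to `σ`. As `f i = 0`, the initial term and the part of the
  -- generator with `a.2` disappear, and only the exit term and its rate are left.
  · rw [← h3]
    refine setIntegral_congr_fun ((hZ.past).le s _ h.measurableSet)
      fun ω hω => ?_
    rw [h.start ω hω, hf, mul_zero, sub_zero, mul_comm]
    congr 1
    refine intervalIntegral.integral_congr_Ioo_of_le (by exact_mod_cast h.le ω) fun r hr => ?_
    have h4 := h.const ω hω r.toNNReal (NNReal.le_toNNReal_of_coe_le hr.1.le)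
      ((Real.toNNReal_lt_iff_lt_coe (s.coe_nonneg.trans hr.1.le)).2 hr.2)
    have h5 : Z r.toNNReal ω = ((Z r.toNNReal ω).1, i) := Prod.ext rfl h4
    simp only [couplOp, h4, hf, zero_mul, zero_add]
    rw [h5, mul_comm]
  · exact h.integral_abs_couplOp_le hq hA hZ.cadlag ha h1 h2 hF ω

include hD

/-- During a sojourn, the compensated chain has mean zero. -/
lemma Sojourn.setIntegral_compIncr_of_nonneg
    (h : Sojourn q Z hZ.measurable i n s t K σ) (hf : f i = 0) (hf0 : ∀ j, 0 ≤ f j) :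
    ∫ ω in K, compIncr q f s (σ ω) (fun r => Z r ω) ∂P = 0 := by
  obtain ⟨F, hF0, hF⟩ := exists_bound_fin f
  have hσ := measurable_of_isStoppingTime h.isStop
  have hK := (hZ.past).le s _ h.measurableSet
  have hfm : Measurable fun ω => f (Z (σ ω) ω).2 :=
    (hZ.proc.comp (continuous_of_discreteTopology.comp continuous_snd : Continuous
      fun z : E × Fin (m + 1) => f z.2)).eval hσ
  have hXu := measurable_uncurry_of_rightCont hZ.fst.1 fun ω => (hZ.fst.2 ω).rightCont
  have hXσ : Measurable fun ω => (Z (σ ω) ω).1 := hXu.comp (hσ.prodMk measurable_id)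
  have hrate := fun (g : E → ℝ) (hg : Continuous g) (D : ℝ) (hD : ∀ x, |g x| ≤ D) =>
    integral_stopped_rate (P := P) hq hZ.proc i f hσ h.le h.le_right h.clock hK hg hD
  have hX2 : Measurable fun p : Ω × ℝ => (Z p.2.toNNReal p.1).1 :=
    hXu.comp ((measurable_real_toNNReal.comp measurable_snd).prodMk measurable_fst)
  -- Two finite measures on `E` are compared: the law of the first component at `σ`, weighted by `f`
  -- of the chain on `K`, and its expected occupation measure, weighted by the exit rate. By
  -- `setIntegral_exit_eq` they agree on the domain of `A`, hence they have the same total mass. The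
  -- conditions `0 ≤ f` and `f i = 0` make both weights nonnegative.
  have hmass := hD.integral_weight_eq (ρ₁ := P) (ρ₂ := P.prod (volume.restrict (Set.Ioc (s : ℝ) t)))
    (by rintro _ ⟨a, ha, rfl⟩; exact (hA ha).1.1.measurable) hXσ hX2
    (w₁ := K.indicator fun ω => f (Z (σ ω) ω).2)
    (w₂ := fun p => if p.2.toNNReal < σ p.1 then K.indicator (fun _ => 1) p.1 *
      jumpOp q f ((Z p.2.toNNReal p.1).1, i) else 0) (hfm.indicator hK)
    (Measurable.ite (measurableSet_lt (measurable_real_toNNReal.comp measurable_snd)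
      (hσ.comp measurable_fst)) (((measurable_const.indicator hK).comp measurable_fst).mul
        (((hq.continuous_jumpOp f).comp (Continuous.prodMk_left i)).measurable.comp hX2))
      measurable_const)
    ((integrable_of_abs_le hfm fun ω => hF _).indicator hK)
    (by simpa only [mul_one] using (hrate (fun _ => 1) continuous_const 1 (by simp)).1)
    (fun ω => Set.indicator_nonneg (fun ω _ => hf0 _) ω)
    (fun p => by
      split_ifs
      · refine mul_nonneg (Set.indicator_nonneg (fun _ _ => zero_le_one) _)
          (Finset.sum_nonneg fun p' _ => ?_)
        dsimp only
        split_ifs with h1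
        · rw [← h1, hf, sub_zero]
          exact mul_nonneg (hq.nonneg _ _) (hf0 _)
        · simp
      · exact le_rfl)
    (by
      rintro _ ⟨a, ha, rfl⟩
      obtain ⟨D, hD0, h1, h2⟩ := exists_bound_pair hA ha
      obtain ⟨-, h3, h4⟩ := hrate a.1 (hA ha).1.1 D h1
      have h5 := h.setIntegral_exit_eq hq hA hZ hf ha
      rw [integral_sub ?_ h3, ← h4, sub_eq_zero, ← integral_indicator hK] at h5
      · rw [← h5]
        congr 1
        ext ω
        by_cases h : ω ∈ K <;> simp [h]
      · refine (integrable_of_abs_le (c := F * D) (hfm.mul ((hA ha).1.1.measurable.comp hXσ))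
          fun ω => ?_).integrableOn
        rw [Pi.mul_apply, abs_mul]
        exact mul_le_mul (hF _) (h1 _) (abs_nonneg _) hF0)
  obtain ⟨-, h3, h4⟩ := hrate (fun _ => 1) continuous_const 1 (by simp)
  simp only [mul_one] at h3 h4
  rw [h4, integral_indicator hK, ← sub_eq_zero,
    ← integral_sub (integrable_of_abs_le hfm fun ω => hF _).integrableOn h3] at hmass
  rw [← hmass]
  refine setIntegral_congr_fun hK fun ω hω => ?_
  simp only [compIncr]
  rw [h.start ω hω, hf, sub_zero]
  congr 1
  refine intervalIntegral.integral_congr_Ioo_of_le (by exact_mod_cast h.le ω) fun r hr => ?_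
  have h5 := h.const ω hω r.toNNReal (NNReal.le_toNNReal_of_coe_le hr.1.le)
    ((Real.toNNReal_lt_iff_lt_coe (s.coe_nonneg.trans hr.1.le)).2 hr.2)
  exact congrArg (jumpOp q f) (Prod.ext rfl h5)

end Sojourn

/-! ### Mean zero and orthogonality to martingales during a sojourn -/

section SojournOrthogonality

include hq

/-- The compensated increments depend linearly on the function, and constants do not matter. -/
lemma compIncr_sub_of_eq {f g h : Fin (m + 1) → ℝ} {c : ℝ} (hf : ∀ j, f j = c + g j - h j)
    (hz : IsCadlag z) (s σ : ℝ≥0) :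
    compIncr q f s σ z = compIncr q g s σ z - compIncr q h s σ z := by
  have hi := fun (f : Fin (m + 1) → ℝ) (u v : ℝ) =>
    (hz.comp (hq.continuous_jumpOp f)).intervalIntegrable u v
  have h1 : ∀ z, jumpOp q f z = jumpOp q g z - jumpOp q h z := fun z => by
    simp only [jumpOp, hf, ← Finset.sum_sub_distrib]
    exact Finset.sum_congr rfl fun _ _ => by ring
  simp only [compIncr, h1, hf]
  rw [intervalIntegral.integral_sub (hi g _ _) (hi h _ _)]
  ring

include hA hD

/-- The function `f - f i` is the difference of its positive and negative parts, both of which are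
nonnegative and vanish at `i`; constants do not contribute to compensated increments. -/
lemma Sojourn.setIntegral_compIncr
    (h : Sojourn q Z hZ.measurable i n s t K σ) (f : Fin (m + 1) → ℝ) :
    ∫ ω in K, compIncr q f s (σ ω) (fun r => Z r ω) ∂P = 0 := by
  have h1 := fun ω => compIncr_sub_of_eq hq (f := f) (g := fun j => max (f j - f i) 0)
    (h := fun j => max (f i - f j) 0) (c := f i) (fun j => by
      have := max_zero_sub_max_neg_zero_eq_self (f j - f i)
      rw [neg_sub] at this
      linarith) (hZ.cadlag ω) s (σ ω)
  have h2 := fun f => (integrable_compIncr (P := P) hq hZ.proc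
    (measurable_of_isStoppingTime h.isStop) h.le h.clock f).integrableOn (s := K)
  simp only [h1]
  rw [integral_sub (h2 _) (h2 _),
    h.setIntegral_compIncr_of_nonneg hq hA hZ hD (by simp) (fun j => le_max_right _ _),
    h.setIntegral_compIncr_of_nonneg hq hA hZ hD (by simp) (fun j => le_max_right _ _), sub_zero]

lemma Sojourn.integral_mul_compIncr
    (h : Sojourn q Z hZ.measurable i n s t K σ) (f : Fin (m + 1) → ℝ) {H : Ω → ℝ}
    (hH : Measurable[hZ.past s] H) (hint : Integrable (fun ω => H ω * (K.indicator (fun _ => 1) ω *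
      compIncr q f s (σ ω) fun r => Z r ω)) P) :
    ∫ ω, H ω * (K.indicator (fun _ => 1) ω * compIncr q f s (σ ω) fun r => Z r ω) ∂P = 0 := by
  have hle := (hZ.past).le s
  have hK := hle K h.measurableSet
  have h1 : ∀ ω, K.indicator (fun _ => 1) ω * compIncr q f s (σ ω) (fun r => Z r ω) =
      K.indicator (fun ω => compIncr q f s (σ ω) fun r => Z r ω) ω := fun ω => by
    by_cases hω : ω ∈ K <;> simp [hω]
  simp only [h1] at hint ⊢
  refine integral_mul_eq_zero_of_setIntegral hle ((integrable_compIncr hq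
    hZ.proc (measurable_of_isStoppingTime h.isStop) h.le h.clock f).indicator hK)
    (fun G hG => ?_) hH hint
  rw [setIntegral_indicator hK, Set.inter_comm]
  exact (h.inter hG).setIntegral_compIncr hq hA hZ hD f

/-- During a sojourn, the compensated chain is orthogonal to the martingales of the first
component. -/
lemma Sojourn.integral_mul_martingale
    (h : Sojourn q Z hZ.measurable i n s t K σ) (hn : 0 ≤ n) (f : Fin (m + 1) → ℝ)
    (ha : a ∈ A) {T : ℝ≥0} (htT : t ≤ T) :
    ∫ ω, K.indicator (fun _ => 1) ω * compIncr q f s (σ ω) (fun r => Z r ω) *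
      (testProcess a.1 a.2 (fun t ω => (Z t ω).1) T ω -
        testProcess a.1 a.2 (fun t ω => (Z t ω).1) s ω) ∂P = 0 := by
  obtain ⟨D, hD0, h1, h2⟩ := exists_bound_pair hA ha
  obtain ⟨F, -, hF⟩ := exists_bound_fin f
  have ha1 : Continuous a.1 := (hA ha).1.1
  have ha2 : Continuous a.2 := (hA ha).2.1
  set ℱ := hZ.past with hℱ
  set M := testProcess a.1 a.2 fun t ω => (Z t ω).1 with hMdef
  have hM : Martingale M ℱ P := hZ.martingale_fst hq hA ha
  have hK := ℱ.le s K h.measurableSet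
  set κ : Ω → ℝ := K.indicator fun _ => (1 : ℝ) with hκ
  have hκm : Measurable κ := measurable_const.indicator hK
  have hκs : ∀ r, s ≤ r → Measurable[ℱ r] κ := fun r hr =>
    measurable_const.indicator (ℱ.mono hr K h.measurableSet)
  have hκ1 : ∀ w, |κ w| ≤ 1 := fun w => by by_cases hw : w ∈ K <;> simp [hκ, hw]
  have hσm := measurable_of_isStoppingTime h.isStop
  have hMp : CadlagProc M := cadlagProc_testProcess hZ.fst ha1 ha2
  have hfY : CadlagProc fun r w => f (Z r w).2 :=
    hZ.proc.comp (continuous_of_discreteTopology.comp continuous_snd)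
  have hσT : ∀ ω, σ ω ≤ T := fun ω => (h.le_right ω).trans htT
  have hMe : ∀ {τ : Ω → ℝ≥0}, IsStop ℱ τ → (∀ ω, s ≤ τ ω) →
      (∀ ω, τ ω ≤ T) → ∫ w, κ w * (f (Z (τ w) w).2 * (M T w - M (τ w) w)) ∂P = 0 :=
    fun {τ} hτ hsτ hτT => by
      have := (integral_mul_sub_stopped_eq_zero hM (fun ω => (hMp.2 ω).rightCont) hτ hsτ hτT
        (G := fun r w => κ w * f (Z r w).2) (fun r hr => (hκs r hr).mul
          ((measurable_of_countable f).comp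
            (measurable_snd.comp (measurable_natural' hZ.measurable le_rfl))))
        (fun w r _ => continuousWithinAt_const.mul ((hfY.2 w r).1)) (C := F) (fun r w =>
          (abs_indicator_one_mul_le _ _ _).trans (hF _))).2
      simpa only [mul_assoc] using this
  obtain ⟨i3, e3⟩ := setIntegral_couplOp_eq (P := P) (f := f) hq hZ.proc ha1 ha2 hD0 h1 h2 hMdef.symm hK
    hκ.symm hσm h.le h.le_right htT hn h.clock (hMe h.isStop h.le hσT)
    (hMe (isStoppingTime_const _ s) (fun _ => le_rfl) fun w => (h.le w).trans (hσT w))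
    (fun r hsr hrt => integral_mul_martingale_sub_eq_zero hM (hrt.trans htT)
      (Measurable.ite (IsStop.measurableSet_lt h.isStop r)
        ((hκs r hsr).mul ((hq.continuous_jumpOp f).measurable.comp
          (measurable_natural' hZ.measurable le_rfl))) measurable_const))
    (fun r hsr hrt hint => by
      have hrw : ∀ w, (if r < σ w then κ w * (a.2 (Z r w).1 *
          compIncr q f r (σ w) fun u => Z u w) else 0) =
          a.2 (Z r w).1 * ((K ∩ {ω | r < σ ω}).indicator (fun _ => 1) w *
            compIncr q f r (max r (σ w)) fun v => Z v w) := fun w => by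
        by_cases hw : r < σ w
        · rw [if_pos hw, max_eq_right hw.le]
          by_cases hwK : w ∈ K <;> simp [hκ, hw, hwK]
        · simp [hw]
      simp only [hrw] at hint ⊢
      exact (h.restart hq hZ.cadlag hn hsr hrt).integral_mul_compIncr hq hA hZ hD f
        ((ha2.measurable.comp measurable_fst).comp (measurable_natural' hZ.measurable le_rfl)) hint)
  -- The local martingale problem makes the product side zero. What remains is the compensated
  -- increment weighted by `M T` plus the initial value and the integral up to `s`; subtracting the
  -- weight `a.1` at time `s`, which also has mean zero, turns this weight into `M T - M s`.
  rw [hZ.setIntegral_stopped_eq_zero hq hA ha f h.isStop h.le h.le_right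
    (h.integral_abs_couplOp_le hq hA hZ.cadlag ha h1 h2 hF) h.measurableSet] at e3
  have i6 : Integrable (fun w => a.1 (Z s w).1 * (κ w * compIncr q f s (σ w) fun v => Z v w)) P :=
    ((integrable_compIncr (P := P) hq hZ.proc hσm h.le h.clock f).bdd_mul hκm.aestronglyMeasurable
      (.of_forall hκ1)).bdd_mul (ha1.measurable.comp (hZ.fst.1 s)).aestronglyMeasurable
        (.of_forall fun w => h1 _)
  have e6 : ∫ w, a.1 (Z s w).1 * (κ w * compIncr q f s (σ w) fun v => Z v w) ∂P = 0 :=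
    h.integral_mul_compIncr hq hA hZ hD f
    ((ha1.measurable.comp measurable_fst).comp (measurable_natural' hZ.measurable le_rfl)) i6
  have h36 := integral_sub i3 i6
  rw [e6, sub_zero, ← e3] at h36
  rw [← h36]
  congr 1
  ext w
  have h9 : M s w = a.1 (Z s w).1 - a.1 (Z 0 w).1 - ∫ r in (0 : ℝ)..s, a.2 (Z r.toNNReal w).1 := rfl
  rw [h9]
  ring

end SojournOrthogonality

/-! ### Well-posedness and changes of measure -/

section ChangeOfMeasure

variable {S : Type*} [TopologicalSpace S] [TopologicalSpace.MetrizableSpace S]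
  [SecondCountableTopology S] [MeasurableSpace S] [BorelSpace S]
  {Ω : Type*} [MeasurableSpace Ω]

def pathMap (X : ℝ≥0 → Ω → S) (hX : ∀ ω, IsCadlag fun t => X t ω) (ω : Ω) : PathSpace S :=
  ⟨fun t => X t ω, hX ω⟩

lemma measurable_coord (t : ℝ≥0) : Measurable (coord t : PathSpace S → S) :=
  (measurable_pi_apply t).comp measurable_subtype_coe

lemma measurable_pathMap {X : ℝ≥0 → Ω → S} (hXm : ∀ t, Measurable (X t))
    (hX : ∀ ω, IsCadlag fun t => X t ω) : Measurable (pathMap X hX) :=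
  (measurable_pi_iff.2 hXm).subtype_mk

lemma measurable_testProcess_natural {X : ℝ≥0 → Ω → S} (hXm : ∀ t, Measurable (X t))
    (hX : ∀ ω, IsCadlag fun t => X t ω) {f g : S → ℝ} (hf : Continuous f) (hg : Continuous g)
    (t : ℝ≥0) : Measurable[naturalFiltration X hXm t] (testProcess f g X t) :=
  ((hf.measurable.comp (measurable_natural' hXm le_rfl)).sub
    (hf.measurable.comp (measurable_natural' hXm zero_le))).sub
    (measurable_integral_of_le_of (x := fun u ω => g (X u ω))
      (fun _ hu => hg.measurable.comp (measurable_natural' hXm hu))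
      fun ω => ((hX ω).comp hg).rightCont)

/-- A bounded density which preserves the martingale property of the test processes. -/
structure IsMPWeight (A : Set ((S → ℝ) × (S → ℝ))) (X : ℝ≥0 → Ω → S) (hX : ∀ t, Measurable (X t))
    (P : Measure Ω) (L : Ω → ℝ) : Prop where
  measurable : Measurable L
  nonneg : ∀ ω, 0 ≤ L ω
  bdd : ∃ C, ∀ ω, |L ω| ≤ C
  orth : ∀ a ∈ A, ∀ u T : ℝ≥0, u ≤ T → ∀ H, MeasurableSet[naturalFiltration X hX u] H →
    ∫ ω in H, L ω * (testProcess a.1 a.2 X T ω - testProcess a.1 a.2 X u ω) ∂P = 0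

variable {A : Set ((S → ℝ) × (S → ℝ))} {P : Measure Ω} [IsProbabilityMeasure P]
  {X : ℝ≥0 → Ω → S} {hXm : ∀ t, Measurable (X t)} {L : Ω → ℝ}

lemma IsMPWeight.const_mul (h : IsMPWeight A X hXm P L) {c : ℝ} (hc : 0 ≤ c) :
    IsMPWeight A X hXm P fun ω => c * L ω where
  measurable := h.measurable.const_mul c
  nonneg ω := mul_nonneg hc (h.nonneg ω)
  bdd := by
    obtain ⟨C, hC⟩ := h.bdd
    exact ⟨|c| * C, fun ω => by rw [abs_mul]; exact mul_le_mul_of_nonneg_left (hC ω) (abs_nonneg _)⟩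
  orth a ha u T huT H hH := by
    simp only [mul_assoc]
    rw [integral_const_mul, h.orth a ha u T huT H hH, mul_zero]

lemma IsMPWeight.integrable (h : IsMPWeight A X hXm P L) : Integrable L P :=
  h.bdd.elim fun _ hC => integrable_of_abs_le h.measurable hC

/-- The law of the path under a density. -/
noncomputable def weightedLaw (P : Measure Ω) (L : Ω → ℝ) (X : ℝ≥0 → Ω → S)
    (hX : ∀ ω, IsCadlag fun t => X t ω) : Measure (PathSpace S) :=
  (P.withDensity fun ω => ENNReal.ofReal (L ω)).map (pathMap X hX)

variable (hX : ∀ ω, IsCadlag fun t => X t ω)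

include hX

lemma IsMPWeight.isFiniteMeasure (h : IsMPWeight A X hXm P L) :
    IsFiniteMeasure (weightedLaw P L X hX) := by
  have := isFiniteMeasure_withDensity_ofReal h.integrable.2
  exact inferInstanceAs (IsFiniteMeasure (Measure.map _ _))

lemma IsMPWeight.setIntegral_eq (h : IsMPWeight A X hXm P L) {f : PathSpace S → ℝ}
    (hf : Measurable f) {G : Set (PathSpace S)} (hG : MeasurableSet G) :
    ∫ x in G, f x ∂(weightedLaw P L X hX) =
      ∫ ω in pathMap X hX ⁻¹' G, L ω * f (pathMap X hX ω) ∂P := by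
  rw [← integral_indicator hG, ← integral_indicator (measurable_pathMap hXm hX hG), weightedLaw,
    integral_map_withDensity_ofReal P (measurable_pathMap hXm hX) h.measurable h.nonneg
      (hf.indicator hG)]
  congr 1
  ext ω
  by_cases hω : pathMap X hX ω ∈ G
  · rw [Set.indicator_of_mem hω, Set.indicator_of_mem (Set.mem_preimage.2 hω)]
  · rw [Set.indicator_of_notMem hω, mul_zero, Set.indicator_of_notMem (s := pathMap X hX ⁻¹' G) hω]

lemma IsMPWeight.real_eq (h : IsMPWeight A X hXm P L) {G : Set (PathSpace S)}
    (hG : MeasurableSet G) : (weightedLaw P L X hX).real G = ∫ ω in pathMap X hX ⁻¹' G, L ω ∂P := by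
  have := h.setIntegral_eq hX (f := fun _ => 1) measurable_const hG
  simpa using this

lemma IsMPWeight.solvesMP (hA : A ⊆ boundedContinuous S ×ˢ boundedContinuous S)
    (h : IsMPWeight A X hXm P L) (h1 : ∫ ω, L ω ∂P = 1) :
    IsProbabilityMeasure (weightedLaw P L X hX) ∧ SolvesMP A coord (weightedLaw P L X hX) := by
  have hfin := h.isFiniteMeasure hX
  have hprob : IsProbabilityMeasure (weightedLaw P L X hX) := by
    refine ⟨?_⟩
    have h2 := h.real_eq hX MeasurableSet.univ
    rw [Set.preimage_univ, setIntegral_univ, h1] at h2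
    rwa [Measure.real, ENNReal.toReal_eq_one_iff] at h2
  refine ⟨hprob, measurable_coord, fun x => x.2, fun a ha => ?_⟩
  obtain ⟨⟨ha1, D₁, hD₁⟩, ha2, D₂, hD₂⟩ := hA ha
  have hm := fun t => measurable_testProcess_natural (X := coord) (measurable_coord (S := S))
    (fun x => x.2) ha1 ha2 t
  have hm' := fun t => (hm t).mono ((naturalFiltration _ measurable_coord).le t) le_rfl
  have hint : ∀ t, Integrable (testProcess a.1 a.2 coord t) (weightedLaw P L X hX) := fun t =>
    integrable_of_abs_le (hm' t) fun x => abs_testProcess_le (D := max D₁ D₂)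
      (fun x => (hD₁ x).trans (le_max_left _ _)) (fun x => (hD₂ x).trans (le_max_right _ _)) t x
  refine martingale_of_setIntegral_eq hm hint fun u T huT K hK => ?_
  rw [eq_comm, ← sub_eq_zero, ← integral_sub (hint T).integrableOn (hint u).integrableOn,
    h.setIntegral_eq (f := fun x => testProcess a.1 a.2 coord T x - testProcess a.1 a.2 coord u x)
      hX ((hm' T).sub (hm' u)) ((naturalFiltration _ measurable_coord).le u K hK)]
  obtain ⟨B, hB, rfl⟩ := (measurableSet_natural_iff measurable_coord).1 hK
  exact h.orth a ha u T huT _ ((measurableSet_natural_iff hXm).2 ⟨B, hB, rfl⟩)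

/-- If the martingale problem is well-posed, the weighted law of the path is determined by its
initial distribution. -/
lemma WellPosedMP.setIntegral_eq (hA : A ⊆ boundedContinuous S ×ˢ boundedContinuous S)
    (hW : WellPosedMP A) {Ω' : Type*} [MeasurableSpace Ω'] {P' : Measure Ω'}
    [IsProbabilityMeasure P'] {X' : ℝ≥0 → Ω' → S} {hXm' : ∀ t, Measurable (X' t)} {L' : Ω' → ℝ}
    (hX' : ∀ ω, IsCadlag fun t => X' t ω) (h : IsMPWeight A X hXm P L)
    (h' : IsMPWeight A X' hXm' P' L')
    (h0 : ∀ Γ, MeasurableSet Γ → ∫ ω in X 0 ⁻¹' Γ, L ω ∂P = ∫ ω in X' 0 ⁻¹' Γ, L' ω ∂P')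
    {G : Set (PathSpace S)} (hG : MeasurableSet G) :
    ∫ ω in pathMap X hX ⁻¹' G, L ω ∂P = ∫ ω in pathMap X' hX' ⁻¹' G, L' ω ∂P' := by
  have hp : ∫ ω, L ω ∂P = ∫ ω, L' ω ∂P' := by simpa using h0 _ MeasurableSet.univ
  have hp0 : 0 ≤ ∫ ω, L ω ∂P := integral_nonneg h.nonneg
  -- A weight of total mass zero cannot be normalised, but then both sides vanish. Otherwise both
  -- weights are divided by their common mass and become probability densities.
  rcases hp0.eq_or_lt with hz | hpos
  · have h1 : ∫ ω in pathMap X hX ⁻¹' G, L ω ∂P ≤ ∫ ω, L ω ∂P :=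
      setIntegral_le_integral h.integrable (.of_forall h.nonneg)
    have h2 : ∫ ω in pathMap X' hX' ⁻¹' G, L' ω ∂P' ≤ ∫ ω, L' ω ∂P' :=
      setIntegral_le_integral h'.integrable (.of_forall h'.nonneg)
    have h3 : 0 ≤ ∫ ω in pathMap X hX ⁻¹' G, L ω ∂P := integral_nonneg h.nonneg
    have h4 : 0 ≤ ∫ ω in pathMap X' hX' ⁻¹' G, L' ω ∂P' := integral_nonneg h'.nonneg
    linarith
  · set p := ∫ ω, L ω ∂P with hpdef
    have g := h.const_mul (inv_nonneg.2 hp0)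
    have g' := h'.const_mul (inv_nonneg.2 hp0)
    obtain ⟨i, s⟩ := g.solvesMP hX hA (by
      rw [integral_const_mul, ← hpdef, inv_mul_cancel₀ hpos.ne'])
    obtain ⟨i', s'⟩ := g'.solvesMP hX' hA (by
      rw [integral_const_mul, ← hp, inv_mul_cancel₀ hpos.ne'])
    have hinit : (weightedLaw P (fun ω => p⁻¹ * L ω) X hX).map (coord 0) =
        (weightedLaw P' (fun ω => p⁻¹ * L' ω) X' hX').map (coord 0) := by
      ext Γ hΓ
      rw [Measure.map_apply (measurable_coord 0) hΓ, Measure.map_apply (measurable_coord 0) hΓ,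
        ← measureReal_eq_measureReal_iff, g.real_eq hX (measurable_coord 0 hΓ),
        g'.real_eq hX' (measurable_coord 0 hΓ), integral_const_mul, integral_const_mul]
      congr 1
      exact h0 Γ hΓ
    have hprob : IsProbabilityMeasure ((weightedLaw P (fun ω => p⁻¹ * L ω) X hX).map (coord 0)) :=
      Measure.isProbabilityMeasure_map (measurable_coord 0).aemeasurable
    have heq := (hW _ hprob).unique ⟨i, rfl, s⟩ ⟨i', hinit.symm, s'⟩
    have h5 := g.real_eq hX hG
    rw [heq, g'.real_eq hX' hG, integral_const_mul, integral_const_mul] at h5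
    exact (mul_left_cancel₀ (inv_ne_zero hpos.ne') h5).symm

/-- If the martingale problem is well-posed, a bounded function which is orthogonal to the initial
value and to the increments of the test processes is orthogonal to the whole path. -/
lemma WellPosedMP.setIntegral_eq_zero (hA : A ⊆ boundedContinuous S ×ˢ boundedContinuous S)
    (hW : WellPosedMP A)
    (hM : ∀ a ∈ A, Martingale (testProcess a.1 a.2 X) (naturalFiltration X hXm) P)
    {D : Ω → ℝ} (hD : Measurable D) {C : ℝ} (hC : ∀ ω, |D ω| ≤ C)
    (h0 : ∀ Γ, MeasurableSet Γ → ∫ ω in X 0 ⁻¹' Γ, D ω ∂P = 0)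
    (horth : ∀ a ∈ A, ∀ u T : ℝ≥0, u ≤ T → ∀ H, MeasurableSet[naturalFiltration X hXm u] H →
      ∫ ω in H, D ω * (testProcess a.1 a.2 X T ω - testProcess a.1 a.2 X u ω) ∂P = 0)
    {G : Set (PathSpace S)} (hG : MeasurableSet G) : ∫ ω in pathMap X hX ⁻¹' G, D ω ∂P = 0 := by
  have hC0 : 0 ≤ C := by
    obtain ⟨ω⟩ := P.nonempty_of_neZero
    exact (abs_nonneg _).trans (hC ω)
  have hMs : ∀ a ∈ A, ∀ u T : ℝ≥0, u ≤ T → ∀ H, MeasurableSet[naturalFiltration X hXm u] H →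
      ∫ ω in H, C * (testProcess a.1 a.2 X T ω - testProcess a.1 a.2 X u ω) ∂P = 0 :=
    fun a ha u T huT H hH => by
      rw [integral_const_mul, Martingale.setIntegral_sub_eq_zero (hM a ha) huT hH, mul_zero]
  have hDi : Integrable D P := integrable_of_abs_le hD hC
  -- Adding the bound `C` makes `D` a nonnegative weight. It has the same initial distribution as
  -- the constant weight `C`, so well-posedness makes the two path laws equal, and their difference
  -- is the claim.
  have h1 : IsMPWeight A X hXm P fun ω => C + D ω := by
    refine ⟨hD.const_add C, fun ω => ?_, ⟨C + C, fun ω => (abs_add_le _ _).trans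
      (add_le_add (abs_of_nonneg hC0).le (hC ω))⟩, fun a ha u T huT H hH => ?_⟩
    · have := (abs_le.1 (hC ω)).1
      linarith
    · have hd : Integrable (fun ω => testProcess a.1 a.2 X T ω - testProcess a.1 a.2 X u ω) P :=
        ((hM a ha).integrable T).sub ((hM a ha).integrable u)
      simp only [add_mul]
      rw [integral_add (hd.const_mul C).integrableOn
        (hd.bdd_mul hD.aestronglyMeasurable (.of_forall hC)).integrableOn, hMs a ha u T huT H hH,
        horth a ha u T huT H hH, add_zero]
  have h2 : IsMPWeight A X hXm P fun _ => C :=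
    ⟨measurable_const, fun _ => hC0, ⟨|C|, fun _ => le_rfl⟩, hMs⟩
  have h3 : ∀ H : Set Ω, ∫ ω in H, (C + D ω) ∂P = (∫ ω in H, C ∂P) + ∫ ω in H, D ω ∂P := fun H =>
    integral_add (integrable_const _).integrableOn hDi.integrableOn
  have h4 := hW.setIntegral_eq hX hA hX h1 h2 (fun Γ hΓ => by rw [h3, h0 Γ hΓ, add_zero]) hG
  rw [h3] at h4
  linarith

end ChangeOfMeasure

/-! ### Sojourns and the whole path of the first component -/

section SojournPath

abbrev fstPath (Z : ℝ≥0 → Ω → E × Fin (m + 1)) (hZ : ∀ ω, IsCadlag fun t => Z t ω) :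
    Ω → PathSpace E := pathMap (fun t ω => (Z t ω).1) fun ω => (hZ ω).fst

abbrev SolvesLocalMP.fstPath : Ω → PathSpace E := MarkovCoupling.fstPath Z hZ.cadlag

lemma measurableSet_natural_fst (hZm : ∀ t, Measurable (Z t)) {u : ℝ≥0} {H : Set Ω}
    (hH : MeasurableSet[naturalFiltration (fun t ω => (Z t ω).1) (fun t => (hZm t).fst) u] H) :
    MeasurableSet[naturalFiltration Z hZm u] H := by
  obtain ⟨B, hB, rfl⟩ := (measurableSet_natural_iff _).1 hH
  exact (measurableSet_natural_iff _).2 ⟨_, measurable_pi_iff.2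
    (fun r => (measurable_pi_apply r).fst) hB, rfl⟩

lemma IsCadlag.capped {S : Type*} [TopologicalSpace S] {x : ℝ≥0 → S} (hx : IsCadlag x) (t : ℝ≥0) :
    IsCadlag fun r => x (min r t) := by
  refine fun u => ⟨hx.rightCont.comp_monotone (a := fun r => min r t)
    (by fun_prop) (fun _ _ h => min_le_min_right _ h) u, ?_⟩
  rcases le_or_gt u t with h | h
  · obtain ⟨l, hl⟩ := (hx u).2
    refine ⟨l, hl.congr' ?_⟩
    filter_upwards [self_mem_nhdsWithin] with r hr
    rw [min_eq_left ((le_of_lt hr).trans h)]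
  · refine ⟨x t, tendsto_const_nhds.congr' ?_⟩
    filter_upwards [nhdsWithin_le_nhds (Ioi_mem_nhds h)] with r hr
    rw [min_eq_right (le_of_lt hr)]

lemma Sojourn.mono_right {hm : ∀ t, Measurable (Z t)} (h : Sojourn q Z hm i n s t K σ) {T : ℝ≥0}
    (hT : t ≤ T) : Sojourn q Z hm i n s T K σ :=
  { h with le_right := fun ω => (h.le_right ω).trans hT }

lemma measurable_min_of_isStoppingTime {mΩ : MeasurableSpace Ω} {ℱ : Filtration ℝ≥0 mΩ}
    (hσ : IsStop ℱ σ) (u : ℝ≥0) : Measurable[ℱ u] fun ω => min (σ ω) u := by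
  refine measurable_of_Iic fun r => ?_
  rcases le_or_gt u r with h | h
  · convert MeasurableSet.univ
    ext ω
    simp [h]
  · have := ℱ.mono h.le _ (hσ r)
    refine (Set.ext fun ω => ?_ : (fun ω => min (σ ω) u) ⁻¹' Set.Iic r = _) ▸ this
    change min (σ ω) u ≤ r ↔ (σ ω : WithTop ℝ≥0) ≤ r
    rw [WithTop.coe_le_coe, min_le_iff]
    exact ⟨fun h' => h'.resolve_right h.not_ge, Or.inl⟩

include hq

lemma measurable_compIncr_of_le {Θ : Type*} {mΘ : MeasurableSpace Θ}
    {Z : ℝ≥0 → Θ → E × Fin (m + 1)} {t : ℝ≥0} (hZm : ∀ u ≤ t, Measurable[mΘ] (Z u))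
    (hZc : ∀ θ, IsCadlag fun t => Z t θ) (f : Fin (m + 1) → ℝ) {τ σ : Θ → ℝ≥0}
    (hτ : Measurable[mΘ] τ) (hσ : Measurable[mΘ] σ) (hτt : ∀ θ, τ θ ≤ t) (hσt : ∀ θ, σ θ ≤ t) :
    Measurable[mΘ] fun θ => compIncr q f (τ θ) (σ θ) fun r => Z r θ := by
  have h := measurable_compIncr hq (Z := fun r θ => Z (min r t) θ)
    ⟨fun u => hZm _ (min_le_right _ _), fun θ => (hZc θ).capped t⟩ f hτ hσ
  refine (funext fun θ => ?_ : (fun θ => compIncr q f (τ θ) (σ θ) fun r => Z r θ) = _) ▸ h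
  simp only [compIncr, min_eq_left (hτt θ), min_eq_left (hσt θ)]
  congr 1
  refine intervalIntegral.integral_congr fun r hr => ?_
  have hr' : r ≤ t := hr.2.trans (max_le (by exact_mod_cast hτt θ) (by exact_mod_cast hσt θ))
  simp only [min_eq_left (Real.toNNReal_le_iff_le_coe.2 hr')]

include hA hD

/-- Extends `Sojourn.integral_mul_martingale` to increments of the martingale that start at any time
`u`. If `u ≤ s`, the martingale increment is split at `s`, and its first part is known at `s`. If `s
≤ u`, the chain increment is split at `min (σ ω) u`: its first part is known at `u`, and the second
belongs to the sojourn restarted at `u`. -/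
lemma Sojourn.setIntegral_mul_martingale
    (h : Sojourn q Z hZ.measurable i n s t K σ) (hn : 0 ≤ n) (f : Fin (m + 1) → ℝ)
    (ha : a ∈ A) {u : ℝ≥0} (hut : u ≤ t) {H : Set Ω} (hH : MeasurableSet[hZ.past u] H) :
    ∫ ω in H, K.indicator (fun _ => 1) ω * compIncr q f s (σ ω) (fun r => Z r ω) *
      (testProcess a.1 a.2 (fun t ω => (Z t ω).1) t ω -
        testProcess a.1 a.2 (fun t ω => (Z t ω).1) u ω) ∂P = 0 := by
  obtain ⟨D, hD0, h1, h2⟩ := exists_bound_pair hA ha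
  obtain ⟨F, hF0, hF⟩ := exists_bound_fin f
  set ℱ := hZ.past with hℱ
  set M := testProcess a.1 a.2 fun t ω => (Z t ω).1 with hMdef
  have hM : Martingale M ℱ P := hZ.martingale_fst hq hA ha
  have hMm := fun r => (hM.1 r).measurable
  have hMd : ∀ r ≤ t, ∀ r' ≤ t, ∀ ω, |M r ω - M r' ω| ≤ 2 * (2 * D + D * t) := by
    have hMb : ∀ r ≤ t, ∀ ω, |M r ω| ≤ 2 * D + D * t := fun r hr ω =>
      (abs_testProcess_le h1 h2 r ω).trans
        (by have := mul_le_mul_of_nonneg_left (NNReal.coe_le_coe.2 hr) hD0; linarith)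
    exact fun r hr r' hr' ω => (abs_sub _ _).trans (by linarith [hMb r hr ω, hMb r' hr' ω])
  have hσm := measurable_of_isStoppingTime h.isStop
  have hHm := ℱ.le u H hH
  have hint : ∀ {U V : Ω → ℝ}, Measurable U → Measurable V → (∃ C, ∀ ω, |U ω| ≤ C) →
      (∃ C, ∀ ω, |V ω| ≤ C) → Integrable (fun ω => U ω * V ω) P := by
    rintro U V hU hV ⟨C, hC⟩ ⟨C', hC'⟩
    exact (integrable_of_abs_le hU hC).mul_bdd hV.aestronglyMeasurable (.of_forall hC')
  have hκc : ∀ {S : Set Ω} {r : ℝ≥0} {τ : Ω → ℝ≥0}, MeasurableSet S → Measurable τ →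
      (∀ ω, r ≤ τ ω) → (∀ ω, ∫ v in (r : ℝ)..τ ω, totRate q (Z v.toNNReal ω).1 ≤ n) →
      Measurable (fun ω => S.indicator (fun _ => (1 : ℝ)) ω * compIncr q f r (τ ω) fun v => Z v ω) ∧
      ∃ C, ∀ ω, |S.indicator (fun _ => (1 : ℝ)) ω * compIncr q f r (τ ω) fun v => Z v ω| ≤ C := by
    intro S r τ hS hτ hrτ hcl
    exact ⟨measurable_indicator_mul_compIncr hq hZ.proc f measurable_const hτ hS, _, fun ω =>
      abs_indicator_mul_compIncr_le hq hF (hZ.cadlag ω) (hrτ ω) ω (hcl ω)⟩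
  have hMdm : ∀ r r' : ℝ≥0, Measurable fun ω => M r ω - M r' ω := fun r r' =>
    ((hMm r).mono (ℱ.le r) le_rfl).sub ((hMm r').mono (ℱ.le r') le_rfl)
  have hst : s ≤ t := by
    obtain ⟨ω⟩ := P.nonempty_of_neZero
    exact (h.le ω).trans (h.le_right ω)
  rw [← integral_indicator hHm]
  rcases le_total u s with hus | hsu
  · have hHs := ℱ.mono hus H hH
    have g := h.inter hHs
    have hb := hκc (ℱ.le s _ g.measurableSet) hσm g.le g.clock
    have e1 := g.integral_mul_martingale hq hA hZ hD hn f ha le_rfl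
    have i1 := hint hb.1 (hMdm t s) hb.2 ⟨_, hMd t le_rfl s hst⟩
    have i2 := hint (hMdm s u) hb.1 ⟨_, hMd s hst u hut⟩ hb.2
    have e2 := g.integral_mul_compIncr hq hA hZ hD f
      ((hMm s).sub ((hMm u).mono (ℱ.mono hus) le_rfl)) i2
    have e3 := integral_add i1 i2
    rw [e1, zero_add] at e3
    rw [← e3.trans e2]
    congr 1
    ext ω
    by_cases hω : ω ∈ H
    · by_cases hK : ω ∈ K
      · simp [hω, hK]; ring
      · simp [hK]
    · simp [hω]
  · have hKu := ℱ.mono hsu K h.measurableSet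
    have g := (h.restart hq hZ.cadlag hn hsu hut).inter hH
    have hb := hκc (ℱ.le u _ g.measurableSet) (measurable_const.max hσm) g.le g.clock
    have e1 := g.integral_mul_martingale hq hA hZ hD hn f ha le_rfl
    have i1 := hint hb.1 (hMdm t u) hb.2 ⟨_, hMd t le_rfl u hut⟩
    have hb2 := hκc (τ := fun ω => min (σ ω) u) (ℱ.le u _ (hKu.inter hH))
      (hσm.min measurable_const) (fun ω => le_min (h.le ω) hsu) fun ω =>
        integral_totRate_le hq (hZ.cadlag ω) le_rfl (le_min (h.le ω) hsu) (min_le_left _ _) (h.clock ω)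
    have i2 := hint hb2.1 (hMdm t u) hb2.2 ⟨_, hMd t le_rfl u hut⟩
    have e2 := integral_mul_martingale_sub_eq_zero hM hut
      ((measurable_const.indicator (hKu.inter hH)).mul
        (measurable_compIncr_of_le hq (fun v hv => measurable_natural' hZ.measurable hv) hZ.cadlag f
          measurable_const (measurable_min_of_isStoppingTime h.isStop u) (fun _ => hsu)
          fun _ => min_le_right _ _)) i2
    have e3 := integral_add i1 i2
    rw [e1, zero_add] at e3
    rw [← e3.trans e2]
    congr 1
    ext ω
    by_cases hω : ω ∈ H
    · by_cases hK : ω ∈ K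
      · rw [Set.indicator_of_mem hω, compIncr_add hq f (hZ.cadlag ω) s (min (σ ω) u) (σ ω)]
        by_cases hu : u < σ ω
        · simp [hω, hK, hu, min_eq_right hu.le, max_eq_right hu.le]; ring
        · have : compIncr q f (σ ω) (σ ω) (fun v => Z v ω) = 0 := by simp [compIncr]
          simp [hω, hK, hu, min_eq_left (not_lt.1 hu), this]
      · simp [hK]
    · simp [hω]

include hW

/-- During a sojourn, the compensated chain is orthogonal to the path of the first component. -/
lemma Sojourn.setIntegral_path_eq_zero
    (h : Sojourn q Z hZ.measurable i n s t K σ) (hn : 0 ≤ n) (f : Fin (m + 1) → ℝ)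
    {G : Set (PathSpace E)} (hG : MeasurableSet G) : ∫ ω in hZ.fstPath ⁻¹' G,
      K.indicator (fun _ => 1) ω * compIncr q f s (σ ω) (fun r => Z r ω) ∂P = 0 := by
  obtain ⟨F, hF0, hF⟩ := exists_bound_fin f
  have hσm := measurable_of_isStoppingTime h.isStop
  have hK := (hZ.past).le s K h.measurableSet
  have hm := measurable_indicator_mul_compIncr hq hZ.proc f (measurable_const (a := s)) hσm hK
  have hb := fun ω => abs_indicator_mul_compIncr_le (K := K) hq hF (hZ.cadlag ω) (h.le ω) ω
    (h.clock ω)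
  refine hW.setIntegral_eq_zero (hXm := fun t => (hZ.measurable t).fst)
    (fun ω => (hZ.cadlag ω).fst) hA (fun a ha => ?_) hm hb (fun Γ hΓ => ?_)
    (fun a ha u T huT H hH => ?_) hG
  · have hM := hZ.martingale_fst hq hA ha
    refine martingale_of_setIntegral_eq (fun t => measurable_testProcess_natural _
      (fun ω => (hZ.cadlag ω).fst) (hA ha).1.1 (hA ha).2.1 t) hM.integrable
      fun u T huT H hH => hM.setIntegral_eq huT (measurableSet_natural_fst hZ.measurable hH)
  · have hH : MeasurableSet[hZ.past s] ((fun ω => (Z 0 ω).1) ⁻¹' Γ) :=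
      (measurable_fst.comp (measurable_natural' hZ.measurable (zero_le (a := s)))) hΓ
    have h3 := (h.inter hH).setIntegral_compIncr hq hA hZ hD f
    rw [← h3, ← integral_indicator ((hZ.past).le s _ hH),
      ← integral_indicator ((hZ.past).le s _ (h.inter hH).measurableSet)]
    congr 1
    ext ω
    by_cases h1 : (Z 0 ω).1 ∈ Γ <;> by_cases h2 : ω ∈ K <;> simp [h1, h2]
  · have hH' := measurableSet_natural_fst hZ.measurable hH
    have hM := hZ.martingale_fst hq hA ha
    -- The times `u ≤ T` are arbitrary, while the sojourn ends by time `t`. Orthogonality to the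
    -- increments from `u` and from `T` up to the common horizon `max T t` gives the claim by
    -- subtraction.
    have key := fun (v : ℝ≥0) (hv : v ≤ max T t) (hvH : MeasurableSet[hZ.past v] H) => (h.mono_right (le_max_right T t)).setIntegral_mul_martingale hq hA hZ
      hD hn f ha hv hvH
    have e1 := key u (huT.trans (le_max_left _ _)) hH'
    have e2 := key T (le_max_left _ _) ((hZ.past).mono huT H hH')
    have hi : ∀ v : ℝ≥0, Integrable (fun ω => K.indicator (fun _ => (1 : ℝ)) ω *
        compIncr q f s (σ ω) (fun r => Z r ω) *
        (testProcess a.1 a.2 (fun t ω => (Z t ω).1) (max T t) ω -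
          testProcess a.1 a.2 (fun t ω => (Z t ω).1) v ω)) P := fun v =>
      ((hM.integrable _).sub (hM.integrable v)).bdd_mul hm.aestronglyMeasurable (.of_forall hb)
    have e3 := (integral_sub (hi u).integrableOn (hi T).integrableOn).trans
      (by rw [e1, e2, sub_zero] : _ = (0 : ℝ))
    rw [← e3]
    congr 1
    ext ω
    ring

end SojournPath

/-! ### Exit times -/

section ExitTime

variable {F : Type*}

/-- The first time after `a` at which the path `y` has left the state `y a`, capped at `b`. -/
noncomputable def exitT (y : ℝ≥0 → F) (a b : ℝ≥0) : ℝ≥0 := sInf {u | a ≤ u ∧ (y u ≠ y a ∨ b ≤ u)}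

variable {y : ℝ≥0 → F} {a b : ℝ≥0}

lemma exitT_le_of {u : ℝ≥0} (h : a ≤ u) (h' : y u ≠ y a ∨ b ≤ u) : exitT y a b ≤ u :=
  csInf_le (OrderBot.bddBelow _) ⟨h, h'⟩

lemma exitT_le (hab : a ≤ b) : exitT y a b ≤ b := exitT_le_of hab (Or.inr le_rfl)

lemma le_exitT (hab : a ≤ b) : a ≤ exitT y a b :=
  le_csInf ⟨b, hab, Or.inr le_rfl⟩ fun _ h => h.1

lemma exitT_self : exitT y a a = a := le_antisymm (exitT_le le_rfl) (le_exitT le_rfl)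

lemma eq_of_lt_exitT {r : ℝ≥0} (har : a ≤ r) (hr : r < exitT y a b) : y r = y a := by
  by_contra h
  exact hr.not_ge (exitT_le_of har (Or.inl h))

variable [TopologicalSpace F] [DiscreteTopology F]

lemma eventually_eq_of_rightCont (hy : RightCont y) (r : ℝ≥0) : ∀ᶠ u in 𝓝[≥] r, y u = y r :=
  (hy r).eventually (IsOpen.mem_nhds (isOpen_discrete {y r}) rfl)

/-- The infimum is attained: in a discrete space a right continuous path is locally constant to the
right, so a time with neither property cannot be the infimum. -/
lemma exitT_spec (hy : RightCont y) (hab : a ≤ b) : y (exitT y a b) ≠ y a ∨ b ≤ exitT y a b := by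
  by_contra! h
  obtain ⟨h1, h2⟩ := h
  have h3 : ∀ᶠ u in 𝓝[≥] exitT y a b, y u = y a ∧ u < b := by
    filter_upwards [eventually_eq_of_rightCont hy _, nhdsWithin_le_nhds (Iio_mem_nhds h2)]
      with u hu hu'
    exact ⟨hu.trans h1, hu'⟩
  obtain ⟨v, hv, hv'⟩ := (mem_nhdsGE_iff_exists_Ico_subset' h2).1 h3
  suffices h7 : v ≤ exitT y a b from h7.not_gt hv
  refine le_csInf ⟨b, hab, Or.inr le_rfl⟩ fun u hu => ?_
  by_contra! hlt
  have h6 : u ∈ Set.Ico (exitT y a b) v := ⟨csInf_le (OrderBot.bddBelow _) hu, hlt⟩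
  have h4 := hv' h6
  rcases hu.2 with h5 | h5
  · exact h5 h4.1
  · exact h5.not_gt h4.2

lemma lt_exitT (hy : RightCont y) (hab : a < b) : a < exitT y a b := by
  refine lt_of_le_of_ne (le_exitT hab.le) fun h => ?_
  rcases exitT_spec hy hab.le with h1 | h1
  · exact h1 (by rw [← h])
  · exact hab.not_ge (h ▸ h1)

lemma exitT_eq_of_lt (hy : RightCont y) (hab : a ≤ b) {r : ℝ≥0} (har : a ≤ r)
    (hr : r < exitT y a b) : exitT y r b = exitT y a b := by
  have h1 := eq_of_lt_exitT har hr
  have hrb : r ≤ b := hr.le.trans (exitT_le hab)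
  refine le_antisymm (exitT_le_of hr.le ?_) (exitT_le_of (har.trans (le_exitT hrb)) ?_)
  · rw [h1]
    exact exitT_spec hy hab
  · rw [← h1]
    exact exitT_spec hy hrb

/-- By right continuity a change of state is seen at a dyadic time or at `r` itself, which makes the
condition countable. All times are capped by `r`, so it involves only the path up to `r`. -/
lemma exitT_le_iff (hy : RightCont y) (hab : a ≤ b) {r : ℝ≥0} :
    exitT y a b ≤ r ↔ a ≤ r ∧ (b ≤ r ∨ ∃ p : ℕ × ℕ, min a r ≤ min (((p.2 : ℝ≥0) + 1) / 2 ^ p.1) r ∧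
      y (min (((p.2 : ℝ≥0) + 1) / 2 ^ p.1) r) ≠ y (min a r)) := by
  constructor
  · intro h
    have har := (le_exitT hab).trans h
    refine ⟨har, or_iff_not_imp_left.2 fun hbr => ?_⟩
    rw [min_eq_left har]
    have h1 := (exitT_spec hy hab).resolve_right fun h' => hbr (h'.trans h)
    have h2 := (tendsto_min_gridUp h).eventually (eventually_eq_of_rightCont hy _)
    obtain ⟨n, hn⟩ := h2.exists
    refine ⟨(n, ⌊exitT y a b * 2 ^ n⌋₊), ?_, ?_⟩
    · exact le_min ((le_exitT hab).trans (lt_gridUp n _).le) har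
    · exact fun h3 => h1 (hn.symm.trans h3)
  · rintro ⟨har, h | ⟨p, h1, h2⟩⟩
    · exact (exitT_le hab).trans h
    · rw [min_eq_left har] at h1 h2
      exact (exitT_le_of h1 (Or.inl h2)).trans (min_le_right _ _)

/-- If `b` were never reached, the exit times would increase strictly to a limit. The left limit
there makes the path eventually constant along them, whereas the state changes at each exit before
`b`. -/
lemma iterate_exitT_eventually_eq (hy : IsCadlag y) (hab : a ≤ b) :
    ∀ᶠ k in atTop, (fun r => exitT y r b)^[k] a = b := by
  set J : ℕ → ℝ≥0 := fun k => (fun r => exitT y r b)^[k] a with hJ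
  have hs : ∀ k, J (k + 1) = exitT y (J k) b := fun k => Function.iterate_succ_apply' _ _ _
  have hle : ∀ k, J k ≤ b := fun k => by
    induction k with
    | zero => exact hab
    | succ k ih => rw [hs]; exact exitT_le ih
  have hmono : Monotone J := monotone_nat_of_le_succ fun k => by rw [hs]; exact le_exitT (hle k)
  by_contra hne
  have hlt : ∀ k, J k < b := fun k => by
    refine lt_of_le_of_ne (hle k) fun h => hne ?_
    filter_upwards [eventually_ge_atTop k] with l hl
    exact le_antisymm (hle l) (h.symm.le.trans (hmono hl))
  have hbd : BddAbove (Set.range J) := ⟨b, by rintro _ ⟨k, rfl⟩; exact hle k⟩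
  have hJL : ∀ k, J k < ⨆ k, J k := fun k => by
    refine lt_of_lt_of_le ?_ (le_ciSup hbd (k + 1))
    rw [hs]
    exact lt_exitT hy.rightCont (hlt k)
  have hlim : Tendsto J atTop (𝓝[<] ⨆ k, J k) :=
    tendsto_nhdsWithin_iff.2 ⟨tendsto_atTop_ciSup hmono hbd, .of_forall hJL⟩
  obtain ⟨l, hl⟩ := (hy (⨆ k, J k)).2
  have hev := (hl.comp hlim).eventually (IsOpen.mem_nhds (isOpen_discrete {l}) rfl)
  obtain ⟨k, hk, hk'⟩ := (hev.and ((tendsto_add_atTop_nat 1).eventually hev)).exists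
  simp only [Function.comp] at hk hk'
  rw [hs] at hk'
  rcases exitT_spec hy.rightCont (hle k) with h | h
  · exact h (hk'.trans hk.symm)
  · rw [← hs] at h
    exact (hlt _).not_ge h

variable [MeasurableSpace F] [BorelSpace F] [Countable F]

lemma measurableSet_exitT_le {Θ : Type*} {mΘ : MeasurableSpace Θ} {Y : ℝ≥0 → Θ → F} {r : ℝ≥0}
    (hYm : ∀ u ≤ r, Measurable[mΘ] (Y u)) (hY : ∀ θ, RightCont fun t => Y t θ) {A B : Θ → ℝ≥0}
    (hAB : ∀ θ, A θ ≤ B θ) (hA : Measurable[mΘ] fun θ => min (A θ) r)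
    (hA' : MeasurableSet[mΘ] {θ | A θ ≤ r}) (hB : MeasurableSet[mΘ] {θ | B θ ≤ r}) :
    MeasurableSet[mΘ] {θ | exitT (fun t => Y t θ) (A θ) (B θ) ≤ r} := by
  have hset : {θ | exitT (fun t => Y t θ) (A θ) (B θ) ≤ r} = {θ | A θ ≤ r} ∩ ({θ | B θ ≤ r} ∪
      ⋃ p : ℕ × ℕ, {θ | min (A θ) r ≤ min (((p.2 : ℝ≥0) + 1) / 2 ^ p.1) r} ∩
        {θ | Y (min (((p.2 : ℝ≥0) + 1) / 2 ^ p.1) r) θ = Y (min (A θ) r) θ}ᶜ) := by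
    ext θ
    simp only [Set.mem_ofPred_eq, exitT_le_iff (hY _) (hAB _), Set.mem_inter_iff, Set.mem_union,
      Set.mem_iUnion, Set.mem_compl_iff, ne_eq]
  rw [hset]
  refine hA'.inter (hB.union ?_)
  refine MeasurableSet.iUnion fun p => (measurableSet_le hA measurable_const).inter ?_
  obtain ⟨h1, h2⟩ := CadlagProc.capped hYm hY
  have h3 := measurable_eval_of_rightCont h1 h2 hA
  refine (measurableSet_eq_fun (hYm _ (min_le_right _ _)) ?_).compl
  simpa only [min_assoc, min_self] using h3

end ExitTime

lemma setIntegral_eq_zero_of_fiber {Ω ι : Type*} [MeasurableSpace Ω] {P : Measure Ω} [Countable ι]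
    [MeasurableSpace ι] [MeasurableSingletonClass ι] {p : Ω → ι} (hp : Measurable p) {U : Ω → ℝ}
    (hU : Integrable U P) {Q : Set Ω} (hQ : MeasurableSet Q)
    (h : ∀ j, ∫ ω in Q ∩ p ⁻¹' {j}, U ω ∂P = 0) : ∫ ω in Q, U ω ∂P = 0 := by
  have h1 : Q = ⋃ j, Q ∩ p ⁻¹' {j} := by
    ext ω
    simp
  rw [h1, integral_iUnion (fun j => hQ.inter (hp (measurableSet_singleton j))) ?_ hU.integrableOn]
  · simp [h]
  · intro i j hij
    refine Set.disjoint_left.2 fun ω h2 h3 => hij ?_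
    exact h2.2.symm.trans h3.2

/-! ### From sojourns to arbitrary time intervals -/

section RandomStart

lemma isStoppingTime_gridUp {ℱ : Filtration ℝ≥0 ‹MeasurableSpace Ω›} (hS : IsStop ℱ S) (k : ℕ) :
    IsStop ℱ fun ω => gridUp k (S ω) := fun r => by
  have h1 := isStoppingTime_min_gridUp hS (r + 1) k r
  simp only [WithTop.coe_le_coe, min_le_iff, (lt_add_one r).not_ge, or_false] at h1 ⊢
  exact h1

lemma isStoppingTime_exitT (hm : ∀ t, Measurable (Z t)) (hZc : ∀ ω, IsCadlag fun t => Z t ω)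
    (hS : IsStop (naturalFiltration Z hm) S) (hτ : IsStop (naturalFiltration Z hm) τ)
    (hSτ : ∀ ω, S ω ≤ τ ω) : IsStop (naturalFiltration Z hm)
      fun ω => exitT (fun r => (Z r ω).2) (S ω) (τ ω) := fun r => by
  have h1 := hS r
  have h2 := hτ r
  simp only [WithTop.coe_le_coe] at h1 h2 ⊢
  exact measurableSet_exitT_le (Y := fun r ω => (Z r ω).2)
    (fun u hu => measurable_snd.comp (measurable_natural' hm hu))
    (fun ω => ((hZc ω).comp continuous_snd).rightCont) hSτ
    (measurable_min_of_isStoppingTime hS r) h1 h2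

include hq

lemma tendsto_compIncr_left (hz : IsCadlag z) (r σ : ℝ≥0) :
    Tendsto (fun k => compIncr q f (gridUp k r) σ z) atTop (𝓝 (compIncr q f r σ z)) := by
  have hi := fun u v : ℝ => (hz.comp (hq.continuous_jumpOp f)).intervalIntegrable u v
  have h1 : RightCont fun r => compIncr q f r σ z := by
    have h2 : IsCadlag fun r => f (z r).2 :=
      hz.comp (continuous_of_discreteTopology.comp continuous_snd : Continuous
        fun z : E × Fin (m + 1) => f z.2)
    have h3 := (hz.comp (hq.continuous_jumpOp f)).continuous_primitive σ
    intro u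
    refine (continuousWithinAt_const.sub (h2 u).1).sub (h3.neg.continuousWithinAt.congr
      (fun v _ => ?_) ?_) <;> exact intervalIntegral.integral_symm _ _
  exact h1.tendsto_gridUp r

include hA hD hW

/-- Between a stopping time and the next exit time, the compensated chain is orthogonal to the path
of the first component. -/
lemma setIntegral_compIncr_exitT (hn : 0 ≤ n) (hS : IsStop hZ.past S) (hτ : IsStop hZ.past τ)
    (hs : ∀ ω, s ≤ S ω) (hSτ : ∀ ω, S ω ≤ τ ω) (hτt : ∀ ω, τ ω ≤ t)
    (hcl : ∀ ω, ∫ r in (s : ℝ)..τ ω, totRate q (Z r.toNNReal ω).1 ≤ n)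
    (hK : MeasurableSet[hZ.past s] K) (f : Fin (m + 1) → ℝ)
    {G : Set (PathSpace E)} (hG : MeasurableSet G) : ∫ ω in hZ.fstPath ⁻¹' G,
      K.indicator (fun _ => 1) ω * compIncr q f (S ω)
        (exitT (fun r => (Z r ω).2) (S ω) (τ ω)) (fun r => Z r ω) ∂P = 0 := by
  obtain ⟨F, hF0, hF⟩ := exists_bound_fin f
  set ℱ := hZ.past with hℱ
  have hY : ∀ ω, RightCont fun r => (Z r ω).2 := fun ω =>
    ((hZ.cadlag ω).comp continuous_snd).rightCont
  have hQ := measurable_pathMap (X := fun t ω => (Z t ω).1) (fun t => (hZ.measurable t).fst)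
    (fun ω => (hZ.cadlag ω).fst) hG
  set Q := hZ.fstPath ⁻¹' G with hQdef
  -- The random start is rounded up to a grid, so that it takes countably many values. Since the
  -- rounded time may pass `τ`, the end of the interval becomes the larger of the two.
  set V : ℕ → Ω → ℝ≥0 := fun k ω => gridUp k (S ω) with hV
  have hVs : ∀ k, IsStop ℱ (V k) := isStoppingTime_gridUp hS
  have hmax := fun k => isStoppingTime_max (hVs k) hτ
  have hJs := fun k => isStoppingTime_exitT hZ.measurable hZ.cadlag (hVs k) (hmax k)
    fun ω => le_max_left _ _
  set J : ℕ → Ω → ℝ≥0 := fun k ω => exitT (fun r => (Z r ω).2) (V k ω) (max (V k ω) (τ ω)) with hJ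
  set U : ℕ → Ω → ℝ := fun k ω => K.indicator (fun _ => 1) ω *
    compIncr q f (V k ω) (J k ω) fun r => Z r ω with hU
  have hUm : ∀ k, Measurable (U k) := fun k =>
    measurable_indicator_mul_compIncr hq hZ.proc f (measurable_of_isStoppingTime (hVs k))
      (measurable_of_isStoppingTime (hJs k)) (ℱ.le s K hK)
  have hsV : ∀ k ω, s ≤ V k ω := fun k ω => (hs ω).trans (lt_gridUp _ _).le
  have hclk : ∀ ω (a b : ℝ≥0), s ≤ a → a ≤ b → b ≤ max a (τ ω) →
      ∫ r in (a : ℝ)..b, totRate q (Z r.toNNReal ω).1 ≤ n := fun ω a b hsa hab hb => by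
    rcases le_total a (τ ω) with h | h
    · rw [max_eq_right h] at hb
      exact integral_totRate_le hq (hZ.cadlag ω) hsa hab hb (hcl ω)
    · rw [max_eq_left h] at hb
      rw [le_antisymm hb hab, intervalIntegral.integral_same]
      exact hn
  have hJ1 : ∀ k ω, V k ω ≤ J k ω := fun k ω => le_exitT (le_max_left _ _)
  have hJ2 : ∀ k ω, J k ω ≤ max (V k ω) (τ ω) := fun k ω => exitT_le (le_max_left _ _)
  have hUb : ∀ k ω, |U k ω| ≤ 2 * F + 2 * F * n := fun k ω =>
    abs_indicator_mul_compIncr_le hq hF (hZ.cadlag ω) (hJ1 k ω) ω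
      (hclk ω _ _ (hsV k ω) (hJ1 k ω) (hJ2 k ω))
  have hlim : ∀ ω, Tendsto (fun k => U k ω) atTop (𝓝 (K.indicator (fun _ => 1) ω *
      compIncr q f (S ω) (exitT (fun r => (Z r ω).2) (S ω) (τ ω)) fun r => Z r ω)) := by
    intro ω
    refine tendsto_const_nhds.mul ?_
    -- If `S = τ`, all increments vanish. Otherwise the rounded start eventually precedes the exit
    -- time, and the exit time seen from it is the original one.
    rcases (hSτ ω).eq_or_lt with h | h
    · have h1 : ∀ a, compIncr q f a a (fun r => Z r ω) = 0 := fun a => by simp [compIncr]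
      rw [← h, exitT_self, h1]
      refine tendsto_const_nhds.congr fun k => ?_
      have h2 : max (V k ω) (τ ω) = V k ω := max_eq_left (h ▸ (lt_gridUp k _).le)
      simp only [hJ, h2, exitT_self, h1]
    · have h1 : S ω < exitT (fun r => (Z r ω).2) (S ω) (τ ω) := lt_exitT (hY ω) h
      refine (tendsto_compIncr_left hq (f := f) (hZ.cadlag ω) (S ω)
        (exitT (fun r => (Z r ω).2) (S ω) (τ ω))).congr' ?_
      filter_upwards [(tendsto_nhdsWithin_iff.1 (tendsto_gridUp (S ω))).1.eventually
        (Iio_mem_nhds h1)] with k hk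
      have h2 : V k ω < exitT (fun r => (Z r ω).2) (S ω) (τ ω) := hk
      have h3 : max (V k ω) (τ ω) = τ ω := max_eq_right (h2.le.trans (exitT_le h.le))
      have h4 : J k ω = exitT (fun r => (Z r ω).2) (S ω) (τ ω) := by
        simp only [hJ]
        rw [h3]
        exact exitT_eq_of_lt (hY ω) h.le (lt_gridUp k _).le h2
      rw [h4]
  refine tendsto_nhds_unique (tendsto_integral_of_dominated_convergence
    (fun _ => 2 * F + 2 * F * n) (fun k => (hUm k).aestronglyMeasurable)
    (integrable_const _) (fun k => .of_forall (hUb k)) (.of_forall hlim))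
    (tendsto_const_nhds.congr fun k => Eq.symm ?_)
  -- The fibres of this map fix the rounded start `v` and the state of the chain at that time. On
  -- each fibre the interval is a sojourn with deterministic start.
  have hp : Measurable fun ω => (⌊S ω * 2 ^ k⌋₊, (Z (V k ω) ω).2) :=
    (Nat.measurable_floor.comp ((measurable_of_isStoppingTime hS).mul_const _)).prodMk
      (measurable_eval_of_rightCont (fun r => (hZ.measurable r).snd) hY
        (measurable_of_isStoppingTime (hVs k)))
  refine setIntegral_eq_zero_of_fiber hp (integrable_of_abs_le (hUm k) (hUb k)) hQ fun j => ?_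
  set v : ℝ≥0 := ((j.1 : ℝ≥0) + 1) / 2 ^ k with hv
  have hVv : ∀ ω, (⌊S ω * 2 ^ k⌋₊, (Z (V k ω) ω).2) = j → V k ω = v := fun ω hω => by
    simp only [hv, ← hω]
    rfl
  rcases lt_or_ge v s with hvs | hsv
  · have : Q ∩ (fun ω => (⌊S ω * 2 ^ k⌋₊, (Z (V k ω) ω).2)) ⁻¹' {j} = ∅ := by
      refine Set.eq_empty_of_forall_notMem fun ω hω => ?_
      exact ((hVv ω hω.2) ▸ hsV k ω).not_gt hvs
    rw [this, Measure.restrict_empty, integral_zero_measure]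
  set Kv : Set Ω := K ∩ ({ω | V k ω = v} ∩ {ω | (Z v ω).2 = j.2}) with hKv
  have hso : Sojourn q Z hZ.measurable j.2 n v (max v t) Kv
      fun ω => exitT (fun r => (Z r ω).2) v (max v (τ ω)) := by
    have hst := isStoppingTime_max (isStoppingTime_const ℱ v) hτ
    refine ⟨isStoppingTime_exitT hZ.measurable hZ.cadlag (isStoppingTime_const ℱ v) hst
      fun ω => le_max_left _ _, fun ω => le_exitT (le_max_left _ _), fun ω =>
      (exitT_le (le_max_left _ _)).trans (max_le_max_left _ (hτt ω)), ?_, fun ω hω => hω.2.2,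
      fun ω hω r hr hr' => (eq_of_lt_exitT hr hr').trans hω.2.2, fun ω =>
      hclk ω _ _ hsv (le_exitT (le_max_left _ _)) (exitT_le (le_max_left _ _))⟩
    refine (ℱ.mono hsv K hK).inter (MeasurableSet.inter ?_ ?_)
    · have := (hVs k).measurableSet_eq v
      simpa only [WithTop.coe_inj] using this
    · exact (measurable_snd.comp (measurable_natural' hZ.measurable le_rfl))
        (measurableSet_singleton j.2)
  have h1 := hso.setIntegral_path_eq_zero hq hA hZ hD hW hn f hG
  rw [← h1, ← integral_indicator hQ, ← integral_indicator]
  · congr 1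
    ext ω
    by_cases hωQ : ω ∈ Q
    · by_cases hω : (⌊S ω * 2 ^ k⌋₊, (Z (V k ω) ω).2) = j
      · have hmem : ω ∈ Q ∩ (fun ω => (⌊S ω * 2 ^ k⌋₊, (Z (V k ω) ω).2)) ⁻¹' {j} := ⟨hωQ, hω⟩
        rw [Set.indicator_of_mem hmem, Set.indicator_of_mem hωQ]
        have h2 := hVv ω hω
        have h3 : (Z v ω).2 = j.2 := by rw [← h2, ← hω]
        have h4 : ω ∈ Kv ↔ ω ∈ K := ⟨fun h => h.1, fun h => ⟨h, h2, h3⟩⟩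
        simp only [hU, hJ, h2]
        by_cases hωK : ω ∈ K
        · simp [h4.2 hωK, hωK]
        · simp [mt h4.1 hωK, hωK]
      · rw [Set.indicator_of_notMem (fun h => hω h.2), Set.indicator_of_mem hωQ,
          Set.indicator_of_notMem, zero_mul]
        rintro ⟨-, h2, h3⟩
        refine hω (Prod.ext ?_ ?_)
        · have h5 : ((⌊S ω * 2 ^ k⌋₊ : ℝ≥0) + 1) / 2 ^ k = ((j.1 : ℝ≥0) + 1) / 2 ^ k := h2
          rw [div_left_inj' (by positivity), add_left_inj] at h5
          exact_mod_cast h5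
        · exact (by rw [show V k ω = v from h2]; exact h3)
    · rw [Set.indicator_of_notMem (fun h => hωQ h.1), Set.indicator_of_notMem hωQ]
  · exact hQ.inter (hp (measurableSet_singleton j))

/-- Up to a stopping time at which the clock is bounded, the compensated chain is orthogonal to the
path of the first component. -/
lemma setIntegral_compIncr_path (hn : 0 ≤ n) (hτ : IsStop hZ.past τ)
    (hs : ∀ ω, s ≤ τ ω) (hτt : ∀ ω, τ ω ≤ t)
    (hcl : ∀ ω, ∫ r in (s : ℝ)..τ ω, totRate q (Z r.toNNReal ω).1 ≤ n)
    (hK : MeasurableSet[hZ.past s] K) (f : Fin (m + 1) → ℝ)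
    {G : Set (PathSpace E)} (hG : MeasurableSet G) : ∫ ω in hZ.fstPath ⁻¹' G,
      K.indicator (fun _ => 1) ω * compIncr q f s (τ ω) (fun r => Z r ω) ∂P = 0 := by
  obtain ⟨F, hF0, hF⟩ := exists_bound_fin f
  set ℱ := hZ.past with hℱ
  -- The successive exit times, starting from `s`. They reach `τ` after finitely many steps, so the
  -- increment up to `τ` is the limit of telescoping sums of the increments between consecutive
  -- exits.
  set J : ℕ → Ω → ℝ≥0 := fun k ω => (fun r => exitT (fun u => (Z u ω).2) r (τ ω))^[k] s with hJ
  have hsucc : ∀ k ω, J (k + 1) ω = exitT (fun u => (Z u ω).2) (J k ω) (τ ω) := fun k ω =>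
    Function.iterate_succ_apply' _ _ _
  have hprop : ∀ k, IsStop ℱ (J k) ∧ (∀ ω, s ≤ J k ω) ∧
      ∀ ω, J k ω ≤ τ ω := fun k => by
    induction k with
    | zero => exact ⟨isStoppingTime_const ℱ s, fun _ => le_rfl, hs⟩
    | succ k ih =>
      rw [show J (k + 1) = _ from funext (hsucc k)]
      exact ⟨isStoppingTime_exitT hZ.measurable hZ.cadlag ih.1 hτ ih.2.2,
        fun ω => (ih.2.1 ω).trans (le_exitT (ih.2.2 ω)), fun ω => exitT_le (ih.2.2 ω)⟩
  have hJm := fun k => measurable_of_isStoppingTime (hprop k).1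
  have hm := fun {α β : Ω → ℝ≥0} (hα : Measurable α) (hβ : Measurable β) =>
    measurable_indicator_mul_compIncr hq hZ.proc f hα hβ (ℱ.le s K hK)
  have hb := fun {α β : ℝ≥0} ω (hα : s ≤ α) (hαβ : α ≤ β) (hβ : β ≤ τ ω) =>
    abs_indicator_mul_compIncr_le (K := K) hq hF (hZ.cadlag ω) hαβ ω
      (integral_totRate_le hq (hZ.cadlag ω) hα hαβ hβ (hcl ω))
  have hlim : ∀ ω, Tendsto (fun k => K.indicator (fun _ => (1 : ℝ)) ω *
      compIncr q f s (J k ω) fun r => Z r ω) atTop (𝓝 (K.indicator (fun _ => (1 : ℝ)) ω *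
      compIncr q f s (τ ω) fun r => Z r ω)) := fun ω => by
    refine tendsto_const_nhds.congr' ?_
    filter_upwards [iterate_exitT_eventually_eq ((hZ.cadlag ω).comp continuous_snd) (hs ω)]
      with k hk
    simp only [hJ, hk]
  refine tendsto_nhds_unique (tendsto_integral_of_dominated_convergence
    (fun _ => 2 * F + 2 * F * n) (fun k => (hm measurable_const (hJm k)).aestronglyMeasurable)
    (integrable_const _) (fun k => .of_forall fun ω => hb ω le_rfl ((hprop k).2.1 ω)
      ((hprop k).2.2 ω)) (.of_forall hlim)) (tendsto_const_nhds.congr fun k => Eq.symm ?_)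
  induction k with
  | zero => simp [hJ, compIncr]
  | succ k ih =>
    have h1 := setIntegral_compIncr_exitT hq hA hZ hD hW hn (hprop k).1 hτ (hprop k).2.1
      (hprop k).2.2 hτt hcl hK f hG
    simp only [← hsucc] at h1
    have i1 := integrable_of_abs_le (μ := P) (hm measurable_const (hJm k))
      fun ω => hb ω le_rfl ((hprop k).2.1 ω) ((hprop k).2.2 ω)
    have i2 := integrable_of_abs_le (μ := P) (hm (hJm k) (hJm (k + 1)))
      fun ω => hb ω ((hprop k).2.1 ω) (by rw [hsucc]; exact le_exitT ((hprop k).2.2 ω))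
        ((hprop (k + 1)).2.2 ω)
    have h2 := integral_add (i1.integrableOn (s := hZ.fstPath ⁻¹' G)) i2.integrableOn
    rw [ih, h1, add_zero] at h2
    rw [← h2]
    congr 1
    ext ω
    rw [compIncr_add hq f (hZ.cadlag ω) s (J k ω) (J (k + 1) ω)]
    ring

end RandomStart

/-! ### Orthogonality on events with bounded rates -/

section BoundedRates

/-- The paths along which the total rate is bounded by `N` up to time `t`. -/
def rateBdd (q : OffDiag m → E → ℝ) (t : ℝ≥0) (N : ℕ) : Set (PathSpace E) :=
  ⋂ p : ℕ × ℕ, (fun x => totRate q (coord (min (((p.2 : ℝ≥0) + 1) / 2 ^ p.1) t) x)) ⁻¹' Set.Iic (N : ℝ)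

include hq

lemma measurableSet_rateBdd (t : ℝ≥0) (N : ℕ) : MeasurableSet (rateBdd q t N) :=
  MeasurableSet.iInter fun _ =>
    (hq.continuous_totRate.measurable.comp (measurable_coord _)) measurableSet_Iic

/-- `rateBdd` constrains countably many times only, to be measurable; right continuity extends the
bound to all times up to `t`. -/
lemma totRate_le_of_mem_rateBdd {t r : ℝ≥0} {N : ℕ} {x : PathSpace E} (hx : x ∈ rateBdd q t N)
    (hr : r ≤ t) : totRate q (x.1 r) ≤ N := by
  have h1 := ((x.2.capped t).comp hq.continuous_totRate).rightCont.tendsto_gridUp r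
  rw [min_eq_left hr] at h1
  exact le_of_tendsto' h1 fun n => Set.mem_iInter.1 hx (n, ⌊r * 2 ^ n⌋₊)

lemma exists_mem_rateBdd (t : ℝ≥0) (x : PathSpace E) : ∃ N, x ∈ rateBdd q t N := by
  obtain ⟨C, hC⟩ := (x.2.comp hq.continuous_totRate).locBdd.bdd t
  refine ⟨⌈C⌉₊, Set.mem_iInter.2 fun p => ?_⟩
  exact ((le_abs_self _).trans (hC _ (min_le_right _ _))).trans (Nat.le_ceil C)

omit hq in
lemma monotone_rateBdd (t : ℝ≥0) : Monotone (rateBdd q t) := fun _ _ h _ hx =>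
  Set.mem_iInter.2 fun p => le_trans (α := ℝ) (Set.mem_iInter.1 hx p) (Nat.cast_le.2 h)

include hA hD hW

/-- As long as the rates are bounded, the compensated chain is orthogonal to the functions of the
path of the first component. -/
lemma setIntegral_mul_compIncr_eq_zero {s r t : ℝ≥0} (hsr : s ≤ r)
    (hrt : r ≤ t) (N : ℕ) {K : Set Ω} (hK : MeasurableSet[hZ.past s] K)
    (f : Fin (m + 1) → ℝ) {Φ : PathSpace E → ℝ} (hΦ : Measurable Φ) {C : ℝ} (hC : ∀ x, |Φ x| ≤ C) :
    ∫ ω in K ∩ hZ.fstPath ⁻¹' rateBdd q t N,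
      Φ (hZ.fstPath ω) * compIncr q f s r (fun u => Z u ω) ∂P = 0 := by
  obtain ⟨F, hF0, hF⟩ := exists_bound_fin f
  set π := hZ.fstPath with hπ
  have hXm : ∀ t, Measurable fun ω => (Z t ω).1 := fun t => (hZ.measurable t).fst
  have hXc : ∀ ω, IsCadlag fun t => (Z t ω).1 := fun ω => (hZ.cadlag ω).fst
  have hπm : Measurable π := measurable_pathMap hXm _
  have hR := measurableSet_rateBdd hq t N
  have hKm := (hZ.past).le s K hK
  -- If the total rate is at most `N` up to `t`, the total clock never exceeds `N * t < n`. On this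
  -- event the capped time `τ` is therefore equal to `r`.
  set n : ℕ := ⌈(N : ℝ) * t⌉₊ + 1 with hn
  set τ : Ω → ℝ≥0 := fun ω => capT (totClk q fun r => (Z r ω).1) n s r with hτdef
  have hτ : IsStop hZ.past τ :=
    fun u => measurableSet_natural_fst hZ.measurable (isStoppingTime_capT hq hXm hXc n s r u)
  have hcl : ∀ ω, ∫ u in (s : ℝ)..τ ω, totRate q (Z u.toNNReal ω).1 ≤ n := fun ω => by
    rw [← hq.totClk_sub (hXc ω)]
    exact apply_capT_sub_le (hq.continuous_totClk (hXc ω)) (hq.monotone_totClk (hXc ω))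
      (hq.totClk_nonneg _)
  have hτr : ∀ ω, π ω ∈ rateBdd q t N → τ ω = r := fun ω hω => by
    refine le_antisymm (capT_le hsr) (not_lt.1 fun h => ?_)
    have h1 := ((capT_le_iff (hq.continuous_totClk (hXc ω)) (hq.monotone_totClk (hXc ω))).1
      le_rfl).2.resolve_left h.not_ge
    have h2 : totClk q (fun r => (Z r ω).1) (τ ω) ≤ ∫ u in (0 : ℝ)..τ ω, (N : ℝ) := by
      refine intervalIntegral.integral_mono_on (τ ω).coe_nonneg
        (((hXc ω).comp hq.continuous_totRate).intervalIntegrable _ _) intervalIntegrable_const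
        fun u hu => totRate_le_of_mem_rateBdd hq hω ?_
      exact (Real.toNNReal_le_iff_le_coe.2 hu.2).trans (h.le.trans hrt)
    rw [intervalIntegral.integral_const, sub_zero, smul_eq_mul, mul_comm] at h2
    have h3 : (τ ω : ℝ) ≤ t := by exact_mod_cast h.le.trans hrt
    have h4 : (N : ℝ) * τ ω ≤ N * t := by gcongr
    have h5 := Nat.le_ceil ((N : ℝ) * t)
    have h6 : (n : ℝ) = ⌈(N : ℝ) * t⌉₊ + 1 := by rw [hn]; push_cast; rfl
    have h7 : (n : ℝ) ≤ totClk q (fun r => (Z r ω).1) (τ ω) := h1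
    linarith
  set U : Ω → ℝ := (π ⁻¹' rateBdd q t N).indicator fun ω => K.indicator (fun _ => 1) ω *
    compIncr q f s (τ ω) fun u => Z u ω with hU
  have hUm : Measurable U := (measurable_indicator_mul_compIncr hq hZ.proc f measurable_const
    (measurable_of_isStoppingTime hτ) hKm).indicator (hπm hR)
  have hUb : ∀ ω, |U ω| ≤ 2 * F + 2 * F * n := fun ω => by
    have h1 := abs_indicator_mul_compIncr_le (K := K) hq hF (hZ.cadlag ω) (le_capT : s ≤ τ ω) ω
      (hcl ω)
    by_cases h3 : ω ∈ π ⁻¹' rateBdd q t N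
    · simpa [hU, h3] using h1
    · simpa [hU, h3] using (abs_nonneg _).trans h1
  have hUi := integrable_of_abs_le (μ := P) hUm hUb
  -- The event of bounded rates belongs to the path of the first component, future included. It may
  -- be absorbed because the orthogonality is to the whole path.
  have key := integral_mul_eq_zero_of_setIntegral (m₀ := MeasurableSpace.comap π inferInstance)
    hπm.comap_le hUi (fun H hH => by
      obtain ⟨G, hG, rfl⟩ := hH
      rw [hU, setIntegral_indicator (hπm hR), ← Set.preimage_inter]
      exact setIntegral_compIncr_path hq hA hZ hD hW n.cast_nonneg hτ (fun ω => le_capT)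
        (fun ω => capT_le hsr) hcl hK f (hG.inter hR))
    (Φ := fun ω => Φ (π ω)) (hΦ.comp (comap_measurable π))
    (hUi.bdd_mul (hΦ.comp hπm).aestronglyMeasurable (.of_forall fun ω => hC _))
  rw [← key, ← integral_indicator (hKm.inter (hπm hR))]
  congr 1
  ext ω
  by_cases h3 : ω ∈ π ⁻¹' rateBdd q t N
  · by_cases h4 : ω ∈ K
    · simp [hU, h3, h4, hτr ω h3]
    · simp [hU, h4]
  · have h4 : ω ∉ K ∩ π ⁻¹' rateBdd q t N := fun h => h3 h.2
    rw [Set.indicator_of_notMem h4, hU, Set.indicator_of_notMem h3, mul_zero]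

end BoundedRates

/-! ### The evolution equation of the occupation integrals -/

section Gronwall

/-- The integral of a function of the path of the first component over the part of an event on which
the chain is in a given state. -/
noncomputable def occ (P : Measure Ω) (Z : ℝ≥0 → Ω → E × Fin (m + 1))
    (hZ : ∀ ω, IsCadlag fun t => Z t ω) (W : Set Ω) (Φ : PathSpace E → ℝ) (r : ℝ≥0)
    (k : Fin (m + 1)) : ℝ :=
  ∫ ω in W, Φ (fstPath Z hZ ω) * (if (Z r ω).2 = k then 1 else 0) ∂P

lemma measurable_ite_snd (hZm : ∀ t, Measurable (Z t)) (r : ℝ≥0) (k : Fin (m + 1)) :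
    Measurable fun ω => if (Z r ω).2 = k then (1 : ℝ) else 0 :=
  Measurable.ite ((hZm r).snd (measurableSet_singleton k)) measurable_const measurable_const

lemma abs_occ_le (hZ : ∀ ω, IsCadlag fun t => Z t ω) (W : Set Ω) {Φ : PathSpace E → ℝ} {C : ℝ}
    (hC0 : 0 ≤ C) (hC : ∀ x, |Φ x| ≤ C) (r : ℝ≥0) (k : Fin (m + 1)) : |occ P Z hZ W Φ r k| ≤ C := by
  have h := norm_integral_le_of_norm_le_const (μ := P.restrict W) (C := C)
    (f := fun ω => Φ (fstPath Z hZ ω) * (if (Z r ω).2 = k then (1 : ℝ) else 0))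
    (.of_forall fun ω => by
      rw [Real.norm_eq_abs, abs_mul]
      refine (mul_le_of_le_one_right (abs_nonneg _) ?_).trans (hC _)
      split_ifs <;> simp)
  refine h.trans (mul_le_of_le_one_right hC0 (by simp))

/-- The truncated rates are bounded, so a bounded path functional multiplied by such a rate is again
bounded, and the evolution equation can be iterated. On `rateBdd` they coincide with the original
rates. -/
noncomputable def minRate (q : OffDiag m → E → ℝ) (N : ℕ) (p : OffDiag m) (x : E) : ℝ := min (q p x) N

include hq

lemma rateFun_minRate (N : ℕ) : RateFun (minRate q N) :=
  ⟨fun p => (hq.continuous p).min continuous_const, fun p x => le_min (hq.nonneg p x) N.cast_nonneg⟩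

lemma abs_minRate_le (N : ℕ) (p : OffDiag m) (x : E) : |minRate q N p x| ≤ N := by
  rw [abs_of_nonneg ((rateFun_minRate hq N).nonneg p x)]
  exact min_le_right _ _

lemma minRate_eq {N : ℕ} {x : E} (h : totRate q x ≤ N) (p : OffDiag m) : minRate q N p x = q p x :=
  min_eq_left ((Finset.single_le_sum (f := fun p => q p x) (fun p _ => hq.nonneg p x)
    (Finset.mem_univ p)).trans h)

include hA hD hW

/-- Evolution equation of the occupation integrals. -/
lemma occ_sub_occ {s r t : ℝ≥0} (hsr : s ≤ r) (hrt : r ≤ t) (N : ℕ) {K : Set Ω}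
    (hK : MeasurableSet[hZ.past s] K) {Φ : PathSpace E → ℝ}
    (hΦ : Measurable Φ) {C : ℝ} (hC : ∀ x, |Φ x| ≤ C) (k : Fin (m + 1)) :
    IntervalIntegrable (fun u : ℝ => ∑ p : OffDiag m,
      ((if p.1.2 = k then 1 else 0) - (if p.1.1 = k then 1 else 0)) *
        occ P Z hZ.cadlag (K ∩ hZ.fstPath ⁻¹' rateBdd q t N)
          (fun x => Φ x * minRate q N p (x.1 u.toNNReal)) u.toNNReal p.1.1) volume s r ∧
    occ P Z hZ.cadlag (K ∩ hZ.fstPath ⁻¹' rateBdd q t N) Φ r k -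
      occ P Z hZ.cadlag (K ∩ hZ.fstPath ⁻¹' rateBdd q t N) Φ s k =
    ∫ u in (s : ℝ)..r, ∑ p : OffDiag m,
      ((if p.1.2 = k then 1 else 0) - (if p.1.1 = k then 1 else 0)) *
        occ P Z hZ.cadlag (K ∩ hZ.fstPath ⁻¹' rateBdd q t N)
          (fun x => Φ x * minRate q N p (x.1 u.toNNReal)) u.toNNReal p.1.1 := by
  set π := hZ.fstPath with hπ
  set W := K ∩ π ⁻¹' rateBdd q t N with hWdef
  set f : Fin (m + 1) → ℝ := fun j => if j = k then 1 else 0 with hf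
  have hπm : Measurable π := measurable_pathMap (fun t => (hZ.measurable t).fst) _
  have hWm : MeasurableSet W := ((hZ.past).le s K hK).inter
    (hπm (measurableSet_rateBdd hq t N))
  have hqN := rateFun_minRate hq N
  have hj : CadlagProc fun u ω => jumpOp (minRate q N) f (Z u ω) :=
    hZ.proc.comp (hqN.continuous_jumpOp f)
  have hF : ∀ j, |f j| ≤ 1 := fun j => by simp only [hf]; split_ifs <;> simp
  have hjb : ∀ z, |jumpOp (minRate q N) f z| ≤ 2 * 1 * ∑ p : OffDiag m, (N : ℝ) := fun z =>
    (hqN.abs_genRate_le hF (fun _ => z.1) (fun _ => z.2) 0).trans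
      (mul_le_mul_of_nonneg_left (Finset.sum_le_sum fun p _ =>
        (le_abs_self _).trans (abs_minRate_le hq N p _)) (by norm_num))
  have hC0 : 0 ≤ C := by
    obtain ⟨ω⟩ := P.nonempty_of_neZero
    exact (abs_nonneg _).trans (hC (π ω))
  have hΦm : Measurable fun ω => Φ (π ω) := hΦ.comp hπm
  have hg : Integrable (Function.uncurry fun (ω : Ω) (u : ℝ) =>
      Φ (π ω) * jumpOp (minRate q N) f (Z u.toNNReal ω))
      ((P.restrict W).prod (volume.restrict (Set.Ioc (s : ℝ) r))) := by
    refine integrable_of_abs_le (c := C * (2 * 1 * ∑ p : OffDiag m, (N : ℝ)))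
      ((hΦm.comp measurable_fst).mul (hj.uncurry.comp
        ((measurable_real_toNNReal.comp measurable_snd).prodMk measurable_fst))) fun p => ?_
    simp only [Function.uncurry]
    rw [abs_mul]
    exact mul_le_mul (hC _) (hjb _) (abs_nonneg _) hC0
  -- With `f` the indicator of the state `k`, the jump operator is the flow into `k` minus the flow
  -- out of `k`.
  have hocc : ∀ u : ℝ≥0, ∑ p : OffDiag m,
      ((if p.1.2 = k then 1 else 0) - (if p.1.1 = k then 1 else 0)) *
        occ P Z hZ.cadlag W (fun x => Φ x * minRate q N p (x.1 u)) u p.1.1 =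
      ∫ ω in W, Φ (π ω) * jumpOp (minRate q N) f (Z u ω) ∂P := fun u => by
    simp only [jumpOp, Finset.mul_sum]
    rw [integral_finsetSum]
    · refine Finset.sum_congr rfl fun p _ => ?_
      rw [occ, ← integral_const_mul]
      congr 1
      ext ω
      change _ * (Φ (π ω) * minRate q N p (Z u ω).1 * _) = _
      simp only [hf]
      split_ifs <;> ring
    · intro p _
      have hm1 : Measurable fun ω => (if (Z u ω).2 = p.1.1 then minRate q N p (Z u ω).1 else 0) :=
        Measurable.ite ((hZ.measurable u).snd (measurableSet_singleton _))
          ((hqN.continuous p).measurable.comp (hZ.measurable u).fst) measurable_const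
      refine (integrable_of_abs_le (c := C * (N * (1 + 1))) (hΦm.mul (hm1.mul_const _)) fun ω => ?_)
      rw [abs_mul, abs_mul]
      refine mul_le_mul (hC _) (mul_le_mul ?_ ((abs_sub _ _).trans (add_le_add (hF _) (hF _)))
        (abs_nonneg _) N.cast_nonneg) (by positivity) hC0
      split_ifs
      · exact abs_minRate_le hq N p _
      · simp
  simp only [hocc]
  have hi := hg.integral_prod_right
  refine ⟨(intervalIntegrable_iff_integrableOn_Ioc_of_le (by exact_mod_cast hsr)).2 hi, ?_⟩
  rw [intervalIntegral.integral_of_le (by exact_mod_cast hsr), ← integral_integral_swap hg]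
  have h0 := setIntegral_mul_compIncr_eq_zero hq hA hZ hD hW hsr hrt N hK f hΦ hC
  have hi1 : ∀ u, Integrable (fun ω => Φ (π ω) * f (Z u ω).2) (P.restrict W) := fun u =>
    (integrable_of_abs_le (c := C * 1) (hΦm.mul (measurable_ite_snd hZ.measurable u k))
      fun ω => by
        rw [abs_mul]
        exact mul_le_mul (hC _) (hF _) (abs_nonneg _) hC0)
  have h1 : ∫ ω in W, Φ (π ω) * compIncr q f s r (fun u => Z u ω) ∂P =
      ∫ ω in W, (Φ (π ω) * f (Z r ω).2 - Φ (π ω) * f (Z s ω).2 -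
        ∫ u in Set.Ioc (s : ℝ) r, Φ (π ω) * jumpOp (minRate q N) f (Z u.toNNReal ω)) ∂P := by
    refine setIntegral_congr_fun hWm fun ω hω => ?_
    change _ * (_ - _ - _) = _
    rw [integral_const_mul, ← intervalIntegral.integral_of_le (by exact_mod_cast hsr), mul_sub,
      mul_sub]
    congr 2
    refine intervalIntegral.integral_congr fun u hu => ?_
    rw [Set.uIcc_of_le (by exact_mod_cast hsr)] at hu
    have hb : totRate q (Z u.toNNReal ω).1 ≤ N := totRate_le_of_mem_rateBdd hq hω.2
      ((Real.toNNReal_le_iff_le_coe.2 hu.2).trans hrt)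
    change jumpOp q f _ = jumpOp _ f _
    simp only [jumpOp]
    exact Finset.sum_congr rfl fun p _ => by rw [minRate_eq hq hb p]
  have hi2 : Integrable (fun ω => ∫ u in Set.Ioc (s : ℝ) r,
      Φ (π ω) * jumpOp (minRate q N) f (Z u.toNNReal ω)) (P.restrict W) := hg.integral_prod_left
  have hi3 : Integrable (fun ω => Φ (π ω) * f (Z r ω).2 - Φ (π ω) * f (Z s ω).2) (P.restrict W) :=
    (hi1 r).sub (hi1 s)
  rw [h1, integral_sub hi3 hi2, integral_sub (hi1 r) (hi1 s), sub_eq_zero] at h0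
  exact h0

end Gronwall

/-! ### Agreement of two solutions propagates in time -/

section Propagation

/-- Two measures agree about the path of the first component, the event `K` and the state of the
chain at time `s`. -/
def Agree (P P' : Measure Ω) (Z : ℝ≥0 → Ω → E × Fin (m + 1)) (hZ : ∀ ω, IsCadlag fun t => Z t ω)
    (s : ℝ≥0) (K : Set Ω) : Prop :=
  ∀ G, MeasurableSet G → ∀ k, P (K ∩ (fun ω => (Z s ω).2) ⁻¹' {k} ∩ fstPath Z hZ ⁻¹' G) =
    P' (K ∩ (fun ω => (Z s ω).2) ⁻¹' {k} ∩ fstPath Z hZ ⁻¹' G)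

lemma Agree.inter {hZ : ∀ ω, IsCadlag fun t => Z t ω} {s : ℝ≥0} {K : Set Ω}
    (h : Agree P P' Z hZ s K) (J : Set (Fin (m + 1))) :
    Agree P P' Z hZ s (K ∩ (fun ω => (Z s ω).2) ⁻¹' J) := fun G hG k => by
  by_cases hk : k ∈ J
  · have hs : K ∩ (fun ω => (Z s ω).2) ⁻¹' J ∩ (fun ω => (Z s ω).2) ⁻¹' {k} =
        K ∩ (fun ω => (Z s ω).2) ⁻¹' {k} := by
      rw [Set.inter_assoc, ← Set.preimage_inter,
        Set.inter_eq_right.2 (Set.singleton_subset_iff.2 hk)]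
    rw [hs]
    exact h G hG k
  · have : (fun ω => (Z s ω).2) ⁻¹' J ∩ (fun ω => (Z s ω).2) ⁻¹' {k} = ∅ := by
      rw [← Set.preimage_inter, Set.inter_singleton_eq_empty.2 hk, Set.preimage_empty]
    rw [Set.inter_assoc K, this]
    simp

lemma Agree.occ_eq {hZ : ∀ ω, IsCadlag fun t => Z t ω} (hZm : ∀ t, Measurable (Z t)) {s : ℝ≥0}
    {K : Set Ω} (hK : MeasurableSet K) (h : Agree P P' Z hZ s K) {R : Set (PathSpace E)}
    (hR : MeasurableSet R) {Φ : PathSpace E → ℝ} (hΦ : Measurable Φ) (k : Fin (m + 1)) :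
    occ P Z hZ (K ∩ fstPath Z hZ ⁻¹' R) Φ s k = occ P' Z hZ (K ∩ fstPath Z hZ ⁻¹' R) Φ s k := by
  set π := fstPath Z hZ with hπ
  have hπm : Measurable π := measurable_pathMap (fun t => (hZm t).fst) _
  have hk : MeasurableSet ((fun ω => (Z s ω).2) ⁻¹' {k}) :=
    (hZm s).snd (measurableSet_singleton k)
  have h1 : ∀ ρ : Measure Ω, occ ρ Z hZ (K ∩ π ⁻¹' R) Φ s k =
      ∫ x, R.indicator Φ x ∂((ρ.restrict (K ∩ (fun ω => (Z s ω).2) ⁻¹' {k})).map π) := fun ρ => by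
    rw [integral_map hπm.aemeasurable (hΦ.indicator hR).aestronglyMeasurable, occ,
      ← integral_indicator (hK.inter (hπm hR)), ← integral_indicator (hK.inter hk)]
    congr 1
    ext ω
    by_cases h1 : ω ∈ K <;> by_cases h2 : π ω ∈ R <;> by_cases h3 : (Z s ω).2 = k <;>
      simp [h1, h2, h3, ← hπ]
  rw [h1, h1]
  congr 1
  ext G hG
  rw [Measure.map_apply hπm hG, Measure.map_apply hπm hG, Measure.restrict_apply (hπm hG),
    Measure.restrict_apply (hπm hG), Set.inter_comm]
  exact h G hG k

include hq hA hZ' hD hW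

/-- Both occupation integrals solve the same linear evolution equation with the same value at time
`s`. Iterating it `l` times bounds the difference by the `l`th term of an exponential series. The
functional `Φ` must vary in the induction because every iteration multiplies it by a rate at an
earlier time. -/
lemma abs_occ_sub_le {s t : ℝ≥0} (N : ℕ) {K : Set Ω} (hK : MeasurableSet[hZ.past s] K)
    (h0 : Agree P P' Z hZ.cadlag s K) (l : ℕ) {Φ : PathSpace E → ℝ} (hΦ : Measurable Φ) {C : ℝ}
    (hC0 : 0 ≤ C) (hC : ∀ x, |Φ x| ≤ C) (k : Fin (m + 1)) {r : ℝ≥0} (hsr : s ≤ r) (hrt : r ≤ t) :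
    |occ P Z hZ.cadlag (K ∩ hZ.fstPath ⁻¹' rateBdd q t N) Φ r k -
      occ P' Z hZ.cadlag (K ∩ hZ.fstPath ⁻¹' rateBdd q t N) Φ r k| ≤
      2 * C * ((∑ _p : OffDiag m, (N : ℝ)) * ((r : ℝ) - s)) ^ l / l.factorial := by
  set W := K ∩ hZ.fstPath ⁻¹' rateBdd q t N with hWdef
  set Λ : ℝ := ∑ _p : OffDiag m, (N : ℝ) with hΛ
  have hKm := (hZ.past).le s K hK
  induction l generalizing Φ C k r with
  | zero =>
    simp only [pow_zero, mul_one, Nat.factorial_zero, Nat.cast_one, div_one]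
    refine (abs_sub _ _).trans ?_
    linarith [abs_occ_le (P := P) hZ.cadlag W hC0 hC r k,
      abs_occ_le (P := P') hZ.cadlag W hC0 hC r k]
  | succ l ih =>
    obtain ⟨i1, e1⟩ := occ_sub_occ hq hA hZ hD hW hsr hrt N hK hΦ hC k
    obtain ⟨i2, e2⟩ := occ_sub_occ hq hA hZ' hD hW hsr hrt N hK hΦ hC k
    have e3 := h0.occ_eq hZ.measurable hKm (measurableSet_rateBdd hq t N) hΦ k
    have e4 : occ P Z hZ.cadlag W Φ r k - occ P' Z hZ.cadlag W Φ r k =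
        (occ P Z hZ.cadlag W Φ r k - occ P Z hZ.cadlag W Φ s k) -
          (occ P' Z hZ.cadlag W Φ r k - occ P' Z hZ.cadlag W Φ s k) := by
      rw [e3]; ring
    rw [e4, e1, e2, ← intervalIntegral.integral_sub i1 i2, ← Real.norm_eq_abs]
    have hsr' : (s : ℝ) ≤ r := by exact_mod_cast hsr
    have hb : ∫ u in (s : ℝ)..r, 2 * C * Λ ^ (l + 1) / l.factorial * (u - s) ^ l =
        2 * C * (Λ * ((r : ℝ) - s)) ^ (l + 1) / (l + 1).factorial := by
      rw [intervalIntegral.integral_const_mul,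
        intervalIntegral.integral_comp_sub_right (fun x => x ^ l) (s : ℝ), integral_pow, sub_self,
        zero_pow (Nat.succ_ne_zero l), sub_zero, Nat.factorial_succ]
      push_cast
      field_simp
      rw [mul_pow]
      ring
    rw [← hb]
    refine intervalIntegral.norm_integral_le_of_norm_le hsr' (.of_forall fun u hu => ?_)
      (by apply Continuous.intervalIntegrable; fun_prop)
    have hsu : s ≤ u.toNNReal := NNReal.le_toNNReal_of_coe_le hu.1.le
    have hut : u.toNNReal ≤ t := (Real.toNNReal_le_iff_le_coe.2 hu.2).trans hrt
    rw [← Finset.sum_sub_distrib, Real.norm_eq_abs]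
    refine (Finset.abs_sum_le_sum_abs _ _).trans ?_
    have hp : ∀ p ∈ (Finset.univ : Finset (OffDiag m)), |((if p.1.2 = k then 1 else 0) -
        (if p.1.1 = k then (1 : ℝ) else 0)) * occ P Z hZ.cadlag W
          (fun x => Φ x * minRate q N p (x.1 u.toNNReal)) u.toNNReal p.1.1 -
        ((if p.1.2 = k then 1 else 0) - (if p.1.1 = k then 1 else 0)) * occ P' Z hZ.cadlag W
          (fun x => Φ x * minRate q N p (x.1 u.toNNReal)) u.toNNReal p.1.1| ≤
        N * (2 * C * (Λ * (u - s)) ^ l / l.factorial) := fun p _ => by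
      rw [← mul_sub, abs_mul]
      have h1 : |((if p.1.2 = k then 1 else 0) - (if p.1.1 = k then (1 : ℝ) else 0))| ≤ 1 := by
        split_ifs <;> simp
      refine (mul_le_of_le_one_left (abs_nonneg _) h1).trans ?_
      have h2 := ih (Φ := fun x => Φ x * minRate q N p (x.1 u.toNNReal))
        (hΦ.mul (((rateFun_minRate hq N).continuous p).measurable.comp (measurable_coord _)))
        (C := C * N) (by positivity) (fun x => by
          rw [abs_mul]
          exact mul_le_mul (hC x) (abs_minRate_le hq N p _) (abs_nonneg _) hC0) p.1.1 hsu hut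
      rw [Real.coe_toNNReal _ (s.coe_nonneg.trans hu.1.le)] at h2
      refine h2.trans (le_of_eq ?_)
      ring
    refine (Finset.sum_le_sum hp).trans (le_of_eq ?_)
    rw [← Finset.sum_mul, ← hΛ, mul_pow]
    ring

/-- As `l` grows, the factorial bound forces equality on every event of bounded rates; these events
increase to the whole path space because a cadlag path is bounded on `[0, t]`. -/
lemma Agree.mono {s t : ℝ≥0} (hst : s ≤ t) {K : Set Ω} (hK : MeasurableSet[hZ.past s] K)
    (h0 : Agree P P' Z hZ.cadlag s K) : Agree P P' Z hZ.cadlag t K := by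
  intro G hG k
  set π := hZ.fstPath with hπ
  have hKm := (hZ.past).le s K hK
  have hπm : Measurable π := measurable_pathMap (fun t => (hZ.measurable t).fst) _
  have hk : MeasurableSet ((fun ω => (Z t ω).2) ⁻¹' {k}) :=
    (hZ.measurable t).snd (measurableSet_singleton k)
  set V : ℕ → Set Ω := fun N => K ∩ (fun ω => (Z t ω).2) ⁻¹' {k} ∩ π ⁻¹' G ∩
    π ⁻¹' rateBdd q t N with hV
  have hVm : ∀ N, MeasurableSet (V N) := fun N =>
    ((hKm.inter hk).inter (hπm hG)).inter (hπm (measurableSet_rateBdd hq t N))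
  have hocc : ∀ (ρ : Measure Ω) [IsProbabilityMeasure ρ] (N : ℕ), occ ρ Z hZ.cadlag
      (K ∩ π ⁻¹' rateBdd q t N) (G.indicator fun _ => 1) t k = ρ.real (V N) := fun ρ _ N => by
    rw [← integral_indicator_one (hVm N), occ,
      ← integral_indicator (hKm.inter (hπm (measurableSet_rateBdd hq t N)))]
    congr 1
    ext ω
    by_cases h1 : ω ∈ K <;> by_cases h2 : π ω ∈ G <;> by_cases h3 : (Z t ω).2 = k <;>
      by_cases h4 : π ω ∈ rateBdd q t N <;> simp [hV, h1, h2, h3, h4, ← hπ]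
  have heq : ∀ N, P (V N) = P' (V N) := fun N => by
    rw [← measureReal_eq_measureReal_iff, ← hocc P N, ← hocc P' N, ← sub_eq_zero, ← abs_nonpos_iff]
    have hlim := (FloorSemiring.tendsto_pow_div_factorial_atTop
      ((∑ _p : OffDiag m, (N : ℝ)) * ((t : ℝ) - s))).const_mul (2 * 1)
    rw [mul_zero] at hlim
    refine ge_of_tendsto' hlim fun l => ?_
    rw [← mul_div_assoc]
    exact abs_occ_sub_le hq hA hZ hZ' hD hW N hK h0 l (measurable_const.indicator hG) zero_le_one
      (fun x => by by_cases hx : x ∈ G <;> simp [hx]) k hst le_rfl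
  have hun : ⋃ N, V N = K ∩ (fun ω => (Z t ω).2) ⁻¹' {k} ∩ π ⁻¹' G := by
    rw [hV, ← Set.inter_iUnion]
    refine Set.inter_eq_left.2 fun ω _ => Set.mem_iUnion.2 (exists_mem_rateBdd hq t (π ω))
  have hmono : Monotone V := fun N N' h =>
    Set.inter_subset_inter_right _ (Set.preimage_mono (monotone_rateBdd t h))
  rw [← hun]
  refine tendsto_nhds_unique (tendsto_measure_iUnion_atTop hmono) ?_
  simp only [Function.comp_def, heq]
  exact tendsto_measure_iUnion_atTop hmono

end Propagation

/-! ### Uniqueness of the law -/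

section Uniqueness

include hq hA

/-- The initial state of the chain is known to the joint filtration, in which the test processes of
the first component are martingales; restriction to it keeps the martingale property. -/
lemma SolvesLocalMP.isMPWeight_indicator (hZ : SolvesLocalMP (couplGen A q) Z P)
    (k : Fin (m + 1)) : IsMPWeight A (fun t ω => (Z t ω).1) (fun t => (hZ.measurable t).fst) P
      (((fun ω => (Z 0 ω).2) ⁻¹' {k}).indicator fun _ => 1) := by
  have hk : MeasurableSet ((fun ω => (Z 0 ω).2) ⁻¹' {k}) :=
    (hZ.measurable 0).snd (measurableSet_singleton k)
  refine ⟨measurable_const.indicator hk, fun ω => Set.indicator_nonneg (fun _ _ => zero_le_one) ω,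
    ⟨1, fun ω => ?_⟩, fun a ha u T huT H hH => ?_⟩
  · by_cases h : ω ∈ (fun ω => (Z 0 ω).2) ⁻¹' {k} <;> simp [h]
  · have hk0 : MeasurableSet[hZ.past u]
        ((fun ω => (Z 0 ω).2) ⁻¹' {k}) :=
      (measurable_natural' hZ.measurable zero_le).snd (measurableSet_singleton k)
    have hH' := measurableSet_natural_fst hZ.measurable hH
    rw [← Martingale.setIntegral_sub_eq_zero (hZ.martingale_fst hq hA ha) huT (hH'.inter hk0),
      ← setIntegral_indicator hk]
    congr 1
    ext ω
    by_cases h : ω ∈ (fun ω => (Z 0 ω).2) ⁻¹' {k} <;> simp [h]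

include hZ' hW

/-- Restricted to the event that the chain starts in `k`, the first component has the same initial
distribution under both measures, so well-posedness for `A` equates the laws of its whole path. -/
lemma agree_zero (h0 : P.map (Z 0) = P'.map (Z 0)) : Agree P P' Z hZ.cadlag 0 Set.univ:= by
  intro G hG k
  have hk : MeasurableSet ((fun ω => (Z 0 ω).2) ⁻¹' {k}) :=
    (hZ.measurable 0).snd (measurableSet_singleton k)
  have h1 : ∀ (ρ : Measure Ω) (S : Set Ω),
      ∫ ω in S, ((fun ω => (Z 0 ω).2) ⁻¹' {k}).indicator (fun _ => (1 : ℝ)) ω ∂ρ =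
        ρ.real ((fun ω => (Z 0 ω).2) ⁻¹' {k} ∩ S) := fun ρ S => by
    rw [setIntegral_indicator hk, Set.inter_comm]
    simp
  have h2 := hW.setIntegral_eq (fun ω => (hZ.cadlag ω).fst) hA (fun ω => (hZ.cadlag ω).fst)
    (hZ.isMPWeight_indicator hq hA k) (hZ'.isMPWeight_indicator hq hA k) (fun Γ hΓ => by
      rw [h1, h1]
      have h3 : (fun ω => (Z 0 ω).2) ⁻¹' {k} ∩ (fun ω => (Z 0 ω).1) ⁻¹' Γ =
        Z 0 ⁻¹' (Prod.snd ⁻¹' {k} ∩ Prod.fst ⁻¹' Γ) := rfl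
      have h4 : MeasurableSet (Prod.snd ⁻¹' {k} ∩ Prod.fst ⁻¹' Γ : Set (E × Fin (m + 1))) :=
        (measurable_snd (measurableSet_singleton k)).inter (measurable_fst hΓ)
      rw [h3, ← map_measureReal_apply (hZ.measurable 0) h4, h0,
        map_measureReal_apply (hZ.measurable 0) h4]) hG
  rw [h1, h1, measureReal_eq_measureReal_iff] at h2
  rwa [Set.univ_inter]

include hD

/-- Induction on the last observation time: the new event is intersected at its own time by
`Agree.inter`, and the agreement is carried forward by `Agree.mono`. -/
lemma agree_cylinder (h0 : P.map (Z 0) = P'.map (Z 0)) (J : ℝ≥0 → Set (Fin (m + 1)))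
    (I : Finset ℝ≥0) : ∀ t, (∀ u ∈ I, u ≤ t) →
      Agree P P' Z hZ.cadlag t (⋂ u ∈ I, (fun ω => (Z u ω).2) ⁻¹' J u) := by
  have hm : ∀ (I : Finset ℝ≥0) (t : ℝ≥0), (∀ u ∈ I, u ≤ t) →
      MeasurableSet[hZ.past t]
        (⋂ u ∈ I, (fun ω => (Z u ω).2) ⁻¹' J u) := fun I t h =>
    Finset.measurableSet_biInter I fun u hu =>
      (measurable_natural' hZ.measurable (h u hu)).snd (Set.toFinite _).measurableSet
  refine Finset.induction_on_max I ?_ ?_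
  · intro t _
    simp only [Finset.notMem_empty, Set.iInter_of_empty, Set.iInter_univ]
    exact Agree.mono hq hA hZ hZ' hD hW zero_le MeasurableSet.univ
      (agree_zero hq hA hZ hZ' hW h0)
  · intro a I hI ih t ht
    have h1 := (ih a fun u hu => (hI u hu).le).inter (J a)
    have h2 : (⋂ u ∈ insert a I, (fun ω => (Z u ω).2) ⁻¹' J u) =
        (⋂ u ∈ I, (fun ω => (Z u ω).2) ⁻¹' J u) ∩ (fun ω => (Z a ω).2) ⁻¹' J a := by
      rw [Finset.set_biInter_insert, Set.inter_comm]
    rw [← h2] at h1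
    refine Agree.mono hq hA hZ hZ' hD hW (ht a (Finset.mem_insert_self a I)) (hm _ a ?_) h1
    intro u hu
    rcases Finset.mem_insert.1 hu with rfl | h
    exacts [le_rfl, (hI u h).le]

/-- The law of a solution of the local martingale problem is determined by the initial law. -/
theorem map_pathMap_eq (h0 : P.map (Z 0) = P'.map (Z 0)) :
    P.map (pathMap Z hZ.cadlag) = P'.map (pathMap Z hZ.cadlag) := by
  set π := hZ.fstPath with hπ
  set Y : Ω → ℝ≥0 → Fin (m + 1) := fun ω t => (Z t ω).2 with hY
  have hπm : Measurable π := measurable_pathMap (fun t => (hZ.measurable t).fst) _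
  have hYm : Measurable Y := measurable_pi_iff.2 fun t => (hZ.measurable t).snd
  have h1 : ∀ G, MeasurableSet G →
      (P.restrict (π ⁻¹' G)).map Y = (P'.restrict (π ⁻¹' G)).map Y := fun G hG => by
    have hc : ∀ C ∈ squareCylinders fun _ : ℝ≥0 => {s : Set (Fin (m + 1)) | MeasurableSet s},
        (P.restrict (π ⁻¹' G)).map Y C = (P'.restrict (π ⁻¹' G)).map Y C := by
      rintro C ⟨I, J, hJ, rfl⟩
      have hCm : MeasurableSet ((I : Set ℝ≥0).pi J) :=
        MeasurableSet.pi I.countable_toSet fun u _ => (Set.toFinite _).measurableSet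
      obtain ⟨t, ht⟩ := I.bddAbove
      have hag := agree_cylinder hq hA hZ hZ' hD hW h0 J I t fun u hu => ht hu
      rw [Measure.map_apply hYm hCm, Measure.map_apply hYm hCm, Measure.restrict_apply (hYm hCm),
        Measure.restrict_apply (hYm hCm)]
      set S := Y ⁻¹' (I : Set ℝ≥0).pi J ∩ π ⁻¹' G with hS
      have hSk : ∀ k, (fun ω => (Z t ω).2) ⁻¹' {k} ∩ S =
          (⋂ u ∈ I, (fun ω => (Z u ω).2) ⁻¹' J u) ∩ (fun ω => (Z t ω).2) ⁻¹' {k} ∩ π ⁻¹' G := by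
        intro k
        ext ω
        simp only [hS, Set.mem_inter_iff, Set.mem_preimage, Set.mem_pi, Set.mem_iInter, hY,
          Finset.mem_coe]
        tauto
      have hsum : ∀ ρ : Measure Ω, ρ S = ∑ k, ρ ((fun ω => (Z t ω).2) ⁻¹' {k} ∩ S) := fun ρ => by
        rw [← measure_biUnion_finset]
        · congr 1
          ext ω
          simp
        · intro k _ l _ hkl
          exact Set.disjoint_left.2 fun ω h h' => hkl (h.1.symm.trans h'.1)
        · exact fun k _ => ((hZ.measurable t).snd (measurableSet_singleton k)).inter
            ((hYm hCm).inter (hπm hG))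
      rw [hsum P, hsum P']
      exact Finset.sum_congr rfl fun k _ => by rw [hSk]; exact hag G hG k
    refine ext_of_generate_finite _ (generateFrom_squareCylinders (α := fun _ => Fin (m + 1))).symm
      (isPiSystem_squareCylinders (fun _ => MeasurableSpace.isPiSystem_measurableSet) (by simp)) hc ?_
    exact hc _ ⟨∅, fun _ => Set.univ, by simp, by simp⟩
  have h2 : P.map (fun ω => (π ω, Y ω)) = P'.map (fun ω => (π ω, Y ω)) := by
    have : IsFiniteMeasure (P.map fun ω => (π ω, Y ω)) := inferInstance
    refine Measure.ext_prod fun {G} {C} hG hC => ?_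
    rw [Measure.map_apply (hπm.prodMk hYm) (hG.prod hC),
      Measure.map_apply (hπm.prodMk hYm) (hG.prod hC)]
    have h3 := congrArg (fun ρ => ρ C) (h1 G hG)
    simp only [Measure.map_apply hYm hC, Measure.restrict_apply (hYm hC)] at h3
    rw [Set.inter_comm] at h3
    exact h3
  have hzm := measurable_pathMap hZ.measurable hZ.cadlag
  -- The σ-algebra of the path space is the trace of the product σ-algebra, so the joint law of the
  -- two component paths, without regularity of the second one, determines the law.
  set J : PathSpace E × (ℝ≥0 → Fin (m + 1)) → ℝ≥0 → E × Fin (m + 1) :=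
    fun w t => (w.1.1 t, w.2 t) with hJ
  have hJm : Measurable J := measurable_pi_iff.2 fun t =>
    ((measurable_coord t).comp measurable_fst).prodMk
      ((measurable_pi_apply t).comp measurable_snd)
  ext H hH
  obtain ⟨B, hB, rfl⟩ := hH
  have h4 := congrArg (fun ρ => ρ (J ⁻¹' B)) h2
  simp only [Measure.map_apply (hπm.prodMk hYm) (hJm hB)] at h4
  rw [Measure.map_apply hzm (measurable_subtype_coe hB),
    Measure.map_apply hzm (measurable_subtype_coe hB)]
  exact h4

end Uniqueness

/-! ### Existence for arbitrary initial distributions -/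

section Existence

include hq in
lemma drivenZ_zero {Ω : Type*} {X : ℝ≥0 → Ω → E} (hXc : ∀ ω, IsCadlag fun t => X t ω)
    (k : Fin (m + 1)) (w : Ω × CountSpace m) : drivenZ q X k 0 w = (X 0 w.1, k) := by
  refine Prod.ext rfl ?_
  change sol _ _ _ _ = k
  rw [sol_eq_clampFin_solZ (hq.ratePath (hXc w.1)) w.2.2, solZ, posZ]
  simp [shiftZ, w.2.2.zero, clampFin_coe]

include hq hA

lemma StoppedId.map_pathMap {Ω : Type*} [MeasurableSpace Ω] {P : Measure Ω}
    {Z : ℝ≥0 → Ω → E × Fin (m + 1)} (hZm : ∀ t, Measurable (Z t))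
    (hZc : ∀ ω, IsCadlag fun t => Z t ω) (hS : StoppedId A q Z P) :
    StoppedId A q coord (P.map (pathMap Z hZc)) := by
  intro a ha f n s t hst B hB
  have hπ := measurable_pathMap hZm hZc
  have hK : MeasurableSet {x : PathSpace (E × Fin (m + 1)) |
      (fun r : Set.Iic s => coord (r : ℝ≥0) x) ∈ B} :=
    (measurable_pi_iff.2 fun r : Set.Iic s => measurable_coord (r : ℝ≥0)) hB
  rw [setIntegral_map hK (measurable_stoppedIncr_of_le hq (hA ha).1.1 (hA ha).2.1 n hst (fun u _ => measurable_coord u)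
      fun x => x.2).aestronglyMeasurable hπ.aemeasurable]
  exact hS a ha f n s t hst B hB

/-- The stopped identities use localising times that are fixed functionals of the path. They are
therefore linear in the measure and survive mixing. -/
lemma StoppedId.sum {Ω : Type*} [MeasurableSpace Ω] {Z : ℝ≥0 → Ω → E × Fin (m + 1)}
    (hZm : ∀ t, Measurable (Z t)) (hZc : ∀ ω, IsCadlag fun t => Z t ω) {ι : Type*} [Fintype ι]
    {P : ι → Measure Ω} [∀ i, IsProbabilityMeasure (P i)] {c : ι → ENNReal} (hc : ∀ i, c i ≠ ⊤)
    (hS : ∀ i, StoppedId A q Z (P i)) : StoppedId A q Z (∑ i, c i • P i) := by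
  intro a ha f n s t hst B hB
  obtain ⟨D, hD0, h1, h2⟩ := exists_bound_pair hA ha
  obtain ⟨F, hF0, hF⟩ := exists_bound_fin f
  have hK : MeasurableSet {ω | (fun r : Set.Iic s => Z r ω) ∈ B} :=
    (measurable_pi_iff.2 fun r : Set.Iic s => hZm r) hB
  have hint : ∀ i, Integrable ({ω | (fun r : Set.Iic s => Z r ω) ∈ B}.indicator
      fun ω => stoppedIncr q a f n s t fun r => Z r ω) (P i) := fun i =>
    (integrable_of_abs_le (measurable_stoppedIncr_of_le hq (hA ha).1.1 (hA ha).2.1 n hst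
      (fun u _ => hZm u) hZc) fun ω => abs_stoppedIncr_le hq hD0 hF0 (hA ha).1.1 (hA ha).2.1
        h1 h2 hF n hst (hZc ω)).indicator hK
  rw [← integral_indicator hK, integral_finsetSum_measure fun i _ => (hint i).smul_measure (hc i)]
  refine Finset.sum_eq_zero fun i _ => ?_
  rw [integral_smul_measure, integral_indicator hK, hS i a ha f n s t hst B hB, smul_zero]

omit hq hA in
/-- A measure on `E × {0, …, m}` is a mixture of products with point masses. -/
lemma exists_mixture (μ : Measure (E × Fin (m + 1))) [IsProbabilityMeasure μ] :
    ∃ ν : Fin (m + 1) → Measure E, (∀ k, IsProbabilityMeasure (ν k)) ∧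
      μ = ∑ k, μ (Prod.snd ⁻¹' {k}) • (ν k).map fun x => (x, k) := by
  have hk : ∀ k, MeasurableSet (Prod.snd ⁻¹' {k} : Set (E × Fin (m + 1))) := fun k =>
    measurable_snd (measurableSet_singleton k)
  -- For a state of mass zero there is nothing to condition on; any probability measure will do, as
  -- it receives weight zero.
  refine ⟨fun k => if μ (Prod.snd ⁻¹' {k}) = 0 then μ.map Prod.fst else
    (cond μ (Prod.snd ⁻¹' {k})).map Prod.fst, fun k => ?_, ?_⟩
  · dsimp only
    split_ifs with h
    · exact Measure.isProbabilityMeasure_map measurable_fst.aemeasurable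
    · have := cond_isProbabilityMeasure h
      exact Measure.isProbabilityMeasure_map measurable_fst.aemeasurable
  · ext S hS
    have h1 : ∀ k, (μ (Prod.snd ⁻¹' {k}) • Measure.map (fun x => (x, k))
        (if μ (Prod.snd ⁻¹' {k}) = 0 then μ.map Prod.fst else
          (cond μ (Prod.snd ⁻¹' {k})).map Prod.fst)) S = μ (Prod.snd ⁻¹' {k} ∩ S) := fun k => by
      split_ifs with h
      · rw [h, zero_smul, Measure.coe_zero, Pi.zero_apply,
          measure_mono_null Set.inter_subset_left h]
      · rw [Measure.smul_apply, Measure.map_apply measurable_prodMk_right hS,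
          Measure.map_apply measurable_fst (measurable_prodMk_right hS), cond_apply (hk k),
          smul_eq_mul, ← mul_assoc, ENNReal.mul_inv_cancel h (measure_ne_top _ _), one_mul]
        congr 1
        ext ⟨x, j⟩
        simp only [Set.mem_inter_iff, Set.mem_preimage, Set.mem_singleton_iff]
        exact and_congr_right fun h => by rw [h]
    rw [Measure.finsetSum_apply]
    simp only [h1]
    rw [← measure_biUnion_finset]
    · congr 1
      ext z
      simp
    · exact fun k _ l _ hkl => Set.disjoint_left.2 fun z h h' => hkl (h.1.symm.trans h'.1)
    · exact fun k _ => (hk k).inter hS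

include hW

/-- Existence for the local martingale problem of the coupled generator. -/
theorem exists_solvesLocalMP (μ : Measure (E × Fin (m + 1)))
    [IsProbabilityMeasure μ] : ∃ P : Measure (PathSpace (E × Fin (m + 1))),
      IsProbabilityMeasure P ∧ P.map (coord 0) = μ ∧ SolvesLocalMP (couplGen A q) coord P := by
  obtain ⟨ν, hν, hμ⟩ := exists_mixture μ
  choose R hR _ using fun k => hW (ν k) (hν k)
  have hRp := fun k => (hR k).1
  have hcad : ∀ x : PathSpace E, IsCadlag fun t => coord t x := fun x => x.2
  have hZ := fun k : Fin (m + 1) => cadlagProc_drivenZ (k := k) hq hcad measurable_coord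
  set ρ : Fin (m + 1) → Measure (PathSpace (E × Fin (m + 1))) := fun k =>
    ((R k).prod (countMeasure m)).map (pathMap (drivenZ q coord k) (hZ k).2) with hρ
  have hρp : ∀ k, IsProbabilityMeasure (ρ k) := fun k =>
    Measure.isProbabilityMeasure_map (measurable_pathMap (hZ k).1 _).aemeasurable
  have hρ0 : ∀ k, (ρ k).map (coord 0) = (ν k).map fun x => (x, k) := fun k => by
    rw [hρ, Measure.map_map (measurable_coord 0) (measurable_pathMap (hZ k).1 _)]
    have h1 : coord 0 ∘ pathMap (drivenZ q coord k) (hZ k).2 =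
        (fun x => (x, k)) ∘ coord 0 ∘ Prod.fst :=
      funext fun w => drivenZ_zero hq hcad k w
    rw [h1, ← Measure.map_map measurable_prodMk_right ((measurable_coord 0).comp measurable_fst),
      ← Measure.map_map (measurable_coord 0) measurable_fst, measurePreserving_fst.map_eq,
      (hR k).2.1]
  have hS : StoppedId A q coord (∑ k, μ (Prod.snd ⁻¹' {k}) • ρ k) :=
    StoppedId.sum hq hA measurable_coord (fun x => x.2) (fun k => measure_ne_top _ _) fun k =>
      StoppedId.map_pathMap hq hA (hZ k).1 (hZ k).2
        (stoppedId_drivenZ hq measurable_coord hcad hA (hR k).2.2.martingale)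
  have h0 : (∑ k, μ (Prod.snd ⁻¹' {k}) • ρ k).map (coord 0) = μ := by
    rw [← Measure.sum_fintype, Measure.map_sum (measurable_coord 0).aemeasurable,
      Measure.sum_fintype]
    simp only [Measure.map_smul, hρ0]
    exact hμ.symm
  have hp : IsProbabilityMeasure (∑ k, μ (Prod.snd ⁻¹' {k}) • ρ k) := by
    refine ⟨?_⟩
    rw [← Set.preimage_univ (f := coord 0), ← Measure.map_apply (measurable_coord 0) .univ, h0,
      measure_univ]
  exact ⟨_, hp, h0, StoppedId.solvesLocalMP hq hA measurable_coord (fun x => x.2) hS⟩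

include hD

/-- Well-posedness is inherited by the coupled generator. -/
theorem wellPosedLocalMP_couplGen : WellPosedLocalMP (couplGen A q):= by
  intro μ hμ
  obtain ⟨P, hP, h0, hZ⟩ := exists_solvesLocalMP hq hA hW μ
  refine ⟨P, ⟨hP, h0, hZ⟩, fun P' ⟨hP', h0', hZ'⟩ => ?_⟩
  have := map_pathMap_eq hq hA hZ' hZ hD hW (h0'.trans h0.symm)
  have hid : pathMap coord hZ'.cadlag = id := rfl
  rwa [hid, Measure.map_id, Measure.map_id] at this

end Existence

end Coupling

end MarkovCoupling

theorem lemma2p7 {E : Type u} [MetricSpace E] [CompleteSpace E] [SecondCountableTopology E]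
    [MeasurableSpace E] [BorelSpace E]
    (A : Set ((E → ℝ) × (E → ℝ))) (m : ℕ) (ϖ : Measure E) (η : Fin m → E → ℝ) (lam : Fin m → ℝ)
    (Q : Matrix (Fin (m + 1)) (Fin (m + 1)) ℝ) (ξ : Fin m → Fin (m + 1) → ℝ)
    (h : MarkovCoupling.ChainAssumption A m ϖ η lam Q ξ) :
    -- every cadlag solution `X` of the martingale problem for `A` extends to a solution `(X, Y)`
    (∀ (Ω : Type v) [MeasurableSpace Ω] (P : Measure Ω) [IsProbabilityMeasure P]
      (X : ℝ≥0 → Ω → E), MarkovCoupling.SolvesMP A X P → ∀ k : Fin (m + 1),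
        ∃ (Ω' : Type v) (_ : MeasurableSpace Ω') (P' : Measure Ω') (_ : IsProbabilityMeasure P')
          (π : Ω' → Ω) (_ : MeasurePreserving π P' P)
          (N : MarkovCoupling.OffDiag m → ℝ≥0 → Ω' → ℕ) (Y : ℝ≥0 → Ω' → Fin (m + 1)),
          MarkovCoupling.IsPoissonDriven (MarkovCoupling.rate Q η ξ) k
            (fun t ω => X t (π ω)) Y N P' ∧
          MarkovCoupling.SolvesLocalMP (MarkovCoupling.coupledGenerator A Q η ξ)
            (fun t ω => (X t (π ω), Y t ω)) P' ∧ (MarkovCoupling.IsMarkov X P →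
            MarkovCoupling.IsMarkov (fun t ω => (X t (π ω), Y t ω)) P')) ∧
    -- well-posedness for `A` implies well-posedness for `B`
    (MarkovCoupling.DeterminesMass (Prod.fst '' A) → MarkovCoupling.WellPosedMP A →
      MarkovCoupling.WellPosedLocalMP (MarkovCoupling.coupledGenerator A Q η ξ)) := by
  refine ⟨fun Ω _ P _ X hX k => MarkovCoupling.exists_coupling h P X hX k, fun hD hW => ?_⟩
  rw [MarkovCoupling.coupledGenerator_eq]
  exact MarkovCoupling.wellPosedLocalMP_couplGen h.rateFun h.eigenmeasure.subset hD hW
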